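/- **Setting.** Let $T,h,\overline\nu_1,\overline\nu_2,r>0$ and $\Omega=\mathbb T^2\times(0,h)\ni(x,z)$, $\mathbb T^2=(\mathbb R/\mathbb Z)^2$. The subscript $x$ denotes horizontal derivatives, $\Delta=\Delta_x+\partial_{zz}$, $D_x(u)=\frac12(\nabla_xu+\nabla_x^tu)$, $A_x(u)=\frac12(\nabla_xu-\nabla_x^tu)$. For regularization parameters $\varepsilon,\mu,\delta,\eta,\kappa,r_0>0$ consider the system on $(0,T)\times\Omega$ $$\partial_t\xi+{\rm div}_x(\xi\overline u)=\varepsilon\Delta_x\xi,\qquad \partial_z\xi=0,$$ $$\partial_t(\xi u)+{\rm div}_x(\xi u\otimes u)+\partial_z(\xi uw)+\nabla_x\xi+r_0u+r\xi|u|u+\mu\Delta^2u+\varepsilon\nabla_x\xi\cdot\nabla_xu$$ $$=2\overline\nu_1{\rm div}_x(\xi D_x(u))+\overline\nu_2\partial_z(\xi\partial_zu)+\eta\nabla_x\xi^{-10}+\kappa\xi\nabla_x\Big(\frac{\Delta_x\sqrt\xi}{\sqrt\xi}\Big)+\delta\xi\nabla_x\Delta_x^5\xi,$$ for the density $\xi(t,x)$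 and the horizontal velocity $u(t,x,z)\in\mathbb R^2$, with $\partial_zu=0$ at $z=0,h$, where $\overline u=\frac1h\int_0^hu\,d\tau$, $\widetilde u(z)=\int_0^zu\,d\tau$ and $$w=-\frac{{\rm div}_x(\xi\widetilde u)}{\xi}+z\,\frac{{\rm div}_x(\xi\overline u)}{\xi}.$$ The initial data are $\xi_0=\xi_0(x)\in C^\infty(\mathbb T^2)$ with $\xi_0\ge\varsigma$ for some constant $\varsigma>0$, and $u_0\in L^2(\Omega)^2$. The energy is $$E(\xi,u)=\int_\Omega\tfrac12\xi|u|^2+\xi\ln\xi-\xi+1+\tfrac1{11}\eta\xi^{-10}+\kappa|\nabla_x\sqrt\xi|^2+\tfrac\delta2|\nabla_x\Delta_x^2\xi|^2\,dxdz,\qquad E_0=E(\xi_0,u_0).$$ A *weak solution* with these data is a pair $(\xi,u)$, with $w$ as above, such that $\sqrt\xi u\in L^\infty(0,T;L^2)$, $u\in L^2(0,T;H^2)$, $\partial_zu=0$ at $z=0,h$, the equations and the initial conditions $\xi(0)=\xi_0$, $(\xi u)(0)=\xi_0u_0$ hold in the weak sense (for the momentum equation: against smooth test functions $\varphi$ that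 vanish near $t=T$ and satisfy $\partial_z\varphi=0$ at $z=0,h$), and for a.e. $t\in(0,T)$ the energy inequality holds: $$E(\xi,u)(t)+\int_0^t\!\!\int_\Omega\Big(4\varepsilon|\nabla_x\sqrt\xi|^2+r_0|u|^2+r\xi|u|^3+2\overline\nu_1\xi|D_x(u)|^2+\overline\nu_2\xi|\partial_zu|^2+\mu|\Delta u|^2$$ $$+\tfrac25\eta\varepsilon|\nabla_x\xi^{-5}|^2+\tfrac{\kappa\varepsilon}2\xi|\nabla_x^2\ln\xi|^2+\delta\varepsilon|\Delta_x^3\xi|^2\Big)dxdzds\le E_0.$$ **Lemma 4.1.** Fix $T,h,\overline\nu_1,\overline\nu_2,r$, the initial data $(\xi_0,u_0)$ and a bound $M$. There are a constant $C>0$, independent of $\varepsilon,\mu,\delta,\eta,\kappa,r_0$, and a constant $C(\delta,\eta)>0$, depending on the parameters only through $\delta,\eta$, such that the following holds for all $\varepsilon,\mu>0$ and all $\delta,\eta,\kappa,r_0\in(0,M]$. If $(\xi,u)$ is a weak solution with data $(\xi_0,u_0)$ such that $\xi$ is bounded below by a positive constant a.e. and $\xi\in L^\infty(0,T;H^5)\cap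 L^2(0,T;H^6)$, then all the integrands below are integrable and, for a.e. $t\in(0,T)$, $$\int_\Omega\Big(\tfrac12\xi|u+2\overline\nu_1\nabla_x\ln\xi|^2-2\overline\nu_1r_0\ln\xi\Big)(t)\,dxdz+\int_0^t\!\!\int_\Omega\Big(2\overline\nu_1\xi|\partial_zw|^2+8\overline\nu_1|\nabla_x\sqrt\xi|^2+r\xi|u|^3+\overline\nu_2\xi|\partial_zu|^2$$ $$+\tfrac85\eta\overline\nu_1|\nabla_x\xi^{-5}|^2+\mu|\Delta u|^2+\kappa\overline\nu_1\xi|\nabla_x^2\ln\xi|^2+r_0|u|^2+2\delta\overline\nu_1|\Delta_x^3\xi|^2+2\overline\nu_1\xi|A_x(u)|^2+\overline\nu_1r_0\varepsilon\frac{|\nabla_x\xi|^2}{\xi^2}\Big)dxdzds$$ $$\le\int_\Omega\Big(\tfrac12\xi_0|u_0+2\overline\nu_1\nabla_x\ln\xi_0|^2-2\overline\nu_1r_0\ln\xi_0\Big)dxdz+E_0+C+\varepsilon C(\delta,\eta)+\sqrt\mu\,C(\delta,\eta).$$ -/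

import Mathlib

open MeasureTheory Set
open scoped ContDiff

noncomputable section

namespace CPE

/-! ### Geometry

Space points are `x : Fin 3 → ℝ`, with horizontal coordinates `x 0, x 1` (period one) and vertical
coordinate `x 2 ∈ (0, h)`. Functions on `T² × (0, h)` are functions on `ℝ³` with period one in
`x 0` and `x 1`; integrals are taken over the unit cell. -/

/-- Space-time points `(t, x)`. -/
abbrev Pt : Type := ℝ × (Fin 3 → ℝ)

/-- The index of the `j`-th horizontal coordinate. -/
def hor (j : Fin 2) : Fin 3 := j.castSucc

/-- The cell `[0,1)² × (0, h)` representing `Ω = T² × (0, h)`. -/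
def Om (h : ℝ) : Set (Fin 3 → ℝ) :=
  {x | x 0 ∈ Ico (0 : ℝ) 1 ∧ x 1 ∈ Ico (0 : ℝ) 1 ∧ x 2 ∈ Ioo (0 : ℝ) h}

/-- The space-time cylinder `(0, T) × Ω`. -/
def Q (T h : ℝ) : Set Pt := Ioo (0 : ℝ) T ×ˢ Om h

/-- Period one in both horizontal coordinates (functions of space). -/
def PeriodicS {β : Type} (f : (Fin 3 → ℝ) → β) : Prop :=
  ∀ (j : Fin 2) (x : Fin 3 → ℝ), f (x + Pi.single (hor j) 1) = f x

/-- Period one in both horizontal coordinates (functions of space-time). -/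
def Periodic {β : Type} (f : Pt → β) : Prop :=
  ∀ t : ℝ, PeriodicS fun x => f (t, x)

/-! ### Classical derivatives (for test functions and initial data) -/

/-- `∂ᵢ f` for a function of space. -/
def sd (i : Fin 3) (f : (Fin 3 → ℝ) → ℝ) : (Fin 3 → ℝ) → ℝ :=
  fun x => fderiv ℝ f x (Pi.single i 1)

/-- `∂ᵢ φ` (space derivative) for a function of space-time. -/
def pd (i : Fin 3) (φ : Pt → ℝ) : Pt → ℝ :=
  fun p => fderiv ℝ φ p (0, Pi.single i 1)

/-- `∂ₜ φ` for a function of space-time. -/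
def td (φ : Pt → ℝ) : Pt → ℝ :=
  fun p => fderiv ℝ φ p (1, 0)

/-! ### Test functions -/

/-- Smooth on `ℝ × ℝ³` and periodic in the horizontal variables. -/
def SmoothPer (φ : Pt → ℝ) : Prop := ContDiff ℝ ∞ φ ∧ Periodic φ

/-- Test functions with compact support in `(0, T) × T² × (0, h)`. -/
def TestInterior (T h : ℝ) (φ : Pt → ℝ) : Prop :=
  SmoothPer φ ∧ ∃ a b c d : ℝ, 0 < a ∧ b < T ∧ 0 < c ∧ d < h ∧
    ∀ p, φ p ≠ 0 → p.1 ∈ Icc a b ∧ p.2 2 ∈ Icc c d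

/-- Test functions with compact support in time in `(0, T)`, unrestricted at `z = 0, h`. -/
def TestTime (T : ℝ) (φ : Pt → ℝ) : Prop :=
  SmoothPer φ ∧ ∃ a b : ℝ, 0 < a ∧ b < T ∧ ∀ p, φ p ≠ 0 → p.1 ∈ Icc a b

/-- Test functions that vanish near `t = T`, but not necessarily at `t = 0`. -/
def TestInitial (T : ℝ) (φ : Pt → ℝ) : Prop :=
  SmoothPer φ ∧ ∃ b < T, ∀ p : Pt, b ≤ p.1 → φ p = 0

/-- Vanishing vertical derivative on the horizontal boundaries `z = 0` and `z = h`. -/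
def NeumannTest (h : ℝ) (φ : Pt → ℝ) : Prop :=
  ∀ p : Pt, p.2 2 = 0 ∨ p.2 2 = h → pd 2 φ p = 0

/-! ### Weak derivatives and Sobolev-Bochner spaces -/

/-- `g` is the weak derivative `∂ᵢ f` on `(0, T) × Ω` (both integrable). -/
def IsWeakDeriv (T h : ℝ) (i : Fin 3) (f g : Pt → ℝ) : Prop :=
  IntegrableOn f (Q T h) ∧ IntegrableOn g (Q T h) ∧
    ∀ φ, TestInterior T h φ → ∫ p in Q T h, f p * pd i φ p = -∫ p in Q T h, g p * φ p

open Classical in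
/-- The weak derivative `∂ᵢ f` on `(0, T) × Ω`, unique almost everywhere (zero if there is none). -/
def wd (T h : ℝ) (i : Fin 3) (f : Pt → ℝ) : Pt → ℝ :=
  if H : ∃ g, IsWeakDeriv T h i f g then H.choose else 0

/-- `f ∈ L²(0, T; Hᵏ(Ω))`. -/
def L2H (T h : ℝ) : ℕ → (Pt → ℝ) → Prop
  | 0, f => MemLp f 2 (volume.restrict (Q T h))
  | k + 1, f => MemLp f 2 (volume.restrict (Q T h)) ∧
      ∀ i : Fin 3, (∃ g, IsWeakDeriv T h i f g) ∧ L2H T h k (wd T h i f)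

/-- `f ∈ L^∞(0, T; L²(Ω))`. -/
def LinfL2 (T h : ℝ) (f : Pt → ℝ) : Prop :=
  AEStronglyMeasurable f (volume.restrict (Q T h)) ∧
    ∃ B : NNReal, ∀ᵐ t ∂(volume.restrict (Ioo (0 : ℝ) T)),
      eLpNorm (fun x => f (t, x)) 2 (volume.restrict (Om h)) ≤ B

/-- `f ∈ L^∞(0, T; Hᵏ(Ω))`. -/
def LinfH (T h : ℝ) : ℕ → (Pt → ℝ) → Prop
  | 0, f => LinfL2 T h f
  | k + 1, f => LinfL2 T h f ∧
      ∀ i : Fin 3, (∃ g, IsWeakDeriv T h i f g) ∧ LinfH T h k (wd T h i f)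

/-! ### Differential expressions

They are written for an arbitrary operator `d i` of partial differentiation, so that the same
formulas apply to solutions (`d = wd T h`) and to initial data (`d = sd`). -/

section Expressions

variable {α : Type} (d : Fin 3 → (α → ℝ) → α → ℝ)

/-- The horizontal Laplacian `Δₓ f`. -/
def lapH (f : α → ℝ) : α → ℝ := fun p => ∑ j : Fin 2, d (hor j) (d (hor j) f) p

/-- The full Laplacian `Δ f`. -/
def lap (f : α → ℝ) : α → ℝ := fun p => ∑ j : Fin 3, d j (d j f) p

/-- The horizontal divergence `divₓ v`. -/
def divH (v : α → Fin 2 → ℝ) : α → ℝ := fun p => ∑ j : Fin 2, d (hor j) (fun q => v q j) p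

/-- `|∇ₓ f|²`. -/
def gradSq (f : α → ℝ) : α → ℝ := fun p => ∑ j : Fin 2, (d (hor j) f p) ^ 2

/-- `|∇ₓ² f|²`. -/
def hessSq (f : α → ℝ) : α → ℝ :=
  fun p => ∑ i : Fin 2, ∑ j : Fin 2, (d (hor i) (d (hor j) f) p) ^ 2

/-- The entries of `Dₓ(u) = (∇ₓ u + ∇ₓᵗ u) / 2`. -/
def symGrad (u : α → Fin 2 → ℝ) (i j : Fin 2) : α → ℝ :=
  fun p => (d (hor i) (fun q => u q j) p + d (hor j) (fun q => u q i) p) / 2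

/-- The entries of `Aₓ(u) = (∇ₓ u - ∇ₓᵗ u) / 2`. -/
def skewGrad (u : α → Fin 2 → ℝ) (i j : Fin 2) : α → ℝ :=
  fun p => (d (hor i) (fun q => u q j) p - d (hor j) (fun q => u q i) p) / 2

end Expressions

/-- `|v|²`. -/
def sq (v : Fin 2 → ℝ) : ℝ := ∑ i : Fin 2, (v i) ^ 2

/-- The Euclidean length `|v|`. -/
def len (v : Fin 2 → ℝ) : ℝ := Real.sqrt (sq v)

/-! ### The regularized system -/

/-- Final time, height of the layer, viscosities `ν̄₁, ν̄₂`, coefficient of the damping. -/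
structure Fixed where
  T : ℝ
  h : ℝ
  ν₁ : ℝ
  ν₂ : ℝ
  r : ℝ
  T_pos : 0 < T
  h_pos : 0 < h
  ν₁_pos : 0 < ν₁
  ν₂_pos : 0 < ν₂
  r_pos : 0 < r

/-- The regularization parameters. -/
structure Reg where
  ε : ℝ
  μ : ℝ
  δ : ℝ
  η : ℝ
  κ : ℝ
  r₀ : ℝ
  ε_pos : 0 < ε
  μ_pos : 0 < μ
  δ_pos : 0 < δ
  η_pos : 0 < η
  κ_pos : 0 < κ
  r₀_pos : 0 < r₀

/-- The vertical mean `ū = (1/h) ∫₀ʰ u dτ`. -/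
def ubar (h : ℝ) (u : Pt → Fin 2 → ℝ) : Pt → Fin 2 → ℝ :=
  fun p i => (1 / h) * ∫ τ in (0 : ℝ)..h, u (p.1, Function.update p.2 2 τ) i

/-- The vertical primitive `ũ(z) = ∫₀ᶻ u dτ`. -/
def utilde (u : Pt → Fin 2 → ℝ) : Pt → Fin 2 → ℝ :=
  fun p i => ∫ τ in (0 : ℝ)..(p.2 2), u (p.1, Function.update p.2 2 τ) i

/-- The vertical velocity `w = - divₓ(ξ ũ) / ξ + z divₓ(ξ ū) / ξ`. -/
def vert (T h : ℝ) (ξ : Pt → ℝ) (u : Pt → Fin 2 → ℝ) : Pt → ℝ :=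
  fun p => -(divH (wd T h) (fun q j => ξ q * utilde u q j) p) / ξ p
    + p.2 2 * (divH (wd T h) (fun q j => ξ q * ubar h u q j) p / ξ p)

/-- The integrand of the energy `E(ξ, u)`. -/
def energyDensity {α : Type} (d : Fin 3 → (α → ℝ) → α → ℝ) (R : Reg)
    (ξ : α → ℝ) (u : α → Fin 2 → ℝ) : α → ℝ :=
  fun p => 1 / 2 * ξ p * sq (u p) + (ξ p * Real.log (ξ p) - ξ p + 1)
    + 1 / 11 * R.η * (ξ p) ^ (-10 : ℤ)
    + R.κ * gradSq d (fun q => Real.sqrt (ξ q)) p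
    + R.δ / 2 * gradSq d (lapH d (lapH d ξ)) p

/-- The initial energy `E₀ = E(ξ₀, u₀)`. -/
def initialEnergy (P : Fixed) (R : Reg)
    (ξ₀ : (Fin 3 → ℝ) → ℝ) (u₀ : (Fin 3 → ℝ) → Fin 2 → ℝ) : ℝ :=
  ∫ x in Om P.h, energyDensity sd R ξ₀ u₀ x

/-- The integrand of the dissipation in the energy inequality. -/
def energyDissipation (P : Fixed) (R : Reg) (ξ : Pt → ℝ) (u : Pt → Fin 2 → ℝ) : Pt → ℝ :=
  let d := wd P.T P.h
  fun p => 4 * R.ε * gradSq d (fun q => Real.sqrt (ξ q)) p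
    + R.r₀ * sq (u p)
    + P.r * ξ p * len (u p) ^ 3
    + 2 * P.ν₁ * ξ p * (∑ i : Fin 2, ∑ j : Fin 2, (symGrad d u i j p) ^ 2)
    + P.ν₂ * ξ p * (∑ i : Fin 2, (d 2 (fun q => u q i) p) ^ 2)
    + R.μ * (∑ i : Fin 2, (lap d (fun q => u q i) p) ^ 2)
    + 2 / 5 * R.η * R.ε * gradSq d (fun q => (ξ q) ^ (-5 : ℤ)) p
    + R.κ * R.ε / 2 * ξ p * hessSq d (fun q => Real.log (ξ q)) p
    + R.δ * R.ε * (lapH d (lapH d (lapH d ξ)) p) ^ 2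

/-- The integrand of the weak form of `∂ₜξ + divₓ(ξ ū) = ε Δₓ ξ`. -/
def massForm (P : Fixed) (R : Reg) (ξ : Pt → ℝ) (u : Pt → Fin 2 → ℝ) (φ : Pt → ℝ) : Pt → ℝ :=
  let d := wd P.T P.h
  fun p => -(ξ p * td φ p)
    - (∑ j : Fin 2, ξ p * ubar P.h u p j * pd (hor j) φ p)
    + R.ε * (∑ j : Fin 2, d (hor j) ξ p * pd (hor j) φ p)

/-- The integrand of the weak form of the momentum equation
`∂ₜ(ξu) + divₓ(ξu ⊗ u) + ∂_z(ξuw) + ∇ₓξ + r₀u + rξ|u|u + μΔ²u + ε∇ₓξ·∇ₓu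
  = 2ν̄₁divₓ(ξDₓ(u)) + ν̄₂∂_z(ξ∂_z u) + η∇ₓξ⁻¹⁰ + κξ∇ₓ(Δₓ√ξ/√ξ) + δξ∇ₓΔₓ⁵ξ`.
The last two terms are understood through
`∫ ξ∇ₓ(Δₓ√ξ/√ξ)·φ = -2∫ Δₓ√ξ ∇ₓ√ξ·φ - ∫ Δₓ√ξ √ξ divₓφ` and
`∫ ξ∇ₓΔₓ⁵ξ·φ = -∫ Δₓ²divₓ(ξφ) Δₓ³ξ`. -/
def momentumForm (P : Fixed) (R : Reg) (ξ : Pt → ℝ) (u : Pt → Fin 2 → ℝ)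
    (φ : Pt → Fin 2 → ℝ) : Pt → ℝ :=
  let d := wd P.T P.h
  let s : Pt → ℝ := fun q => Real.sqrt (ξ q)
  fun p => -(∑ i : Fin 2, ξ p * u p i * td (fun q => φ q i) p)
    - (∑ i : Fin 2, ∑ j : Fin 2, ξ p * u p i * u p j * pd (hor j) (fun q => φ q i) p)
    - (∑ i : Fin 2, ξ p * u p i * vert P.T P.h ξ u p * pd 2 (fun q => φ q i) p)
    - ξ p * divH pd φ p
    + R.r₀ * (∑ i : Fin 2, u p i * φ p i)
    + P.r * (∑ i : Fin 2, ξ p * len (u p) * u p i * φ p i)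
    + R.μ * (∑ i : Fin 2, lap d (fun q => u q i) p * lap pd (fun q => φ q i) p)
    + R.ε * (∑ i : Fin 2, ∑ j : Fin 2,
        d (hor j) ξ p * d (hor j) (fun q => u q i) p * φ p i)
    + 2 * P.ν₁ * (∑ i : Fin 2, ∑ j : Fin 2,
        ξ p * symGrad d u i j p * pd (hor j) (fun q => φ q i) p)
    + P.ν₂ * (∑ i : Fin 2, ξ p * d 2 (fun q => u q i) p * pd 2 (fun q => φ q i) p)
    + R.η * ((ξ p) ^ (-10 : ℤ) * divH pd φ p)
    + 2 * R.κ * (∑ i : Fin 2, lapH d s p * d (hor i) s p * φ p i)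
    + R.κ * (lapH d s p * s p * divH pd φ p)
    + R.δ * (lapH d (lapH d (divH d fun q j => ξ q * φ q j)) p
        * lapH d (lapH d (lapH d ξ)) p)

/-- Initial data: a smooth density, independent of `z` and bounded below by a positive constant,
and a square integrable horizontal velocity. -/
structure IsInitialData (P : Fixed)
    (ξ₀ : (Fin 3 → ℝ) → ℝ) (u₀ : (Fin 3 → ℝ) → Fin 2 → ℝ) : Prop where
  density_smooth : ContDiff ℝ ∞ ξ₀
  density_periodic : PeriodicS ξ₀
  density_vertical : ∀ x y : Fin 3 → ℝ, x 0 = y 0 → x 1 = y 1 → ξ₀ x = ξ₀ y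
  density_pos : ∃ ς > 0, ∀ x, ς ≤ ξ₀ x
  velocity_periodic : PeriodicS u₀
  velocity_memLp : ∀ i, MemLp (fun x => u₀ x i) 2 (volume.restrict (Om P.h))

/-- `(ξ, u)`, together with the vertical velocity `vert P.T P.h ξ u`, is a (finite energy) weak
solution of the regularized system on `(0, T) × Ω` with initial data `(ξ₀, u₀)`. -/
structure IsWeakSolution (P : Fixed) (R : Reg)
    (ξ₀ : (Fin 3 → ℝ) → ℝ) (u₀ : (Fin 3 → ℝ) → Fin 2 → ℝ)
    (ξ : Pt → ℝ) (u : Pt → Fin 2 → ℝ) : Prop where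
  density_periodic : Periodic ξ
  velocity_periodic : Periodic u
  /-- `∂_z ξ = 0` -/
  density_vertical : ∀ (t : ℝ) (x y : Fin 3 → ℝ), x 0 = y 0 → x 1 = y 1 → ξ (t, x) = ξ (t, y)
  /-- `√ξ u ∈ L^∞(0, T; L²)` -/
  velocity_LinfL2 : ∀ i, LinfL2 P.T P.h fun p => Real.sqrt (ξ p) * u p i
  /-- `u ∈ L²(0, T; H²)` -/
  velocity_L2H2 : ∀ i, L2H P.T P.h 2 fun p => u p i
  /-- `∂_z u = 0` at `z = 0` and `z = h`, in the sense of traces -/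
  velocity_neumann : ∀ i φ, TestTime P.T φ →
    ∫ p in Q P.T P.h, wd P.T P.h 2 (fun q => u q i) p * pd 2 φ p
      = -∫ p in Q P.T P.h, wd P.T P.h 2 (wd P.T P.h 2 fun q => u q i) p * φ p
  mass : ∀ φ, TestInitial P.T φ →
    ∫ p in Q P.T P.h, massForm P R ξ u φ p = ∫ x in Om P.h, ξ₀ x * φ (0, x)
  momentum : ∀ φ : Pt → Fin 2 → ℝ,
    (∀ i, TestInitial P.T fun p => φ p i) → (∀ i, NeumannTest P.h fun p => φ p i) →
    ∫ p in Q P.T P.h, momentumForm P R ξ u φ p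
      = ∫ x in Om P.h, ∑ i : Fin 2, ξ₀ x * u₀ x i * φ (0, x) i
  energy : ∀ᵐ t ∂(volume.restrict (Ioo (0 : ℝ) P.T)),
    (∫ x in Om P.h, energyDensity (wd P.T P.h) R ξ u (t, x))
      + ∫ p in Q t P.h, energyDissipation P R ξ u p ≤ initialEnergy P R ξ₀ u₀

/-! ### The Bresch-Desjardins functionals -/

/-- `½ ξ |u + 2ν̄₁ ∇ₓ ln ξ|² - 2ν̄₁ r₀ ln ξ`. -/
def bdDensity {α : Type} (d : Fin 3 → (α → ℝ) → α → ℝ) (P : Fixed) (R : Reg)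
    (ξ : α → ℝ) (u : α → Fin 2 → ℝ) : α → ℝ :=
  fun p => 1 / 2 * ξ p *
      sq (fun i => u p i + 2 * P.ν₁ * d (hor i) (fun q => Real.log (ξ q)) p)
    - 2 * P.ν₁ * R.r₀ * Real.log (ξ p)

/-- The integrand of all the space-time dissipation terms of the Bresch-Desjardins entropy. -/
def bdDissipation (P : Fixed) (R : Reg) (ξ : Pt → ℝ) (u : Pt → Fin 2 → ℝ) : Pt → ℝ :=
  let d := wd P.T P.h
  fun p => 2 * P.ν₁ * ξ p * (d 2 (vert P.T P.h ξ u) p) ^ 2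
    + 8 * P.ν₁ * gradSq d (fun q => Real.sqrt (ξ q)) p
    + P.r * ξ p * len (u p) ^ 3
    + P.ν₂ * ξ p * (∑ i : Fin 2, (d 2 (fun q => u q i) p) ^ 2)
    + 8 / 5 * R.η * P.ν₁ * gradSq d (fun q => (ξ q) ^ (-5 : ℤ)) p
    + R.μ * (∑ i : Fin 2, (lap d (fun q => u q i) p) ^ 2)
    + R.κ * P.ν₁ * ξ p * hessSq d (fun q => Real.log (ξ q)) p
    + R.r₀ * sq (u p)
    + 2 * R.δ * P.ν₁ * (lapH d (lapH d (lapH d ξ)) p) ^ 2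
    + 2 * P.ν₁ * ξ p * (∑ i : Fin 2, ∑ j : Fin 2, (skewGrad d u i j p) ^ 2)
    + P.ν₁ * R.r₀ * R.ε * (gradSq d ξ p / (ξ p) ^ 2)

end CPE

end

noncomputable section
set_option linter.unusedSectionVars false

namespace CPE
open Filter Topology

/-! ### Absolutely continuous functions on an interval, up to null sets -/

/-- On `(0, L)` the function `a` agrees almost everywhere with the primitive of `α` that has
the value `c` at `0` and the value `e` at `L`. -/
def LineAC (L : ℝ) (a α : ℝ → ℝ) (c e : ℝ) : Prop :=
  IntegrableOn α (Ioo 0 L) ∧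
    (∀ᵐ s ∂(volume.restrict (Ioo 0 L)), a s = c + ∫ τ in (0 : ℝ)..s, α τ) ∧
    e = c + ∫ τ in (0 : ℝ)..L, α τ

section OneDim

variable {L : ℝ}

lemma intervalIntegrable_of_Ioo (hL : 0 < L) {α : ℝ → ℝ} (h : IntegrableOn α (Ioo 0 L)) :
    IntervalIntegrable α volume 0 L :=
  (intervalIntegrable_iff_integrableOn_Ioo_of_le hL.le).2 h

lemma integral_eq_sub_of_absolutelyContinuous (hL : 0 < L) {F φ : ℝ → ℝ}
    (hF : AbsolutelyContinuousOnInterval F 0 L)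
    (hd : ∀ᵐ s ∂(volume.restrict (Ioo 0 L)), HasDerivAt F (φ s) s) :
    IntegrableOn φ (Ioo 0 L) ∧ ∀ s ∈ Icc 0 L, F s = F 0 + ∫ τ in (0 : ℝ)..s, φ τ := by
  have he : ∀ᵐ s ∂(volume.restrict (Ioo 0 L)), deriv F s = φ s := by
    filter_upwards [hd] with s hs using hs.deriv
  have hI : IntegrableOn (deriv F) (Ioo 0 L) :=
    (intervalIntegrable_iff_integrableOn_Ioo_of_le hL.le).1 hF.intervalIntegrable_deriv
  refine ⟨hI.congr he, fun s hs => ?_⟩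
  have h1 : AbsolutelyContinuousOnInterval F 0 s :=
    hF.mono (by rw [uIcc_of_le hs.1, uIcc_of_le hL.le]; exact Icc_subset_Icc_right hs.2)
  have h2 := h1.integral_deriv_eq_sub
  have h3 : ∫ τ in (0 : ℝ)..s, φ τ = ∫ τ in (0 : ℝ)..s, deriv F τ := by
    rw [intervalIntegral.integral_of_le hs.1, intervalIntegral.integral_of_le hs.1,
      integral_Ioc_eq_integral_Ioo, integral_Ioc_eq_integral_Ioo]
    refine integral_congr_ae ?_
    have := ae_restrict_of_ae_restrict_of_subset (Ioo_subset_Ioo_right hs.2) he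
    filter_upwards [this] with x hx using hx.symm
  rw [h3, h2]; ring

namespace LineAC

variable {a b α β : ℝ → ℝ} {c d e f : ℝ}

lemma congr (h : LineAC L a α c e) (ha : ∀ᵐ s ∂(volume.restrict (Ioo 0 L)), b s = a s)
    (hα : ∀ᵐ s ∂(volume.restrict (Ioo 0 L)), β s = α s) (hL : 0 < L) : LineAC L b β c e := by
  have key : ∀ s ∈ Icc 0 L, ∫ τ in (0 : ℝ)..s, β τ = ∫ τ in (0 : ℝ)..s, α τ := by
    intro s hs
    rw [intervalIntegral.integral_of_le hs.1, intervalIntegral.integral_of_le hs.1,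
      integral_Ioc_eq_integral_Ioo, integral_Ioc_eq_integral_Ioo]
    exact integral_congr_ae
      (ae_restrict_of_ae_restrict_of_subset (Ioo_subset_Ioo_right hs.2) hα)
  refine ⟨h.1.congr (by filter_upwards [hα] with s hs using hs.symm), ?_, ?_⟩
  · filter_upwards [h.2.1, ha, ae_restrict_mem measurableSet_Ioo] with s h1 h2 h3
    rw [h2, h1, key s ⟨h3.1.le, h3.2.le⟩]
  · rw [h.2.2, key L ⟨hL.le, le_rfl⟩]

/-- The absolutely continuous representative. -/
lemma rep (hL : 0 < L) (h : LineAC L a α c e) :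
    AbsolutelyContinuousOnInterval (fun s => c + ∫ τ in (0 : ℝ)..s, α τ) 0 L ∧
    ∀ᵐ s ∂(volume.restrict (Ioo 0 L)),
      HasDerivAt (fun s => c + ∫ τ in (0 : ℝ)..s, α τ) (α s) s := by
  have hI := intervalIntegrable_of_Ioo hL h.1
  constructor
  · have h1 := hI.absolutelyContinuousOnInterval_intervalIntegral (c := 0) (by simp)
    have h2 : AbsolutelyContinuousOnInterval (fun _ : ℝ => c) 0 L :=
      (LipschitzWith.const c).lipschitzOnWith.absolutelyContinuousOnInterval (K := 0)
    exact h2.add h1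
  · rw [ae_restrict_iff' measurableSet_Ioo]
    filter_upwards [hI.ae_hasDerivAt_integral] with s hs hm
    have := hs (by rw [uIcc_of_le hL.le]; exact Ioo_subset_Icc_self hm) 0 (by simp)
    exact this.const_add c

lemma of_rep (hL : 0 < L) {F φ : ℝ → ℝ} (hF : AbsolutelyContinuousOnInterval F 0 L)
    (hd : ∀ᵐ s ∂(volume.restrict (Ioo 0 L)), HasDerivAt F (φ s) s) :
    LineAC L F φ (F 0) (F L) := by
  obtain ⟨h1, h2⟩ := integral_eq_sub_of_absolutelyContinuous hL hF hd
  refine ⟨h1, ?_, h2 L ⟨hL.le, le_rfl⟩⟩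
  filter_upwards [ae_restrict_mem measurableSet_Ioo] with s hs
  exact h2 s ⟨hs.1.le, hs.2.le⟩

lemma mul (hL : 0 < L) (h : LineAC L a α c e) (h' : LineAC L b β d f) :
    LineAC L (fun s => a s * b s) (fun s => α s * b s + a s * β s) (c * d) (e * f) := by
  obtain ⟨r1, r2⟩ := h.rep hL
  obtain ⟨r1', r2'⟩ := h'.rep hL
  have key := of_rep hL (r1.fun_mul r1')
    (φ := fun s => α s * (d + ∫ τ in (0 : ℝ)..s, β τ) + (c + ∫ τ in (0 : ℝ)..s, α τ) * β s)
    (by filter_upwards [r2, r2'] with s h1 h2 using h1.mul h2)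
  simp only [intervalIntegral.integral_same, add_zero, ← h.2.2, ← h'.2.2] at key
  refine key.congr ?_ ?_ hL
  · filter_upwards [h.2.1, h'.2.1] with s h1 h2
    rw [h1, h2]
  · filter_upwards [h.2.1, h'.2.1] with s h1 h2
    rw [h1, h2]

lemma add (hL : 0 < L) (h : LineAC L a α c e) (h' : LineAC L b β d f) :
    LineAC L (fun s => a s + b s) (fun s => α s + β s) (c + d) (e + f) := by
  have hi := intervalIntegrable_of_Ioo hL h.1
  have hi' := intervalIntegrable_of_Ioo hL h'.1
  refine ⟨h.1.add h'.1, ?_, ?_⟩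
  · filter_upwards [h.2.1, h'.2.1, ae_restrict_mem measurableSet_Ioo] with s h1 h2 hs
    have hm : uIcc 0 s ⊆ uIcc 0 L := by
      rw [uIcc_of_le hs.1.le, uIcc_of_le hL.le]; exact Icc_subset_Icc_right hs.2.le
    rw [intervalIntegral.integral_add (hi.mono_set hm) (hi'.mono_set hm), h1, h2]; ring
  · rw [intervalIntegral.integral_add hi hi', h.2.2, h'.2.2]; ring

lemma const (L c : ℝ) : LineAC L (fun _ => c) (fun _ => 0) c c := by
  refine ⟨integrableOn_zero, ?_, ?_⟩ <;> simp

lemma of_hasDerivAt (hL : 0 < L) {F φ : ℝ → ℝ} (hF : ∀ s, HasDerivAt F (φ s) s)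
    (hφ : Continuous φ) : LineAC L F φ (F 0) (F L) := by
  have hi : ∀ s, IntervalIntegrable φ volume 0 s := fun s => hφ.intervalIntegrable 0 s
  have key : ∀ s, F s = F 0 + ∫ τ in (0 : ℝ)..s, φ τ := fun s => by
    rw [intervalIntegral.integral_eq_sub_of_hasDerivAt (fun x _ => hF x) (hi s)]; ring
  exact ⟨(intervalIntegrable_iff_integrableOn_Ioo_of_le hL.le).1 (hi L),
    Eventually.of_forall key, key L⟩

lemma integral_eq (hL : 0 < L) (h : LineAC L a α c e) : ∫ s in Ioo 0 L, α s = e - c := by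
  rw [h.2.2, intervalIntegral.integral_of_le hL.le, integral_Ioc_eq_integral_Ioo]; ring

/-- Chain rule for a `C¹` function on an interval `K` that contains the values. -/
lemma comp (hL : 0 < L) (h : LineAC L a α c e) {K : Set ℝ} (hK : IsClosed K)
    {F F' : ℝ → ℝ} (hF : ∀ x ∈ K, HasDerivAt F (F' x) x) (hF' : ContinuousOn F' K)
    (haK : ∀ᵐ s ∂(volume.restrict (Ioo 0 L)), a s ∈ K) :
    LineAC L (fun s => F (a s)) (fun s => F' (a s) * α s) (F c) (F e) := by
  obtain ⟨r1, r2⟩ := h.rep hL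
  set R : ℝ → ℝ := fun s => c + ∫ τ in (0 : ℝ)..s, α τ with hR
  have hcont : ContinuousOn R (Icc 0 L) := by
    have := r1.continuousOn; rwa [uIcc_of_le hL.le] at this
  have hRK' : ∀ s ∈ Ioo 0 L, R s ∈ K := by
    have h1 : ∀ᵐ s ∂(volume.restrict (Ioo 0 L)), R s ∈ K := by
      filter_upwards [haK, h.2.1] with s h1 h2
      rw [hR]; dsimp only; rwa [← h2]
    intro s hs
    by_contra hn
    have hnb : R ⁻¹' Kᶜ ∈ 𝓝 s := 
      (hcont.continuousAt (Icc_mem_nhds hs.1 hs.2)) (hK.isOpen_compl.mem_nhds hn)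
    have hnb2 : R ⁻¹' Kᶜ ∩ Ioo 0 L ∈ 𝓝 s := inter_mem hnb (Ioo_mem_nhds hs.1 hs.2)
    have hpos := Measure.measure_pos_of_mem_nhds volume hnb2
    rw [ae_restrict_iff' measurableSet_Ioo, ae_iff] at h1
    refine hpos.ne' (measure_mono_null ?_ h1)
    rintro x ⟨hx1, hx2⟩
    simp only [mem_ofPred_eq, Classical.not_imp]
    exact ⟨hx2, hx1⟩
  have hRK : ∀ s ∈ Icc 0 L, R s ∈ K := by
    have : MapsTo R (closure (Ioo 0 L)) (closure K) := by
      apply MapsTo.closure_of_continuousOn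
      · exact fun s hs => hRK' s hs
      · rwa [closure_Ioo hL.ne]
    rw [closure_Ioo hL.ne, hK.closure_eq] at this
    exact this
  have himg : IsCompact (R '' Icc 0 L) := isCompact_Icc.image_of_continuousOn hcont
  have himgc : Convex ℝ (R '' Icc 0 L) :=
    (isPreconnected_Icc.image _ hcont).ordConnected.convex
  have hsub : R '' Icc 0 L ⊆ K := by rintro _ ⟨s, hs, rfl⟩; exact hRK s hs
  obtain ⟨C, hC⟩ := (himg.exists_bound_of_continuousOn (hF'.mono hsub))
  have hlip : LipschitzOnWith (Real.toNNReal C) F (R '' Icc 0 L) := by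
    apply himgc.lipschitzOnWith_of_nnnorm_hasDerivWithin_le (f' := F')
    · intro x hx; exact (hF x (hsub hx)).hasDerivWithinAt
    · intro x hx
      rw [← NNReal.coe_le_coe, coe_nnnorm]
      exact (hC x hx).trans (Real.le_coe_toNNReal C)
  have hAC : AbsolutelyContinuousOnInterval (fun s => F (R s)) 0 L := by
    unfold AbsolutelyContinuousOnInterval at r1 ⊢
    have r1' := r1.const_mul ((Real.toNNReal C : NNReal) : ℝ)
    rw [mul_zero] at r1'
    refine squeeze_zero' (Eventually.of_forall fun E => Finset.sum_nonneg fun _ _ => dist_nonneg)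
      ?_ r1'
    have : ∀ᶠ E in (AbsolutelyContinuousOnInterval.totalLengthFilter ⊓
        𝓟 (AbsolutelyContinuousOnInterval.disjWithin 0 L)),
        E ∈ AbsolutelyContinuousOnInterval.disjWithin 0 L :=
      mem_inf_of_right (mem_principal_self _)
    filter_upwards [this] with E hE
    rw [Finset.mul_sum]
    refine Finset.sum_le_sum fun i hi => ?_
    have hi' := hE.1 i hi
    rw [uIcc_of_le hL.le] at hi'
    exact hlip.dist_le_mul _ (mem_image_of_mem _ hi'.1) _ (mem_image_of_mem _ hi'.2)
  have key := of_rep hL hAC (φ := fun s => F' (R s) * α s) (by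
    filter_upwards [r2, ae_restrict_mem measurableSet_Ioo] with s h1 h2
    exact (hF (R s) (hRK' s h2)).comp s h1)
  have h0 : R 0 = c := by simp [hR]
  have hLe : R L = e := h.2.2.symm
  rw [h0, hLe] at key
  refine key.congr ?_ ?_ hL
  · filter_upwards [h.2.1] with s h1; rw [h1]
  · filter_upwards [h.2.1] with s h1; rw [h1]

end LineAC
end OneDim

/-- Smooth functions with compact support in `(0, L)`. -/
def Bump (L : ℝ) (ϑ : ℝ → ℝ) : Prop :=
  ContDiff ℝ ∞ ϑ ∧ ∃ a b : ℝ, 0 < a ∧ b < L ∧ ∀ x, ϑ x ≠ 0 → x ∈ Icc a b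

lemma contDiff_primitive {ϑ : ℝ → ℝ} (h : ContDiff ℝ ∞ ϑ) (a : ℝ) :
    ContDiff ℝ ∞ (fun x => ∫ τ in a..x, ϑ τ) ∧
      ∀ x, HasDerivAt (fun x => ∫ τ in a..x, ϑ τ) (ϑ x) x := by
  have hd : ∀ x, HasDerivAt (fun x => ∫ τ in a..x, ϑ τ) (ϑ x) x := fun x =>
    intervalIntegral.integral_hasDerivAt_right (h.continuous.intervalIntegrable _ _)
      (h.continuous.stronglyMeasurableAtFilter _ _) h.continuous.continuousAt
  refine ⟨?_, hd⟩
  rw [contDiff_infty_iff_deriv]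
  refine ⟨fun x => (hd x).differentiableAt, ?_⟩
  have : deriv (fun x => ∫ τ in a..x, ϑ τ) = ϑ := funext fun x => (hd x).deriv
  rwa [this]

lemma exists_unit_bump {L : ℝ} (hL : 0 < L) :
    ∃ χ, Bump L χ ∧ ∫ s in Ioo 0 L, χ s = 1 := by
  let f : ContDiffBump (L / 2) := ⟨L / 8, L / 4, by positivity, by linarith⟩
  have hsupp : ∀ x, f.normed volume x ≠ 0 → x ∈ Icc (L / 4) (3 * L / 4) := by
    intro x hx
    have : x ∈ Function.support (f.normed volume) := hx
    rw [f.support_normed_eq, Real.ball_eq_Ioo] at this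
    simp only [f, mem_Ioo] at this
    exact ⟨by linarith [this.1], by linarith [this.2]⟩
  refine ⟨f.normed volume, ⟨f.contDiff_normed, L / 4, 3 * L / 4, by positivity, by linarith,
    hsupp⟩, ?_⟩
  rw [setIntegral_eq_integral_of_forall_compl_eq_zero, f.integral_normed]
  intro x hx
  by_contra h
  have := hsupp x h
  exact hx ⟨by linarith [this.1], by linarith [this.2]⟩

namespace Bump
variable {L : ℝ} {ϑ ϑ' : ℝ → ℝ}

lemma continuous (h : Bump L ϑ) : Continuous ϑ := h.1.continuous

lemma zero_left (h : Bump L ϑ) : ϑ 0 = 0 := by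
  obtain ⟨_, a, b, ha, hb, hs⟩ := h
  by_contra h0; have := (hs 0 h0).1; linarith

lemma zero_right (h : Bump L ϑ) : ϑ L = 0 := by
  obtain ⟨_, a, b, ha, hb, hs⟩ := h
  by_contra h0; have := (hs L h0).2; linarith

lemma bound (h : Bump L ϑ) : ∃ B, ∀ x, |ϑ x| ≤ B := by
  obtain ⟨hs, a, b, ha, hb, hsupp⟩ := h
  obtain ⟨B, hB⟩ := isCompact_Icc.exists_bound_of_continuousOn
    (s := Icc a b) hs.continuous.continuousOn
  refine ⟨max B 0, fun x => ?_⟩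
  by_cases hx : ϑ x = 0
  · simp [hx]
  · exact (hB x (hsupp x hx)).trans (le_max_left _ _)

lemma deriv_bump (h : Bump L ϑ) : Bump L (deriv ϑ) := by
  obtain ⟨hs, a, b, ha, hb, hsupp⟩ := h
  refine ⟨(contDiff_infty_iff_deriv.1 hs).2, a, b, ha, hb, fun x hx => ?_⟩
  by_contra hn
  apply hx
  have : ϑ =ᶠ[𝓝 x] fun _ => 0 := by
    filter_upwards [isClosed_Icc.isOpen_compl.mem_nhds hn] with y hy
    by_contra h0
    exact hy (hsupp y h0)
  rw [this.deriv_eq]; simp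

/-- Bumps of zero mean are derivatives of bumps. -/
lemma exists_primitive (hL : 0 < L) (h : Bump L ϑ) (h0 : ∫ s in Ioo 0 L, ϑ s = 0) :
    ∃ χ, Bump L χ ∧ deriv χ = ϑ := by
  obtain ⟨hs, a, b, ha, hb, hsupp⟩ := h
  obtain ⟨h1, h2⟩ := contDiff_primitive hs 0
  refine ⟨_, ⟨h1, a, b, ha, hb, fun x hx => ?_⟩, funext fun x => (h2 x).deriv⟩
  by_contra hn
  apply hx
  have hz : ∀ y, y ∉ Icc a b → ϑ y = 0 := fun y hy => by
    by_contra h; exact hy (hsupp y h)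
  by_cases hxa : x < a
  · have : ∀ y ∈ uIcc 0 x, ϑ y = (fun _ => (0:ℝ)) y := by
      intro y hy
      apply hz
      intro hy'
      rcases le_total 0 x with h | h
      · rw [uIcc_of_le h] at hy; linarith [hy.2, hy'.1]
      · rw [uIcc_of_ge h] at hy; linarith [hy.2, hy'.1]
    rw [intervalIntegral.integral_congr this]; simp
  · have hxb : b < x := by
      by_contra hb'; exact hn ⟨not_lt.1 hxa, not_lt.1 hb'⟩
    have e1 : ∫ τ in (0:ℝ)..L, ϑ τ = 0 := by
      rw [intervalIntegral.integral_of_le hL.le, integral_Ioc_eq_integral_Ioo, h0]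
    have e2 : ∫ τ in L..x, ϑ τ = 0 := by
      have : ∀ y ∈ uIcc L x, ϑ y = (fun _ => (0:ℝ)) y := by
        intro y hy
        apply hz
        intro hy'
        rcases le_total L x with h | h
        · rw [uIcc_of_le h] at hy; linarith [hy.1, hy'.2]
        · rw [uIcc_of_ge h] at hy; linarith [hy.1, hy'.2]
      rw [intervalIntegral.integral_congr this]; simp
    rw [← intervalIntegral.integral_add_adjacent_intervals
      (hs.continuous.intervalIntegrable 0 L) (hs.continuous.intervalIntegrable L x), e1, e2, add_zero]

lemma sub_smul (h : Bump L ϑ) (h' : Bump L ϑ') (c : ℝ) : Bump L (fun x => ϑ x - c * ϑ' x) := by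
  obtain ⟨hs, a, b, ha, hb, hsupp⟩ := h
  obtain ⟨hs', a', b', ha', hb', hsupp'⟩ := h'
  refine ⟨hs.sub (contDiff_const.mul hs'), min a a', max b b', lt_min ha ha', max_lt hb hb',
    fun x hx => ?_⟩
  by_cases h1 : ϑ x = 0
  · by_cases h2 : ϑ' x = 0
    · simp [h1, h2] at hx
    · have := hsupp' x h2
      exact ⟨(min_le_right _ _).trans this.1, this.2.trans (le_max_right _ _)⟩
  · have := hsupp x h1
    exact ⟨(min_le_left _ _).trans this.1, this.2.trans (le_max_left _ _)⟩

end Bump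

/-- A way of moving the points of a measure space along a coordinate with values in `(0, L)`:
`up p s` is `p` with the coordinate `co p` replaced by `s`. -/
structure Line {X : Type} [MeasurableSpace X] (m : Measure X) where
  up : X → ℝ → X
  co : X → ℝ
  L : ℝ
  /-- whether functions are taken to be periodic along the lines -/
  per : Prop
  L_pos : 0 < L
  meas_up : Measurable fun q : X × ℝ => up q.1 q.2
  meas_co : Measurable co
  co_up : ∀ p s, co (up p s) = s
  up_up : ∀ p s s', up (up p s) s' = up p s'
  up_co : ∀ p, up p (co p) = p
  co_mem : ∀ᵐ p ∂m, co p ∈ Ioo 0 L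
  map_up : Measure.map (fun q : X × ℝ => up q.1 q.2) (m.prod (volume.restrict (Ioo 0 L)))
    = ENNReal.ofReal L • m

namespace Line
variable {X : Type} [MeasurableSpace X] {m : Measure X} (ℓ : Line m)

/-- Lebesgue measure on the range of the coordinate. -/
abbrev lam : Measure ℝ := volume.restrict (Ioo 0 ℓ.L)

lemma lam_real : (ℓ.lam).real univ = ℓ.L := by
  simp [lam, Measure.real, ℓ.L_pos.le]

lemma qmp : Measure.QuasiMeasurePreserving (fun q : X × ℝ => ℓ.up q.1 q.2) (m.prod ℓ.lam) m := by
  refine ⟨ℓ.meas_up, ?_⟩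
  rw [lam, ℓ.map_up]
  exact Measure.smul_absolutelyContinuous

variable {ℓ}
variable [IsFiniteMeasure m]

lemma ae_line {P : X → Prop} (h : ∀ᵐ p ∂m, P p) : ∀ᵐ p ∂m, ∀ᵐ s ∂ℓ.lam, P (ℓ.up p s) :=
  Measure.ae_ae_of_ae_prod (ℓ.qmp.ae h)

lemma lintegral_prod_line {F : X → ENNReal} (hF : AEMeasurable F m) :
    ∫⁻ p, ∫⁻ s, F (ℓ.up p s) ∂ℓ.lam ∂m = ENNReal.ofReal ℓ.L * ∫⁻ p, F p ∂m := by
  have h1 : AEMeasurable F (Measure.map (fun q : X × ℝ => ℓ.up q.1 q.2) (m.prod ℓ.lam)) :=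
    hF.mono_ac ℓ.qmp.absolutelyContinuous
  have h2 := lintegral_map' h1 ℓ.meas_up.aemeasurable
  rw [lam, ℓ.map_up, lintegral_smul_measure] at h2
  rw [smul_eq_mul] at h2
  rw [h2]
  exact (lintegral_prod (fun q : X × ℝ => F (ℓ.up q.1 q.2))
    (hF.comp_quasiMeasurePreserving ℓ.qmp)).symm

lemma integrable_line {f : X → ℝ} (hf : Integrable f m) :
    Integrable (fun q : X × ℝ => f (ℓ.up q.1 q.2)) (m.prod ℓ.lam) := by
  have : Integrable f (Measure.map (fun q : X × ℝ => ℓ.up q.1 q.2) (m.prod ℓ.lam)) := by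
    rw [lam, ℓ.map_up]; exact hf.smul_measure ENNReal.ofReal_ne_top
  exact this.comp_measurable ℓ.meas_up

lemma integral_prod_line {f : X → ℝ} (hf : Integrable f m) :
    ∫ p, ∫ s, f (ℓ.up p s) ∂ℓ.lam ∂m = ℓ.L * ∫ p, f p ∂m := by
  rw [integral_integral (integrable_line hf)]
  have h1 : AEStronglyMeasurable f (Measure.map (fun q : X × ℝ => ℓ.up q.1 q.2) (m.prod ℓ.lam)) := by
    rw [lam, ℓ.map_up]; exact (hf.smul_measure ENNReal.ofReal_ne_top).1
  have h2 := integral_map ℓ.meas_up.aemeasurable h1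
  rw [← h2, lam, ℓ.map_up, integral_smul_measure, ENNReal.toReal_ofReal ℓ.L_pos.le, smul_eq_mul]

lemma ae_integrable_line {f : X → ℝ} (hf : Integrable f m) :
    ∀ᵐ p ∂m, Integrable (fun s => f (ℓ.up p s)) ℓ.lam :=
  (integrable_line hf).prod_right_ae

lemma ae_eq_of_line {f g : X → ℝ} (hf : AEStronglyMeasurable f m) (hg : AEStronglyMeasurable g m)
    (h : ∀ᵐ p ∂m, ∀ᵐ s ∂ℓ.lam, f (ℓ.up p s) = g (ℓ.up p s)) : f =ᵐ[m] g := by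
  have h1 := lintegral_prod_line (ℓ := ℓ) (F := fun p => ‖f p - g p‖ₑ) (hf.sub hg).enorm
  have h2 : ∫⁻ p, ∫⁻ s, ‖f (ℓ.up p s) - g (ℓ.up p s)‖ₑ ∂ℓ.lam ∂m = 0 := by
    rw [lintegral_congr_ae (g := fun _ => 0)]
    · simp
    · filter_upwards [h] with p hp
      rw [lintegral_congr_ae (g := fun _ => 0)]
      · simp
      · filter_upwards [hp] with s hs; simp [hs]
  rw [h2] at h1
  have h3 : ∫⁻ p, ‖f p - g p‖ₑ ∂m = 0 := by
    rcases mul_eq_zero.1 h1.symm with h | h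
    · rw [ENNReal.ofReal_eq_zero] at h; linarith [ℓ.L_pos]
    · exact h
  have h4 := (lintegral_eq_zero_iff' (hf.sub hg).enorm).1 h3
  filter_upwards [h4] with p hp
  simpa [sub_eq_zero] using hp

variable (ℓ)

/-- `g` is the derivative of `f` along almost every line. -/
def AC (f g : X → ℝ) : Prop :=
  ∀ᵐ p ∂m, ∃ c e, (ℓ.per → c = e) ∧
    LineAC ℓ.L (fun s => f (ℓ.up p s)) (fun s => g (ℓ.up p s)) c e

variable {ℓ}

lemma AC.congr {f g f' g' : X → ℝ} (h : ℓ.AC f g) (hf : f' =ᵐ[m] f) (hg : g' =ᵐ[m] g) :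
    ℓ.AC f' g' := by
  filter_upwards [h, ae_line hf, ae_line hg] with p ⟨c, e, h1, h2⟩ h3 h4
  exact ⟨c, e, h1, h2.congr h3 h4 ℓ.L_pos⟩

lemma AC.mul {f g f' g' : X → ℝ} (h : ℓ.AC f g) (h' : ℓ.AC f' g') :
    ℓ.AC (fun p => f p * f' p) (fun p => g p * f' p + f p * g' p) := by
  filter_upwards [h, h'] with p ⟨c, e, h1, h2⟩ ⟨c', e', h1', h2'⟩
  exact ⟨c * c', e * e', fun hp => by rw [h1 hp, h1' hp], h2.mul ℓ.L_pos h2'⟩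

lemma AC.comp {f g : X → ℝ} (h : ℓ.AC f g) {K : Set ℝ} (hK : IsClosed K)
    {F F' : ℝ → ℝ} (hF : ∀ x ∈ K, HasDerivAt F (F' x) x) (hF' : ContinuousOn F' K)
    (hfK : ∀ᵐ p ∂m, f p ∈ K) : ℓ.AC (fun p => F (f p)) (fun p => F' (f p) * g p) := by
  filter_upwards [h, ae_line hfK] with p ⟨c, e, h1, h2⟩ h3
  exact ⟨F c, F e, fun hp => by rw [h1 hp], h2.comp ℓ.L_pos hK hF hF' h3⟩

end Line

namespace Line
variable {X : Type} [MeasurableSpace X] {m : Measure X} (ℓ : Line m)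

/-- Integral operators acting along the lines. -/
def op (k : ℝ → ℝ → ℝ) (f : X → ℝ) : X → ℝ :=
  fun p => ∫ s, k (ℓ.co p) s * f (ℓ.up p s) ∂ℓ.lam

/-- Bounded measurable kernels. -/
def Ker (k : ℝ → ℝ → ℝ) : Prop :=
  Measurable (Function.uncurry k) ∧ ∃ B, ∀ x s, |k x s| ≤ B

variable {ℓ} [IsFiniteMeasure m] {k : ℝ → ℝ → ℝ} {f g : X → ℝ}

lemma op_up (p : X) (x : ℝ) : ℓ.op k f (ℓ.up p x) = ∫ s, k x s * f (ℓ.up p s) ∂ℓ.lam := by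
  simp only [op, ℓ.co_up, ℓ.up_up]

lemma integrable_ker_mul (hk : Ker k) (hf : Integrable f m) :
    Integrable (fun q : X × ℝ => k (ℓ.co q.1) q.2 * f (ℓ.up q.1 q.2)) (m.prod ℓ.lam) := by
  obtain ⟨h1, B, hB⟩ := hk
  refine (integrable_line hf).bdd_mul (c := B) ?_ ?_
  · exact (h1.comp ((ℓ.meas_co.comp measurable_fst).prodMk measurable_snd)).aestronglyMeasurable
  · exact Eventually.of_forall fun q => by simpa using hB _ _

lemma integrable_op (hk : Ker k) (hf : Integrable f m) : Integrable (ℓ.op k f) m :=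
  (integrable_ker_mul hk hf).integral_prod_left

lemma ae_integrable_ker (hk : Ker k) (hf : Integrable f m) :
    ∀ᵐ p ∂m, ∀ x, Integrable (fun s => k x s * f (ℓ.up p s)) ℓ.lam := by
  obtain ⟨h1, B, hB⟩ := hk
  filter_upwards [ae_integrable_line (ℓ := ℓ) hf] with p hp x
  refine hp.bdd_mul (c := B) ?_ ?_
  · exact (h1.comp (measurable_const.prodMk measurable_id)).aestronglyMeasurable
  · exact Eventually.of_forall fun q => by simpa using hB _ _

lemma op_congr (h : f =ᵐ[m] g) : ℓ.op k f =ᵐ[m] ℓ.op k g := by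
  filter_upwards [ae_line h] with p hp
  exact integral_congr_ae (by filter_upwards [hp] with s hs; rw [hs])

/-- The kernel of the primitive that vanishes at `0`. -/
def primKer : ℝ → ℝ → ℝ := fun x s => if s < x then 1 else 0

lemma ker_prim : Ker primKer := by
  refine ⟨?_, 1, fun x s => ?_⟩
  · exact Measurable.ite (measurableSet_lt measurable_snd measurable_fst) measurable_const
      measurable_const
  · unfold primKer; split_ifs <;> simp

lemma prim_integral {α : ℝ → ℝ} {L x : ℝ} (hx : x ∈ Icc 0 L) :
    ∫ s, primKer x s * α s ∂(volume.restrict (Ioo 0 L)) = ∫ τ in (0 : ℝ)..x, α τ := by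
  have : (fun s => primKer x s * α s) = (Iio x).indicator α := by
    ext s; by_cases h : s < x <;> simp [primKer, h, indicator]
  rw [this, integral_indicator measurableSet_Iio, Measure.restrict_restrict measurableSet_Iio,
    intervalIntegral.integral_of_le hx.1, integral_Ioc_eq_integral_Ioo]
  congr 2
  ext s; simp only [mem_inter_iff, mem_Iio, mem_Ioo]
  exact ⟨fun h => ⟨h.2.1, h.1⟩, fun h => ⟨h.2, h.1, h.2.trans_le hx.2⟩⟩

lemma bump_integrable {L : ℝ} {ϑ α : ℝ → ℝ} (h : Continuous ϑ) (hB : ∃ B, ∀ x, |ϑ x| ≤ B)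
    (hα : Integrable α (volume.restrict (Ioo 0 L))) :
    Integrable (fun s => α s * ϑ s) (volume.restrict (Ioo 0 L)) := by
  obtain ⟨B, hB⟩ := hB
  exact hα.mul_bdd (c := B) h.aestronglyMeasurable (Eventually.of_forall fun x => by simpa using hB x)

/-- A function with a weak derivative is absolutely continuous along almost every line. -/
theorem ac_of_weak (hf : Integrable f m) (hg : Integrable g m) (R : Set (X → ℝ))
    (hinv : ∀ ρ ∈ R, ∀ p s, ρ (ℓ.up p s) = ρ p)
    (hbd : ∀ ρ ∈ R, Measurable ρ ∧ ∃ B, ∀ p, |ρ p| ≤ B)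
    (hsep : ∀ H, Integrable H m →
      (∀ ρ ∈ R, ∀ ϑ, Bump ℓ.L ϑ → ∫ p, H p * (ρ p * ϑ (ℓ.co p)) ∂m = 0) → H =ᵐ[m] 0)
    (hw : ∀ ρ ∈ R, ∀ χ, Bump ℓ.L χ →
      ∫ p, f p * (ρ p * deriv χ (ℓ.co p)) ∂m = -∫ p, g p * (ρ p * χ (ℓ.co p)) ∂m)
    (hper : ℓ.per → ∀ ρ ∈ R, ∫ p, g p * ρ p ∂m = 0) : ℓ.AC f g := by
  have hL := ℓ.L_pos
  obtain ⟨χ₀, hχ₀, hχ₀1⟩ := exists_unit_bump hL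
  have hint : ∀ F : X → ℝ, Integrable F m → ∀ ρ ∈ R, ∀ ϑ, Bump ℓ.L ϑ →
      Integrable (fun p => F p * (ρ p * ϑ (ℓ.co p))) m := by
    intro F hF ρ hρ ϑ hϑ
    obtain ⟨h1, B, hB⟩ := hbd ρ hρ
    obtain ⟨B', hB'⟩ := hϑ.bound
    refine hF.mul_bdd (c := B * B') ?_ ?_
    · exact (h1.mul (hϑ.continuous.measurable.comp ℓ.meas_co)).aestronglyMeasurable
    · refine Eventually.of_forall fun p => ?_
      rw [norm_mul]
      exact mul_le_mul (hB p) (hB' _) (norm_nonneg _) ((abs_nonneg _).trans (hB p))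
  have hker0 : Ker (fun _ s => χ₀ s) := by
    obtain ⟨B, hB⟩ := hχ₀.bound
    exact ⟨hχ₀.continuous.measurable.comp measurable_snd, B, fun _ s => hB s⟩
  set K : X → ℝ := fun p => f p - ℓ.op primKer g p with hK
  have hKi : Integrable K m := hf.sub (integrable_op ker_prim hg)
  set H : X → ℝ := fun p => K p - ℓ.op (fun _ s => χ₀ s) K p with hH
  have hHi : Integrable H m := hKi.sub (integrable_op hker0 hKi)
  have hKup : ∀ p, ∀ᵐ s ∂ℓ.lam, K (ℓ.up p s) = f (ℓ.up p s) - ∫ τ in (0 : ℝ)..s, g (ℓ.up p τ) := by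
    intro p
    filter_upwards [ae_restrict_mem measurableSet_Ioo] with s hs
    simp only [hK, op_up]
    rw [prim_integral (α := fun τ => g (ℓ.up p τ)) ⟨hs.1.le, hs.2.le⟩]
  have hH0 : H =ᵐ[m] 0 := by
    refine hsep H hHi fun ρ hρ ϑ hϑ => ?_
    set I := ∫ s in Ioo 0 ℓ.L, ϑ s with hI
    have hϑ0 := hϑ.sub_smul hχ₀ I
    have hi1 : ∀ {ψ : ℝ → ℝ}, Bump ℓ.L ψ → IntegrableOn ψ (Ioo 0 ℓ.L) := fun hψ =>
      (hψ.continuous.integrableOn_Icc (a := 0) (b := ℓ.L)).mono_set Ioo_subset_Icc_self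
    obtain ⟨χ, hχ, hχd⟩ := hϑ0.exists_primitive hL (by
      rw [integral_sub (hi1 hϑ) ((hi1 hχ₀).const_mul I), integral_const_mul, hχ₀1]
      simp [hI])
    have e1 := integral_prod_line (ℓ := ℓ) (hint H hHi ρ hρ ϑ hϑ)
    have e2 := integral_prod_line (ℓ := ℓ)
      ((hint f hf ρ hρ (deriv χ) hχ.deriv_bump).add (hint g hg ρ hρ χ hχ))
    have e3 : ∫ p, ((fun p => f p * (ρ p * deriv χ (ℓ.co p))) +
        (fun p => g p * (ρ p * χ (ℓ.co p)))) p ∂m = 0 := by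
      rw [integral_add' (hint f hf ρ hρ (deriv χ) hχ.deriv_bump) (hint g hg ρ hρ χ hχ),
        hw ρ hρ χ hχ]; ring
    rw [e3, mul_zero] at e2
    suffices hs : ∫ p, ∫ s, H (ℓ.up p s) * (ρ (ℓ.up p s) * ϑ (ℓ.co (ℓ.up p s))) ∂ℓ.lam ∂m = 0 by
      rw [hs] at e1
      exact (mul_eq_zero.1 e1.symm).resolve_left hL.ne'
    rw [← e2]
    refine integral_congr_ae ?_
    filter_upwards [ae_integrable_line (ℓ := ℓ) hf, ae_integrable_line (ℓ := ℓ) hg,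
      ae_integrable_line (ℓ := ℓ) hKi] with p hfp hgp hKp
    simp only [Pi.add_apply, ℓ.co_up, hinv ρ hρ]
    set c := ℓ.op (fun _ s => χ₀ s) K p with hc
    have hHp : ∀ s, H (ℓ.up p s) = K (ℓ.up p s) - c := by
      intro s; simp only [hH, hc, op, ℓ.up_up]
    simp only [hHp]
    have hA : LineAC ℓ.L (fun s => ∫ τ in (0 : ℝ)..s, g (ℓ.up p τ)) (fun s => g (ℓ.up p s)) 0
        (∫ τ in (0 : ℝ)..ℓ.L, g (ℓ.up p τ)) :=
      ⟨hgp, by simp, by simp⟩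
    have hχac : LineAC ℓ.L χ (deriv χ) (χ 0) (χ ℓ.L) := LineAC.of_hasDerivAt hL
      (fun s => ((hχ.1.differentiable (by simp)) s).hasDerivAt) hχ.deriv_bump.continuous
    have hz := (hA.mul hL hχac).integral_eq hL
    rw [hχ.zero_left, hχ.zero_right] at hz
    simp only [mul_zero, sub_zero] at hz
    have hAi : Integrable (fun s => ∫ τ in (0 : ℝ)..s, g (ℓ.up p τ)) ℓ.lam := by
      have h1 : Integrable (fun s => f (ℓ.up p s) - K (ℓ.up p s)) ℓ.lam := hfp.sub hKp
      refine h1.congr ?_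
      filter_upwards [hKup p] with s hs; rw [hs]; ring
    have b1 := bump_integrable hϑ.continuous hϑ.bound hKp
    have b2 := bump_integrable hχ₀.continuous hχ₀.bound hKp
    have b3 := bump_integrable hχ.continuous hχ.bound hgp
    have b4 := bump_integrable hχ.deriv_bump.continuous hχ.deriv_bump.bound hfp
    have b5 := bump_integrable hχ.deriv_bump.continuous hχ.deriv_bump.bound hAi
    rw [integral_add b3 b5] at hz
    have hcK : c = ∫ s, K (ℓ.up p s) * χ₀ s ∂ℓ.lam := by
      simp only [hc, op, mul_comm]
    have s1 : ∫ s, (K (ℓ.up p s) - c) * (ρ p * ϑ s) ∂ℓ.lam =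
        ρ p * (∫ s, K (ℓ.up p s) * ϑ s ∂ℓ.lam - c * I) := by
      have : ∀ s, (K (ℓ.up p s) - c) * (ρ p * ϑ s) =
          ρ p * (K (ℓ.up p s) * ϑ s - c * ϑ s) := fun s => by ring
      simp only [this]
      rw [integral_const_mul, integral_sub b1 ((hi1 hϑ).const_mul c), integral_const_mul]
    have s2 : ∫ s, (f (ℓ.up p s) * (ρ p * deriv χ s) + g (ℓ.up p s) * (ρ p * χ s)) ∂ℓ.lam =
        ρ p * (∫ s, f (ℓ.up p s) * deriv χ s ∂ℓ.lam + ∫ s, g (ℓ.up p s) * χ s ∂ℓ.lam) := by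
      have : ∀ s, f (ℓ.up p s) * (ρ p * deriv χ s) + g (ℓ.up p s) * (ρ p * χ s) =
          ρ p * (f (ℓ.up p s) * deriv χ s + g (ℓ.up p s) * χ s) := fun s => by ring
      simp only [this]
      rw [integral_const_mul, integral_add b4 b3]
    rw [s1, s2]
    have s3 : ∫ s, K (ℓ.up p s) * ϑ s ∂ℓ.lam - c * I = ∫ s, K (ℓ.up p s) * deriv χ s ∂ℓ.lam := by
      rw [hχd]
      have : ∀ s, K (ℓ.up p s) * (ϑ s - I * χ₀ s) =
          K (ℓ.up p s) * ϑ s - I * (K (ℓ.up p s) * χ₀ s) := fun s => by ring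
      simp only [this]
      rw [integral_sub b1 (b2.const_mul I), integral_const_mul, hcK]; ring
    have s4 : ∫ s, K (ℓ.up p s) * deriv χ s ∂ℓ.lam = ∫ s, f (ℓ.up p s) * deriv χ s ∂ℓ.lam -
        ∫ s, (∫ τ in (0 : ℝ)..s, g (ℓ.up p τ)) * deriv χ s ∂ℓ.lam := by
      rw [← integral_sub b4 b5]
      refine integral_congr_ae ?_
      filter_upwards [hKup p] with s hs; rw [hs]; ring
    rw [s3, s4]
    have : ∫ s, g (ℓ.up p s) * χ s ∂ℓ.lam =
      -∫ s, (∫ τ in (0 : ℝ)..s, g (ℓ.up p τ)) * deriv χ s ∂ℓ.lam := by linarith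
    rw [this]; ring
  have hJ : ℓ.per → (ℓ.op (fun _ _ => 1) g) =ᵐ[m] 0 := by
    intro hp
    have hk1 : Ker (fun _ _ : ℝ => (1 : ℝ)) := ⟨measurable_const, 1, by simp⟩
    have hJi := integrable_op (ℓ := ℓ) hk1 hg
    refine hsep _ hJi fun ρ hρ ϑ hϑ => ?_
    have e1 := integral_prod_line (ℓ := ℓ) (hint _ hJi ρ hρ ϑ hϑ)
    have hgρ : Integrable (fun p => g p * ρ p) m := by
      obtain ⟨h1, B, hB⟩ := hbd ρ hρ
      exact hg.mul_bdd (c := B) h1.aestronglyMeasurable (Eventually.of_forall fun p => by simpa using hB p)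
    have e2 := integral_prod_line (ℓ := ℓ) hgρ
    rw [hper hp ρ hρ, mul_zero] at e2
    have e3 : ∫ p, ∫ s, ℓ.op (fun _ _ => 1) g (ℓ.up p s) *
        (ρ (ℓ.up p s) * ϑ (ℓ.co (ℓ.up p s))) ∂ℓ.lam ∂m =
        (∫ s, ϑ s ∂ℓ.lam) * ∫ p, ∫ s, g (ℓ.up p s) * ρ (ℓ.up p s) ∂ℓ.lam ∂m := by
      rw [← integral_const_mul]
      refine integral_congr_ae (Eventually.of_forall fun p => ?_)
      simp only [op_up, ℓ.co_up, hinv ρ hρ, one_mul]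
      rw [integral_const_mul, integral_const_mul, integral_mul_const]; ring
    rw [e3, e2, mul_zero] at e1
    exact (mul_eq_zero.1 e1.symm).resolve_left hL.ne'
  have hJ' : ∀ᵐ p ∂m, ℓ.per → ∫ s, g (ℓ.up p s) ∂ℓ.lam = 0 := by
    by_cases hp : ℓ.per
    · filter_upwards [hJ hp] with p h _
      simpa [op] using h
    · exact Eventually.of_forall fun p h => absurd h hp
  filter_upwards [ae_line hH0, hJ', ae_integrable_line (ℓ := ℓ) hg] with p h1 h2 h3
  set c := ℓ.op (fun _ s => χ₀ s) K p with hc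
  refine ⟨c, c + ∫ τ in (0 : ℝ)..ℓ.L, g (ℓ.up p τ), fun hp => ?_, h3, ?_, rfl⟩
  · rw [intervalIntegral.integral_of_le hL.le, integral_Ioc_eq_integral_Ioo]
    have := h2 hp
    simp only [lam] at this
    rw [this, add_zero]
  · filter_upwards [h1, hKup p] with s hs1 hs2
    have hHp : H (ℓ.up p s) = K (ℓ.up p s) - c := by
      simp only [hH, hc, op, ℓ.up_up]
    rw [hHp, hs2] at hs1
    simp only [Pi.zero_apply] at hs1
    linarith

end Line

/-- The side lengths of the cell. -/
def side (h : ℝ) (i : Fin 3) : ℝ := if i = 2 then h else 1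

/-- Lebesgue measure on the cell. -/
abbrev mO (h : ℝ) : Measure (Fin 3 → ℝ) := volume.restrict (Om h)

/-- Lebesgue measure on the space-time cylinder. -/
abbrev mQ (T h : ℝ) : Measure Pt := volume.restrict (Q T h)

lemma mO_eq (h : ℝ) : mO h = Measure.pi fun i => volume.restrict (Ioo 0 (side h i)) := by
  have h1 : Om h = Set.univ.pi fun i : Fin 3 => if i = 2 then Ioo 0 h else Ico 0 1 := by
    ext x
    simp only [Om, mem_ofPred_eq, mem_univ_pi]
    constructor
    · rintro ⟨h0, h1, h2⟩ i
      fin_cases i <;> simp_all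
    · intro H
      exact ⟨by simpa using H 0, by simpa using H 1, by simpa using H 2⟩
  rw [mO, h1, volume_pi, Measure.restrict_pi_pi]
  congr 1
  ext1 i
  by_cases hi : i = 2
  · simp [hi, side]
  · simp only [hi, if_false, side]
    exact Measure.restrict_congr_set Ioo_ae_eq_Ico.symm

lemma mQ_eq (T h : ℝ) : mQ T h = (volume.restrict (Ioo 0 T)).prod (mO h) := by
  rw [mQ, mO, Measure.prod_restrict]; rfl

instance (h : ℝ) : IsFiniteMeasure (mO h) := by rw [mO_eq]; infer_instance

instance (T h : ℝ) : IsFiniteMeasure (mQ T h) := by rw [mQ_eq]; infer_instance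

lemma measurable_update_prod (i : Fin 3) :
    Measurable fun q : (Fin 3 → ℝ) × ℝ => Function.update q.1 i q.2 := by
  rw [measurable_pi_iff]
  intro j
  by_cases hj : j = i
  · subst hj; simpa using measurable_snd
  · simpa [hj] using measurable_fst.eval (a := j)

lemma map_update_pi (μ : Fin 3 → Measure ℝ) [∀ i, IsFiniteMeasure (μ i)] (i : Fin 3) :
    Measure.map (fun q : (Fin 3 → ℝ) × ℝ => Function.update q.1 i q.2)
      ((Measure.pi μ).prod (μ i)) = μ i univ • Measure.pi μ := by
  have hm : Measurable fun q : (Fin 3 → ℝ) × ℝ => Function.update q.1 i q.2 :=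
    measurable_update_prod i
  set ν := Function.update μ i (μ i univ • μ i) with hν
  have hfin : ∀ j, IsFiniteMeasure (ν j) := by
    intro j
    by_cases hj : j = i
    · subst hj
      simp only [hν, Function.update_self]
      exact Measure.smul_finite _ (measure_ne_top _ _)
    · simp only [hν, Function.update_of_ne hj]; infer_instance
  have key : ∀ μ' : Measure (Fin 3 → ℝ), (∀ s : Fin 3 → Set ℝ, (∀ j, MeasurableSet (s j)) →
      μ' (univ.pi s) = μ i univ * ∏ j, μ j (s j)) → Measure.pi ν = μ' := by
    intro μ' hμ'
    refine Measure.pi_eq fun s hs => ?_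
    have hprod : ∏ j, ν j (s j) =
        μ i univ * ∏ j, μ j (s j) := by
      rw [← Finset.mul_prod_erase Finset.univ _ (Finset.mem_univ i),
        ← Finset.mul_prod_erase Finset.univ (fun j => μ j (s j)) (Finset.mem_univ i)]
      simp only [hν, Function.update_self, Measure.smul_apply, smul_eq_mul, mul_assoc]
      congr 2
      refine Finset.prod_congr rfl fun j hj => ?_
      rw [Function.update_of_ne (Finset.ne_of_mem_erase hj)]
    rw [hprod, hμ' s hs]
  rw [← key (μ i univ • Measure.pi μ) fun s hs => by rw [Measure.smul_apply, Measure.pi_pi]; rfl]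
  symm
  refine key _ fun s hs => ?_
  rw [Measure.map_apply hm (MeasurableSet.univ_pi hs)]
  have : (fun q : (Fin 3 → ℝ) × ℝ => Function.update q.1 i q.2) ⁻¹' (univ.pi s) =
      (univ.pi (Function.update s i univ)) ×ˢ (s i) := by
    ext q
    simp only [mem_preimage, Set.mem_pi, mem_univ, forall_true_left, mem_prod]
    constructor
    · intro H
      refine ⟨fun j => ?_, by simpa using H i⟩
      by_cases hj : j = i
      · subst hj; simp
      · simpa [hj] using H j
    · rintro ⟨H1, H2⟩ j
      by_cases hj : j = i
      · subst hj; simpa using H2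
      · simpa [hj] using H1 j
  rw [this, Measure.prod_prod, Measure.pi_pi,
    ← Finset.mul_prod_erase Finset.univ _ (Finset.mem_univ i),
    ← Finset.mul_prod_erase Finset.univ (fun j => μ j (s j)) (Finset.mem_univ i)]
  simp only [Function.update_self]
  rw [mul_assoc, mul_comm (∏ x ∈ _, _)]
  congr 2
  refine Finset.prod_congr rfl fun j hj => ?_
  rw [Function.update_of_ne (Finset.ne_of_mem_erase hj)]

variable {T h : ℝ} [hT : Fact (0 < T)] [hh : Fact (0 < h)]

lemma side_pos (i : Fin 3) : 0 < side h i := by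
  unfold side; split_ifs; exacts [hh.out, one_pos]

variable (h) in
/-- The lines in the `i`-th coordinate direction in the cell. -/
def sLine (i : Fin 3) : Line (mO h) where
  up x s := Function.update x i s
  co x := x i
  L := side h i
  per := i ≠ 2
  L_pos := side_pos i
  meas_up := measurable_update_prod i
  meas_co := measurable_pi_apply i
  co_up _ _ := by simp
  up_up _ _ _ := by simp
  up_co _ := by simp
  co_mem := by
    rw [mO_eq]
    have := (Measure.quasiMeasurePreserving_eval
      (fun i => (volume : Measure ℝ).restrict (Ioo 0 (side h i))) i).ae
      (ae_restrict_mem measurableSet_Ioo)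
    exact this
  map_up := by
    rw [mO_eq, map_update_pi (fun i => (volume : Measure ℝ).restrict (Ioo 0 (side h i)))]
    simp

/-- The lines of a factor, as lines of a product space. -/
def Line.prod {X : Type} [MeasurableSpace X] {m : Measure X} [IsFiniteMeasure m] (ℓ : Line m)
    (μ : Measure ℝ) [IsFiniteMeasure μ] : Line (μ.prod m) where
  up p s := (p.1, ℓ.up p.2 s)
  co p := ℓ.co p.2
  L := ℓ.L
  per := ℓ.per
  L_pos := ℓ.L_pos
  meas_up := by
    have := ℓ.meas_up
    exact (measurable_fst.comp measurable_fst).prodMk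
      (this.comp ((measurable_snd.comp measurable_fst).prodMk measurable_snd))
  meas_co := ℓ.meas_co.comp measurable_snd
  co_up _ _ := ℓ.co_up _ _
  up_up _ _ _ := by simp [ℓ.up_up]
  up_co _ := by simp [ℓ.up_co]
  co_mem := Measure.quasiMeasurePreserving_snd.ae ℓ.co_mem
  map_up := by
    have h1 := (measurePreserving_prodAssoc μ m (volume.restrict (Ioo 0 ℓ.L))).map_eq
    have h2 := Measure.map_prod_map (f := (id : ℝ → ℝ)) μ (m.prod (volume.restrict (Ioo 0 ℓ.L)))
      measurable_id ℓ.meas_up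
    rw [ℓ.map_up, Measure.map_id, Measure.prod_smul_right, ← h1,
      Measure.map_map (measurable_id.prodMap ℓ.meas_up) (MeasurableEquiv.measurable _)] at h2
    rw [h2]
    rfl

/-- The lines in the direction of the first factor of a product space. -/
def Line.first {X : Type} [MeasurableSpace X] (m : Measure X) [IsFiniteMeasure m] (T : ℝ)
    [hT : Fact (0 < T)] : Line ((volume.restrict (Ioo (0 : ℝ) T)).prod m) where
  up p s := (s, p.2)
  co p := p.1
  L := T
  per := False
  L_pos := hT.out
  meas_up := measurable_snd.prodMk (measurable_snd.comp measurable_fst)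
  meas_co := measurable_fst
  co_up _ _ := rfl
  up_up _ _ _ := rfl
  up_co _ := rfl
  co_mem := Measure.quasiMeasurePreserving_fst.ae (ae_restrict_mem measurableSet_Ioo)
  map_up := by
    set μ := (volume : Measure ℝ).restrict (Ioo (0 : ℝ) T)
    have hμ : ENNReal.ofReal T = μ univ := by simp [μ]
    rw [hμ, ← Measure.prod_smul_left]
    have hf : IsFiniteMeasure (μ univ • μ) := Measure.smul_finite μ (measure_ne_top μ univ)
    have hmeas : Measurable fun q : (ℝ × X) × ℝ => (q.2, q.1.2) :=
      measurable_snd.prodMk (measurable_snd.comp measurable_fst)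
    symm
    refine Measure.prod_eq fun s t hs ht => ?_
    rw [Measure.map_apply hmeas (hs.prod ht)]
    have : (fun q : (ℝ × X) × ℝ => (q.2, q.1.2)) ⁻¹' s ×ˢ t = (univ ×ˢ t) ×ˢ s := by
      ext q; simp [and_comm]
    rw [this, Measure.prod_prod, Measure.prod_prod, Measure.smul_apply, smul_eq_mul]
    ring

/-- Transport of lines along an equality of measures. -/
def Line.cast {X : Type} [MeasurableSpace X] {m m' : Measure X} (ℓ : Line m) (e : m = m') :
    Line m' where
  up := ℓ.up
  co := ℓ.co
  L := ℓ.L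
  per := ℓ.per
  L_pos := ℓ.L_pos
  meas_up := ℓ.meas_up
  meas_co := ℓ.meas_co
  co_up := ℓ.co_up
  up_up := ℓ.up_up
  up_co := ℓ.up_co
  co_mem := e ▸ ℓ.co_mem
  map_up := e ▸ ℓ.map_up

variable (T h)

/-- The lines in the `i`-th spatial direction in the space-time cylinder. -/
def qLine (i : Fin 3) : Line (mQ T h) :=
  ((sLine h i).prod (volume.restrict (Ioo 0 T))).cast (mQ_eq T h).symm

/-- The lines in the time direction in the space-time cylinder. -/
def tLine : Line (mQ T h) := (Line.first (mO h) T).cast (mQ_eq T h).symm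

@[simp] lemma qLine_up (i : Fin 3) (p : Pt) (s : ℝ) :
    (qLine T h i).up p s = (p.1, Function.update p.2 i s) := rfl
@[simp] lemma qLine_co (i : Fin 3) (p : Pt) : (qLine T h i).co p = p.2 i := rfl
@[simp] lemma qLine_L (i : Fin 3) : (qLine T h i).L = side h i := rfl
@[simp] lemma qLine_per (i : Fin 3) : (qLine T h i).per = (i ≠ 2) := rfl
@[simp] lemma tLine_up (p : Pt) (s : ℝ) : (tLine T h).up p s = (s, p.2) := rfl
@[simp] lemma tLine_co (p : Pt) : (tLine T h).co p = p.1 := rfl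
@[simp] lemma tLine_L : (tLine T h).L = T := rfl

/-! ### Test functions of tensor form -/

/-- The periodic extension in the horizontal variables, no change in the vertical variable. -/
def pext (i : Fin 3) (f : ℝ → ℝ) : ℝ → ℝ := if i = 2 then f else fun x => f (Int.fract x)

/-- Products of functions of one variable. -/
def tens (α : ℝ → ℝ) (b : Fin 3 → ℝ → ℝ) : Pt → ℝ := fun p => α p.1 * ∏ i, b i (p.2 i)

lemma contDiff_fract {f : ℝ → ℝ} (hf : Bump 1 f) : ContDiff ℝ ∞ fun x => f (Int.fract x) := by
  obtain ⟨hs, a, b, ha, hb, hsupp⟩ := hf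
  rw [contDiff_iff_contDiffAt]
  intro x
  by_cases hx : Int.fract x = 0
  · have hev : (fun x => f (Int.fract x)) =ᶠ[𝓝 x] fun _ => 0 := by
      have hxn : (⌊x⌋ : ℝ) = x := by have := Int.fract_add_floor x; rw [hx] at this; linarith
      set c := min (min a (1 - b)) 1 with hc
      have hcpos : 0 < c := lt_min (lt_min ha (by linarith)) one_pos
      have hc1 : c ≤ 1 := min_le_right _ _
      filter_upwards [Ioo_mem_nhds (show x - c < x by linarith) (show x < x + c by linarith)] with y hy
      by_contra h0
      have h1 := hsupp _ h0
      have hca : c ≤ a := (min_le_left _ _).trans (min_le_left _ _)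
      have hcb : c ≤ 1 - b := (min_le_left _ _).trans (min_le_right _ _)
      rcases le_or_gt x y with hxy | hxy
      · have : ⌊y⌋ = ⌊x⌋ := by
          rw [Int.floor_eq_iff]
          constructor
          · rw [hxn]; exact hxy
          · rw [hxn]; linarith [hy.2]
        have h2 : Int.fract y = y - x := by
          rw [← hxn, ← this]; rfl
        rw [h2] at h1; linarith [h1.1, hy.2]
      · have : ⌊y⌋ = ⌊x⌋ - 1 := by
          rw [Int.floor_eq_iff]
          push_cast
          constructor
          · rw [hxn]; linarith [hy.1]
          · rw [hxn]; linarith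
        have h2 : Int.fract y = y - x + 1 := by
          have : Int.fract y = y - ⌊y⌋ := rfl
          rw [this, ‹⌊y⌋ = _›]; push_cast; rw [hxn]; ring
        rw [h2] at h1; linarith [h1.2, hy.1]
    exact (contDiffAt_const (c := (0:ℝ))).congr_of_eventuallyEq hev
  · have hpos : 0 < Int.fract x := lt_of_le_of_ne (Int.fract_nonneg x) (Ne.symm hx)
    have hev : (fun x => f (Int.fract x)) =ᶠ[𝓝 x] fun y => f (y - ⌊x⌋) := by
      have h1 : (⌊x⌋ : ℝ) < x := by have := Int.fract_add_floor x; linarith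
      filter_upwards [Ioo_mem_nhds h1 (Int.lt_floor_add_one x)] with y hy
      have : ⌊y⌋ = ⌊x⌋ := by
        rw [Int.floor_eq_iff]; exact ⟨hy.1.le, hy.2⟩
      have h2 : Int.fract y = y - ⌊y⌋ := rfl
      rw [h2, this]
    refine ContDiffAt.congr_of_eventuallyEq ?_ hev
    exact (hs.comp (contDiff_id.sub contDiff_const)).contDiffAt

lemma contDiff_pext {h : ℝ} {i : Fin 3} {f : ℝ → ℝ} (hf : Bump (side h i) f) :
    ContDiff ℝ ∞ (pext i f) := by
  unfold pext
  split_ifs with hi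
  · exact hf.1
  · simp only [side, hi, if_false] at hf; exact contDiff_fract hf

lemma pext_periodic {j : Fin 2} (f : ℝ → ℝ) (x : ℝ) :
    pext (hor j) f (x + 1) = pext (hor j) f x := by
  have : hor j ≠ 2 := by fin_cases j <;> decide
  simp [pext, this]

lemma pext_eq {h : ℝ} {i : Fin 3} (f : ℝ → ℝ) {x : ℝ} (hx : x ∈ Ioo 0 (side h i)) :
    pext i f x = f x := by
  unfold pext
  split_ifs with hi
  · rfl
  · simp only [side, hi, if_false] at hx
    show f (Int.fract x) = f x
    rw [Int.fract_eq_self.2 ⟨hx.1.le, hx.2⟩]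

lemma smoothPer_tens {α : ℝ → ℝ} {b : Fin 3 → ℝ → ℝ} (hα : ContDiff ℝ ∞ α)
    (hb : ∀ i, ContDiff ℝ ∞ (b i)) (hp : ∀ j x, b (hor j) (x + 1) = b (hor j) x) :
    SmoothPer (tens α b) := by
  constructor
  · refine (hα.comp contDiff_fst).mul (contDiff_prod fun i _ => ?_)
    exact (hb i).comp ((contDiff_apply ℝ ℝ i).comp contDiff_snd)
  · intro t j x
    simp only [tens]
    congr 1
    refine Finset.prod_congr rfl fun i _ => ?_
    by_cases hi : i = hor j
    · subst hi; simp [hp]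
    · simp [hi]

lemma pd_eq_deriv {φ : Pt → ℝ} (hφ : Differentiable ℝ φ) (i : Fin 3) (p : Pt) (s : ℝ) :
    HasDerivAt (fun s => φ (p.1, Function.update p.2 i s))
      (pd i φ (p.1, Function.update p.2 i s)) s := by
  have h1 : HasDerivAt (fun s => (p.1, Function.update p.2 i s)) ((0 : ℝ), Pi.single i (1:ℝ)) s :=
    (hasDerivAt_const s p.1).prodMk (hasDerivAt_update p.2 i s)
  exact (hφ _).hasFDerivAt.comp_hasDerivAt s h1

lemma td_eq_deriv {φ : Pt → ℝ} (hφ : Differentiable ℝ φ) (p : Pt) (s : ℝ) :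
    HasDerivAt (fun s => φ (s, p.2)) (td φ (s, p.2)) s := by
  have h1 : HasDerivAt (fun s => (s, p.2)) ((1 : ℝ), (0 : Fin 3 → ℝ)) s :=
    (hasDerivAt_id s).prodMk (hasDerivAt_const s p.2)
  exact (hφ _).hasFDerivAt.comp_hasDerivAt s h1

lemma tens_update {α : ℝ → ℝ} {b : Fin 3 → ℝ → ℝ} (i : Fin 3) (f : ℝ → ℝ) (p : Pt) :
    tens α (Function.update b i f) p = tens α (Function.update b i fun _ => 1) p * f (p.2 i) := by
  have key : ∀ g : ℝ → ℝ, ∏ j, (Function.update b i g) j (p.2 j) =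
      g (p.2 i) * ∏ j ∈ Finset.univ.erase i, b j (p.2 j) := by
    intro g
    rw [← Finset.mul_prod_erase Finset.univ _ (Finset.mem_univ i)]
    simp only [Function.update_self]
    congr 1
    exact Finset.prod_congr rfl fun j hj => by
      rw [Function.update_of_ne (Finset.ne_of_mem_erase hj)]
  simp only [tens, key]; ring

lemma tens_one_update {α : ℝ → ℝ} {b : Fin 3 → ℝ → ℝ} (i : Fin 3) (p : Pt) (s : ℝ) :
    tens α (Function.update b i fun _ => 1) (p.1, Function.update p.2 i s) =
      tens α (Function.update b i fun _ => 1) p := by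
  simp only [tens]
  congr 1
  refine Finset.prod_congr rfl fun j _ => ?_
  by_cases hj : j = i
  · subst hj; simp
  · simp [hj]

lemma pd_tens {α : ℝ → ℝ} {b : Fin 3 → ℝ → ℝ} (hα : ContDiff ℝ ∞ α)
    (hb : ∀ i, ContDiff ℝ ∞ (b i)) (i : Fin 3) (p : Pt) :
    pd i (tens α b) p = tens α (Function.update b i (deriv (b i))) p := by
  have hd : Differentiable ℝ (tens α b) := by
    have : ContDiff ℝ ∞ (tens α b) :=
      (hα.comp contDiff_fst).mul (contDiff_prod fun i _ =>
        (hb i).comp ((contDiff_apply ℝ ℝ i).comp contDiff_snd))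
    exact this.differentiable (by simp)
  have h1 := pd_eq_deriv hd i p (p.2 i)
  have h2 : (fun s => tens α b (p.1, Function.update p.2 i s)) =
      fun s => tens α (Function.update b i fun _ => 1) p * b i s := by
    ext s
    have := tens_update (α := α) (b := b) i (b i) (p.1, Function.update p.2 i s)
    rw [Function.update_eq_self, tens_one_update] at this
    simpa using this
  rw [h2] at h1
  have h3 := (((hb i).differentiable (by simp)) (p.2 i)).hasDerivAt.const_mul
    (tens α (Function.update b i fun _ => 1) p)
  have h4 := h1.unique h3
  rw [tens_update]
  simpa using h4

/-- Bumps in every variable. -/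
def IsBumps (T h : ℝ) (α : ℝ → ℝ) (b : Fin 3 → ℝ → ℝ) : Prop :=
  Bump T α ∧ ∀ i, Bump (side h i) (b i)

lemma testInterior_tens {T h : ℝ} {α : ℝ → ℝ} {b : Fin 3 → ℝ → ℝ} (hα : Bump T α)
    (hb : ∀ i, ContDiff ℝ ∞ (b i)) (hp : ∀ j x, b (hor j) (x + 1) = b (hor j) x)
    (h2 : Bump h (b 2)) : TestInterior T h (tens α b) := by
  refine ⟨smoothPer_tens hα.1 hb hp, ?_⟩
  obtain ⟨_, a1, b1, ha1, hb1, hs1⟩ := hα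
  obtain ⟨_, a2, b2, ha2, hb2, hs2⟩ := h2
  refine ⟨a1, b1, a2, b2, ha1, hb1, ha2, hb2, fun p hp => ⟨hs1 _ ?_, hs2 _ ?_⟩⟩
  · intro h0; simp [tens, h0] at hp
  · intro h0
    apply hp
    simp only [tens]
    rw [Finset.prod_eq_zero (Finset.mem_univ 2) h0, mul_zero]

/-- Smooth approximations of the indicator function of `[-r, r]`. -/
def plateau (r : ℝ) (n : ℕ) (x : ℝ) : ℝ :=
  Real.smoothTransition (1 + n * (r - x)) * Real.smoothTransition (1 + n * (r + x))

lemma contDiff_plateau (r : ℝ) (n : ℕ) : ContDiff ℝ ∞ (plateau r n) := by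
  unfold plateau
  refine (Real.smoothTransition.contDiff.comp ?_).mul (Real.smoothTransition.contDiff.comp ?_)
  all_goals fun_prop

lemma plateau_le (r : ℝ) (n : ℕ) (x : ℝ) : |plateau r n x| ≤ 1 := by
  unfold plateau
  rw [abs_of_nonneg (mul_nonneg (Real.smoothTransition.nonneg _) (Real.smoothTransition.nonneg _))]
  exact mul_le_one₀ (Real.smoothTransition.le_one _) (Real.smoothTransition.nonneg _)
    (Real.smoothTransition.le_one _)

lemma plateau_ne {r : ℝ} {n : ℕ} (hn : 0 < n) {x : ℝ} (hx : plateau r n x ≠ 0) :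
    |x| ≤ r + 1 / n := by
  have hn' : (0:ℝ) < n := by exact_mod_cast hn
  unfold plateau at hx
  have h1 := left_ne_zero_of_mul hx
  have h2 := right_ne_zero_of_mul hx
  rw [Ne, Real.smoothTransition.zero_iff_nonpos, not_le] at h1 h2
  rw [abs_le]
  have e : (n:ℝ) * (1 / n) = 1 := by field_simp
  constructor
  · by_contra hc; push Not at hc
    nlinarith
  · by_contra hc; push Not at hc
    nlinarith

lemma plateau_tendsto (r x : ℝ) :
    Tendsto (fun n : ℕ => plateau r n x) atTop (𝓝 (if |x| ≤ r then 1 else 0)) := by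
  split_ifs with hx
  · refine tendsto_const_nhds.congr fun n => ?_
    rw [abs_le] at hx
    unfold plateau
    rw [Real.smoothTransition.one_of_one_le, Real.smoothTransition.one_of_one_le, mul_one]
    · have := mul_nonneg (Nat.cast_nonneg (α := ℝ) n) (show 0 ≤ r + x by linarith); linarith
    · have := mul_nonneg (Nat.cast_nonneg (α := ℝ) n) (show 0 ≤ r - x by linarith); linarith
  · push Not at hx
    refine tendsto_const_nhds.congr' ?_
    obtain ⟨N, hN⟩ := exists_nat_gt (1 / (|x| - r))
    filter_upwards [eventually_ge_atTop (max N 1)] with n hn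
    by_contra h0
    have hn1 : 0 < n := lt_of_lt_of_le one_pos ((le_max_right _ _).trans hn)
    have h1 := plateau_ne hn1 (Ne.symm h0)
    have h2 : (N : ℝ) ≤ n := by exact_mod_cast (le_max_left _ _).trans hn
    have h3 : (0:ℝ) < |x| - r := by linarith
    have hn' : (0:ℝ) < n := by exact_mod_cast hn1
    rw [div_lt_iff₀ h3] at hN
    have e : (n:ℝ) * (1 / n) = 1 := by field_simp
    nlinarith

variable {T h : ℝ} [hT : Fact (0 < T)] [hh : Fact (0 < h)]

/-- The interior of the space-time cylinder has full measure. -/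
lemma ae_mem_interior : ∀ᵐ p ∂(mQ T h), p.1 ∈ Ioo 0 T ∧ ∀ i, p.2 i ∈ Ioo 0 (side h i) := by
  have h1 := (tLine T h).co_mem
  have h2 : ∀ᵐ p ∂(mQ T h), ∀ i, p.2 i ∈ Ioo 0 (side h i) :=
    ae_all_iff.2 fun i => (qLine T h i).co_mem
  filter_upwards [h1, h2] with p a b using ⟨a, b⟩

lemma measurableSet_Om : MeasurableSet (Om h) := by
  unfold Om
  refine MeasurableSet.inter ?_ (MeasurableSet.inter ?_ ?_)
  exacts [(measurable_pi_apply 0) measurableSet_Ico, (measurable_pi_apply 1) measurableSet_Ico,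
    (measurable_pi_apply 2) measurableSet_Ioo]

lemma measurableSet_Q : MeasurableSet (Q T h) := measurableSet_Ioo.prod measurableSet_Om

/-- Products of bumps separate integrable functions. -/
theorem ae_zero_of_tens {H : Pt → ℝ} (hH : Integrable H (mQ T h))
    (h0 : ∀ α b, IsBumps T h α b → ∫ p, H p * tens α (fun i => pext i (b i)) p ∂(mQ T h) = 0) :
    H =ᵐ[mQ T h] 0 := by
  have hloc : LocallyIntegrable ((Q T h).indicator H) (volume : Measure Pt) :=
    ((integrable_indicator_iff measurableSet_Q).2 hH).locallyIntegrable
  have h1 := IsUnifLocDoublingMeasure.ae_tendsto_average (μ := (volume : Measure Pt)) hloc 1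
  have h2 : ∀ᵐ p ∂(mQ T h), ∀ {ι : Type} {l : Filter ι} (w : ι → Pt) (δ : ι → ℝ)
      (_ : Tendsto δ l (𝓝[>] 0)) (_ : ∀ᶠ j in l, p ∈ Metric.closedBall (w j) (1 * δ j)),
      Tendsto (fun j => ⨍ y in Metric.closedBall (w j) (δ j), (Q T h).indicator H y) l
        (𝓝 ((Q T h).indicator H p)) := by
    apply ae_restrict_of_ae; exact h1
  filter_upwards [h2, ae_mem_interior, ae_restrict_mem measurableSet_Q] with p hp hpi hpQ
  have hlim := hp (ι := ℝ) (l := 𝓝[>] 0) (fun _ => p) (fun r => r) tendsto_id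
    (by filter_upwards [self_mem_nhdsWithin] with r hr
        have hr' : (0:ℝ) < r := hr
        simp [hr'.le])
  rw [indicator_of_mem hpQ] at hlim
  refine tendsto_nhds_unique hlim (tendsto_const_nhds.congr' ?_)
  obtain ⟨d, hd, hd1, hd2⟩ : ∃ d > 0, (d < p.1 ∧ p.1 + d < T) ∧
      ∀ i, d < p.2 i ∧ p.2 i + d < side h i := by
    have hpos : ∀ i, 0 < min (p.2 i) (side h i - p.2 i) := fun i =>
      lt_min (hpi.2 i).1 (by linarith [(hpi.2 i).2])
    have hpos' : 0 < min p.1 (T - p.1) := lt_min hpi.1.1 (by linarith [hpi.1.2])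
    refine ⟨min (min p.1 (T - p.1)) (min (min (p.2 0) (side h 0 - p.2 0))
      (min (min (p.2 1) (side h 1 - p.2 1)) (min (p.2 2) (side h 2 - p.2 2)))) / 2, ?_, ?_, ?_⟩
    · have := lt_min hpos' (lt_min (hpos 0) (lt_min (hpos 1) (hpos 2))); linarith
    all_goals
      have key := lt_min hpos' (lt_min (hpos 0) (lt_min (hpos 1) (hpos 2)))
      set M := min (min p.1 (T - p.1)) (min (min (p.2 0) (side h 0 - p.2 0))
        (min (min (p.2 1) (side h 1 - p.2 1)) (min (p.2 2) (side h 2 - p.2 2)))) with hM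
      have hl : M ≤ min p.1 (T - p.1) := min_le_left _ _
      have hr : M ≤ _ := min_le_right _ _
      have hr0 := hr.trans (min_le_left _ _)
      have hr12 := hr.trans (min_le_right _ _)
      have hr1 := hr12.trans (min_le_left _ _)
      have hr2 := hr12.trans (min_le_right _ _)
    · rw [le_min_iff] at hl; constructor <;> linarith [hl.1, hl.2]
    · rw [le_min_iff] at hr0 hr1 hr2
      intro i
      fin_cases i
      · exact ⟨by simp only [Fin.zero_eta]; linarith [hr0.1],
          by simp only [Fin.zero_eta]; linarith [hr0.2]⟩
      · exact ⟨by simp only [Fin.mk_one]; linarith [hr1.1],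
          by simp only [Fin.mk_one]; linarith [hr1.2]⟩
      · exact ⟨by simp only [Fin.reduceFinMk]; linarith [hr2.1],
          by simp only [Fin.reduceFinMk]; linarith [hr2.2]⟩
  filter_upwards [Ioo_mem_nhdsGT (show (0:ℝ) < d / 2 by linarith)] with r hr
  rw [setAverage_eq]
  suffices hs : ∫ y in Metric.closedBall p r, (Q T h).indicator H y = 0 by
    rw [hs, smul_zero]; rfl
  have hmem : ∀ q : Pt, q ∈ Metric.closedBall p r ↔
      (|q.1 - p.1| ≤ r ∧ ∀ i, |q.2 i - p.2 i| ≤ r) := by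
    intro q
    rw [Metric.mem_closedBall, Prod.dist_eq, max_le_iff, dist_pi_le_iff hr.1.le]
    simp [Real.dist_eq]
  obtain ⟨N, hN⟩ := exists_nat_gt (2 / d)
  have hNb : ∀ n : ℕ, max N 1 ≤ n → r + 1 / (n:ℝ) < d := by
    intro n hn
    have hn1 : (1:ℝ) ≤ n := by exact_mod_cast (le_max_right _ _).trans hn
    have hn2 : (N:ℝ) ≤ n := by exact_mod_cast (le_max_left _ _).trans hn
    have : 1 / (n:ℝ) < d / 2 := by
      rw [div_lt_div_iff₀ (by linarith) two_pos]
      rw [div_lt_iff₀ hd] at hN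
      nlinarith
    linarith [hr.2]
  have hbump : ∀ n : ℕ, max N 1 ≤ n → IsBumps T h (fun x => plateau r n (x - p.1))
      (fun i x => plateau r n (x - p.2 i)) := by
    intro n hn
    have hn1 : 0 < n := lt_of_lt_of_le one_pos ((le_max_right _ _).trans hn)
    have hb := hNb n hn
    refine ⟨⟨(contDiff_plateau r n).comp (contDiff_id.sub contDiff_const), p.1 - (r + 1 / n),
      p.1 + (r + 1 / n), by linarith [hd1.1], by linarith [hd1.2], fun x hx => ?_⟩, fun i =>
      ⟨(contDiff_plateau r n).comp (contDiff_id.sub contDiff_const), p.2 i - (r + 1 / n),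
      p.2 i + (r + 1 / n), by linarith [(hd2 i).1], by linarith [(hd2 i).2], fun x hx => ?_⟩⟩
    all_goals
      have := abs_le.1 (plateau_ne hn1 hx)
      constructor <;> linarith [this.1, this.2]
  have hlim2 : Tendsto (fun n : ℕ => ∫ q, H q * tens (fun x => plateau r n (x - p.1))
      (fun i => pext i fun x => plateau r n (x - p.2 i)) q ∂(mQ T h)) atTop
      (𝓝 (∫ q, H q * (if (|q.1 - p.1| ≤ r ∧ ∀ i, |q.2 i - p.2 i| ≤ r) then 1 else 0) ∂(mQ T h))) := by
    refine tendsto_integral_filter_of_dominated_convergence (fun q => |H q|) ?_ ?_ hH.abs ?_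
    · filter_upwards [eventually_ge_atTop (max N 1)] with n hn
      refine hH.1.mul (Continuous.aestronglyMeasurable ?_)
      have := (smoothPer_tens (α := fun x => plateau r n (x - p.1))
        (b := fun i => pext i fun x => plateau r n (x - p.2 i)) (hbump n hn).1.1
        (fun i => contDiff_pext ((hbump n hn).2 i)) fun j x => pext_periodic _ _).1.continuous
      exact this
    · refine Eventually.of_forall fun n => ?_
      filter_upwards [ae_mem_interior (T := T) (h := h)] with q hq
      have : |tens (fun x => plateau r n (x - p.1))
          (fun i => pext i fun x => plateau r n (x - p.2 i)) q| ≤ 1 := by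
        simp only [tens]
        rw [abs_mul, Finset.abs_prod]
        refine mul_le_one₀ (plateau_le _ _ _) (Finset.prod_nonneg fun _ _ => abs_nonneg _)
          (Finset.prod_le_one (fun _ _ => abs_nonneg _) fun i _ => ?_)
        rw [pext_eq _ (hq.2 i)]
        exact plateau_le _ _ _
      rw [norm_mul]
      exact mul_le_of_le_one_right (norm_nonneg _) this
    · filter_upwards [ae_mem_interior (T := T) (h := h)] with q hq
      refine Tendsto.const_mul _ ?_
      have e : (if (|q.1 - p.1| ≤ r ∧ ∀ i, |q.2 i - p.2 i| ≤ r) then (1:ℝ) else 0) =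
          (if |q.1 - p.1| ≤ r then 1 else 0) * ∏ i, (if |q.2 i - p.2 i| ≤ r then (1:ℝ) else 0) := by
        rw [Fin.prod_univ_three]
        simp only [Fin.forall_fin_succ, IsEmpty.forall_iff, and_true, Fin.succ_zero_eq_one,
          Fin.succ_one_eq_two]
        by_cases c0 : |q.1 - p.1| ≤ r <;> by_cases c1 : |q.2 0 - p.2 0| ≤ r <;>
          by_cases c2 : |q.2 1 - p.2 1| ≤ r <;> by_cases c3 : |q.2 2 - p.2 2| ≤ r <;>
          simp [c0, c1, c2, c3]
      rw [e]
      simp only [tens]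
      refine (plateau_tendsto r _).mul (tendsto_finsetProd _ fun i _ => ?_)
      refine (plateau_tendsto r (q.2 i - p.2 i)).congr fun n => ?_
      rw [pext_eq _ (hq.2 i)]
  have hlim3 : Tendsto (fun n : ℕ => ∫ q, H q * tens (fun x => plateau r n (x - p.1))
      (fun i => pext i fun x => plateau r n (x - p.2 i)) q ∂(mQ T h)) atTop (𝓝 0) := by
    refine tendsto_const_nhds.congr' ?_
    filter_upwards [eventually_ge_atTop (max N 1)] with n hn
    exact (h0 _ _ (hbump n hn)).symm
  have hz := tendsto_nhds_unique hlim2 hlim3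
  rw [← hz, ← integral_indicator (Metric.isClosed_closedBall.measurableSet),
    ← integral_indicator measurableSet_Q]
  congr 1
  ext q
  by_cases hq : q ∈ Q T h
  · by_cases hq2 : q ∈ Metric.closedBall p r
    · simp only [indicator_of_mem hq, indicator_of_mem hq2, if_pos ((hmem q).1 hq2), mul_one]
    · have h5 := mt (hmem q).2 hq2
      simp only [indicator_of_mem hq, indicator_of_notMem hq2, if_neg h5, mul_zero]
  · simp [indicator, hq]

variable {T h : ℝ} [hT : Fact (0 < T)] [hh : Fact (0 < h)]

lemma tens_bound {α : ℝ → ℝ} {b : Fin 3 → ℝ → ℝ} (hα : ∃ B, ∀ x, |α x| ≤ B)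
    (hb : ∀ i, ∃ B, ∀ x, |b i x| ≤ B) : ∃ B, ∀ p, |tens α b p| ≤ B := by
  obtain ⟨A, hA⟩ := hα
  choose B hB using hb
  refine ⟨A * ∏ i, B i, fun p => ?_⟩
  rw [tens, abs_mul, Finset.abs_prod]
  exact mul_le_mul (hA _) (Finset.prod_le_prod (fun _ _ => abs_nonneg _) fun i _ => hB i _)
    (Finset.prod_nonneg fun _ _ => abs_nonneg _) ((abs_nonneg _).trans (hA 0))

lemma pext_bound {i : Fin 3} {f : ℝ → ℝ} (hf : ∃ B, ∀ x, |f x| ≤ B) :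
    ∃ B, ∀ x, |pext i f x| ≤ B := by
  obtain ⟨B, hB⟩ := hf
  exact ⟨B, fun x => by unfold pext; split_ifs; exacts [hB x, hB _]⟩

lemma hor_ne (j : Fin 2) : hor j ≠ 2 := by fin_cases j <;> decide

lemma deriv_pext {i : Fin 3} {f : ℝ → ℝ} {x : ℝ} (hx : x ∈ Ioo 0 (side h i)) :
    deriv (pext i f) x = deriv f x := by
  refine Filter.EventuallyEq.deriv_eq ?_
  filter_upwards [Ioo_mem_nhds hx.1 hx.2] with y hy using pext_eq f hy

/-- The factors of the test functions that do not depend on the `i`-th coordinate. -/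
def tensFactors (T h : ℝ) (i : Fin 3) : Set (Pt → ℝ) :=
  {ρ | ∃ α b, IsBumps T h α b ∧
    ρ = tens α (Function.update (fun j => pext j (b j)) i fun _ => 1)}

lemma tensFactors_bdd (i : Fin 3) : ∀ ρ ∈ tensFactors T h i, Measurable ρ ∧ ∃ B, ∀ p, |ρ p| ≤ B := by
  rintro ρ ⟨α, b, hb, rfl⟩
  constructor
  · have hm : ∀ j, Measurable (Function.update (fun j => pext j (b j)) i (fun _ => 1) j) := by
      intro j
      by_cases hj : j = i
      · subst hj; simp
      · simpa [hj] using (contDiff_pext (hb.2 j)).continuous.measurable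
    exact (hb.1.continuous.measurable.comp measurable_fst).mul
      (Finset.measurable_prod _ fun j _ =>
        (hm j).comp ((measurable_pi_apply j).comp measurable_snd))
  · refine tens_bound hb.1.bound fun j => ?_
    by_cases hj : j = i
    · subst hj; exact ⟨1, by simp⟩
    · simpa [hj] using pext_bound (hb.2 j).bound

lemma tensFactors_sep (i : Fin 3) {H : Pt → ℝ} (hH : Integrable H (mQ T h))
    (h0 : ∀ ρ ∈ tensFactors T h i, ∀ ϑ, Bump (side h i) ϑ →
      ∫ p, H p * (ρ p * ϑ (p.2 i)) ∂(mQ T h) = 0) : H =ᵐ[mQ T h] 0 := by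
  refine ae_zero_of_tens hH fun α b hb => ?_
  rw [← h0 _ ⟨α, b, hb, rfl⟩ (b i) (hb.2 i)]
  refine integral_congr_ae ?_
  filter_upwards [ae_mem_interior (T := T) (h := h)] with p hp
  have := tens_update (α := α) (b := fun j => pext j (b j)) i (pext i (b i)) p
  rw [Function.update_eq_self] at this
  rw [this, pext_eq _ (hp.2 i)]

lemma testInterior_update {i : Fin 3} {α : ℝ → ℝ} {b : Fin 3 → ℝ → ℝ} (hb : IsBumps T h α b)
    {f : ℝ → ℝ} (hf : ContDiff ℝ ∞ f) (hp : i ≠ 2 → ∀ x, f (x + 1) = f x)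
    (h2 : i = 2 → Bump h f) :
    TestInterior T h (tens α (Function.update (fun j => pext j (b j)) i f)) := by
  refine testInterior_tens hb.1 (fun j => ?_) (fun j x => ?_) ?_
  · by_cases hj : j = i
    · subst hj; simpa using hf
    · simpa [hj] using contDiff_pext (hb.2 j)
  · by_cases hj : hor j = i
    · subst hj; simpa using hp (hor_ne j) x
    · simpa [hj] using pext_periodic _ _
  · by_cases hj : 2 = i
    · subst hj; simpa using h2 rfl
    · have := hb.2 2
      simpa [hj, pext, side] using this

/-- The identity defining weak derivatives, for the test functions that separate. -/
def TensWeak (T h : ℝ) (i : Fin 3) (f g : Pt → ℝ) : Prop :=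
  ∀ φ, TestInterior T h φ → (∃ α b, φ = tens α b ∧ Bump T α ∧ (∀ j, ContDiff ℝ ∞ (b j)) ∧
    (∀ j x, b (hor j) (x + 1) = b (hor j) x) ∧ Bump h (b 2)) →
    ∫ p in Q T h, f p * pd i φ p = -∫ p in Q T h, g p * φ p

theorem ac_of_tensWeak {i : Fin 3} {f g : Pt → ℝ} (hf : Integrable f (mQ T h))
    (hg : Integrable g (mQ T h)) (hw : TensWeak T h i f g) : (qLine T h i).AC f g := by
  have hsm : ∀ {α : ℝ → ℝ} {b : Fin 3 → ℝ → ℝ}, IsBumps T h α b → ∀ {f : ℝ → ℝ},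
      ContDiff ℝ ∞ f → ∀ j, ContDiff ℝ ∞ (Function.update (fun j => pext j (b j)) i f j) := by
    intro α b hb f hf j
    by_cases hj : j = i
    · subst hj; simpa using hf
    · simpa [hj] using contDiff_pext (hb.2 j)
  have hpp : ∀ {α : ℝ → ℝ} {b : Fin 3 → ℝ → ℝ}, IsBumps T h α b → ∀ {f : ℝ → ℝ},
      (i ≠ 2 → ∀ x, f (x + 1) = f x) → ∀ j x,
      Function.update (fun j => pext j (b j)) i f (hor j) (x + 1) =
        Function.update (fun j => pext j (b j)) i f (hor j) x := by
    intro α b hb f hp j x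
    by_cases hj : hor j = i
    · subst hj; simpa using hp (hor_ne j) x
    · simpa [hj] using pext_periodic _ _
  have h22 : ∀ {α : ℝ → ℝ} {b : Fin 3 → ℝ → ℝ}, IsBumps T h α b → ∀ {f : ℝ → ℝ},
      (i = 2 → Bump h f) → Bump h (Function.update (fun j => pext j (b j)) i f 2) := by
    intro α b hb f h2
    by_cases hj : 2 = i
    · subst hj; simpa using h2 rfl
    · have := hb.2 2
      simpa [hj, pext, side] using this
  refine Line.ac_of_weak hf hg (tensFactors T h i) ?_ (tensFactors_bdd i)
    (fun H hH h0 => tensFactors_sep i hH h0) ?_ ?_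
  · rintro ρ ⟨α, b, hb, rfl⟩ p s
    exact tens_one_update i p s
  · rintro ρ ⟨α, b, hb, rfl⟩ χ hχ
    have hper : i ≠ 2 → ∀ x, pext i χ (x + 1) = pext i χ x := by
      intro hi x; simp [pext, hi]
    have hb2 : i = 2 → Bump h (pext i χ) := by
      intro hi; subst hi; simpa [pext, side] using hχ
    have htest := testInterior_update (i := i) hb (contDiff_pext hχ) hper hb2
    have := hw _ htest ⟨α, _, rfl, hb.1, hsm hb (contDiff_pext hχ), hpp hb hper, h22 hb hb2⟩
    convert! this using 1
    · refine integral_congr_ae ?_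
      filter_upwards [ae_mem_interior (T := T) (h := h)] with p hp
      rw [pd_tens hb.1.1 (hsm hb (contDiff_pext hχ)), Function.update_idem, Function.update_self,
        tens_update i (deriv (pext i χ)), deriv_pext (hp.2 i)]
      rfl
    · congr 1
      refine integral_congr_ae ?_
      filter_upwards [ae_mem_interior (T := T) (h := h)] with p hp
      rw [tens_update i (pext i χ), pext_eq _ (hp.2 i)]
      rfl
  · rintro hi ρ ⟨α, b, hb, rfl⟩
    have hi' : i ≠ 2 := hi
    have h1 : ContDiff ℝ ∞ (fun _ : ℝ => (1:ℝ)) := contDiff_const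
    have htest := testInterior_update (i := i) hb h1 (fun _ _ => rfl) (fun h => absurd h hi')
    have := hw _ htest ⟨α, _, rfl, hb.1, hsm hb h1, hpp hb (fun _ _ => rfl),
      h22 hb (fun h => absurd h hi')⟩
    have e : ∀ p, pd i (tens α (Function.update (fun j => pext j (b j)) i fun _ => 1)) p = 0 := by
      intro p
      rw [pd_tens hb.1.1 (hsm hb h1), Function.update_idem, tens_update i,
        Function.update_self]
      simp
    simp only [e, mul_zero, integral_zero] at this
    linarith

lemma ac_of_isWeakDeriv {i : Fin 3} {f g : Pt → ℝ} (hw : IsWeakDeriv T h i f g) :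
    (qLine T h i).AC f g :=
  ac_of_tensWeak hw.1 hw.2.1 fun φ hφ _ => hw.2.2 φ hφ

lemma Line.integral_zero_of_closed {X : Type} [MeasurableSpace X] {m : Measure X}
    [IsFiniteMeasure m] {ℓ : Line m} {f g : X → ℝ} (hg : Integrable g m)
    (h : ∀ᵐ p ∂m, ∃ c, LineAC ℓ.L (fun s => f (ℓ.up p s)) (fun s => g (ℓ.up p s)) c c) :
    ∫ p, g p ∂m = 0 := by
  have h1 := integral_prod_line (ℓ := ℓ) hg
  have h2 : ∫ p, ∫ s, g (ℓ.up p s) ∂ℓ.lam ∂m = 0 := by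
    rw [integral_congr_ae (g := fun _ => (0:ℝ))]
    · simp
    · filter_upwards [h] with p ⟨c, h2⟩
      rw [h2.integral_eq ℓ.L_pos, sub_self]
  rw [h2] at h1
  exact (mul_eq_zero.1 h1.symm).resolve_left ℓ.L_pos.ne'

/-- Points of the closed cell. -/
def Qc (T h : ℝ) : Set Pt := Icc 0 T ×ˢ Set.univ.pi fun i => Icc 0 (side h i)

lemma isCompact_Qc : IsCompact (Qc T h) :=
  isCompact_Icc.prod (isCompact_univ_pi fun _ => isCompact_Icc)

lemma memLp_top_of_continuous {φ : Pt → ℝ} (hφ : Continuous φ) : MemLp φ ⊤ (mQ T h) := by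
  obtain ⟨B, hB⟩ := (isCompact_Qc (T := T) (h := h)).exists_bound_of_continuousOn hφ.continuousOn
  refine memLp_top_of_bound hφ.aestronglyMeasurable B ?_
  filter_upwards [ae_mem_interior (T := T) (h := h)] with p hp
  exact hB p ⟨Ioo_subset_Icc_self hp.1, fun i _ => Ioo_subset_Icc_self (hp.2 i)⟩

lemma continuous_pd {φ : Pt → ℝ} (hφ : ContDiff ℝ ∞ φ) (i : Fin 3) : ContDiff ℝ ∞ (pd i φ) :=
  (hφ.fderiv_right (m := ∞) (by simp)).clm_apply contDiff_const

lemma lineAC_of_smooth {φ : Pt → ℝ} (hφ : ContDiff ℝ ∞ φ) (i : Fin 3) (p : Pt) :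
    LineAC (side h i) (fun s => φ (p.1, Function.update p.2 i s))
      (fun s => pd i φ (p.1, Function.update p.2 i s)) (φ (p.1, Function.update p.2 i 0))
      (φ (p.1, Function.update p.2 i (side h i))) := by
  refine LineAC.of_hasDerivAt (F := fun s => φ (p.1, Function.update p.2 i s)) (side_pos i)
    (fun s => pd_eq_deriv (hφ.differentiable (by simp)) i p s) ?_
  exact (continuous_pd hφ i).continuous.comp (by fun_prop)

lemma periodic_update {φ : Pt → ℝ} (hφ : Periodic φ) (j : Fin 2) (p : Pt) :
    φ (p.1, Function.update p.2 (hor j) 1) = φ (p.1, Function.update p.2 (hor j) 0) := by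
  have := hφ p.1 j (Function.update p.2 (hor j) 0)
  change φ (p.1, _) = φ (p.1, _) at this
  rw [← this]
  congr 2
  ext i
  by_cases hi : i = hor j
  · subst hi; simp
  · simp [hi]

lemma exists_hor {i : Fin 3} (hi : i ≠ 2) : ∃ j : Fin 2, hor j = i := by
  fin_cases i
  · exact ⟨0, rfl⟩
  · exact ⟨1, rfl⟩
  · exact absurd rfl hi

theorem isWeakDeriv_of_ac {i : Fin 3} {f g : Pt → ℝ} (hf : Integrable f (mQ T h))
    (hg : Integrable g (mQ T h)) (hac : (qLine T h i).AC f g) : IsWeakDeriv T h i f g := by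
  refine ⟨hf, hg, fun φ hφ => ?_⟩
  have hb1 := memLp_top_of_continuous (T := T) (h := h) hφ.1.1.continuous
  have hb2 := memLp_top_of_continuous (T := T) (h := h) (continuous_pd hφ.1.1 i).continuous
  have hi1 : Integrable (fun p => f p * pd i φ p) (mQ T h) := hf.mul_of_top_left hb2
  have hi2 : Integrable (fun p => g p * φ p) (mQ T h) := hg.mul_of_top_left hb1
  have hz : ∫ p, (g p * φ p + f p * pd i φ p) ∂(mQ T h) = 0 := by
    refine Line.integral_zero_of_closed (ℓ := qLine T h i) (f := fun p => f p * φ p)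
      (hi2.add hi1) ?_
    filter_upwards [hac] with p ⟨c, e, h1, h2⟩
    have h3 := lineAC_of_smooth (h := h) hφ.1.1 i p
    have h4 := h2.mul (side_pos i) h3
    refine ⟨c * φ (p.1, Function.update p.2 i 0), ?_⟩
    convert! h4 using 1
    by_cases hi : i = 2
    · subst hi
      obtain ⟨a, b, c', d, ha, hb, hc, hd, hs⟩ := hφ.2
      have z1 : φ (p.1, Function.update p.2 2 0) = 0 := by
        by_contra h0; have := (hs _ h0).2.1; simp at this; linarith
      have z2 : φ (p.1, Function.update p.2 2 (side h 2)) = 0 := by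
        by_contra h0; have := (hs _ h0).2.2; simp [side] at this; linarith
      rw [z1, z2, mul_zero, mul_zero]
    · obtain ⟨j, rfl⟩ := exists_hor hi
      have : side h (hor j) = 1 := by simp [side, hor_ne]
      rw [this, periodic_update hφ.1.2, h1 hi]
  rw [integral_add hi2 hi1] at hz
  linarith

lemma isWeakDeriv_unique {i : Fin 3} {f f' g g' : Pt → ℝ} (h1 : IsWeakDeriv T h i f g)
    (h2 : IsWeakDeriv T h i f' g') (hf : f =ᵐ[mQ T h] f') : g =ᵐ[mQ T h] g' := by
  have key : (fun p => g p - g' p) =ᵐ[mQ T h] 0 := by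
    refine ae_zero_of_tens (h1.2.1.sub h2.2.1) fun α b hb => ?_
    have htest : TestInterior T h (tens α fun i => pext i (b i)) := by
      refine testInterior_tens hb.1 (fun j => contDiff_pext (hb.2 j))
        (fun j x => pext_periodic _ _) ?_
      have := hb.2 2; simpa [pext, side] using this
    have hb1 := memLp_top_of_continuous (T := T) (h := h) htest.1.1.continuous
    have e1 := h1.2.2 _ htest
    have e2 := h2.2.2 _ htest
    have e3 : ∫ p in Q T h, f p * pd i (tens α fun i => pext i (b i)) p =
        ∫ p in Q T h, f' p * pd i (tens α fun i => pext i (b i)) p := by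
      refine integral_congr_ae ?_
      filter_upwards [hf] with p hp; rw [hp]
    have hi1 : Integrable (fun p => g p * tens α (fun i => pext i (b i)) p) (mQ T h) :=
      Integrable.mul_of_top_left h1.2.1 hb1
    have hi2 : Integrable (fun p => g' p * tens α (fun i => pext i (b i)) p) (mQ T h) :=
      Integrable.mul_of_top_left h2.2.1 hb1
    simp only [sub_mul]
    rw [integral_sub hi1 hi2]
    linarith
  filter_upwards [key] with p hp
  simpa [sub_eq_zero] using hp

lemma IsWeakDeriv.congr {i : Fin 3} {f f' g g' : Pt → ℝ} (h1 : IsWeakDeriv T h i f g)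
    (hf : f' =ᵐ[mQ T h] f) (hg : g' =ᵐ[mQ T h] g) : IsWeakDeriv T h i f' g' := by
  refine ⟨Integrable.congr h1.1 hf.symm, Integrable.congr h1.2.1 hg.symm, fun φ hφ => ?_⟩
  have e1 : ∫ p in Q T h, f' p * pd i φ p = ∫ p in Q T h, f p * pd i φ p :=
    integral_congr_ae (by filter_upwards [hf] with p hp; rw [hp])
  have e2 : ∫ p in Q T h, g' p * φ p = ∫ p in Q T h, g p * φ p :=
    integral_congr_ae (by filter_upwards [hg] with p hp; rw [hp])
  rw [e1, e2, h1.2.2 φ hφ]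

lemma isWeakDeriv_wd {i : Fin 3} {f : Pt → ℝ} (H : ∃ g, IsWeakDeriv T h i f g) :
    IsWeakDeriv T h i f (wd T h i f) := by
  rw [wd, dif_pos H]; exact H.choose_spec

lemma IsWeakDeriv.wd_eq {i : Fin 3} {f g : Pt → ℝ} (H : IsWeakDeriv T h i f g) :
    wd T h i f =ᵐ[mQ T h] g :=
  isWeakDeriv_unique (isWeakDeriv_wd ⟨g, H⟩) H (ae_eq_refl _)

lemma wd_congr {i : Fin 3} {f f' : Pt → ℝ} (hf : f =ᵐ[mQ T h] f') :
    wd T h i f =ᵐ[mQ T h] wd T h i f' := by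
  by_cases H : ∃ g, IsWeakDeriv T h i f g
  · obtain ⟨g, hg⟩ := H
    exact hg.wd_eq.trans (hg.congr hf.symm (ae_eq_refl _)).wd_eq.symm
  · have H' : ¬ ∃ g, IsWeakDeriv T h i f' g := by
      rintro ⟨g, hg⟩; exact H ⟨g, hg.congr hf (ae_eq_refl _)⟩
    rw [wd, wd, dif_neg H, dif_neg H']

/-! ### Operators along different lines commute -/

namespace Line
variable {X : Type} [MeasurableSpace X] {m : Measure X} [IsFiniteMeasure m] {ℓ ℓ' : Line m}
  {k k' : ℝ → ℝ → ℝ} {f g : X → ℝ}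

/-- The coordinates of the two families of lines are independent of each other. -/
structure Indep (ℓ ℓ' : Line m) : Prop where
  up_comm : ∀ p s s', ℓ'.up (ℓ.up p s) s' = ℓ.up (ℓ'.up p s') s
  co_left : ∀ p s, ℓ'.co (ℓ.up p s) = ℓ'.co p
  co_right : ∀ p s, ℓ.co (ℓ'.up p s) = ℓ.co p

lemma integrable_two_lines (hf : Integrable f m) :
    ∀ᵐ p ∂m, Integrable (fun q : ℝ × ℝ => f (ℓ'.up (ℓ.up p q.1) q.2)) (ℓ.lam.prod ℓ'.lam) := by
  have h1 := integrable_line (ℓ := ℓ') hf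
  have h2 : Integrable (fun q : X × ℝ => f (ℓ'.up q.1 q.2))
      (Measure.map (Prod.map (fun q : X × ℝ => ℓ.up q.1 q.2) (id : ℝ → ℝ))
        ((m.prod ℓ.lam).prod ℓ'.lam)) := by
    rw [← Measure.map_prod_map _ _ ℓ.meas_up measurable_id, Measure.map_id]
    have : Measure.map (fun q : X × ℝ => ℓ.up q.1 q.2) (m.prod ℓ.lam) = ENNReal.ofReal ℓ.L • m :=
      ℓ.map_up
    rw [this, Measure.prod_smul_left]
    exact h1.smul_measure ENNReal.ofReal_ne_top
  have h3 := h2.comp_measurable (ℓ.meas_up.prodMap measurable_id)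
  have h4 := (measurePreserving_prodAssoc m ℓ.lam ℓ'.lam).symm.integrable_comp_of_integrable h3
  exact h4.prod_right_ae

lemma op_comm (hi : Indep ℓ ℓ') (hk : Ker k) (hk' : Ker k') (hf : Integrable f m) :
    ℓ.op k (ℓ'.op k' f) =ᵐ[m] ℓ'.op k' (ℓ.op k f) := by
  filter_upwards [integrable_two_lines (ℓ := ℓ) (ℓ' := ℓ') hf] with p hp
  obtain ⟨h1, B, hB⟩ := hk
  obtain ⟨h1', B', hB'⟩ := hk'
  simp only [op, hi.co_left, hi.co_right, ← integral_const_mul]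
  rw [integral_integral_swap]
  · refine integral_congr_ae (Eventually.of_forall fun s' => ?_)
    refine integral_congr_ae (Eventually.of_forall fun s => ?_)
    simp only [hi.up_comm]; ring
  · have e : (Function.uncurry fun s s' => k (ℓ.co p) s * (k' (ℓ'.co p) s' *
        f (ℓ'.up (ℓ.up p s) s'))) = fun q : ℝ × ℝ => (k (ℓ.co p) q.1 * k' (ℓ'.co p) q.2) *
        f (ℓ'.up (ℓ.up p q.1) q.2) := by
      ext q; simp [Function.uncurry]; ring
    rw [e]
    refine hp.bdd_mul (c := B * B') ?_ (Eventually.of_forall fun q => ?_)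
    · exact ((h1.comp (measurable_const.prodMk measurable_fst)).mul
        (h1'.comp (measurable_const.prodMk measurable_snd))).aestronglyMeasurable
    · rw [norm_mul]
      exact mul_le_mul (hB _ _) (hB' _ _) (norm_nonneg _) ((abs_nonneg _).trans (hB 0 0))

lemma op_sub (hk : Ker k) (hf : Integrable f m) (hg : Integrable g m) :
    ℓ.op k (fun p => f p - g p) =ᵐ[m] fun p => ℓ.op k f p - ℓ.op k g p := by
  filter_upwards [ae_integrable_ker (ℓ := ℓ) hk hf, ae_integrable_ker (ℓ := ℓ) hk hg] with p h1 h2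
  simp only [op, mul_sub]
  exact integral_sub (h1 _) (h2 _)

/-- The kernel of the mean over `(0, L)`. -/
def meanKer (L : ℝ) : ℝ → ℝ → ℝ := fun _ _ => 1 / L

lemma ker_mean (L : ℝ) : Ker (meanKer L) :=
  ⟨measurable_const, |1 / L|, fun _ _ => le_rfl⟩

lemma mean_const (c : ℝ) : ∫ _s, 1 / ℓ.L * c ∂ℓ.lam = c := by
  have := ℓ.L_pos
  rw [integral_const, ℓ.lam_real, smul_eq_mul]
  field_simp

lemma ac_iff (hf : Integrable f m) (hg : Integrable g m) : ℓ.AC f g ↔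
    ((fun p => f p - ℓ.op primKer g p) =ᵐ[m]
      ℓ.op (meanKer ℓ.L) (fun p => f p - ℓ.op primKer g p)) ∧
    (ℓ.per → ℓ.op (meanKer ℓ.L) g =ᵐ[m] 0) := by
  have hL := ℓ.L_pos
  have hKi : Integrable (fun p => f p - ℓ.op primKer g p) m := hf.sub (integrable_op ker_prim hg)
  have hKup : ∀ p, ∀ᵐ s ∂ℓ.lam, ℓ.op primKer g (ℓ.up p s) = ∫ τ in (0 : ℝ)..s, g (ℓ.up p τ) := by
    intro p
    filter_upwards [ae_restrict_mem measurableSet_Ioo] with s hs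
    rw [op_up, prim_integral (α := fun τ => g (ℓ.up p τ)) ⟨hs.1.le, hs.2.le⟩]
  constructor
  · intro h
    constructor
    · refine ae_eq_of_line (ℓ := ℓ) hKi.1 (integrable_op (ker_mean _) hKi).1 ?_
      filter_upwards [h] with p ⟨c, e, h1, h2⟩
      have key : ∀ᵐ s ∂ℓ.lam, f (ℓ.up p s) - ℓ.op primKer g (ℓ.up p s) = c := by
        filter_upwards [h2.2.1, hKup p] with s h3 h4
        rw [h3, h4]; ring
      have key2 : ∀ s, ℓ.op (meanKer ℓ.L) (fun p => f p - ℓ.op primKer g p) (ℓ.up p s) = c := by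
        intro s
        rw [op_up, ← mean_const (ℓ := ℓ) c]
        refine integral_congr_ae ?_
        filter_upwards [key] with s' hs'
        simp only [meanKer, hs']
      filter_upwards [key] with s hs
      rw [hs, key2]
    · intro hp
      filter_upwards [h] with p ⟨c, e, h1, h2⟩
      have := h2.integral_eq hL
      rw [h1 hp, sub_self] at this
      simp only [op, meanKer, integral_const_mul, lam, Pi.zero_apply]
      rw [this, mul_zero]
  · rintro ⟨h1, h2⟩
    have h2' : ∀ᵐ p ∂m, ℓ.per → ∫ s, g (ℓ.up p s) ∂ℓ.lam = 0 := by
      by_cases hp : ℓ.per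
      · filter_upwards [h2 hp] with p h _
        simp only [op, meanKer, integral_const_mul, Pi.zero_apply] at h
        exact (mul_eq_zero.1 h).resolve_left (by positivity)
      · exact Eventually.of_forall fun p h => absurd h hp
    filter_upwards [ae_line (ℓ := ℓ) h1, h2', ae_integrable_line (ℓ := ℓ) hg] with p h3 h4 h5
    set c := ℓ.op (meanKer ℓ.L) (fun p => f p - ℓ.op primKer g p) p with hc
    refine ⟨c, c + ∫ τ in (0 : ℝ)..ℓ.L, g (ℓ.up p τ), fun hp => ?_, h5, ?_, rfl⟩
    · have h6 := h4 hp
      simp only [lam] at h6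
      rw [intervalIntegral.integral_of_le hL.le, integral_Ioc_eq_integral_Ioo, h6, add_zero]
    · filter_upwards [h3, hKup p] with s h6 h7
      have : ℓ.op (meanKer ℓ.L) (fun p => f p - ℓ.op primKer g p) (ℓ.up p s) = c := by
        simp only [hc, op, ℓ.up_up, meanKer]
      rw [this, h7] at h6
      linarith

lemma AC.op (h : ℓ.AC f g) (hi : Indep ℓ ℓ') (hf : Integrable f m) (hg : Integrable g m)
    (hk : Ker k) : ℓ.AC (ℓ'.op k f) (ℓ'.op k g) := by
  obtain ⟨h1, h2⟩ := (ac_iff hf hg).1 h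
  have hP := integrable_op (ℓ := ℓ) ker_prim hg
  rw [ac_iff (integrable_op hk hf) (integrable_op hk hg)]
  have e1 : (fun p => ℓ'.op k f p - ℓ.op primKer (ℓ'.op k g) p) =ᵐ[m]
      ℓ'.op k (fun p => f p - ℓ.op primKer g p) := by
    filter_upwards [op_sub (ℓ := ℓ') hk hf hP, op_comm hi ker_prim hk hg] with p a b
    rw [a, b]
  constructor
  · refine e1.trans ((op_congr h1).trans ?_)
    refine (op_comm hi (ker_mean _) hk (hf.sub hP)).symm.trans ?_
    exact op_congr e1.symm
  · intro hp
    refine (op_comm hi (ker_mean _) hk hg).trans ((op_congr (h2 hp)).trans ?_)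
    exact Eventually.of_forall fun p => by simp [Line.op]

/-- The transposed operator. -/
lemma integral_op_mul (hk : Ker k) (hf : Integrable f m) (hg : Integrable g m)
    (h1 : Integrable (fun p => ℓ.op k f p * g p) m)
    (h2 : Integrable (fun p => f p * ℓ.op (fun x s => k s x) g p) m) :
    ∫ p, ℓ.op k f p * g p ∂m = ∫ p, f p * ℓ.op (fun x s => k s x) g p ∂m := by
  have e1 := integral_prod_line (ℓ := ℓ) h1
  have e2 := integral_prod_line (ℓ := ℓ) h2
  have key : ∫ p, ∫ s, ℓ.op k f (ℓ.up p s) * g (ℓ.up p s) ∂ℓ.lam ∂m =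
      ∫ p, ∫ s, f (ℓ.up p s) * ℓ.op (fun x s => k s x) g (ℓ.up p s) ∂ℓ.lam ∂m := by
    refine integral_congr_ae ?_
    filter_upwards [ae_integrable_line (ℓ := ℓ) hf, ae_integrable_line (ℓ := ℓ) hg] with p hfp hgp
    simp only [op_up, ← integral_const_mul, ← integral_mul_const]
    rw [integral_integral_swap]
    · refine integral_congr_ae (Eventually.of_forall fun s' => ?_)
      refine integral_congr_ae (Eventually.of_forall fun s => ?_)
      ring
    · obtain ⟨h1, B, hB⟩ := hk
      have e : (Function.uncurry fun x s => k x s * f (ℓ.up p s) * g (ℓ.up p x)) =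
          fun q : ℝ × ℝ => k q.1 q.2 * (g (ℓ.up p q.1) * f (ℓ.up p q.2)) := by
        ext q; simp [Function.uncurry]; ring
      rw [e]
      refine (hgp.mul_prod hfp).bdd_mul (c := B) h1.aestronglyMeasurable
        (Eventually.of_forall fun q => hB _ _)
  rw [key, e2] at e1
  exact (mul_left_cancel₀ ℓ.L_pos.ne' e1).symm

end Line

variable {T h : ℝ} [hT : Fact (0 < T)] [hh : Fact (0 < h)]

lemma indep_qLine {i j : Fin 3} (hij : i ≠ j) : Line.Indep (qLine T h i) (qLine T h j) := by
  refine ⟨fun p s s' => ?_, fun p s => ?_, fun p s => ?_⟩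
  · simp [Function.update_comm hij]
  · simp [hij.symm]
  · simp [hij]

lemma indep_qLine_tLine (i : Fin 3) : Line.Indep (qLine T h i) (tLine T h) :=
  ⟨fun _ _ _ => rfl, fun _ _ => rfl, fun _ _ => rfl⟩

/-! ### Functions with weak derivatives in Lebesgue spaces -/

/-- `g` is the weak derivative `∂ᵢ f`, and both functions belong to `L^p`. -/
structure W (T h : ℝ) (p : ENNReal) (i : Fin 3) (f g : Pt → ℝ) : Prop where
  left : MemLp f p (mQ T h)
  right : MemLp g p (mQ T h)
  weak : IsWeakDeriv T h i f g

namespace W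
variable {p q r : ENNReal} {i : Fin 3} {f g f' g' : Pt → ℝ}

lemma ac (H : W T h p i f g) : (qLine T h i).AC f g := ac_of_isWeakDeriv H.weak

lemma of_ac (hp : 1 ≤ p) (hf : MemLp f p (mQ T h)) (hg : MemLp g p (mQ T h))
    (hac : (qLine T h i).AC f g) : W T h p i f g :=
  ⟨hf, hg, isWeakDeriv_of_ac (hf.integrable hp) (hg.integrable hp) hac⟩

lemma wd_eq (H : W T h p i f g) : wd T h i f =ᵐ[mQ T h] g := H.weak.wd_eq

lemma congr (H : W T h p i f g) (hf : f' =ᵐ[mQ T h] f) (hg : g' =ᵐ[mQ T h] g) :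
    W T h p i f' g' :=
  ⟨(memLp_congr_ae hf).2 H.left, (memLp_congr_ae hg).2 H.right, H.weak.congr hf hg⟩

lemma mono (H : W T h p i f g) (hpq : q ≤ p) : W T h q i f g :=
  ⟨H.left.mono_exponent hpq, H.right.mono_exponent hpq, H.weak⟩

lemma mul [p.HolderTriple q r] (hr : 1 ≤ r) (H : W T h p i f g) (H' : W T h q i f' g') :
    W T h r i (fun x => f x * f' x) (fun x => g x * f' x + f x * g' x) :=
  of_ac hr (H'.left.mul' H.left) ((H'.left.mul' H.right).add (H'.right.mul' H.left))
    (H.ac.mul H'.ac)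

lemma add (hp : 1 ≤ p) (H : W T h p i f g) (H' : W T h p i f' g') :
    W T h p i (fun x => f x + f' x) (fun x => g x + g' x) := by
  refine of_ac hp (H.left.add H'.left) (H.right.add H'.right) ?_
  filter_upwards [H.ac, H'.ac] with x ⟨c, e, h1, h2⟩ ⟨c', e', h1', h2'⟩
  exact ⟨c + c', e + e', fun hp => by rw [h1 hp, h1' hp], h2.add (side_pos i) h2'⟩

lemma of_const_line (hp : 1 ≤ p) (hf : MemLp f p (mQ T h))
    (hc : ∀ x s, f (x.1, Function.update x.2 i s) = f x) : W T h p i f (fun _ => 0) := by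
  refine of_ac hp hf (memLp_const 0) ?_
  refine Eventually.of_forall fun x => ⟨f x, f x, fun _ => rfl, ?_⟩
  simp only [qLine_up, hc]
  exact LineAC.const _ _

lemma const (c : ℝ) (hp : 1 ≤ p) : W T h p i (fun _ => c) (fun _ => 0) :=
  of_const_line hp (memLp_const c) fun _ _ => rfl

lemma const_mul (hp : 1 ≤ p) (c : ℝ) (H : W T h p i f g) :
    W T h p i (fun x => c * f x) (fun x => c * g x) := by
  refine of_ac hp (H.left.const_mul c) (H.right.const_mul c) ?_
  have := (const (T := T) (h := h) (p := ⊤) (i := i) c le_top).ac.mul H.ac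
  refine this.congr (ae_eq_refl _) (Eventually.of_forall fun x => ?_)
  simp

lemma neg (hp : 1 ≤ p) (H : W T h p i f g) : W T h p i (fun x => -f x) (fun x => -g x) := by
  simpa using H.const_mul hp (-1)

lemma sub (hp : 1 ≤ p) (H : W T h p i f g) (H' : W T h p i f' g') :
    W T h p i (fun x => f x - f' x) (fun x => g x - g' x) := by
  simpa [sub_eq_add_neg] using H.add hp (H'.neg hp)

lemma of_smooth {φ : Pt → ℝ} (hφ : SmoothPer φ) : W T h p i φ (pd i φ) := by
  refine (of_ac (p := ⊤) le_top (memLp_top_of_continuous hφ.1.continuous)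
    (memLp_top_of_continuous (continuous_pd hφ.1 i).continuous) ?_).mono le_top
  refine Eventually.of_forall fun x => ⟨_, _, fun hi => ?_, lineAC_of_smooth hφ.1 i x⟩
  obtain ⟨j, rfl⟩ := exists_hor hi
  have : side h (hor j) = 1 := by simp [side, hor_ne]
  rw [this, periodic_update hφ.2]

lemma op {ℓ' : Line (mQ T h)} {k : ℝ → ℝ → ℝ} (H : W T h p i f g)
    (hi : Line.Indep (qLine T h i) ℓ') (hk : Line.Ker k)
    (hp : 1 ≤ p) (h1 : MemLp (ℓ'.op k f) p (mQ T h)) (h2 : MemLp (ℓ'.op k g) p (mQ T h)) :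
    W T h p i (ℓ'.op k f) (ℓ'.op k g) :=
  of_ac hp h1 h2 (H.ac.op hi (H.left.integrable hp) (H.right.integrable hp) hk)

end W

lemma memLp_top_comp {f : Pt → ℝ} (hf : AEStronglyMeasurable f (mQ T h)) {c B : ℝ}
    {F : ℝ → ℝ} (hF : ContinuousOn F (Icc c B)) (hcB : ∀ᵐ p ∂(mQ T h), f p ∈ Icc c B) :
    MemLp (fun p => F (f p)) ⊤ (mQ T h) := by
  by_cases hle : c ≤ B
  · have hcont : Continuous fun x => F (max c (min x B)) := by
      refine hF.comp_continuous (by fun_prop) fun x => ⟨le_max_left _ _, max_le hle (min_le_right _ _)⟩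
    have h1 : AEStronglyMeasurable (fun p => F (max c (min (f p) B))) (mQ T h) :=
      hcont.comp_aestronglyMeasurable hf
    have h2 : (fun p => F (max c (min (f p) B))) =ᵐ[mQ T h] fun p => F (f p) := by
      filter_upwards [hcB] with p hp
      rw [min_eq_left hp.2, max_eq_right hp.1]
    obtain ⟨C, hC⟩ := isCompact_Icc.exists_bound_of_continuousOn hF
    refine memLp_top_of_bound (h1.congr h2) C ?_
    filter_upwards [hcB] with p hp using hC _ hp
  · have : ∀ᵐ p ∂(mQ T h), False := by
      filter_upwards [hcB] with p hp using hle (hp.1.trans hp.2)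
    have h0 : mQ T h = 0 := by
      rw [← ae_eq_bot]; exact Filter.eventually_false_iff_eq_bot.1 this
    rw [h0]; exact ⟨aestronglyMeasurable_zero_measure _, by simp⟩

/-- Chain rule for functions with values in a compact interval. -/
lemma W.comp {p : ENNReal} (hp : 1 ≤ p) {i : Fin 3} {f g : Pt → ℝ} (H : W T h p i f g) {c B : ℝ}
    {F F' : ℝ → ℝ} (hF : ∀ x ∈ Icc c B, HasDerivAt F (F' x) x) (hF' : ContinuousOn F' (Icc c B))
    (hcB : ∀ᵐ p ∂(mQ T h), f p ∈ Icc c B) :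
    W T h p i (fun x => F (f x)) (fun x => F' (f x) * g x) := by
  have h1 := memLp_top_comp H.left.1 (fun x hx => (hF x hx).continuousAt.continuousWithinAt) hcB
  have h2 := memLp_top_comp H.left.1 hF' hcB
  exact W.of_ac hp (h1.mono_exponent le_top) (H.right.mul' h2)
    (H.ac.comp isClosed_Icc hF hF' hcB)

/-! ### Integrals over part of the time interval -/

lemma integral_Q_eq {t : ℝ} (ht : t ≤ T) (g : Pt → ℝ) :
    ∫ p in Q t h, g p = ∫ p, (Iio t).indicator (fun _ => (1:ℝ)) p.1 * g p ∂(mQ T h) := by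
  have e : (fun p : Pt => (Iio t).indicator (fun _ => (1:ℝ)) p.1 * g p) =
      (Prod.fst ⁻¹' (Iio t)).indicator g := by
    ext p; by_cases hp : p.1 < t <;> simp [indicator, hp]
  rw [e, integral_indicator (measurable_fst measurableSet_Iio), mQ,
    Measure.restrict_restrict (measurable_fst measurableSet_Iio)]
  congr 2
  ext p
  simp only [Q, mem_prod, mem_inter_iff, mem_preimage, mem_Iio, mem_Ioo]
  constructor
  · rintro ⟨⟨a, b⟩, c⟩; exact ⟨b, ⟨a, b.trans_le ht⟩, c⟩
  · rintro ⟨a, ⟨b, _⟩, c⟩; exact ⟨⟨b, a⟩, c⟩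

lemma indicator_bdd (t : ℝ) : Measurable ((Iio t).indicator fun _ => (1:ℝ)) ∧
    ∃ B, ∀ s, |(Iio t).indicator (fun _ => (1:ℝ)) s| ≤ B := by
  refine ⟨measurable_const.indicator measurableSet_Iio, 1, fun s => ?_⟩
  by_cases hs : s < t <;> simp [indicator, hs]

variable {T h : ℝ} [hT : Fact (0 < T)] [hh : Fact (0 < h)]

/-! ### Commuting weak derivatives -/

lemma pd_comm {φ : Pt → ℝ} (hφ : ContDiff ℝ ∞ φ) (i j : Fin 3) :
    pd i (pd j φ) = pd j (pd i φ) := by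
  have key : ∀ (i j : Fin 3) p, pd i (pd j φ) p =
      fderiv ℝ (fderiv ℝ φ) p (0, Pi.single i 1) (0, Pi.single j 1) := by
    intro i j p
    have h1 : DifferentiableAt ℝ (fderiv ℝ φ) p :=
      ((hφ.fderiv_right (m := ∞) (by simp)).differentiable (by simp)).differentiableAt
    change fderiv ℝ (fun q => fderiv ℝ φ q (0, Pi.single j 1)) p _ = _
    rw [fderiv_clm_apply h1 (differentiableAt_const _)]
    simp
  ext p
  rw [key, key]
  have hs : IsSymmSndFDerivAt ℝ φ p :=
    hφ.contDiffAt.isSymmSndFDerivAt (by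
    rw [minSmoothness_of_isRCLikeNormedField]
    exact WithTop.coe_le_coe.2 (le_top : (2 : ℕ∞) ≤ ⊤))
  exact hs _ _

lemma Periodic.pd {φ : Pt → ℝ} (hφ : Periodic φ) (i : Fin 3) : Periodic (pd i φ) := by
  intro t j x
  have e : φ = fun p : Pt => φ (p + (0, Pi.single (hor j) 1)) := by
    ext p
    have := hφ p.1 j p.2
    simpa [Prod.add_def] using this.symm
  simp only [CPE.pd]
  conv_rhs => rw [e]
  rw [fderiv_comp_add_right (𝕜 := ℝ) (f := φ) (0, Pi.single (hor j) 1)]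
  simp

lemma SmoothPer.pd {φ : Pt → ℝ} (hφ : SmoothPer φ) (i : Fin 3) : SmoothPer (pd i φ) :=
  ⟨continuous_pd hφ.1 i, hφ.2.pd i⟩

lemma TestInterior.pd {φ : Pt → ℝ} (hφ : TestInterior T h φ) (i : Fin 3) :
    TestInterior T h (pd i φ) := by
  obtain ⟨h1, a, b, c, d, ha, hb, hc, hd, hs⟩ := hφ
  refine ⟨h1.pd i, a, b, c, d, ha, hb, hc, hd, fun p hp => ?_⟩
  by_contra hn
  have hcl : IsClosed {q : Pt | q.1 ∈ Icc a b ∧ q.2 2 ∈ Icc c d} :=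
    (isClosed_Icc.preimage continuous_fst).inter
      (isClosed_Icc.preimage ((continuous_apply 2).comp continuous_snd))
  have hz : φ =ᶠ[𝓝 p] fun _ => 0 := by
    filter_upwards [hcl.isOpen_compl.mem_nhds hn] with q hq
    by_contra h0
    exact hq (hs q h0)
  apply hp
  simp only [CPE.pd]
  rw [hz.fderiv_eq]
  simp

/-- Weak derivatives in two directions commute. -/
lemma IsWeakDeriv.comm {i j : Fin 3} {f g k g' : Pt → ℝ} (h1 : IsWeakDeriv T h i f g)
    (h2 : IsWeakDeriv T h j g k) (h3 : IsWeakDeriv T h j f g') : IsWeakDeriv T h i g' k := by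
  refine ⟨h3.2.1, h2.2.1, fun φ hφ => ?_⟩
  have e1 := h3.2.2 _ (hφ.pd i)
  have e2 := h1.2.2 _ (hφ.pd j)
  have e3 := h2.2.2 _ hφ
  rw [pd_comm hφ.1.1 j i, e2] at e1
  linarith

lemma IsWeakDeriv.vertical_zero {i : Fin 3} {f g : Pt → ℝ} (h1 : IsWeakDeriv T h i f g)
    (h2 : IsWeakDeriv T h 2 f fun _ => 0) : IsWeakDeriv T h 2 g fun _ => 0 := by
  have h0 : IsWeakDeriv T h i (fun _ => 0) (fun _ => 0) := (W.const (p := 1) 0 le_rfl).weak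
  exact h2.comm h0 h1

lemma wd_comm {i j : Fin 3} {f : Pt → ℝ} (h1 : ∃ g, IsWeakDeriv T h i f g)
    (h2 : ∃ g, IsWeakDeriv T h j f g) (h3 : ∃ g, IsWeakDeriv T h j (wd T h i f) g) :
    wd T h i (wd T h j f) =ᵐ[mQ T h] wd T h j (wd T h i f) :=
  ((isWeakDeriv_wd h1).comm (isWeakDeriv_wd h3) (isWeakDeriv_wd h2)).wd_eq

/-! ### Convergence in `L²` -/

section Conv
variable {X : Type} [MeasurableSpace X] {m : Measure X}

/-- Bounded sequences that tend to zero in `L²` tend to zero in `L^p` after multiplication by a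
function in `L^p`. -/
lemma tendsto_eLpNorm_mul_zero {q : ENNReal} (hq0 : q ≠ 0) (hq : q ≠ ⊤) {H : ℕ → X → ℝ} {g : X → ℝ}
    (hg : MemLp g q m) (hH : ∀ n, AEStronglyMeasurable (H n) m)
    (h0 : Tendsto (fun n => eLpNorm (H n) 2 m) atTop (𝓝 0)) {B : ℝ}
    (hB : ∀ n, ∀ᵐ x ∂m, |H n x| ≤ B) :
    Tendsto (fun n => eLpNorm (fun x => H n x * g x) q m) atTop (𝓝 0) := by
  have hr := ENNReal.toReal_pos hq0 hq
  set r := q.toReal with hrd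
  have hm : TendstoInMeasure m H atTop (fun _ => 0) := by
    refine tendstoInMeasure_of_tendsto_eLpNorm (p := 2) (by norm_num) hH
      aestronglyMeasurable_const ?_
    have e : ∀ n, (H n - fun _ => (0:ℝ)) = H n := fun n => by ext x; simp
    simpa only [e] using h0
  refine tendsto_of_subseq_tendsto fun ns hns => ?_
  obtain ⟨ms, hms, hae⟩ := (hm.comp hns).exists_seq_tendsto_ae
  refine ⟨ms, ?_⟩
  have key : Tendsto (fun n => ∫⁻ x, ‖H (ns (ms n)) x * g x‖ₑ ^ r ∂m) atTop (𝓝 0) := by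
    have := tendsto_lintegral_of_dominated_convergence' (μ := m)
      (F := fun n x => ‖H (ns (ms n)) x * g x‖ₑ ^ r) (f := fun _ => 0)
      (fun x => ‖B * g x‖ₑ ^ r) (fun n => ?_) (fun n => ?_) ?_ ?_
    · simpa using this
    · exact (((hH _).mul hg.1).enorm).pow_const _
    · filter_upwards [hB (ns (ms n))] with x hx
      gcongr
      rw [enorm_mul, enorm_mul]
      gcongr
      rw [Real.enorm_eq_ofReal_abs, Real.enorm_eq_ofReal_abs]
      exact ENNReal.ofReal_le_ofReal (hx.trans (le_abs_self B))
    · have := (hg.const_mul B).2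
      have h2 := lintegral_rpow_enorm_lt_top_of_eLpNorm_lt_top hq0 hq this
      exact h2.ne
    · filter_upwards [hae] with x hx
      have h1 : Tendsto (fun n => H (ns (ms n)) x * g x) atTop (𝓝 0) := by
        simpa using hx.mul_const (g x)
      have h2 := (h1.enorm).ennrpow_const r
      simpa [hr] using h2
  have h3 := key.ennrpow_const (1/r : ℝ)
  simp only [eLpNorm_eq_lintegral_rpow_enorm_toReal (p := q) hq0 hq]
  simpa [hr] using h3

lemma tendsto_eLpNorm_mul {F G : ℕ → X → ℝ} {f g : X → ℝ} (hF : ∀ n, MemLp (F n) 2 m)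
    (hf : MemLp f 2 m) (hG : ∀ n, MemLp (G n) 2 m) (hg : MemLp g 2 m)
    (hFf : Tendsto (fun n => eLpNorm (fun x => F n x - f x) 2 m) atTop (𝓝 0))
    (hGg : Tendsto (fun n => eLpNorm (fun x => G n x - g x) 2 m) atTop (𝓝 0)) {B : ℝ}
    (hFB : ∀ n, ∀ᵐ x ∂m, |F n x| ≤ B) (hfB : ∀ᵐ x ∂m, |f x| ≤ B) :
    Tendsto (fun n => eLpNorm (fun x => F n x * G n x - f x * g x) 2 m) atTop (𝓝 0) := by
  have h1 := tendsto_eLpNorm_mul_zero (q := 2) (by norm_num) (by norm_num) (H := fun n x => F n x - f x) hg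
    (fun n => (hF n).1.sub hf.1) hFf (B := B + B) fun n => by
      filter_upwards [hFB n, hfB] with x h1 h2
      exact (abs_sub _ _).trans (add_le_add h1 h2)
  have h2 : Tendsto (fun n => ENNReal.ofReal B * eLpNorm (fun x => G n x - g x) 2 m) atTop
      (𝓝 0) := by
    simpa using ENNReal.Tendsto.const_mul hGg (Or.inr ENNReal.ofReal_ne_top)
  have h3 := h2.add h1
  rw [add_zero] at h3
  refine tendsto_of_tendsto_of_tendsto_of_le_of_le tendsto_const_nhds h3 (fun _ => zero_le)
    fun n => ?_
  have e : (fun x => F n x * G n x - f x * g x) =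
      (fun x => F n x * (G n x - g x)) + fun x => (F n x - f x) * g x := by
    ext x; simp only [Pi.add_apply]; ring
  rw [e]
  refine (eLpNorm_add_le ((hF n).1.mul ((hG n).1.sub hg.1)) (((hF n).1.sub hf.1).mul hg.1)
    (by norm_num)).trans ?_
  refine add_le_add ?_ le_rfl
  refine (eLpNorm_le_mul_eLpNorm_of_ae_le_mul (p := 2) (c := B) ?_).trans_eq rfl
  filter_upwards [hFB n] with x hx
  change ‖F n x * (G n x - g x)‖ ≤ _
  rw [norm_mul]
  gcongr
  exact hx

end Conv

/-- Convergence in `L²`, and uniform boundedness if `1 ≤ b`. -/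
structure ConvL2 (T h : ℝ) (b : ℕ) (F : ℕ → Pt → ℝ) (f : Pt → ℝ) : Prop where
  seq : ∀ n, MemLp (F n) 2 (mQ T h)
  lim : MemLp f 2 (mQ T h)
  tend : Tendsto (fun n => eLpNorm (fun x => F n x - f x) 2 (mQ T h)) atTop (𝓝 0)
  bdd : 1 ≤ b → ∃ B, (∀ n, ∀ᵐ x ∂(mQ T h), |F n x| ≤ B) ∧ ∀ᵐ x ∂(mQ T h), |f x| ≤ B

/-- Convergence in `L²` of the horizontal derivatives up to order `m`, those of order less than `b`
being bounded. -/
def Conv (T h : ℝ) : ℕ → ℕ → (ℕ → Pt → ℝ) → (Pt → ℝ) → Prop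
  | b, 0, F, f => ConvL2 T h b F f
  | b, m + 1, F, f => ConvL2 T h b F f ∧ ∀ i : Fin 2,
      (∀ n, ∃ g, IsWeakDeriv T h (hor i) (F n) g) ∧ (∃ g, IsWeakDeriv T h (hor i) f g) ∧
        Conv T h (b - 1) m (fun n => wd T h (hor i) (F n)) (wd T h (hor i) f)

namespace ConvL2
variable {b b' : ℕ} {F G : ℕ → Pt → ℝ} {f g : Pt → ℝ}

lemma congr (H : ConvL2 T h b F f) (hF : ∀ n, G n =ᵐ[mQ T h] F n) (hf : g =ᵐ[mQ T h] f) :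
    ConvL2 T h b G g := by
  refine ⟨fun n => (memLp_congr_ae (hF n)).2 (H.seq n), (memLp_congr_ae hf).2 H.lim, ?_,
    fun hb => ?_⟩
  · convert! H.tend using 2 with n
    refine eLpNorm_congr_ae ?_
    filter_upwards [hF n, hf] with x h1 h2
    rw [h1, h2]
  · obtain ⟨B, h1, h2⟩ := H.bdd hb
    refine ⟨B, fun n => ?_, ?_⟩
    · filter_upwards [h1 n, hF n] with x h3 h4
      rwa [h4]
    · filter_upwards [h2, hf] with x h3 h4
      rwa [h4]

lemma mono (H : ConvL2 T h b F f) (hb : b' ≤ b) : ConvL2 T h b' F f :=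
  ⟨H.seq, H.lim, H.tend, fun h => H.bdd (h.trans hb)⟩

lemma add (H : ConvL2 T h b F f) (H' : ConvL2 T h b G g) :
    ConvL2 T h b (fun n x => F n x + G n x) (fun x => f x + g x) := by
  refine ⟨fun n => (H.seq n).add (H'.seq n), H.lim.add H'.lim, ?_, fun hb => ?_⟩
  · have h3 := H.tend.add H'.tend
    rw [add_zero] at h3
    refine tendsto_of_tendsto_of_tendsto_of_le_of_le tendsto_const_nhds h3 (fun _ => zero_le)
      fun n => ?_
    have e : (fun x => F n x + G n x - (f x + g x)) =
        (fun x => F n x - f x) + fun x => G n x - g x := by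
      ext x; simp only [Pi.add_apply]; ring
    rw [e]
    exact eLpNorm_add_le ((H.seq n).1.sub H.lim.1) ((H'.seq n).1.sub H'.lim.1) (by norm_num)
  · obtain ⟨B, h1, h2⟩ := H.bdd hb
    obtain ⟨B', h1', h2'⟩ := H'.bdd hb
    refine ⟨B + B', fun n => ?_, ?_⟩
    · filter_upwards [h1 n, h1' n] with x h3 h4
      exact (abs_add_le _ _).trans (add_le_add h3 h4)
    · filter_upwards [h2, h2'] with x h3 h4
      exact (abs_add_le _ _).trans (add_le_add h3 h4)

lemma mul_of_bdd (H : ConvL2 T h b F f) (H' : ConvL2 T h b' G g) (hb : 1 ≤ b) :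
    ConvL2 T h (min b b') (fun n x => F n x * G n x) (fun x => f x * g x) := by
  obtain ⟨B, h1, h2⟩ := H.bdd hb
  have mem : ∀ {u v : Pt → ℝ}, MemLp u 2 (mQ T h) → (∀ᵐ x ∂(mQ T h), |u x| ≤ B) →
      MemLp v 2 (mQ T h) → MemLp (fun x => u x * v x) 2 (mQ T h) := fun hu hB hv =>
    hv.mul' (memLp_top_of_bound hu.1 B hB)
  refine ⟨fun n => mem (H.seq n) (h1 n) (H'.seq n), mem H.lim h2 H'.lim,
    tendsto_eLpNorm_mul H.seq H.lim H'.seq H'.lim H.tend H'.tend h1 h2, fun hm => ?_⟩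
  obtain ⟨B', h1', h2'⟩ := H'.bdd (hm.trans (min_le_right _ _))
  have bd : ∀ {u v : Pt → ℝ}, (∀ᵐ x ∂(mQ T h), |u x| ≤ B) → (∀ᵐ x ∂(mQ T h), |v x| ≤ B') →
      ∀ᵐ x ∂(mQ T h), |u x * v x| ≤ B * B' := fun hu hv => by
    filter_upwards [hu, hv] with x h3 h4
    rw [abs_mul]
    exact mul_le_mul h3 h4 (abs_nonneg _) ((abs_nonneg _).trans h3)
  exact ⟨B * B', fun n => bd (h1 n) (h1' n), bd h2 h2'⟩

lemma mul (H : ConvL2 T h b F f) (H' : ConvL2 T h b' G g) (hb : 0 < b + b') :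
    ConvL2 T h (min b b') (fun n x => F n x * G n x) (fun x => f x * g x) := by
  by_cases h1 : 1 ≤ b
  · exact H.mul_of_bdd H' h1
  · have h2 := H'.mul_of_bdd H (by omega : 1 ≤ b')
    rw [min_comm] at h2
    simpa only [mul_comm] using h2

end ConvL2

namespace Conv

lemma base : ∀ {m b : ℕ} {F : ℕ → Pt → ℝ} {f : Pt → ℝ}, Conv T h b m F f → ConvL2 T h b F f
  | 0, _, _, _, H => H
  | _ + 1, _, _, _, H => H.1

lemma congr : ∀ {m b : ℕ} {F G : ℕ → Pt → ℝ} {f g : Pt → ℝ}, Conv T h b m F f →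
    (∀ n, G n =ᵐ[mQ T h] F n) → g =ᵐ[mQ T h] f → Conv T h b m G g
  | 0, _, _, _, _, _, H, hF, hf => ConvL2.congr H hF hf
  | _ + 1, _, _, _, _, _, H, hF, hf => by
    refine ⟨H.1.congr hF hf, fun i => ⟨fun n => ?_, ?_, ?_⟩⟩
    · obtain ⟨g, hg⟩ := (H.2 i).1 n
      exact ⟨g, hg.congr (hF n) (ae_eq_refl _)⟩
    · obtain ⟨g, hg⟩ := (H.2 i).2.1
      exact ⟨g, hg.congr hf (ae_eq_refl _)⟩
    · exact congr (H.2 i).2.2 (fun n => wd_congr (hF n)) (wd_congr hf)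

lemma mono_left : ∀ {m b b' : ℕ} {F : ℕ → Pt → ℝ} {f : Pt → ℝ}, Conv T h b m F f → b' ≤ b →
    Conv T h b' m F f
  | 0, _, _, _, _, H, hb => ConvL2.mono H hb
  | _ + 1, _, _, _, _, H, hb =>
    ⟨H.1.mono hb, fun i => ⟨(H.2 i).1, (H.2 i).2.1, mono_left (H.2 i).2.2 (Nat.sub_le_sub_right hb 1)⟩⟩

lemma pred : ∀ {m b : ℕ} {F : ℕ → Pt → ℝ} {f : Pt → ℝ}, Conv T h b (m + 1) F f → Conv T h b m F f
  | 0, _, _, _, H => H.1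
  | _ + 1, _, _, _, H => ⟨H.1, fun i => ⟨(H.2 i).1, (H.2 i).2.1, pred (H.2 i).2.2⟩⟩

lemma mono_right {m m' b : ℕ} {F : ℕ → Pt → ℝ} {f : Pt → ℝ} (H : Conv T h b m F f) (hm : m' ≤ m) :
    Conv T h b m' F f := by
  induction m with
  | zero => rwa [Nat.le_zero.1 hm]
  | succ m ih =>
    by_cases h : m' = m + 1
    · rwa [h]
    · exact ih H.pred (by omega)

lemma isWeakDeriv_seq {m b : ℕ} {F : ℕ → Pt → ℝ} {f : Pt → ℝ} (H : Conv T h b (m + 1) F f)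
    (i : Fin 2) (n : ℕ) : W T h 2 (hor i) (F n) (wd T h (hor i) (F n)) :=
  ⟨H.1.seq n, (H.2 i).2.2.base.seq n, isWeakDeriv_wd ((H.2 i).1 n)⟩

lemma isWeakDeriv_lim {m b : ℕ} {F : ℕ → Pt → ℝ} {f : Pt → ℝ} (H : Conv T h b (m + 1) F f)
    (i : Fin 2) : W T h 2 (hor i) f (wd T h (hor i) f) :=
  ⟨H.1.lim, (H.2 i).2.2.base.lim, isWeakDeriv_wd (H.2 i).2.1⟩

/-- A sequence with given derivatives. -/
lemma of_deriv {m b : ℕ} {F : ℕ → Pt → ℝ} {f : Pt → ℝ} {F' : Fin 2 → ℕ → Pt → ℝ}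
    {f' : Fin 2 → Pt → ℝ} (H : ConvL2 T h b F f)
    (h1 : ∀ i n, IsWeakDeriv T h (hor i) (F n) (F' i n))
    (h2 : ∀ i, IsWeakDeriv T h (hor i) f (f' i)) (h3 : ∀ i, Conv T h (b - 1) m (F' i) (f' i)) :
    Conv T h b (m + 1) F f :=
  ⟨H, fun i => ⟨fun n => ⟨_, h1 i n⟩, ⟨_, h2 i⟩, (h3 i).congr (fun n => (h1 i n).wd_eq) (h2 i).wd_eq⟩⟩

lemma add : ∀ {m b : ℕ} {F G : ℕ → Pt → ℝ} {f g : Pt → ℝ}, Conv T h b m F f → Conv T h b m G g →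
    Conv T h b m (fun n x => F n x + G n x) (fun x => f x + g x)
  | 0, _, _, _, _, _, H, H' => ConvL2.add H H'
  | m + 1, b, F, G, f, g, H, H' => of_deriv (H.1.add H'.1)
      (fun i n => ((H.isWeakDeriv_seq i n).add (by norm_num) (H'.isWeakDeriv_seq i n)).weak)
      (fun i => ((H.isWeakDeriv_lim i).add (by norm_num) (H'.isWeakDeriv_lim i)).weak)
      fun i => add (H.2 i).2.2 (H'.2 i).2.2

lemma mul : ∀ {m b b' : ℕ} {F G : ℕ → Pt → ℝ} {f g : Pt → ℝ}, Conv T h b m F f →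
    Conv T h b' m G g → m < b + b' →
    Conv T h (min b b') m (fun n x => F n x * G n x) (fun x => f x * g x)
  | 0, _, _, _, _, _, _, H, H', hb => ConvL2.mul H H' hb
  | m + 1, b, b', F, G, f, g, H, H', hb => of_deriv (H.1.mul H'.1 (by omega))
      (fun i n => ((H.isWeakDeriv_seq i n).mul (r := 1) le_rfl (H'.isWeakDeriv_seq i n)).weak)
      (fun i => ((H.isWeakDeriv_lim i).mul (r := 1) le_rfl (H'.isWeakDeriv_lim i)).weak)
      fun i => ((mul (H.2 i).2.2 H'.pred (by omega)).mono_left (by omega)).add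
        ((mul H.pred (H'.2 i).2.2 (by omega)).mono_left (by omega))

end Conv

/-- The horizontal derivatives up to order `m` are square integrable, those of order less than `b`
being bounded. -/
def Sob (T h : ℝ) (b m : ℕ) (f : Pt → ℝ) : Prop := Conv T h b m (fun _ => f) f

namespace Sob
variable {b b' m : ℕ} {f g : Pt → ℝ}

lemma memLp (H : Sob T h b m f) : MemLp f 2 (mQ T h) := (Conv.base H).lim

lemma bdd (H : Sob T h b m f) (hb : 1 ≤ b) : ∃ B, ∀ᵐ x ∂(mQ T h), |f x| ≤ B := by
  obtain ⟨B, _, h2⟩ := (Conv.base H).bdd hb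
  exact ⟨B, h2⟩

lemma memLp_top (H : Sob T h b m f) (hb : 1 ≤ b) : MemLp f ⊤ (mQ T h) := by
  obtain ⟨B, h2⟩ := H.bdd hb
  exact memLp_top_of_bound H.memLp.1 B h2

lemma deriv (H : Sob T h b (m + 1) f) (i : Fin 2) : Sob T h (b - 1) m (wd T h (hor i) f) :=
  (H.2 i).2.2

lemma hasDeriv (H : Sob T h b (m + 1) f) (i : Fin 2) : W T h 2 (hor i) f (wd T h (hor i) f) :=
  Conv.isWeakDeriv_lim H i

/-- The derivative as a pair of bounded functions. -/
lemma hasDeriv_top (H : Sob T h (b + 2) (m + 1) f) (i : Fin 2) :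
    W T h ⊤ (hor i) f (wd T h (hor i) f) :=
  ⟨H.memLp_top (by omega), (H.deriv i).memLp_top (by omega), (H.hasDeriv i).weak⟩

lemma of_memLp (hf : MemLp f 2 (mQ T h)) (hb : 1 ≤ b → ∃ B, ∀ᵐ x ∂(mQ T h), |f x| ≤ B) :
    ConvL2 T h b (fun _ => f) f :=
  ⟨fun _ => hf, hf, by simp, fun h1 => by obtain ⟨B, hB⟩ := hb h1; exact ⟨B, fun _ => hB, hB⟩⟩

lemma congr (H : Sob T h b m f) (hf : g =ᵐ[mQ T h] f) : Sob T h b m g :=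
  Conv.congr H (fun _ => hf) hf

lemma mono (H : Sob T h b m f) {m' : ℕ} (hb : b' ≤ b) (hm : m' ≤ m) : Sob T h b' m' f :=
  Conv.mono_left (Conv.mono_right H hm) hb

lemma add (H : Sob T h b m f) (H' : Sob T h b m g) : Sob T h b m fun x => f x + g x :=
  Conv.add H H'

lemma mul (H : Sob T h b m f) (H' : Sob T h b' m g) (hb : m < b + b') :
    Sob T h (min b b') m fun x => f x * g x :=
  Conv.mul H H' hb

/-- Composition with a smooth function on `(0, ∞)`. -/
lemma comp {c B : ℝ} (hc : 0 < c) (hcB : ∀ᵐ p ∂(mQ T h), f p ∈ Icc c B) :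
    ∀ {m b : ℕ}, Sob T h b m f → 1 ≤ b → m < 2 * b → ∀ {F : ℝ → ℝ},
    ContDiffOn ℝ ∞ F (Ioi 0) → Sob T h b m fun x => F (f x) := by
  have hsub : Icc c B ⊆ Ioi 0 := fun x hx => hc.trans_le hx.1
  have base : ∀ {b : ℕ} {F : ℝ → ℝ}, MemLp f 2 (mQ T h) → ContDiffOn ℝ ∞ F (Ioi 0) →
      ConvL2 T h b (fun _ x => F (f x)) fun x => F (f x) := fun hf hF => by
    have h1 := memLp_top_comp hf.1 (hF.continuousOn.mono hsub) hcB
    refine of_memLp (h1.mono_exponent le_top) fun _ => ?_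
    obtain ⟨C, hC⟩ := isCompact_Icc.exists_bound_of_continuousOn (hF.continuousOn.mono hsub)
    exact ⟨C, by filter_upwards [hcB] with p hp using hC _ hp⟩
  intro m
  induction m with
  | zero => intro b H _ _ F hF; exact base H.memLp hF
  | succ m ih =>
    intro b H hb hm F hF
    have hF' : ContDiffOn ℝ ∞ (_root_.deriv F) (Ioi 0) := hF.deriv_of_isOpen isOpen_Ioi (by simp)
    have hW : ∀ i, W T h 2 (hor i) (fun x => F (f x))
        (fun x => _root_.deriv F (f x) * wd T h (hor i) f x) := fun i =>
      (H.hasDeriv i).comp (by norm_num) (fun x hx =>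
        ((hF.differentiableOn (by simp)).differentiableAt (Ioi_mem_nhds (hsub hx))).hasDerivAt)
        (hF'.continuousOn.mono hsub) hcB
    refine Conv.of_deriv (base H.memLp hF) (fun i _ => (hW i).weak) (fun i => (hW i).weak) fun i => ?_
    exact ((ih (H.mono le_rfl (by omega)) hb (by omega) hF').mul (H.deriv i) (by omega)).mono
      (by omega) le_rfl

end Sob

/-! ### Means along lines -/

/-- The oscillation of a primitive. -/
lemma LineAC.osc {L c e : ℝ} {a α : ℝ → ℝ} (h1 : LineAC L a α c e) {s s' : ℝ} (hsm : s ∈ Ioo 0 L)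
    (hsm' : s' ∈ Ioo 0 L) (hs : a s = c + ∫ τ in (0:ℝ)..s, α τ)
    (hs' : a s' = c + ∫ τ in (0:ℝ)..s', α τ) : |a s - a s'| ≤ ∫ τ in Ioo 0 L, |α τ| := by
  have h3 : a s - a s' = ∫ τ in s'..s, α τ := by
    rw [hs, hs']
    have i1 := intervalIntegrable_of_Ioo hsm.1 (h1.1.mono_set (Ioo_subset_Ioo_right hsm.2.le))
    have i2 := intervalIntegrable_of_Ioo hsm'.1 (h1.1.mono_set (Ioo_subset_Ioo_right hsm'.2.le))
    rw [← intervalIntegral.integral_interval_sub_left i1 i2]; ring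
  rw [h3]
  refine (intervalIntegral.norm_integral_le_integral_norm_uIoc (f := α)).trans ?_
  simp only [Real.norm_eq_abs]
  refine setIntegral_mono_set h1.1.abs (Eventually.of_forall fun _ => abs_nonneg _) ?_
  refine LE.le.eventuallyLE fun τ hτ => ?_
  rw [uIoc_eq_union] at hτ
  rcases hτ with hτ | hτ
  · exact ⟨hsm'.1.trans hτ.1, hτ.2.trans_lt hsm.2⟩
  · exact ⟨hsm.1.trans hτ.1, hτ.2.trans_lt hsm'.2⟩

namespace Line
variable {X : Type} [MeasurableSpace X] {m : Measure X} [IsFiniteMeasure m] {ℓ : Line m}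
  {f g k : X → ℝ}

/-- The mean over the lines. -/
abbrev avg (ℓ : Line m) (f : X → ℝ) : X → ℝ := ℓ.op (meanKer ℓ.L) f

lemma avg_mono (hf : Integrable f m) (hg : Integrable g m) (h : ∀ᵐ p ∂m, f p ≤ g p) :
    ∀ᵐ p ∂m, ℓ.avg f p ≤ ℓ.avg g p := by
  filter_upwards [ae_line (ℓ := ℓ) h, ae_integrable_ker (ℓ := ℓ) (ker_mean ℓ.L) hf,
    ae_integrable_ker (ℓ := ℓ) (ker_mean ℓ.L) hg] with p h1 h2 h3
  refine integral_mono_ae (h2 _) (h3 _) ?_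
  filter_upwards [h1] with s hs
  have := ℓ.L_pos
  simp only [meanKer]
  gcongr

lemma avg_add (hf : Integrable f m) (hg : Integrable g m) :
    ℓ.avg (fun p => f p + g p) =ᵐ[m] fun p => ℓ.avg f p + ℓ.avg g p := by
  filter_upwards [ae_integrable_ker (ℓ := ℓ) (ker_mean ℓ.L) hf,
    ae_integrable_ker (ℓ := ℓ) (ker_mean ℓ.L) hg] with p h2 h3
  simp only [avg, op, mul_add]
  exact integral_add (h2 _) (h3 _)

lemma abs_avg_le (p : X) : |ℓ.avg f p| ≤ ℓ.avg (fun q => |f q|) p := by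
  have := ℓ.L_pos
  refine (abs_integral_le_integral_abs).trans_eq (integral_congr_ae (Eventually.of_forall fun s => ?_))
  simp only [meanKer, abs_mul]
  rw [abs_of_pos (by positivity)]

lemma avg_line (hf : Integrable f m) : ∫ p, ℓ.avg f p ∂m = ∫ p, f p ∂m := by
  have h1 := integral_prod_line (ℓ := ℓ) hf
  have h2 : ∀ p, ℓ.avg f p = 1 / ℓ.L * ∫ s, f (ℓ.up p s) ∂ℓ.lam := fun p => by
    simp only [avg, op, meanKer, integral_const_mul]
  have := ℓ.L_pos
  simp only [h2, integral_const_mul, h1]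
  field_simp

/-- Along a line a function is bounded by its mean and by the mean of its derivative. -/
lemma AC.abs_le (h : ℓ.AC f g) (hf : Integrable f m) (hg : Integrable g m) :
    ∀ᵐ p ∂m, |f p| ≤ ℓ.avg (fun q => |f q| + ℓ.L * |g q|) p := by
  have hL := ℓ.L_pos
  have hi : Integrable (fun q => |f q| + ℓ.L * |g q|) m := hf.abs.add (hg.abs.const_mul _)
  have key : (fun p => max |f p| (ℓ.avg (fun q => |f q| + ℓ.L * |g q|) p)) =ᵐ[m]
      ℓ.avg (fun q => |f q| + ℓ.L * |g q|) := by
    refine ae_eq_of_line (ℓ := ℓ) ?_ (integrable_op (ker_mean _) hi).1 ?_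
    · exact hf.abs.1.sup (integrable_op (ker_mean _) hi).1
    filter_upwards [h, ae_integrable_line (ℓ := ℓ) hf, ae_integrable_line (ℓ := ℓ) hg]
      with p ⟨c, e, _, h1⟩ hfi hgi
    filter_upwards [h1.2.1, ae_restrict_mem measurableSet_Ioo] with s hs hsm
    refine max_eq_right ?_
    rw [avg, op_up]
    have h2 : ∀ᵐ s' ∂ℓ.lam, 1 / ℓ.L * |f (ℓ.up p s)| ≤
        1 / ℓ.L * |f (ℓ.up p s')| + 1 / ℓ.L * ∫ τ, |g (ℓ.up p τ)| ∂ℓ.lam := by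
      filter_upwards [h1.2.1, ae_restrict_mem measurableSet_Ioo] with s' hs' hsm'
      rw [← mul_add]
      gcongr
      have h4 := h1.osc hsm hsm' hs hs'
      have := abs_sub_abs_le_abs_sub (f (ℓ.up p s)) (f (ℓ.up p s'))
      linarith
    have h3 := integral_mono_ae (μ := ℓ.lam) (integrable_const _)
      ((hfi.abs.const_mul _).add (integrable_const _)) h2
    rw [mean_const] at h3
    refine h3.trans_eq ?_
    simp only [meanKer, mul_add, Pi.add_apply]
    rw [integral_add (hfi.abs.const_mul _) (integrable_const _), integral_add (hfi.abs.const_mul _)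
      ((hgi.abs.const_mul _).const_mul _), mean_const]
    congr 1
    simp only [integral_const_mul]
    field_simp
  filter_upwards [key] with p hp
  rw [← hp]; exact le_max_left _ _

/-- Poincaré's inequality along a line. -/
lemma AC.poincare (h : ℓ.AC f g) (h' : ℓ.AC g k) (hper : ℓ.per)
    (hg : Integrable g m) (hk : Integrable k m) :
    ∀ᵐ p ∂m, |g p| ≤ ℓ.L * ℓ.avg (fun q => |k q|) p := by
  have hL := ℓ.L_pos
  have key : (fun p => max |g p| (ℓ.L * ℓ.avg (fun q => |k q|) p)) =ᵐ[m]
      fun p => ℓ.L * ℓ.avg (fun q => |k q|) p := by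
    have hi := (integrable_op (ℓ := ℓ) (ker_mean ℓ.L) hk.abs).const_mul ℓ.L
    refine ae_eq_of_line (ℓ := ℓ) (hg.abs.1.sup hi.1) hi.1 ?_
    filter_upwards [h, h', ae_integrable_line (ℓ := ℓ) hk]
      with p ⟨c, e, h0, h1⟩ ⟨c', e', _, h1'⟩ hki
    have hz : ∫ s in Ioo 0 ℓ.L, g (ℓ.up p s) = 0 := by
      rw [h1.integral_eq hL, h0 hper, sub_self]
    filter_upwards [h1'.2.1, ae_restrict_mem measurableSet_Ioo] with s hs hsm
    refine max_eq_right ?_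
    rw [avg, op_up]
    have h2 : ∀ᵐ s' ∂ℓ.lam, |g (ℓ.up p s) - g (ℓ.up p s')| ≤ ∫ τ, |k (ℓ.up p τ)| ∂ℓ.lam := by
      filter_upwards [h1'.2.1, ae_restrict_mem measurableSet_Ioo] with s' hs' hsm'
      exact h1'.osc hsm hsm' hs hs'
    have hgi : Integrable (fun s => g (ℓ.up p s)) ℓ.lam := h1.1
    have h3 : |∫ s', (g (ℓ.up p s) - g (ℓ.up p s')) ∂ℓ.lam| ≤
        ℓ.L * ∫ τ, |k (ℓ.up p τ)| ∂ℓ.lam := by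
      have := norm_integral_le_of_norm_le_const (μ := ℓ.lam)
        (f := fun s' => g (ℓ.up p s) - g (ℓ.up p s')) h2
      rw [ℓ.lam_real] at this
      rw [mul_comm]; exact this
    rw [integral_sub (integrable_const _) hgi, hz, integral_const, ℓ.lam_real, sub_zero, smul_eq_mul,
      abs_mul, abs_of_pos hL] at h3
    have h4 := le_of_mul_le_mul_left h3 hL
    refine h4.trans_eq ?_
    simp only [meanKer, integral_const_mul]
    field_simp
  filter_upwards [key] with p hp
  rw [← hp]; exact le_max_left _ _

end Line

variable {T h : ℝ} [hT : Fact (0 < T)] [hh : Fact (0 < h)]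

/-! ### Time slices -/

variable (h) in
/-- The integral over a time slice. -/
def sl (f : Pt → ℝ) : ℝ → ℝ := fun t => ∫ x, f (t, x) ∂(mO h)

/-- Lebesgue measure on the time interval. -/
abbrev mT (T : ℝ) : Measure ℝ := volume.restrict (Ioo (0 : ℝ) T)

section Slices
variable {f g : Pt → ℝ}

lemma ae_slice {P : Pt → Prop} (hP : ∀ᵐ p ∂(mQ T h), P p) :
    ∀ᵐ t ∂(mT T), ∀ᵐ x ∂(mO h), P (t, x) := by
  rw [mQ_eq] at hP
  exact Measure.ae_ae_of_ae_prod hP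

lemma ae_of_time {P : ℝ → Prop} (hP : ∀ᵐ t ∂(mT T), P t) : ∀ᵐ p ∂(mQ T h), P p.1 := by
  rw [mQ_eq]
  exact Measure.quasiMeasurePreserving_fst.ae hP

lemma integrable_slice (hf : Integrable f (mQ T h)) :
    ∀ᵐ t ∂(mT T), Integrable (fun x => f (t, x)) (mO h) := by
  rw [mQ_eq] at hf
  exact hf.prod_right_ae

lemma integrable_sl (hf : Integrable f (mQ T h)) : Integrable (sl h f) (mT T) := by
  rw [mQ_eq] at hf
  exact hf.integral_prod_left

lemma integral_sl (hf : Integrable f (mQ T h)) : ∫ t, sl h f t ∂(mT T) = ∫ p, f p ∂(mQ T h) := by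
  rw [mQ_eq] at hf ⊢
  exact integral_integral hf

lemma sl_congr (hfg : f =ᵐ[mQ T h] g) : sl h f =ᵐ[mT T] sl h g := by
  filter_upwards [ae_slice hfg] with t ht using integral_congr_ae ht

lemma sl_mono (hf : Integrable f (mQ T h)) (hg : Integrable g (mQ T h))
    (hfg : ∀ᵐ p ∂(mQ T h), f p ≤ g p) : ∀ᵐ t ∂(mT T), sl h f t ≤ sl h g t := by
  filter_upwards [ae_slice hfg, integrable_slice hf, integrable_slice hg] with t h1 h2 h3
  exact integral_mono_ae h2 h3 h1

lemma sl_add (hf : Integrable f (mQ T h)) (hg : Integrable g (mQ T h)) :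
    ∀ᵐ t ∂(mT T), sl h (fun p => f p + g p) t = sl h f t + sl h g t := by
  filter_upwards [integrable_slice hf, integrable_slice hg] with t h2 h3
  exact integral_add h2 h3

lemma sl_avg (i : Fin 3) (hf : Integrable f (mQ T h)) :
    sl h ((qLine T h i).avg f) =ᵐ[mT T] sl h f := by
  filter_upwards [integrable_slice hf] with t ht
  exact Line.avg_line (ℓ := sLine h i) ht

lemma W.sl_zero {j : Fin 2} (H : W T h 1 (hor j) f g) : ∀ᵐ t ∂(mT T), sl h g t = 0 := by
  have hg := H.right.integrable le_rfl
  have h1 := ((Line.ac_iff (H.left.integrable le_rfl) hg).1 H.ac).2 (hor_ne j)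
  filter_upwards [sl_avg (hor j) hg, sl_congr h1] with t h2 h3
  rw [← h2]
  refine h3.trans ?_
  simp [sl]

lemma mO_real : (mO h).real univ = h := by
  have := hh.out
  rw [Measure.real, mO_eq]
  simp only [Measure.pi_univ, Measure.restrict_apply MeasurableSet.univ, univ_inter,
    Real.volume_Ioo, Fin.prod_univ_three, side]
  simp [this.le]

/-- The iterated mean is the mean over the slice. -/
lemma avg_avg_avg (hf : Integrable f (mQ T h)) :
    (qLine T h 2).avg ((qLine T h 0).avg ((qLine T h 1).avg f)) =ᵐ[mQ T h]
      fun p => (1 / h) * sl h f p.1 := by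
  have hpos := hh.out
  have inv : ∀ (i j : Fin 3) (g : Pt → ℝ), (i ≠ j → ∀ p s, g (p.1, Function.update p.2 i s) = g p) →
      ∀ p s, (qLine T h j).avg g (p.1, Function.update p.2 i s) = (qLine T h j).avg g p := by
    intro i j g hg p s
    simp only [Line.avg, Line.op, Line.meanKer, qLine_up]
    refine integral_congr_ae (Eventually.of_forall fun s' => ?_)
    by_cases hij : i = j
    · subst hij; simp
    · simp only
      rw [Function.update_comm hij]
      have := hg hij (p.1, Function.update p.2 j s') s
      simp only at this
      rw [this]
  set a := (qLine T h 2).avg ((qLine T h 0).avg ((qLine T h 1).avg f)) with ha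
  have hc : ∀ i p s, a (p.1, Function.update p.2 i s) = a p := by
    intro i
    refine inv i 2 _ fun hi => ?_
    refine inv i 0 _ fun hi' => ?_
    refine inv i 1 _ fun hi'' => ?_
    fin_cases i <;> simp_all
  have hc' : ∀ t x y, a (t, x) = a (t, y) := by
    intro t x y
    have e : y = Function.update (Function.update (Function.update x 0 (y 0)) 1 (y 1)) 2 (y 2) := by
      ext i; fin_cases i <;> simp [Function.update]
    have h2 := hc 2 (t, Function.update (Function.update x 0 (y 0)) 1 (y 1)) (y 2)
    have h1 := hc 1 (t, Function.update x 0 (y 0)) (y 1)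
    have h0 := hc 0 (t, x) (y 0)
    simp only at h0 h1 h2
    rw [e, h2, h1, h0]
  have i1 := Line.integrable_op (ℓ := qLine T h 1) (Line.ker_mean (qLine T h 1).L) hf
  have i0 := Line.integrable_op (ℓ := qLine T h 0) (Line.ker_mean (qLine T h 0).L) i1
  have key : ∀ᵐ t ∂(mT T), ∀ x, a (t, x) = (1 / h) * sl h f t := by
    filter_upwards [sl_avg 2 i0, sl_avg 0 i1, sl_avg 1 hf] with t h2 h0 h1 x
    rw [← h1, ← h0, ← h2]
    have : sl h a t = h * a (t, x) := by
      rw [sl, integral_congr_ae (Eventually.of_forall fun y => hc' t y x), integral_const, mO_real,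
        smul_eq_mul]
    change _ = 1 / h * sl h a t
    rw [this]; field_simp
  filter_upwards [ae_of_time (h := h) key] with p hp using hp p.2

end Slices

/-- Functions that do not depend on the vertical coordinate equal their vertical mean. -/
lemma eq_avg_of_vertical {f : Pt → ℝ} (hz : IsWeakDeriv T h 2 f fun _ => 0) :
    f =ᵐ[mQ T h] (qLine T h 2).avg f := by
  have h1 := ((Line.ac_iff hz.1 hz.2.1).1 (ac_of_isWeakDeriv hz)).1
  have e : ∀ p, (qLine T h 2).op Line.primKer (fun _ => 0) p = 0 := fun p => by simp [Line.op]
  simpa only [e, sub_zero] using h1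

lemma ae_abs_le_avg {j : Fin 2} {f g : Pt → ℝ} (H : W T h 1 (hor j) f g) :
    ∀ᵐ p ∂(mQ T h), |f p| ≤ (qLine T h (hor j)).avg (fun q => |f q| + |g q|) p := by
  have := H.ac.abs_le (H.left.integrable le_rfl) (H.right.integrable le_rfl)
  have e : (qLine T h (hor j)).L = 1 := by simp [side, hor_ne]
  simpa only [e, one_mul] using this

/-- The two-dimensional Sobolev inequality, before averaging in the vertical direction. -/
lemma ae_abs_le_avg_avg {f f₀ f₁ f₀₁ : Pt → ℝ} (H0 : W T h 1 (hor 0) f f₀)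
    (H1 : W T h 1 (hor 1) f f₁) (H01 : W T h 1 (hor 1) f₀ f₀₁) :
    ∀ᵐ p ∂(mQ T h), |f p| ≤ (qLine T h 0).avg ((qLine T h 1).avg
      fun q => |f q| + |f₀ q| + (|f₁ q| + |f₀₁ q|)) p := by
  have if' := (H0.left.integrable le_rfl).abs
  have i0 := (H0.right.integrable le_rfl).abs
  have i1 := (H1.right.integrable le_rfl).abs
  have i01 := (H01.right.integrable le_rfl).abs
  have hs : ∀ᵐ p ∂(mQ T h), |f p| + |f₀ p| ≤ (qLine T h 1).avg
      (fun q => |f q| + |f₀ q| + (|f₁ q| + |f₀₁ q|)) p := by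
    filter_upwards [ae_abs_le_avg H1, ae_abs_le_avg H01,
      Line.avg_add (ℓ := qLine T h 1) (if'.add i1) (i0.add i01)] with p h1 h2 h3
    have e : (fun q => |f q| + |f₀ q| + (|f₁ q| + |f₀₁ q|)) =
        fun q => (|f q| + |f₁ q|) + (|f₀ q| + |f₀₁ q|) := by ext q; ring
    rw [e]
    simp only [Pi.add_apply] at h3
    rw [h3]
    exact add_le_add h1 h2
  have := Line.avg_mono (ℓ := qLine T h 0) (if'.add i0) (Line.integrable_op (Line.ker_mean _)
    ((if'.add i0).add (i1.add i01))) hs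
  filter_upwards [ae_abs_le_avg H0, this] with p h1 h2
  exact h1.trans h2

/-- The two-dimensional Sobolev inequality for functions of the horizontal variables. -/
lemma ae_abs_le_sl {f f₀ f₁ f₀₁ : Pt → ℝ} (hz : IsWeakDeriv T h 2 f fun _ => 0)
    (H0 : W T h 1 (hor 0) f f₀) (H1 : W T h 1 (hor 1) f f₁) (H01 : W T h 1 (hor 1) f₀ f₀₁) :
    ∀ᵐ p ∂(mQ T h), |f p| ≤ (1 / h) * sl h (fun q => |f q| + |f₀ q| + (|f₁ q| + |f₀₁ q|)) p.1 := by
  have if' := (H0.left.integrable le_rfl).abs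
  have ig := (if'.add (H0.right.integrable le_rfl).abs).add
    ((H1.right.integrable le_rfl).abs.add (H01.right.integrable le_rfl).abs)
  have i1 := Line.integrable_op (ℓ := qLine T h 1) (Line.ker_mean (qLine T h 1).L) ig
  have i0 := Line.integrable_op (ℓ := qLine T h 0) (Line.ker_mean (qLine T h 0).L) i1
  have := Line.avg_mono (ℓ := qLine T h 2) if' i0 (ae_abs_le_avg_avg H0 H1 H01)
  filter_upwards [this, eq_avg_of_vertical hz, avg_avg_avg ig] with p h1 h2 h3
  rw [h2]
  exact (Line.abs_avg_le p).trans (h1.trans_eq h3)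

/-- Jensen's inequality for averaging operators. -/
lemma Line.op_sq_le {X : Type} [MeasurableSpace X] {m : Measure X} [IsFiniteMeasure m] {ℓ : Line m}
    {k : ℝ → ℝ → ℝ} {f : X → ℝ} (hk : Line.Ker k) (h0 : ∀ x s, 0 ≤ k x s)
    (h1 : ∀ x, ∫ s, k x s ∂ℓ.lam = 1) (hf : Integrable f m) (hf2 : Integrable (fun p => f p ^ 2) m) :
    ∀ᵐ p ∂m, (ℓ.op k f p) ^ 2 ≤ ℓ.op k (fun q => f q ^ 2) p := by
  filter_upwards [ae_integrable_ker (ℓ := ℓ) hk hf, ae_integrable_ker (ℓ := ℓ) hk hf2] with p i1 i2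
  have ik : Integrable (fun s => k (ℓ.co p) s) ℓ.lam := by
    obtain ⟨hm, B, hB⟩ := hk
    exact (integrable_const (1:ℝ)).bdd_mul (c := B)
      (hm.comp (measurable_const.prodMk measurable_id)).aestronglyMeasurable
      (Eventually.of_forall fun s => hB (ℓ.co p) s) |>.congr (Eventually.of_forall fun s => by simp)
  set a := ℓ.op k f p with ha
  have e : ∫ s, k (ℓ.co p) s * (f (ℓ.up p s) - a) ^ 2 ∂ℓ.lam =
      ℓ.op k (fun q => f q ^ 2) p - 2 * a * ℓ.op k f p + a ^ 2 * ∫ s, k (ℓ.co p) s ∂ℓ.lam := by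
    simp only [Line.op]
    have i3 : Integrable (fun s => k (ℓ.co p) s * f (ℓ.up p s) ^ 2 -
      2 * a * (k (ℓ.co p) s * f (ℓ.up p s))) ℓ.lam := (i2 _).sub ((i1 _).const_mul _)
    rw [← integral_const_mul, ← integral_const_mul, ← integral_sub (i2 _) ((i1 _).const_mul _),
      ← integral_add i3 (ik.const_mul _)]
    refine integral_congr_ae (Eventually.of_forall fun s => ?_)
    simp only; ring
  have hnn : 0 ≤ ∫ s, k (ℓ.co p) s * (f (ℓ.up p s) - a) ^ 2 ∂ℓ.lam :=
    integral_nonneg fun s => mul_nonneg (h0 _ _) (sq_nonneg _)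
  rw [e, h1, ← ha] at hnn
  linarith

variable {T h : ℝ} [hT : Fact (0 < T)] [hh : Fact (0 < h)]

lemma Line.avg_sq_le (i : Fin 3) {f : Pt → ℝ} (hf : MemLp f 2 (mQ T h)) :
    ∀ᵐ p ∂(mQ T h), ((qLine T h i).avg f p) ^ 2 ≤ (qLine T h i).avg (fun q => f q ^ 2) p := by
  have hL := (qLine T h i).L_pos
  refine Line.op_sq_le (Line.ker_mean _) (fun _ _ => by simp only [Line.meanKer]; positivity)
    (fun x => ?_) (hf.integrable (by norm_num)) hf.integrable_sq
  have := Line.mean_const (ℓ := qLine T h i) 1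
  simpa [Line.meanKer] using this

/-! ### Bounds on slices -/

lemma sl_abs_le {f : Pt → ℝ} (hf : MemLp f 2 (mQ T h)) {B : ℝ}
    (hB : ∀ᵐ t ∂(mT T), sl h (fun p => f p ^ 2) t ≤ B) :
    ∀ᵐ t ∂(mT T), sl h (fun p => |f p|) t ≤ h + B := by
  have h1 := sl_mono (hf.integrable (by norm_num)).abs ((integrable_const (1:ℝ)).add hf.integrable_sq)
    (Eventually.of_forall fun p => by
      simp only [Pi.add_apply]; nlinarith [sq_nonneg (|f p| - 1), sq_abs (f p)])
  filter_upwards [h1, hB, sl_add (integrable_const (1:ℝ)) hf.integrable_sq] with t h1 h2 h3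
  have h4 : sl h (fun _ => (1:ℝ)) t = h := by rw [sl, integral_const, mO_real]; simp
  change _ ≤ sl h (fun p => 1 + f p ^ 2) t at h1
  rw [h3, h4] at h1
  linarith

lemma LinfL2.slice {f : Pt → ℝ} (hf : LinfL2 T h f) (hf2 : MemLp f 2 (mQ T h)) :
    ∃ B, ∀ᵐ t ∂(mT T), sl h (fun p => f p ^ 2) t ≤ B := by
  obtain ⟨_, B, hB⟩ := hf
  refine ⟨(B:ℝ) ^ 2, ?_⟩
  have hm : ∀ᵐ t ∂(mT T), AEStronglyMeasurable (fun x => f (t, x)) (mO h) := by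
    have := hf2.1
    rw [mQ_eq] at this
    exact this.prodMk_left
  filter_upwards [hB, hm] with t ht hmt
  have hmem : MemLp (fun x => f (t, x)) 2 (mO h) := ⟨hmt, ht.trans_lt ENNReal.coe_lt_top⟩
  have h1 := hmem.eLpNorm_eq_integral_rpow_norm (by norm_num) (by norm_num)
  rw [h1] at ht
  have h2 : 0 ≤ ∫ x, f (t, x) ^ 2 ∂(mO h) := integral_nonneg fun x => sq_nonneg _
  simp only [ENNReal.toReal_ofNat, Real.norm_eq_abs, Real.rpow_ofNat, sq_abs] at ht
  rw [← ENNReal.ofReal_coe_nnreal] at ht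
  replace ht := (ENNReal.ofReal_le_ofReal_iff B.2).1 ht
  have h3 := pow_le_pow_left₀ (by positivity) ht 2
  rw [← Real.rpow_natCast, ← Real.rpow_mul h2] at h3
  simpa [sl] using h3

/-- Functions of the horizontal variables with bounded slices of second order derivatives are
bounded. -/
lemma bdd_of_slices {f : Pt → ℝ} {B : ℝ} (hz : IsWeakDeriv T h 2 f fun _ => 0)
    (H0 : ∀ i, W T h 2 (hor i) f (wd T h (hor i) f))
    (H1 : W T h 2 (hor 1) (wd T h (hor 0) f) (wd T h (hor 1) (wd T h (hor 0) f)))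
    (h0 : ∀ᵐ t ∂(mT T), sl h (fun p => |f p|) t ≤ h + B)
    (h1 : ∀ i, ∀ᵐ t ∂(mT T), sl h (fun p => (wd T h (hor i) f p) ^ 2) t ≤ B)
    (h2 : ∀ᵐ t ∂(mT T), sl h (fun p => (wd T h (hor 1) (wd T h (hor 0) f) p) ^ 2) t ≤ B) :
    ∀ᵐ p ∂(mQ T h), |f p| ≤ 4 * (h + B) / h := by
  have hpos := hh.out
  have if' := ((H0 0).left.integrable (by norm_num)).abs
  have i0 := ((H0 0).right.integrable (by norm_num)).abs
  have i1 := ((H0 1).right.integrable (by norm_num)).abs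
  have i01 := (H1.right.integrable (by norm_num)).abs
  have key := ae_abs_le_sl hz ((H0 0).mono (by norm_num)) ((H0 1).mono (by norm_num))
    (H1.mono (by norm_num))
  have hs : ∀ᵐ t ∂(mT T), sl h (fun q => |f q| + |wd T h (hor 0) f q| + (|wd T h (hor 1) f q| +
      |wd T h (hor 1) (wd T h (hor 0) f) q|)) t ≤ 4 * (h + B) := by
    filter_upwards [sl_add (if'.add i0) (i1.add i01), sl_add if' i0, sl_add i1 i01, h0,
      sl_abs_le (H0 0).right (h1 0), sl_abs_le (H0 1).right (h1 1), sl_abs_le H1.right h2]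
      with t a1 a2 a3 b1 b2 b3 b4
    refine a1.trans_le ?_
    have a2' : _ = _ := a2
    have a3' : _ = _ := a3
    refine (add_le_add a2'.le a3'.le).trans ?_
    linarith
  filter_upwards [key, ae_of_time (h := h) hs] with p h1 h2
  refine h1.trans ?_
  rw [div_mul_eq_mul_div, one_mul]
  gcongr

/-- The regularity of the density in the form of a single hierarchy. -/
lemma sob_of_spaces : ∀ {m b : ℕ} {f : Pt → ℝ}, L2H T h m f → (1 ≤ b → LinfH T h (b + 1) f) →
    b < m → IsWeakDeriv T h 2 f (fun _ => 0) → Sob T h b m f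
  | 0, _, _, _, _, hbm, _ => absurd hbm (Nat.not_lt_zero _)
  | m + 1, b, f, h1, h2, hbm, hz => by
    have hL2 : ∀ {k} {g : Pt → ℝ}, L2H T h k g → MemLp g 2 (mQ T h) := fun {k} {g} hg => by
      cases k with
      | zero => exact hg
      | succ k => exact hg.1
    have bd : 1 ≤ b → ∃ B, ∀ᵐ x ∂(mQ T h), |f x| ≤ B := fun hb => by
      obtain ⟨b, rfl⟩ : ∃ b', b = b' + 1 := ⟨b - 1, by omega⟩
      obtain ⟨m, rfl⟩ : ∃ m', m = m' + 1 := ⟨m - 1, by omega⟩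
      have h3 := h2 hb
      have w0 : ∀ i : Fin 3, W T h 2 i f (wd T h i f) := fun i =>
        ⟨h1.1, hL2 (h1.2 i).2, isWeakDeriv_wd (h1.2 i).1⟩
      have w1 : W T h 2 (hor 1) (wd T h (hor 0) f) (wd T h (hor 1) (wd T h (hor 0) f)) :=
        ⟨(w0 _).right, hL2 ((h1.2 (hor 0)).2.2 (hor 1)).2, isWeakDeriv_wd ((h1.2 (hor 0)).2.2 (hor 1)).1⟩
      obtain ⟨B0, c0⟩ := h3.1.slice h1.1
      have hLf : ∀ {k} {g : Pt → ℝ}, LinfH T h k g → LinfL2 T h g := fun {k} {g} hg => by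
        cases k with
        | zero => exact hg
        | succ k => exact hg.1
      choose B1 c1 using fun i : Fin 2 => (hLf (h3.2 (hor i)).2).slice (w0 (hor i)).right
      obtain ⟨B2, c2⟩ := (hLf ((h3.2 (hor 0)).2.2 (hor 1)).2).slice w1.right
      set B := max (max B0 (max (B1 0) (B1 1))) B2
      refine ⟨_, bdd_of_slices (B := B) hz (fun i => w0 (hor i)) w1
        (sl_abs_le h1.1 (c0.mono fun t ht => ht.trans ?_))
        (fun i => (c1 i).mono fun t ht => ht.trans ?_) (c2.mono fun t ht => ht.trans ?_)⟩
      · exact (le_max_left _ _).trans (le_max_left _ _)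
      · refine le_trans ?_ (le_max_left _ _)
        refine le_trans ?_ (le_max_right _ _)
        fin_cases i
        exacts [le_max_left _ _, le_max_right _ _]
      · exact le_max_right _ _
    have hw : ∀ i : Fin 2, IsWeakDeriv T h (hor i) f (wd T h (hor i) f) := fun i =>
      isWeakDeriv_wd (h1.2 (hor i)).1
    have rec' : ∀ i : Fin 2, Sob T h (b - 1) m (wd T h (hor i) f) := fun i => by
      by_cases hm : m = 0
      · subst hm
        have : b = 0 := by omega
        subst this
        exact Sob.of_memLp (hL2 (h1.2 (hor i)).2) fun hb => absurd hb (by norm_num)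
      · refine sob_of_spaces (h1.2 (hor i)).2 (fun hb => ?_) (by omega) ((hw i).vertical_zero hz)
        have := ((h2 (by omega)).2 (hor i)).2
        rwa [show b = b - 1 + 1 by omega] at this
    exact ⟨Sob.of_memLp h1.1 bd, fun i => ⟨fun _ => (h1.2 (hor i)).1, (h1.2 (hor i)).1, rec' i⟩⟩

/-! ### Derivatives of a function of the horizontal variables are controlled by `∇Δ²` -/

lemma Sob.wd_comm {b m : ℕ} {f : Pt → ℝ} (H : Sob T h b (m + 2) f) (i j : Fin 2) :
    wd T h (hor i) (wd T h (hor j) f) =ᵐ[mQ T h] wd T h (hor j) (wd T h (hor i) f) :=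
  CPE.wd_comm ⟨_, (H.hasDeriv i).weak⟩ ⟨_, (H.hasDeriv j).weak⟩ ⟨_, ((H.deriv i).hasDeriv j).weak⟩

lemma Sob.lapH {b m : ℕ} {f : Pt → ℝ} (H : Sob T h b (m + 2) f) :
    Sob T h (b - 2) m (lapH (wd T h) f) := by
  have := ((H.deriv 0).deriv 0).add ((H.deriv 1).deriv 1)
  refine (this.congr (Eventually.of_forall fun p => ?_)).mono (by omega) le_rfl
  simp [CPE.lapH]

lemma lapH_congr {f g : Pt → ℝ} (hfg : f =ᵐ[mQ T h] g) :
    lapH (wd T h) f =ᵐ[mQ T h] lapH (wd T h) g := by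
  filter_upwards [wd_congr (i := hor 0) (wd_congr (i := hor 0) hfg),
    wd_congr (i := hor 1) (wd_congr (i := hor 1) hfg)] with p h0 h1
  simp only [lapH, Fin.sum_univ_two, h0, h1]

lemma Sob.wd_lapH {b m : ℕ} {f : Pt → ℝ} (H : Sob T h b (m + 3) f) (k : Fin 2) :
    wd T h (hor k) (CPE.lapH (wd T h) f) =ᵐ[mQ T h] CPE.lapH (wd T h) (wd T h (hor k) f) := by
  have w : ∀ j : Fin 2, W T h 2 (hor k) (wd T h (hor j) (wd T h (hor j) f))
      (wd T h (hor k) (wd T h (hor j) (wd T h (hor j) f))) := fun j =>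
    ((H.deriv j).deriv j).hasDeriv k
  have h1 := ((w 0).add (by norm_num) (w 1)).wd_eq
  have e : CPE.lapH (wd T h) f = fun p => wd T h (hor 0) (wd T h (hor 0) f) p +
      wd T h (hor 1) (wd T h (hor 1) f) p := by ext p; simp [CPE.lapH]
  have c : ∀ j : Fin 2, wd T h (hor k) (wd T h (hor j) (wd T h (hor j) f)) =ᵐ[mQ T h]
      wd T h (hor j) (wd T h (hor j) (wd T h (hor k) f)) := fun j =>
    ((H.deriv j).wd_comm (m := m) k j).trans (wd_congr (Sob.wd_comm (m := m + 1) H k j))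
  rw [e]
  filter_upwards [h1, c 0, c 1] with p h1 h2 h3
  rw [h1, h2, h3]
  simp only [CPE.lapH, Fin.sum_univ_two]

lemma sl_poincare {k : Fin 2} {f g g' : Pt → ℝ} (H : W T h 2 (hor k) f g)
    (H' : W T h 2 (hor k) g g') :
    ∀ᵐ t ∂(mT T), sl h (fun p => g p ^ 2) t ≤ sl h (fun p => g' p ^ 2) t := by
  have h1 := H.ac.poincare H'.ac (hor_ne k) (H'.left.integrable (by norm_num))
    (H'.right.integrable (by norm_num))
  have e : (qLine T h (hor k)).L = 1 := by simp [side, hor_ne]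
  have i2 := H'.right.integrable_sq
  have h2 : ∀ᵐ p ∂(mQ T h), g p ^ 2 ≤ (qLine T h (hor k)).avg (fun q => g' q ^ 2) p := by
    filter_upwards [h1, Line.avg_sq_le (hor k) H'.right.abs] with p h1 h2
    rw [e, one_mul] at h1
    have e2 : (fun q => |g'| q ^ 2) = fun q => g' q ^ 2 := by ext q; exact sq_abs _
    rw [e2] at h2
    exact (sq_abs (g p)).symm.trans_le ((pow_le_pow_left₀ (abs_nonneg _) h1 2).trans h2)
  filter_upwards [sl_mono H'.left.integrable_sq (Line.integrable_op (Line.ker_mean _) i2) h2,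
    sl_avg (hor k) i2] with t h1 h2
  exact h1.trans_eq h2

/-- Second derivatives are controlled by the Laplacian. -/
lemma sl_second_le {f : Pt → ℝ} (H : Sob T h 0 3 f) (i j : Fin 2) :
    ∀ᵐ t ∂(mT T), sl h (fun p => (wd T h (hor i) (wd T h (hor j) f) p) ^ 2) t ≤
      sl h (fun p => (lapH (wd T h) f p) ^ 2) t := by
  set d : Fin 2 → (Pt → ℝ) → Pt → ℝ := fun i => wd T h (hor i) with hd
  have w1 : ∀ i, W T h 2 (hor i) (d 1 f) (d i (d 1 f)) := fun i => (H.deriv 1).hasDeriv i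
  have w2 : ∀ i j k, W T h 2 (hor i) (d j (d k f)) (d i (d j (d k f))) := fun i j k =>
    ((H.deriv k).deriv j).hasDeriv i
  have z1 := ((w1 0).mul (r := 1) le_rfl (w2 0 0 1)).sl_zero
  have z2 := ((w1 1).mul (r := 1) le_rfl (w2 1 0 0)).sl_zero
  have i2 : ∀ {u v : Pt → ℝ}, MemLp u 2 (mQ T h) → MemLp v 2 (mQ T h) →
      Integrable (fun p => u p * v p) (mQ T h) := fun hu hv => hu.integrable_mul hv
  have c01 : d 1 (d 0 f) =ᵐ[mQ T h] d 0 (d 1 f) := H.wd_comm (m := 1) 1 0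
  have c001 : d 1 (d 0 (d 0 f)) =ᵐ[mQ T h] d 0 (d 0 (d 1 f)) :=
    ((H.deriv 0).wd_comm (m := 0) 1 0).trans (wd_congr c01)
  have m2 : ∀ i j, MemLp (d i (d j f)) 2 (mQ T h) := fun i j => (w2 0 i j).left
  have key : ∀ᵐ t ∂(mT T), sl h (fun p => (d 0 (d 1 f) p) ^ 2) t =
      sl h (fun p => d 0 (d 0 f) p * d 1 (d 1 f) p) t := by
    have e1 := sl_add (i2 (m2 0 1) (m2 0 1)) (i2 (w1 0).left (w2 0 0 1).right)
    have e2 := sl_add (i2 (m2 1 1) (m2 0 0)) (i2 (w1 0).left (w2 1 0 0).right)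
    have e3 := sl_congr (f := fun p => d 1 f p * d 1 (d 0 (d 0 f)) p)
      (g := fun p => d 1 f p * d 0 (d 0 (d 1 f)) p) (h := h) (T := T)
      (by filter_upwards [c001] with p hp; rw [hp])
    filter_upwards [z1, z2, e1, e2, e3] with t z1 z2 e1 e2 e3
    rw [e1] at z1
    rw [e2, e3] at z2
    have s1 : (fun p => (d 0 (d 1 f) p) ^ 2) = fun p => d 0 (d 1 f) p * d 0 (d 1 f) p := by
      ext p; ring
    have s2 : (fun p => d 0 (d 0 f) p * d 1 (d 1 f) p) = fun p => d 1 (d 1 f) p * d 0 (d 0 f) p := by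
      ext p; ring
    rw [s1, s2]
    linarith
  have hlap : ∀ᵐ t ∂(mT T), sl h (fun p => (lapH (wd T h) f p) ^ 2) t =
      sl h (fun p => (d 0 (d 0 f) p) ^ 2) t + sl h (fun p => (d 1 (d 1 f) p) ^ 2) t +
        2 * sl h (fun p => (d 0 (d 1 f) p) ^ 2) t := by
    have hs := fun i j => (m2 i j).integrable_sq
    filter_upwards [key, integrable_slice (hs 0 0), integrable_slice (hs 1 1),
      integrable_slice (i2 (m2 0 0) (m2 1 1))] with t hk s0 s1 s2
    rw [hk]
    simp only [sl]
    have s3 : Integrable (fun x => d 0 (d 0 f) (t, x) ^ 2 + d 1 (d 1 f) (t, x) ^ 2) (mO h) := s0.add s1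
    rw [← integral_add s0 s1, ← integral_const_mul, ← integral_add s3 (s2.const_mul _)]
    refine integral_congr_ae (Eventually.of_forall fun x => ?_)
    simp only [lapH, Fin.sum_univ_two, hd]
    ring
  have nn : ∀ (g : Pt → ℝ) t, 0 ≤ sl h (fun p => (g p) ^ 2) t := fun g t =>
    integral_nonneg fun x => sq_nonneg _
  have hcc : ∀ᵐ t ∂(mT T), sl h (fun p => (d 1 (d 0 f) p) ^ 2) t =
      sl h (fun p => (d 0 (d 1 f) p) ^ 2) t :=
    sl_congr (by filter_upwards [c01] with p hp; rw [hp])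
  filter_upwards [hlap, hcc] with t h1 h2
  have n0 := nn (d 0 (d 0 f)) t
  have n1 := nn (d 1 (d 1 f)) t
  have n01 := nn (d 0 (d 1 f)) t
  change sl h (fun p => (d i (d j f) p) ^ 2) t ≤ _
  rw [h1]
  fin_cases i <;> fin_cases j
  · change sl h (fun p => (d 0 (d 0 f) p) ^ 2) t ≤ _; linarith
  · change sl h (fun p => (d 0 (d 1 f) p) ^ 2) t ≤ _; linarith
  · change sl h (fun p => (d 1 (d 0 f) p) ^ 2) t ≤ _; linarith
  · change sl h (fun p => (d 1 (d 1 f) p) ^ 2) t ≤ _; linarith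

/-- Iterated horizontal derivatives. -/
def wds (T h : ℝ) : List (Fin 2) → (Pt → ℝ) → Pt → ℝ
  | [], f => f
  | i :: l, f => wd T h (hor i) (wds T h l f)

lemma Sob.wds {b m : ℕ} {f : Pt → ℝ} (H : Sob T h b m f) :
    ∀ {l : List (Fin 2)}, l.length ≤ m → Sob T h (b - l.length) (m - l.length) (wds T h l f)
  | [], _ => H
  | i :: l, hl => by
    have hl' : l.length + 1 ≤ m := hl
    have h1 := H.wds (l := l) (by omega)
    rw [show m - l.length = m - (l.length + 1) + 1 by omega] at h1
    exact (h1.deriv i).mono (by simp; omega) le_rfl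

lemma wds_vertical {b m : ℕ} {f : Pt → ℝ} (H : Sob T h b m f)
    (hz : IsWeakDeriv T h 2 f fun _ => 0) :
    ∀ {l : List (Fin 2)}, l.length ≤ m → IsWeakDeriv T h 2 (wds T h l f) fun _ => 0
  | [], _ => hz
  | i :: l, hl => by
    have hl' : l.length + 1 ≤ m := hl
    have h1 := H.wds (l := l) (by omega)
    rw [show m - l.length = m - (l.length + 1) + 1 by omega] at h1
    exact (h1.hasDeriv i).weak.vertical_zero (wds_vertical H hz (by omega))

lemma sl_wds_le {f : Pt → ℝ} (H : Sob T h 0 6 f) {B : ℝ}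
    (hB : ∀ i : Fin 2, ∀ᵐ t ∂(mT T),
      sl h (fun p => (wd T h (hor i) (lapH (wd T h) (lapH (wd T h) f)) p) ^ 2) t ≤ B) :
    ∀ {l : List (Fin 2)}, 1 ≤ l.length → l.length ≤ 5 →
      ∀ᵐ t ∂(mT T), sl h (fun p => (wds T h l f p) ^ 2) t ≤ B := by
  have slc : ∀ {u v : Pt → ℝ}, u =ᵐ[mQ T h] v → sl h (fun p => (u p) ^ 2) =ᵐ[mT T]
      sl h (fun p => (v p) ^ 2) := fun huv =>
    sl_congr (by filter_upwards [huv] with p hp; rw [hp])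
  have five : ∀ {l : List (Fin 2)}, l.length = 5 →
      ∀ᵐ t ∂(mT T), sl h (fun p => (wds T h l f p) ^ 2) t ≤ B := by
    intro l hl
    obtain ⟨a, b, c, d, e, rfl⟩ : ∃ a b c d e, l = [a, b, c, d, e] := by
      match l, hl with
      | [a, b, c, d, e], _ => exact ⟨a, b, c, d, e, rfl⟩
    have s1 := sl_second_le (((H.deriv e).deriv d).deriv c) a b
    have s2 := sl_second_le (H.lapH.deriv e) c d
    have k1 : lapH (wd T h) (wd T h (hor c) (wd T h (hor d) (wd T h (hor e) f))) =ᵐ[mQ T h]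
        wd T h (hor c) (wd T h (hor d) (wd T h (hor e) (lapH (wd T h) f))) := by
      refine (((H.deriv e).deriv d).wd_lapH (m := 1) c).symm.trans (wd_congr ?_)
      refine ((H.deriv e).wd_lapH (m := 2) d).symm.trans (wd_congr ?_)
      exact (Sob.wd_lapH (m := 3) H e).symm
    have k2 := (H.lapH.wd_lapH (m := 1) e)
    filter_upwards [s1, s2, slc k1, slc k2, hB e] with t s1 s2 k1 k2 hB
    refine s1.trans (k1.trans_le (s2.trans ?_))
    rw [← k2]; exact hB
  have step : ∀ k, 1 ≤ k → k ≤ 4 → (∀ l : List (Fin 2), l.length = k + 1 →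
      ∀ᵐ t ∂(mT T), sl h (fun p => (wds T h l f p) ^ 2) t ≤ B) → ∀ l : List (Fin 2), l.length = k →
      ∀ᵐ t ∂(mT T), sl h (fun p => (wds T h l f p) ^ 2) t ≤ B := by
    intro k hk1 hk hl l hlen
    obtain ⟨i, l, rfl⟩ : ∃ i l', l = i :: l' := by
      match l, hlen with
      | i :: l', _ => exact ⟨i, l', rfl⟩
      | [], h0 => simp at h0; omega
    simp only [List.length_cons] at hlen
    have h1 := H.wds (l := l) (by omega)
    rw [show 6 - l.length = 6 - l.length - 2 + 1 + 1 by omega] at h1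
    filter_upwards [sl_poincare (h1.hasDeriv i) ((h1.deriv i).hasDeriv i),
      hl (i :: i :: l) (by simp; omega)] with t h2 h3
    exact h2.trans h3
  have s5 : ∀ l : List (Fin 2), l.length = 4 + 1 →
      ∀ᵐ t ∂(mT T), sl h (fun p => (wds T h l f p) ^ 2) t ≤ B := fun l hl => five hl
  have s4 := step 4 (by norm_num) (by norm_num) s5
  have s3 := step 3 (by norm_num) (by norm_num) s4
  have s2 := step 2 (by norm_num) (by norm_num) s3
  have s1 := step 1 (by norm_num) (by norm_num) s2
  intro l h1 h2
  obtain hl | hl | hl | hl | hl : l.length = 1 ∨ l.length = 2 ∨ l.length = 3 ∨ l.length = 4 ∨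
    l.length = 5 := by omega
  exacts [s1 l hl, s2 l hl, s3 l hl, s4 l hl, s5 l hl]

/-- The first derivatives up to order three are bounded in terms of the energy. -/
theorem wds_bound {f : Pt → ℝ} (H : Sob T h 0 6 f) (hz : IsWeakDeriv T h 2 f fun _ => 0) {B : ℝ}
    (h0 : ∀ᵐ t ∂(mT T), sl h (fun p => |f p|) t ≤ h + B)
    (hB : ∀ i : Fin 2, ∀ᵐ t ∂(mT T),
      sl h (fun p => (wd T h (hor i) (lapH (wd T h) (lapH (wd T h) f)) p) ^ 2) t ≤ B)
    {l : List (Fin 2)} (hl : l.length ≤ 3) :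
    ∀ᵐ p ∂(mQ T h), |wds T h l f p| ≤ 4 * (h + B) / h := by
  have h1 := H.wds (l := l) (by omega)
  rw [show 6 - l.length = 6 - l.length - 2 + 1 + 1 by omega] at h1
  refine bdd_of_slices (wds_vertical H hz (by omega)) h1.hasDeriv ((h1.deriv 0).hasDeriv 1) ?_
    (fun i => sl_wds_le H hB (l := i :: l) (by simp) (by simp; omega))
    (sl_wds_le H hB (l := 1 :: 0 :: l) (by simp) (by simp; omega))
  by_cases hl0 : l = []
  · subst hl0; exact h0
  · exact sl_abs_le h1.memLp (sl_wds_le H hB (List.length_pos_iff.2 hl0) (by omega))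

variable {T h : ℝ} [hT : Fact (0 < T)] [hh : Fact (0 < h)]

/-! ### Weak time derivatives -/

lemma ae_zero_of_bump {f : ℝ → ℝ} (hf : Integrable f (mT T))
    (h0 : ∀ ϑ, Bump T ϑ → ∫ t, ϑ t * f t ∂(mT T) = 0) : f =ᵐ[mT T] 0 := by
  have h1 := isOpen_Ioo.ae_eq_zero_of_integral_contDiff_smul_eq_zero (U := Ioo (0:ℝ) T) (μ := volume)
    (f := f) (show IntegrableOn f (Ioo 0 T) volume from hf).locallyIntegrableOn fun g hg hc hs => ?_
  · exact (ae_restrict_iff' measurableSet_Ioo).2 h1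
  · have hb : Bump T g := by
      refine ⟨hg, ?_⟩
      by_cases hne : (tsupport g).Nonempty
      · refine ⟨sInf (tsupport g), sSup (tsupport g), (hs (hc.isCompact.sInf_mem hne)).1,
          (hs (hc.isCompact.sSup_mem hne)).2, fun x hx => ?_⟩
        have hx' : x ∈ tsupport g := subset_tsupport g hx
        exact ⟨csInf_le hc.isCompact.bddBelow hx', le_csSup hc.isCompact.bddAbove hx'⟩
      · refine ⟨T / 2, T / 2, by linarith [hT.out], by linarith [hT.out], fun x hx => ?_⟩
        exact absurd ⟨x, subset_tsupport g hx⟩ hne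
    have h2 := h0 g hb
    rw [← setIntegral_eq_integral_of_forall_compl_eq_zero (s := Ioo 0 T)]
    · simpa using h2
    · intro x hx
      have : g x = 0 := by
        by_contra hn
        exact hx (hs (subset_tsupport g hn))
      simp [this]

/-- The primitive of `-α` that vanishes at `T`. -/
def tailInt (T : ℝ) (α : ℝ → ℝ) : ℝ → ℝ := fun t => ∫ τ in t..T, α τ

lemma tailInt_eq (α : ℝ → ℝ) : tailInt T α = fun t => -∫ τ in T..t, α τ := by
  ext t; rw [tailInt, intervalIntegral.integral_symm]

lemma contDiff_tailInt {α : ℝ → ℝ} (hα : ContDiff ℝ ∞ α) :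
    ContDiff ℝ ∞ (tailInt T α) ∧ ∀ t, HasDerivAt (tailInt T α) (-α t) t := by
  rw [tailInt_eq]
  exact ⟨(contDiff_primitive hα T).1.neg, fun t => ((contDiff_primitive hα T).2 t).neg⟩

/-- The weak form of `m' = γ`, `m(0) = c` on `(0, T)`. -/
lemma lineAC_of_weak_time {μ γ : ℝ → ℝ} {c : ℝ} (hm : Integrable μ (mT T))
    (hγ : Integrable γ (mT T))
    (hw : ∀ α, Bump T α → ∫ t, α t * μ t ∂(mT T) =
      c * tailInt T α 0 + ∫ t, tailInt T α t * γ t ∂(mT T)) :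
    ∃ e, LineAC T μ γ c e := by
  have hpos := hT.out
  refine ⟨c + ∫ τ in (0:ℝ)..T, γ τ, hγ, ?_, rfl⟩
  have hP : LineAC T (fun t => c + ∫ τ in (0:ℝ)..t, γ τ) γ c (c + ∫ τ in (0:ℝ)..T, γ τ) :=
    ⟨hγ, Eventually.of_forall fun _ => rfl, rfl⟩
  have hPi : Integrable (fun t => c + ∫ τ in (0:ℝ)..t, γ τ) (mT T) :=
    ((hP.rep hpos).1.continuousOn.mono (by rw [uIcc_of_le hpos.le])).integrableOn_Icc.mono_set
      Ioo_subset_Icc_self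
  have key := ae_zero_of_bump (hm.sub hPi) fun α hα => ?_
  · filter_upwards [key] with t ht
    simpa [sub_eq_zero] using ht
  · obtain ⟨h1, h2⟩ := contDiff_tailInt (T := T) hα.1
    have hχ := LineAC.of_hasDerivAt hpos h2 hα.continuous.neg
    have h3 := (hχ.mul hpos hP).integral_eq hpos
    obtain ⟨C, hC⟩ := isCompact_Icc.exists_bound_of_continuousOn (s := Icc 0 T)
      h1.continuous.continuousOn
    have hαi : ∀ {f}, Integrable f (mT T) → Integrable (fun t => α t * f t) (mT T) := fun hf => by
      obtain ⟨B, hB⟩ := hα.bound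
      exact hf.bdd_mul (c := B) hα.continuous.aestronglyMeasurable (Eventually.of_forall hB)
    have hχi : Integrable (fun t => tailInt T α t * γ t) (mT T) := by
      refine hγ.bdd_mul (c := C) h1.continuous.aestronglyMeasurable ?_
      filter_upwards [ae_restrict_mem measurableSet_Ioo] with t ht
      exact hC t (Ioo_subset_Icc_self ht)
    have h4 : tailInt T α T = 0 := by simp [tailInt]
    have hneg : Integrable (fun t => -(α t * (c + ∫ τ in (0:ℝ)..t, γ τ))) (mT T) := (hαi hPi).neg
    have h5 := integral_add hneg hχi
    rw [integral_neg] at h5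
    simp only [neg_mul] at h3
    rw [h5, h4] at h3
    simp only [Pi.sub_apply, mul_sub]
    rw [integral_sub (hαi hm) (hαi hPi), hw α hα]
    linarith

/-- Smooth periodic functions of space. -/
def SmoothS (β : (Fin 3 → ℝ) → ℝ) : Prop := ContDiff ℝ ∞ β ∧ PeriodicS β

lemma SmoothS.smoothPer {β : (Fin 3 → ℝ) → ℝ} (hβ : SmoothS β) : SmoothPer fun p => β p.2 :=
  ⟨hβ.1.comp contDiff_snd, fun _ => hβ.2⟩

lemma SmoothS.memLp {β : (Fin 3 → ℝ) → ℝ} (hβ : SmoothS β) :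
    MemLp (fun p : Pt => β p.2) ⊤ (mQ T h) :=
  memLp_top_of_continuous hβ.smoothPer.1.continuous

lemma pd_snd {β : (Fin 3 → ℝ) → ℝ} (hβ : SmoothS β) (i : Fin 3) (p : Pt) :
    pd i (fun q => β q.2) p = sd i β p.2 := by
  have h2 : HasFDerivAt (fun q : Pt => β q.2)
      ((fderiv ℝ β p.2).comp (ContinuousLinearMap.snd ℝ ℝ (Fin 3 → ℝ))) p :=
    ((hβ.1.differentiable (by simp)) p.2).hasFDerivAt.comp p hasFDerivAt_snd
  simp only [pd, sd]
  rw [h2.fderiv]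
  simp

lemma pd_time_mul {χ : ℝ → ℝ} {β : (Fin 3 → ℝ) → ℝ} (hχ : ContDiff ℝ ∞ χ) (hβ : SmoothS β)
    (i : Fin 3) (p : Pt) : pd i (fun q => χ q.1 * β q.2) p = χ p.1 * sd i β p.2 := by
  have h1 : HasFDerivAt (fun q : Pt => χ q.1)
      ((fderiv ℝ χ p.1).comp (ContinuousLinearMap.fst ℝ ℝ (Fin 3 → ℝ))) p :=
    ((hχ.differentiable (by simp)) p.1).hasFDerivAt.comp p hasFDerivAt_fst
  have h2 : HasFDerivAt (fun q : Pt => β q.2)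
      ((fderiv ℝ β p.2).comp (ContinuousLinearMap.snd ℝ ℝ (Fin 3 → ℝ))) p :=
    ((hβ.1.differentiable (by simp)) p.2).hasFDerivAt.comp p hasFDerivAt_snd
  simp only [pd, sd]
  rw [show (fun q : Pt => χ q.1 * β q.2) = (fun q : Pt => χ q.1) * fun q => β q.2 from rfl,
    (h1.mul h2).fderiv]
  simp

lemma td_time_mul {χ : ℝ → ℝ} {β : (Fin 3 → ℝ) → ℝ} {χ' : ℝ → ℝ} (hχ : ContDiff ℝ ∞ χ)
    (hχ' : ∀ t, HasDerivAt χ (χ' t) t) (hβ : SmoothS β) (p : Pt) :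
    td (fun q => χ q.1 * β q.2) p = χ' p.1 * β p.2 := by
  have h1 : ContDiff ℝ ∞ fun q : Pt => χ q.1 * β q.2 :=
    (hχ.comp contDiff_fst).mul (hβ.1.comp contDiff_snd)
  have h2 := td_eq_deriv (h1.differentiable (by simp)) p p.1
  exact h2.unique ((hχ' p.1).mul_const (β p.2))

lemma testInitial_time_mul {α : ℝ → ℝ} {β : (Fin 3 → ℝ) → ℝ} (hα : Bump T α) (hβ : SmoothS β) :
    TestInitial T fun q => tailInt T α q.1 * β q.2 := by
  refine ⟨⟨((contDiff_tailInt hα.1).1.comp contDiff_fst).mul (hβ.1.comp contDiff_snd),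
    fun t j x => ?_⟩, ?_⟩
  · simp only [hβ.2 j x]
  · obtain ⟨_, a, b, ha, hb, hs⟩ := hα
    refine ⟨b, hb, fun p hp => ?_⟩
    have : tailInt T α p.1 = 0 := by
      rw [tailInt, intervalIntegral.integral_congr_ae (g := fun _ => 0)]
      · simp
      · refine Eventually.of_forall fun τ hτ => ?_
        by_contra hn
        have h1 := (hs τ hn).2
        rw [uIoc, mem_Ioc] at hτ
        have := le_min hp hb.le
        linarith [hτ.1]
    simp [this]

lemma sl_time_mul (α : ℝ → ℝ) (f : Pt → ℝ) (t : ℝ) :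
    sl h (fun p => α p.1 * f p) t = α t * sl h f t := by
  simp only [sl, integral_const_mul]

lemma sl_prim {g : Pt → ℝ} (hg : Integrable g (mQ T h)) {t : ℝ} (ht : t ∈ Icc 0 T) :
    sl h ((tLine T h).op Line.primKer g) t = ∫ τ in (0:ℝ)..t, sl h g τ := by
  rw [← Line.prim_integral ht]
  simp only [sl, Line.op, ← integral_const_mul]
  rw [integral_integral_swap]
  · rfl
  · obtain ⟨hm, B, hB⟩ := Line.ker_prim
    have h2 : Integrable (fun q : (Fin 3 → ℝ) × ℝ => g (q.2, q.1))
        ((mO h).prod (mT T)) := by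
      rw [mQ_eq] at hg
      exact hg.swap
    refine h2.bdd_mul (c := B) ?_ (Eventually.of_forall fun q => hB _ _)
    exact (hm.comp (measurable_const.prodMk measurable_snd)).aestronglyMeasurable

/-- `∂ₜ f = g` with the initial value `f₀`. -/
structure TD (T h : ℝ) [Fact (0 < T)] [Fact (0 < h)] (f g : Pt → ℝ) (f₀ : (Fin 3 → ℝ) → ℝ) :
    Prop where
  left : Integrable f (mQ T h)
  right : Integrable g (mQ T h)
  init : Integrable f₀ (mO h)
  eq : f =ᵐ[mQ T h] fun p => f₀ p.2 + (tLine T h).op Line.primKer g p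

lemma ae_space {P : Pt → Prop} (hP : ∀ᵐ p ∂(mQ T h), P p) :
    ∀ᵐ x ∂(mO h), ∀ᵐ t ∂(mT T), P (t, x) := by
  rw [mQ_eq] at hP
  have h1 : ∀ᵐ q ∂((mO h).prod (mT T)), P q.swap :=
    (Measure.measurePreserving_swap (μ := mO h) (ν := mT T)).quasiMeasurePreserving.ae hP
  exact Measure.ae_ae_of_ae_prod h1

lemma ae_of_space {f g : Pt → ℝ} (hf : AEStronglyMeasurable f (mQ T h))
    (hg : AEStronglyMeasurable g (mQ T h))
    (hfg : ∀ᵐ x ∂(mO h), ∀ᵐ t ∂(mT T), f (t, x) = g (t, x)) : f =ᵐ[mQ T h] g := by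
  refine Line.ae_eq_of_line (ℓ := tLine T h) hf hg ?_
  have h1 : ∀ᵐ p ∂((mT T).prod (mO h)), ∀ᵐ t ∂(mT T), f (t, p.2) = g (t, p.2) :=
    Measure.quasiMeasurePreserving_snd.ae hfg
  rw [← mQ_eq] at h1
  exact h1

lemma integrable_snd {f₀ : (Fin 3 → ℝ) → ℝ} (hf : Integrable f₀ (mO h)) :
    Integrable (fun p : Pt => f₀ p.2) (mQ T h) := by
  rw [mQ_eq]; exact hf.comp_snd _

namespace TD
variable {f g f' g' : Pt → ℝ} {f₀ f₀' : (Fin 3 → ℝ) → ℝ}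

lemma line (H : TD T h f g f₀) : ∀ᵐ x ∂(mO h),
    ∃ e, LineAC T (fun t => f (t, x)) (fun t => g (t, x)) (f₀ x) e := by
  have hi : ∀ᵐ x ∂(mO h), Integrable (fun t => g (t, x)) (mT T) := by
    have := H.right
    rw [mQ_eq] at this
    exact this.prod_left_ae
  filter_upwards [ae_space H.eq, hi] with x hx hgx
  refine ⟨_, hgx, ?_, rfl⟩
  filter_upwards [hx, ae_restrict_mem measurableSet_Ioo] with t ht htm
  rw [ht]
  simp only [Line.op]
  congr 1
  exact Line.prim_integral (α := fun τ => g (τ, x)) (Ioo_subset_Icc_self htm)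

lemma of_line (hf : Integrable f (mQ T h)) (hg : Integrable g (mQ T h))
    (h0 : Integrable f₀ (mO h)) (hl : ∀ᵐ x ∂(mO h),
      ∃ e, LineAC T (fun t => f (t, x)) (fun t => g (t, x)) (f₀ x) e) : TD T h f g f₀ := by
  refine ⟨hf, hg, h0, ae_of_space hf.1 ((integrable_snd h0).add
    (Line.integrable_op Line.ker_prim hg)).1 ?_⟩
  filter_upwards [hl] with x ⟨e, hx⟩
  filter_upwards [hx.2.1, ae_restrict_mem measurableSet_Ioo] with t ht htm
  rw [ht]
  simp only [Line.op]
  congr 1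
  exact (Line.prim_integral (α := fun τ => g (τ, x)) (Ioo_subset_Icc_self htm)).symm

lemma congr (H : TD T h f g f₀) (hf : f' =ᵐ[mQ T h] f) (hg : g' =ᵐ[mQ T h] g)
    (h0 : f₀' =ᵐ[mO h] f₀) : TD T h f' g' f₀' := by
  refine ⟨H.left.congr hf.symm, H.right.congr hg.symm, H.init.congr h0.symm, ?_⟩
  have h1 : ∀ᵐ p ∂(mQ T h), f₀' p.2 = f₀ p.2 := by
    rw [mQ_eq]; exact Measure.quasiMeasurePreserving_snd.ae h0
  filter_upwards [H.eq, hf, Line.op_congr (ℓ := tLine T h) (k := Line.primKer) hg, h1] with p a b c d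
  rw [b, a, c, d]

lemma mul (H : TD T h f g f₀) (H' : TD T h f' g' f₀')
    (h1 : Integrable (fun p => f p * f' p) (mQ T h))
    (h2 : Integrable (fun p => g p * f' p + f p * g' p) (mQ T h))
    (h3 : Integrable (fun x => f₀ x * f₀' x) (mO h)) :
    TD T h (fun p => f p * f' p) (fun p => g p * f' p + f p * g' p) fun x => f₀ x * f₀' x := by
  refine of_line h1 h2 h3 ?_
  filter_upwards [H.line, H'.line] with x ⟨e, hx⟩ ⟨e', hx'⟩
  exact ⟨e * e', hx.mul hT.out hx'⟩

lemma add (H : TD T h f g f₀) (H' : TD T h f' g' f₀') :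
    TD T h (fun p => f p + f' p) (fun p => g p + g' p) fun x => f₀ x + f₀' x := by
  refine of_line (H.left.add H'.left) (H.right.add H'.right) (H.init.add H'.init) ?_
  filter_upwards [H.line, H'.line] with x ⟨e, hx⟩ ⟨e', hx'⟩
  exact ⟨e + e', hx.add hT.out hx'⟩

lemma comp (H : TD T h f g f₀) {c B : ℝ} {F F' : ℝ → ℝ}
    (hF : ∀ x ∈ Icc c B, HasDerivAt F (F' x) x) (hF' : ContinuousOn F' (Icc c B))
    (hcB : ∀ᵐ p ∂(mQ T h), f p ∈ Icc c B) (h0 : Integrable (fun x => F (f₀ x)) (mO h)) :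
    TD T h (fun p => F (f p)) (fun p => F' (f p) * g p) fun x => F (f₀ x) := by
  have h1 := memLp_top_comp H.left.1 (fun x hx => (hF x hx).continuousAt.continuousWithinAt) hcB
  have h2 := memLp_top_comp H.left.1 hF' hcB
  refine of_line (h1.integrable le_top) (H.right.mul_of_top_right h2) h0 ?_
  filter_upwards [H.line, ae_space hcB] with x ⟨e, hx⟩ hcx
  exact ⟨F e, hx.comp hT.out isClosed_Icc hF hF' hcx⟩

/-- Multiplication by a function of space. -/
lemma mul_space (H : TD T h f g f₀) {β : (Fin 3 → ℝ) → ℝ} (hβ : SmoothS β) :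
    TD T h (fun p => f p * β p.2) (fun p => g p * β p.2) fun x => f₀ x * β x := by
  refine of_line (H.left.mul_of_top_left hβ.memLp) (H.right.mul_of_top_left hβ.memLp) ?_ ?_
  · obtain ⟨C, hC⟩ := (isCompact_univ_pi fun i : Fin 3 => isCompact_Icc (a := (0:ℝ))
      (b := side h i)).exists_bound_of_continuousOn hβ.1.continuous.continuousOn
    refine H.init.mul_bdd (c := C) hβ.1.continuous.aestronglyMeasurable ?_
    filter_upwards [ae_restrict_mem measurableSet_Om] with x hx
    refine hC x fun i _ => ?_
    obtain ⟨h0, h1, h2⟩ := hx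
    fin_cases i
    · exact ⟨h0.1, by simpa [side] using h0.2.le⟩
    · exact ⟨h1.1, by simpa [side] using h1.2.le⟩
    · exact ⟨h2.1.le, by simpa [side] using h2.2.le⟩
  · filter_upwards [H.line] with x ⟨e, hx⟩
    refine ⟨e * β x, ?_⟩
    simpa using hx.mul hT.out (LineAC.const T (β x))

/-- The integrals over the time slices. -/
lemma slice (H : TD T h f g f₀) : ∃ e, LineAC T (sl h f) (sl h g) (∫ x, f₀ x ∂(mO h)) e := by
  refine ⟨_, integrable_sl H.right, ?_, rfl⟩
  filter_upwards [sl_congr H.eq, sl_add (integrable_snd H.init)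
    (Line.integrable_op Line.ker_prim H.right), ae_restrict_mem measurableSet_Ioo] with t h1 h2 h3
  rw [h1, h2, sl_prim H.right (Ioo_subset_Icc_self h3)]
  rfl

/-- A function whose moments have time derivatives. -/
lemma of_slices (hf : Integrable f (mQ T h)) (hg : Integrable g (mQ T h))
    (h0 : Integrable f₀ (mO h)) (hs : ∀ β, SmoothS β → ∃ e, LineAC T (sl h fun p => f p * β p.2)
      (sl h fun p => g p * β p.2) (∫ x, f₀ x * β x ∂(mO h)) e) : TD T h f g f₀ := by
  have ip := Line.integrable_op (ℓ := tLine T h) Line.ker_prim hg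
  have i0 := integrable_snd (T := T) h0
  set F : Pt → ℝ := fun p => f p - (f₀ p.2 + (tLine T h).op Line.primKer g p) with hF
  have hFi : Integrable F (mQ T h) := hf.sub (i0.add ip)
  have key := ae_zero_of_tens hFi fun α b hb => ?_
  · refine ⟨hf, hg, h0, ?_⟩
    filter_upwards [key] with p hp
    exact sub_eq_zero.1 hp
  · set β : (Fin 3 → ℝ) → ℝ := fun x => ∏ i, pext i (b i) (x i) with hβd
    have hβ : SmoothS β := by
      refine ⟨contDiff_prod fun i _ => (contDiff_pext (hb.2 i)).comp (contDiff_apply ℝ ℝ i), ?_⟩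
      have := (smoothPer_tens (α := fun _ => 1) contDiff_const (fun i => contDiff_pext (hb.2 i))
        fun j x => pext_periodic _ _).2 0
      simpa [tens] using this
    obtain ⟨e, he⟩ := hs β hβ
    have mul : ∀ {u : Pt → ℝ}, Integrable u (mQ T h) → Integrable (fun p => u p * β p.2) (mQ T h) :=
      fun hu => hu.mul_of_top_left hβ.memLp
    have e1 : ∀ p, (tLine T h).op Line.primKer g p * β p.2 =
        (tLine T h).op Line.primKer (fun q => g q * β q.2) p := fun p => by
      simp only [Line.op, ← integral_mul_const]
      refine integral_congr_ae (Eventually.of_forall fun s => ?_)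
      simp only [tLine_up]; ring
    have hz : ∀ᵐ t ∂(mT T), sl h (fun p => F p * β p.2) t = 0 := by
      filter_upwards [he.2.1, integrable_slice (mul hf), integrable_slice (mul i0),
        integrable_slice (mul ip), ae_restrict_mem measurableSet_Ioo] with t h1 h2 h3 h4 h5
      have h6 := sl_prim (mul hg) (Ioo_subset_Icc_self h5)
      have i34 : Integrable (fun x => f₀ x * β x + (tLine T h).op Line.primKer g (t, x) * β x)
        (mO h) := h3.add h4
      have e2 : sl h (fun p => F p * β p.2) t = sl h (fun p => f p * β p.2) t -
          (∫ x, f₀ x * β x ∂(mO h) + sl h (fun p => (tLine T h).op Line.primKer g p * β p.2) t) := by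
        simp only [sl, hF, sub_mul, add_mul]
        rw [integral_sub h2 i34, integral_add h3 h4]
      simp only [e1] at e2
      rw [e2, h6, h1]
      ring
    have hI : Integrable (fun p => F p *
        tens α (fun i => pext i (b i)) p) (mQ T h) := by
      refine hFi.mul_of_top_left (memLp_top_of_continuous ?_)
      exact (smoothPer_tens hb.1.1 (fun i => contDiff_pext (hb.2 i))
        fun j x => pext_periodic _ _).1.continuous
    rw [← integral_sl hI, integral_congr_ae (g := fun _ => 0), integral_zero]
    filter_upwards [hz] with t ht
    have e3 : (fun p => F p * tens α (fun i => pext i (b i)) p) =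
        fun p => α p.1 * (F p * β p.2) := by
      ext p; simp only [tens, hβd]; ring
    rw [e3, sl_time_mul, ht, mul_zero]

/-- Space derivatives of an evolution equation. -/
lemma wd (H : TD T h f g f₀) {i : Fin 3} {f₁ g₁ : Pt → ℝ} (h0 : SmoothS f₀)
    (hf : IsWeakDeriv T h i f f₁) (hg : IsWeakDeriv T h i g g₁) : TD T h f₁ g₁ (sd i f₀) := by
  have hg' : W T h 1 i g g₁ := ⟨memLp_one_iff_integrable.2 hg.1, memLp_one_iff_integrable.2 hg.2.1, hg⟩
  have h1 := hg'.op (ℓ' := tLine T h) (k := Line.primKer) (indep_qLine_tLine i) Line.ker_prim le_rfl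
    (memLp_one_iff_integrable.2 (Line.integrable_op Line.ker_prim hg.1))
    (memLp_one_iff_integrable.2 (Line.integrable_op Line.ker_prim hg.2.1))
  have h2 := (W.of_smooth (T := T) (h := h) (i := i) (p := 1) h0.smoothPer).add le_rfl h1
  have h3 := isWeakDeriv_unique hf h2.weak H.eq
  simp only [pd_snd h0] at h3
  refine ⟨hf.2.1, hg.2.1, ?_, h3⟩
  have hc : Continuous (sd i f₀) := (h0.1.continuous_fderiv (by simp)).clm_apply continuous_const
  have hcs : MemLp (fun p : Pt => sd i f₀ p.2) 1 (mQ T h) :=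
    (memLp_top_of_continuous (hc.comp continuous_snd)).mono_exponent le_top
  have h4 := integrable_slice (memLp_one_iff_integrable.1 hcs)
  have : (mT T) ≠ 0 := by
    rw [Ne, Measure.restrict_eq_zero, Real.volume_Ioo]
    simp [hT.out]
  have : NeZero (mT T) := ⟨this⟩
  obtain ⟨t, ht⟩ := h4.exists
  exact ht

end TD

/-! ### Smoothing along horizontal lines -/

/-- The normalization of the kernel. -/
def cosMass (n : ℕ) : ℝ := ∫ s in (0:ℝ)..1, (1 + Real.cos (2 * Real.pi * s)) ^ n

/-- The trigonometric approximate identity `cₙ (1 + cos 2π(x - s))ⁿ`. -/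
def cosKer (n : ℕ) (x s : ℝ) : ℝ := (1 + Real.cos (2 * Real.pi * (x - s))) ^ n / cosMass n

lemma one_add_cos_nonneg (y : ℝ) : 0 ≤ 1 + Real.cos y := by linarith [Real.neg_one_le_cos y]

lemma cosMass_pos (n : ℕ) : 0 < cosMass n := by
  refine intervalIntegral.integral_pos one_pos (by fun_prop) (fun x _ => ?_) ⟨0, by simp, ?_⟩
  · exact pow_nonneg (one_add_cos_nonneg _) n
  · simp only [mul_zero, Real.cos_zero]; positivity

lemma cosKer_nonneg (n : ℕ) (x s : ℝ) : 0 ≤ cosKer n x s :=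
  div_nonneg (pow_nonneg (one_add_cos_nonneg _) n) (cosMass_pos n).le

lemma cosKer_comm (n : ℕ) (x s : ℝ) : cosKer n x s = cosKer n s x := by
  have : 2 * Real.pi * (x - s) = -(2 * Real.pi * (s - x)) := by ring
  rw [cosKer, cosKer, this, Real.cos_neg]

lemma integral_cos_pow (n : ℕ) (x : ℝ) :
    ∫ s in Ioo (0:ℝ) 1, (1 + Real.cos (2 * Real.pi * (x - s))) ^ n = cosMass n := by
  rw [← integral_Ioc_eq_integral_Ioo, ← intervalIntegral.integral_of_le zero_le_one,
    intervalIntegral.integral_comp_sub_left (fun y => (1 + Real.cos (2 * Real.pi * y)) ^ n) x]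
  have hp : Function.Periodic (fun y : ℝ => (1 + Real.cos (2 * Real.pi * y)) ^ n) 1 := by
    intro y
    simp only [mul_add, mul_one, Real.cos_add_two_pi]
  have := hp.intervalIntegral_add_eq (x - 1) 0
  rw [cosMass]
  simpa using this

lemma cosKer_mass (n : ℕ) (x : ℝ) : ∫ s in Ioo (0:ℝ) 1, cosKer n x s = 1 := by
  simp only [cosKer]
  rw [integral_div, integral_cos_pow, div_self (cosMass_pos n).ne']

lemma ker_cosKer (n : ℕ) : Line.Ker (cosKer n) := by
  refine ⟨?_, 2 ^ n / cosMass n, fun x s => ?_⟩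
  · unfold cosKer Function.uncurry; fun_prop
  · rw [abs_of_nonneg (cosKer_nonneg n x s), cosKer]
    have := cosMass_pos n
    have h1 := one_add_cos_nonneg (2 * Real.pi * (x - s))
    have h2 := Real.cos_le_one (2 * Real.pi * (x - s))
    gcongr
    linarith

/-- Smooth functions of period one. -/
def PerSmooth (e : ℝ → ℝ) : Prop := ContDiff ℝ ∞ e ∧ ∀ x, e (x + 1) = e x

/-- Finite sums of products of functions of one variable. -/
def Separable (k : ℝ → ℝ → ℝ) : Prop :=
  ∃ (ι : Type) (_ : Fintype ι) (e f : ι → ℝ → ℝ), (∀ a, PerSmooth (e a)) ∧ (∀ a, PerSmooth (f a)) ∧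
    ∀ x s, k x s = ∑ a, e a x * f a s

lemma Separable.mul {k k' : ℝ → ℝ → ℝ} (hk : Separable k) (hk' : Separable k') :
    Separable fun x s => k x s * k' x s := by
  obtain ⟨ι, _, e, f, he, hf, h1⟩ := hk
  obtain ⟨ι', _, e', f', he', hf', h1'⟩ := hk'
  refine ⟨ι × ι', inferInstance, fun a x => e a.1 x * e' a.2 x, fun a x => f a.1 x * f' a.2 x,
    fun a => ⟨(he _).1.mul (he' _).1, fun x => ?_⟩, fun a => ⟨(hf _).1.mul (hf' _).1, fun x => ?_⟩,
    fun x s => ?_⟩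
  · simp only [(he _).2, (he' _).2]
  · simp only [(hf _).2, (hf' _).2]
  · change k x s * k' x s = _
    rw [h1, h1', Fintype.sum_mul_sum, Fintype.sum_prod_type]
    refine Finset.sum_congr rfl fun a _ => Finset.sum_congr rfl fun b _ => ?_
    ring

lemma PerSmooth.const (c : ℝ) : PerSmooth fun _ => c := ⟨contDiff_const, fun _ => rfl⟩

lemma PerSmooth.cos : PerSmooth fun x => Real.cos (2 * Real.pi * x) :=
  ⟨by fun_prop, fun x => by simp only [mul_add, mul_one, Real.cos_add_two_pi]⟩

lemma PerSmooth.sin : PerSmooth fun x => Real.sin (2 * Real.pi * x) :=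
  ⟨by fun_prop, fun x => by simp only [mul_add, mul_one, Real.sin_add_two_pi]⟩

lemma separable_const (c : ℝ) : Separable fun _ _ => c :=
  ⟨Unit, inferInstance, fun _ _ => c, fun _ _ => 1, fun _ => .const c, fun _ => .const 1,
    fun _ _ => by simp⟩

lemma separable_cosKer (n : ℕ) : Separable (cosKer n) := by
  have h1 : Separable fun x s => 1 + Real.cos (2 * Real.pi * (x - s)) := by
    refine ⟨Fin 3, inferInstance, ![fun _ => 1, fun x => Real.cos (2 * Real.pi * x),
      fun x => Real.sin (2 * Real.pi * x)], ![fun _ => 1, fun x => Real.cos (2 * Real.pi * x),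
      fun x => Real.sin (2 * Real.pi * x)], fun a => ?_, fun a => ?_, fun x s => ?_⟩
    · fin_cases a
      exacts [.const 1, .cos, .sin]
    · fin_cases a
      exacts [.const 1, .cos, .sin]
    · simp only [Fin.sum_univ_three, Matrix.cons_val_zero, Matrix.cons_val_one, Matrix.cons_val,
        mul_sub, Real.cos_sub]
      ring
  have h2 : Separable fun x s => (1 + Real.cos (2 * Real.pi * (x - s))) ^ n := by
    induction n with
    | zero => simpa using separable_const 1
    | succ n ih => simpa only [pow_succ] using ih.mul h1
  have h3 := h2.mul (separable_const (cosMass n)⁻¹)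
  exact h3

lemma PerSmooth.continuous {e : ℝ → ℝ} (he : PerSmooth e) : Continuous e := he.1.continuous

lemma PerSmooth.bdd {e : ℝ → ℝ} (he : PerSmooth e) : ∃ B, ∀ x, |e x| ≤ B := by
  obtain ⟨B, hB⟩ := isCompact_Icc.exists_bound_of_continuousOn (s := Icc (0:ℝ) 1)
    he.continuous.continuousOn
  refine ⟨B, fun x => ?_⟩
  have hp : Function.Periodic e 1 := he.2
  obtain ⟨y, hy, hxy⟩ := hp.exists_mem_Ico₀ one_pos x
  rw [hxy]
  exact hB y ⟨hy.1, hy.2.le⟩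

lemma eLpNorm_two_le {X : Type} [MeasurableSpace X] {m : Measure X} {u v : X → ℝ}
    (hu : MemLp u 2 m) (hv : MemLp v 2 m) (h : ∫ x, u x ^ 2 ∂m ≤ ∫ x, v x ^ 2 ∂m) :
    eLpNorm u 2 m ≤ eLpNorm v 2 m := by
  rw [hu.eLpNorm_eq_integral_rpow_norm (by norm_num) (by norm_num),
    hv.eLpNorm_eq_integral_rpow_norm (by norm_num) (by norm_num)]
  simp only [ENNReal.toReal_ofNat, Real.norm_eq_abs, Real.rpow_ofNat, sq_abs]
  refine ENNReal.ofReal_le_ofReal (Real.rpow_le_rpow (integral_nonneg fun _ => sq_nonneg _) h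
    (by norm_num))

namespace Line
variable {X : Type} [MeasurableSpace X] {m : Measure X} [IsFiniteMeasure m] {ℓ : Line m}
  {f g : X → ℝ}

/-- Smoothing along the lines. -/
abbrev smo (ℓ : Line m) (n : ℕ) (f : X → ℝ) : X → ℝ := ℓ.op (cosKer n) f

lemma smo_up (n : ℕ) (p : X) (x : ℝ) :
    ℓ.smo n f (ℓ.up p x) = ∫ s, cosKer n x s * f (ℓ.up p s) ∂ℓ.lam := op_up p x

lemma smo_mass (hL : ℓ.L = 1) (n : ℕ) (x : ℝ) : ∫ s, cosKer n x s ∂ℓ.lam = 1 := by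
  rw [lam, hL, cosKer_mass]

lemma smo_memLp (hL : ℓ.L = 1) (n : ℕ) (hf : MemLp f 2 m) : MemLp (ℓ.smo n f) 2 m ∧
    ∫ p, (ℓ.smo n f p) ^ 2 ∂m ≤ ∫ p, f p ^ 2 ∂m := by
  have i1 := hf.integrable (by norm_num : (1:ENNReal) ≤ 2)
  have i2 := hf.integrable_sq
  have i3 := integrable_op (ℓ := ℓ) (ker_cosKer n) i2
  have h1 := op_sq_le (ℓ := ℓ) (ker_cosKer n) (cosKer_nonneg n) (smo_mass hL n) i1 i2
  have hm := integrable_op (ℓ := ℓ) (ker_cosKer n) i1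
  have i4 : Integrable (fun p => (ℓ.smo n f p) ^ 2) m := by
    refine i3.mono' (hm.1.pow 2) ?_
    filter_upwards [h1] with p hp
    rwa [Real.norm_eq_abs, abs_of_nonneg (sq_nonneg _)]
  refine ⟨(memLp_two_iff_integrable_sq hm.1).2 i4, (integral_mono_ae i4 i3 h1).trans_eq ?_⟩
  have e : ∀ p, ℓ.op (fun x s => cosKer n s x) (fun _ => 1) p = 1 := fun p => by
    simp only [op, mul_one, cosKer_comm n _ (ℓ.co p)]
    exact smo_mass hL n _
  have := integral_op_mul (ℓ := ℓ) (ker_cosKer n) i2 (integrable_const (1:ℝ)) (by simpa using i3)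
    (by simpa only [e, mul_one] using i2)
  simpa only [e, mul_one] using this

lemma smo_bdd (hL : ℓ.L = 1) (n : ℕ) (hf : AEStronglyMeasurable f m) {B : ℝ} (hB : ∀ᵐ p ∂m, |f p| ≤ B) :
    ∀ᵐ p ∂m, |ℓ.smo n f p| ≤ B := by
  have hf1 : Integrable f m := (memLp_top_of_bound hf B hB).integrable le_top
  have hc : ∀ x, Integrable (fun s => cosKer n x s) ℓ.lam := fun x => by
    by_contra hn
    have := smo_mass hL n x
    rw [integral_undef hn] at this
    exact zero_ne_one this
  filter_upwards [ae_line (ℓ := ℓ) hB, ae_integrable_ker (ℓ := ℓ) (ker_cosKer n) hf1] with p hp hi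
  have h1 : ∫ s, |cosKer n (ℓ.co p) s * f (ℓ.up p s)| ∂ℓ.lam ≤
      ∫ s, cosKer n (ℓ.co p) s * B ∂ℓ.lam := by
    refine integral_mono_ae (hi _).abs ((hc _).mul_const B) ?_
    filter_upwards [hp] with s hs
    rw [abs_mul, abs_of_nonneg (cosKer_nonneg _ _ _)]
    exact mul_le_mul_of_nonneg_left hs (cosKer_nonneg _ _ _)
  rw [integral_mul_const, smo_mass hL, one_mul] at h1
  exact (abs_integral_le_integral_abs).trans h1

/-- Smoothing commutes with the derivative along the lines. -/
lemma AC.smo (hL : ℓ.L = 1) (n : ℕ) (h : ℓ.AC f g) (hper : ℓ.per) (hf : Integrable f m) :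
    ℓ.AC (ℓ.smo n f) (ℓ.smo n g) := by
  obtain ⟨ι, _, e, k, he, hk, hek⟩ := separable_cosKer n
  have hd : ∀ {u : ℝ → ℝ}, PerSmooth u → ∀ x, HasDerivAt u (deriv u x) x := fun hu x =>
    ((hu.1.differentiable (by simp)) x).hasDerivAt
  have hcd : ∀ {u : ℝ → ℝ}, PerSmooth u → Continuous (deriv u) := fun hu =>
    hu.1.continuous_deriv (by simp)
  have hD : ∀ x s, ∑ a, deriv (e a) x * k a s = -∑ a, e a x * deriv (k a) s := by
    intro x s
    have h0 : DifferentiableAt ℝ (fun y => (1 + Real.cos (2 * Real.pi * y)) ^ n / cosMass n) (x - s) := by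
      fun_prop
    have h1 : HasDerivAt (fun x => cosKer n x s) (deriv (fun y => (1 + Real.cos (2 * Real.pi * y)) ^ n /
        cosMass n) (x - s)) x := by
      exact h0.hasDerivAt.comp_sub_const x s
    have h2 : HasDerivAt (fun s => cosKer n x s) (-deriv (fun y => (1 + Real.cos (2 * Real.pi * y)) ^ n /
        cosMass n) (x - s)) s := by
      exact h0.hasDerivAt.comp_const_sub x s
    have h1' : HasDerivAt (fun x => cosKer n x s) (∑ a, deriv (e a) x * k a s) x := by
      simp only [hek]
      exact HasDerivAt.fun_sum fun a _ => (hd (he a) x).mul_const _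
    have h2' : HasDerivAt (fun s => cosKer n x s) (∑ a, e a x * deriv (k a) s) s := by
      simp only [hek]
      exact HasDerivAt.fun_sum fun a _ => (hd (hk a) s).const_mul _
    rw [h1'.unique h1, h2'.unique h2, neg_neg]
  have hmul : ∀ {u : ℝ → ℝ} {v : ℝ → ℝ}, Continuous u → Integrable v ℓ.lam →
      Integrable (fun s => u s * v s) ℓ.lam := by
    intro u v hu hv
    obtain ⟨B, hB⟩ := isCompact_Icc.exists_bound_of_continuousOn (s := Icc 0 ℓ.L) hu.continuousOn
    refine hv.bdd_mul (c := B) hu.aestronglyMeasurable ?_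
    filter_upwards [ae_restrict_mem measurableSet_Ioo] with s hs
    exact hB s (Ioo_subset_Icc_self hs)
  filter_upwards [h, ae_integrable_line (ℓ := ℓ) hf] with p ⟨c, e', h0, h1⟩ hfi
  have hgi : Integrable (fun s => g (ℓ.up p s)) ℓ.lam := h1.1
  have ex : ∀ {v : X → ℝ}, Integrable (fun s => v (ℓ.up p s)) ℓ.lam → ∀ x,
      ℓ.smo n v (ℓ.up p x) = ∑ a, e a x * ∫ s, k a s * v (ℓ.up p s) ∂ℓ.lam := by
    intro v hv x
    rw [smo_up]
    simp only [hek, Finset.sum_mul, mul_assoc]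
    rw [integral_finsetSum _ fun a _ => (hmul (hk a).continuous hv).const_mul _]
    simp only [integral_const_mul]
  have der : ∀ x, HasDerivAt (fun x => ℓ.smo n f (ℓ.up p x)) (ℓ.smo n g (ℓ.up p x)) x := by
    intro x
    have hx : HasDerivAt (fun x => ∑ a, e a x * ∫ s, k a s * f (ℓ.up p s) ∂ℓ.lam)
        (∑ a, deriv (e a) x * ∫ s, k a s * f (ℓ.up p s) ∂ℓ.lam) x :=
      HasDerivAt.fun_sum fun a _ => (hd (he a) x).mul_const _
    have hs : LineAC ℓ.L (fun s => cosKer n x s) (fun s => ∑ a, e a x * deriv (k a) s)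
        (cosKer n x 0) (cosKer n x ℓ.L) := by
      refine LineAC.of_hasDerivAt ℓ.L_pos (fun s => ?_) ?_
      · simp only [hek]
        exact HasDerivAt.fun_sum fun a _ => (hd (hk a) s).const_mul _
      · exact continuous_finsetSum _ fun a _ => (hcd (hk a)).const_mul _
    have hint := (hs.mul ℓ.L_pos h1).integral_eq ℓ.L_pos
    have hb : cosKer n x ℓ.L = cosKer n x 0 := by
      rw [hL, hek, hek]
      refine Finset.sum_congr rfl fun a _ => ?_
      rw [← (hk a).2 0, zero_add]
    rw [hb, ← h0 hper, sub_self] at hint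
    have i1 : Integrable (fun s => (∑ a, e a x * deriv (k a) s) * f (ℓ.up p s)) ℓ.lam :=
      hmul (continuous_finsetSum _ fun a _ => (hcd (hk a)).const_mul _) hfi
    have i2 : Integrable (fun s => cosKer n x s * g (ℓ.up p s)) ℓ.lam := by
      refine hmul ?_ hgi
      change Continuous fun s => cosKer n x s
      simp only [hek]
      exact continuous_finsetSum _ fun a _ => (hk a).continuous.const_mul _
    have hsum : ∫ s, (∑ a, e a x * deriv (k a) s) * f (ℓ.up p s) ∂ℓ.lam +
        ∫ s, cosKer n x s * g (ℓ.up p s) ∂ℓ.lam = 0 := by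
      rw [← integral_add i1 i2]; exact hint
    have hfin : ∑ a, deriv (e a) x * ∫ s, k a s * f (ℓ.up p s) ∂ℓ.lam =
        ℓ.smo n g (ℓ.up p x) := by
      have e1 : ∑ a, deriv (e a) x * ∫ s, k a s * f (ℓ.up p s) ∂ℓ.lam =
          ∫ s, (∑ a, deriv (e a) x * k a s) * f (ℓ.up p s) ∂ℓ.lam := by
        simp only [Finset.sum_mul, mul_assoc]
        rw [integral_finsetSum _ fun a _ => (hmul (hk a).continuous hfi).const_mul _]
        simp only [integral_const_mul]
      rw [e1, smo_up]
      simp only [hD, neg_mul, integral_neg]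
      linarith
    rw [← hfin]
    simpa only [ex hfi] using hx
  have hc : Continuous fun x => ℓ.smo n g (ℓ.up p x) := by
    simp only [ex hgi]
    exact continuous_finsetSum _ fun a _ => (he a).continuous.mul_const _
  refine ⟨_, _, fun _ => ?_, LineAC.of_hasDerivAt ℓ.L_pos der hc⟩
  rw [ex hfi, ex hfi]
  refine Finset.sum_congr rfl fun a _ => ?_
  rw [hL, ← (he a).2 0, zero_add]

end Line

variable {T h : ℝ} [hT : Fact (0 < T)] [hh : Fact (0 < h)]

/-! ### Convergence of the smoothing operators -/

lemma qLine_hor_L (j : Fin 2) : (qLine T h (hor j)).L = 1 := by simp [side, hor_ne]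

lemma ker_avg {X : Type} [MeasurableSpace X] {m : Measure X} (ℓ : Line m) :
    Line.Ker (Line.meanKer ℓ.L) := Line.ker_mean _

lemma smo_tendsto_point (j : Fin 2) {g : Pt → ℝ} (hg : Continuous g) {p : Pt}
    (hp : p.2 (hor j) ∈ Ioo (0:ℝ) 1) :
    Tendsto (fun n => (qLine T h (hor j)).smo n g p) atTop (𝓝 (g p)) := by
  set x₀ := p.2 (hor j) with hx
  have h1 := tendsto_setIntegral_pow_smul_of_unique_maximum_of_isCompact_of_continuousOn
    (μ := volume) (s := Icc (0:ℝ) 1) (x₀ := x₀) isCompact_Icc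
    (c := fun s => 1 + Real.cos (2 * Real.pi * (x₀ - s)))
    (g := fun s => g (p.1, Function.update p.2 (hor j) s)) (by fun_prop) ?_
    (fun s _ => one_add_cos_nonneg _) (by simp) ?_ ?_
  · rw [show (p.1, Function.update p.2 (hor j) x₀) = p by simp [hx]] at h1
    refine h1.congr fun n => ?_
    rw [integral_Icc_eq_integral_Ioo, integral_Icc_eq_integral_Ioo, integral_cos_pow, smul_eq_mul,
      ← integral_const_mul]
    simp only [Line.smo, Line.op, Line.lam, qLine_hor_L, qLine_co, qLine_up, cosKer, smul_eq_mul]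
    refine setIntegral_congr_fun measurableSet_Ioo fun s _ => ?_
    simp only [← hx]
    ring
  · intro s hs hne
    simp only [sub_self, mul_zero, Real.cos_zero]
    refine add_lt_add_right (lt_of_le_of_ne (Real.cos_le_one _) fun h1 => hne ?_) 1
    rw [Real.cos_eq_one_iff] at h1
    obtain ⟨k, hk⟩ := h1
    have h2 : (k:ℝ) = x₀ - s := by
      have := Real.pi_pos
      field_simp at hk
      linarith
    have h3 : (-1:ℝ) < k := by rw [h2]; linarith [hp.1, hs.2]
    have h4 : (k:ℝ) < 1 := by rw [h2]; linarith [hp.2, hs.1]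
    have h5 : k = 0 := by
      have a : (-1:ℤ) < k := by exact_mod_cast h3
      have b : k < (1:ℤ) := by exact_mod_cast h4
      omega
    rw [h5] at h2
    simp at h2
    linarith
  · rw [interior_Icc]; exact subset_closure hp
  · exact (hg.comp (by fun_prop)).continuousOn

lemma smo_tendsto_of_continuous (j : Fin 2) {g : Pt → ℝ} (hc : Continuous g) {B : ℝ}
    (hB : ∀ p, |g p| ≤ B) (hg : MemLp g 2 (mQ T h)) :
    Tendsto (fun n => eLpNorm (fun p => (qLine T h (hor j)).smo n g p - g p) 2 (mQ T h)) atTop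
      (𝓝 0) := by
  have hL := qLine_hor_L (T := T) (h := h) j
  have hgB : ∀ᵐ p ∂(mQ T h), |g p| ≤ B := Eventually.of_forall hB
  have hm : ∀ n, MemLp (fun p => (qLine T h (hor j)).smo n g p - g p) 2 (mQ T h) := fun n =>
    (Line.smo_memLp hL n hg).1.sub hg
  have key : Tendsto (fun n => ∫ p, ((qLine T h (hor j)).smo n g p - g p) ^ 2 ∂(mQ T h)) atTop
      (𝓝 (∫ _p, (0:ℝ) ∂(mQ T h))) := by
    refine tendsto_integral_of_dominated_convergence (fun _ => (2 * B) ^ 2)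
      (fun n => (hm n).1.pow 2) (integrable_const _) (fun n => ?_) ?_
    · filter_upwards [Line.smo_bdd hL n hg.1 hgB, hgB] with p h1 h2
      rw [Real.norm_eq_abs, abs_pow]
      refine pow_le_pow_left₀ (abs_nonneg _) ((abs_sub _ _).trans ?_) 2
      linarith
    · filter_upwards [ae_mem_interior (T := T) (h := h)] with p hp
      have h1 := smo_tendsto_point (T := T) (h := h) j hc (p := p)
        (by simpa [side, hor_ne] using hp.2 (hor j))
      have h2 := (h1.sub_const (g p)).pow 2
      simpa using h2
  rw [integral_zero] at key
  have h3 := (key.rpow_const (p := (2:ℝ)⁻¹) (Or.inr (by norm_num)))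
  have h4 := ENNReal.tendsto_ofReal h3
  rw [Real.zero_rpow (by norm_num), ENNReal.ofReal_zero] at h4
  refine h4.congr fun n => ?_
  rw [(hm n).eLpNorm_eq_integral_rpow_norm (by norm_num) (by norm_num)]
  simp only [ENNReal.toReal_ofNat, Real.norm_eq_abs, Real.rpow_ofNat, sq_abs]

lemma smo_tendsto (j : Fin 2) {f : Pt → ℝ} (hf : MemLp f 2 (mQ T h)) :
    Tendsto (fun n => eLpNorm (fun p => (qLine T h (hor j)).smo n f p - f p) 2 (mQ T h)) atTop
      (𝓝 0) := by
  have hL := qLine_hor_L (T := T) (h := h) j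
  rw [ENNReal.tendsto_nhds_zero]
  intro ε hε
  by_cases htop : ε = ⊤
  · exact Eventually.of_forall fun n => by rw [htop]; exact le_top
  have h3 : ε / 3 ≠ 0 := (ENNReal.div_pos hε.ne' (by norm_num)).ne'
  obtain ⟨g, hfg, hg, hc, hB⟩ : ∃ g : Pt → ℝ, eLpNorm (f - g) 2 (mQ T h) ≤ ε / 3 ∧
      MemLp g 2 (mQ T h) ∧ Continuous g ∧ ∃ B, ∀ p, |g p| ≤ B := by
    obtain ⟨g, hfg, hg⟩ := hf.exists_boundedContinuous_eLpNorm_sub_le (by norm_num) h3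
    exact ⟨g, hfg, hg, g.continuous, ‖g‖, g.norm_coe_le_norm⟩
  obtain ⟨B, hB⟩ := hB
  filter_upwards [(ENNReal.tendsto_nhds_zero.1 (smo_tendsto_of_continuous j hc hB hg)) _
    (pos_iff_ne_zero.2 h3)] with n hn
  set S : (Pt → ℝ) → Pt → ℝ := fun u => (qLine T h (hor j)).smo n u with hS
  have i1 := hf.integrable (by norm_num : (1:ENNReal) ≤ 2)
  have i2 := hg.integrable (by norm_num : (1:ENNReal) ≤ 2)
  have e1 : (fun p => S f p - f p) =ᵐ[mQ T h]
      (S (f - g) + fun p => S g p - g p) - (f - g) := by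
    filter_upwards [Line.op_sub (ℓ := qLine T h (hor j)) (ker_cosKer n) i1 i2] with p hp
    have hp' : S (f - g) p = S f p - S g p := hp
    simp only [Pi.add_apply, Pi.sub_apply, hp']
    ring
  have m1 := (Line.smo_memLp hL n (hf.sub hg))
  have m2 := (Line.smo_memLp hL n hg).1.sub hg
  have c1 : eLpNorm (S (f - g)) 2 (mQ T h) ≤ ε / 3 :=
    (eLpNorm_two_le m1.1 (hf.sub hg) m1.2).trans hfg
  calc eLpNorm (fun p => S f p - f p) 2 (mQ T h)
      = eLpNorm ((S (f - g) + fun p => S g p - g p) - (f - g)) 2 (mQ T h) := eLpNorm_congr_ae e1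
    _ ≤ eLpNorm (S (f - g)) 2 (mQ T h) + eLpNorm (fun p => S g p - g p) 2 (mQ T h) +
        eLpNorm (f - g) 2 (mQ T h) := (eLpNorm_sub_le (m1.1.1.add m2.1) (hf.sub hg).1
          (by norm_num)).trans (add_le_add (eLpNorm_add_le m1.1.1 m2.1 (by norm_num)) le_rfl)
    _ ≤ ε / 3 + ε / 3 + ε / 3 := add_le_add (add_le_add c1 hn) hfg
    _ = ε := ENNReal.add_thirds ε

/-- Smoothing in both horizontal directions. -/
def hsmo (T h : ℝ) [Fact (0 < T)] [Fact (0 < h)] (n : ℕ) (f : Pt → ℝ) : Pt → ℝ :=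
  (qLine T h (hor 0)).smo n ((qLine T h (hor 1)).smo n f)

section
variable {f g : Pt → ℝ} {n : ℕ}

lemma hsmo_memLp (hf : MemLp f 2 (mQ T h)) : MemLp (hsmo T h n f) 2 (mQ T h) :=
  (Line.smo_memLp (qLine_hor_L 0) n (Line.smo_memLp (qLine_hor_L 1) n hf).1).1

lemma hsmo_bdd (hf : MemLp f 2 (mQ T h)) {B : ℝ} (hB : ∀ᵐ p ∂(mQ T h), |f p| ≤ B) :
    ∀ᵐ p ∂(mQ T h), |hsmo T h n f p| ≤ B :=
  Line.smo_bdd (qLine_hor_L 0) n (Line.smo_memLp (qLine_hor_L 1) n hf).1.1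
    (Line.smo_bdd (qLine_hor_L 1) n hf.1 hB)

lemma hsmo_tendsto (hf : MemLp f 2 (mQ T h)) :
    Tendsto (fun n => eLpNorm (fun p => hsmo T h n f p - f p) 2 (mQ T h)) atTop (𝓝 0) := by
  have h3 := (smo_tendsto 1 hf).add (smo_tendsto 0 hf)
  rw [add_zero] at h3
  refine tendsto_of_tendsto_of_tendsto_of_le_of_le tendsto_const_nhds h3 (fun _ => zero_le)
    fun n => ?_
  have m1 := (Line.smo_memLp (qLine_hor_L (T := T) (h := h) 1) n hf).1
  have m2 := Line.smo_memLp (qLine_hor_L (T := T) (h := h) 0) n (m1.sub hf)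
  have m3 := (Line.smo_memLp (qLine_hor_L (T := T) (h := h) 0) n hf).1
  have e1 : (fun p => hsmo T h n f p - f p) =ᵐ[mQ T h]
      (qLine T h (hor 0)).smo n ((qLine T h (hor 1)).smo n f - f) +
      fun p => (qLine T h (hor 0)).smo n f p - f p := by
    filter_upwards [Line.op_sub (ℓ := qLine T h (hor 0)) (ker_cosKer n)
      (m1.integrable (by norm_num)) (hf.integrable (by norm_num))] with p hp
    have hp' : (qLine T h (hor 0)).smo n ((qLine T h (hor 1)).smo n f - f) p =
      (qLine T h (hor 0)).smo n ((qLine T h (hor 1)).smo n f) p - (qLine T h (hor 0)).smo n f p := hp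
    simp only [Pi.add_apply, hp', hsmo]
    ring
  simp only
  rw [eLpNorm_congr_ae e1]
  exact (eLpNorm_add_le m2.1.1 (m3.sub hf).1 (by norm_num)).trans
    (add_le_add (eLpNorm_two_le m2.1 (m1.sub hf) m2.2) le_rfl)

lemma W.smo (n : ℕ) (k : Fin 2) {j : Fin 2} (H : W T h 2 (hor j) f g) :
    W T h 2 (hor j) ((qLine T h (hor k)).smo n f) ((qLine T h (hor k)).smo n g) := by
  have h1 := (Line.smo_memLp (qLine_hor_L k) n H.left).1
  have h2 := (Line.smo_memLp (qLine_hor_L k) n H.right).1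
  have i1 := H.left.integrable (by norm_num : (1:ENNReal) ≤ 2)
  have i2 := H.right.integrable (by norm_num : (1:ENNReal) ≤ 2)
  refine W.of_ac (by norm_num) h1 h2 ?_
  by_cases hjk : hor j = hor k
  · rw [hjk]
    have := H.ac
    rw [hjk] at this
    exact this.smo (qLine_hor_L k) n (hor_ne k) i1
  · exact H.ac.op (indep_qLine hjk) i1 i2 (ker_cosKer n)

lemma W.hsmo (n : ℕ) {j : Fin 2} (H : W T h 2 (hor j) f g) :
    W T h 2 (hor j) (hsmo T h n f) (CPE.hsmo T h n g) :=
  (H.smo n 1).smo n 0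

/-- The smoothed functions converge with all their derivatives. -/
lemma Sob.conv_hsmo : ∀ {m b : ℕ} {f : Pt → ℝ}, Sob T h b m f →
    Conv T h b m (fun n => hsmo T h n f) f := by
  have base : ∀ {m b : ℕ} {f : Pt → ℝ}, Sob T h b m f → ConvL2 T h b (fun n => hsmo T h n f) f :=
    fun H => ⟨fun n => hsmo_memLp H.memLp, H.memLp, hsmo_tendsto H.memLp, fun hb => by
      obtain ⟨B, hB⟩ := H.bdd hb
      exact ⟨B, fun n => hsmo_bdd H.memLp hB, hB⟩⟩
  intro m
  induction m with
  | zero => intro b f H; exact base H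
  | succ m ih =>
    intro b f H
    exact Conv.of_deriv (base H) (fun i n => ((H.hasDeriv i).hsmo n).weak)
      (fun i => (H.hasDeriv i).weak) fun i => ih (H.deriv i)

/-! ### The smoothed functions as finite sums -/

lemma Line.op_separable {X : Type} [MeasurableSpace X] {m : Measure X} [IsFiniteMeasure m]
    {ℓ : Line m} (hL : ℓ.L = 1) {ι : Type} [Fintype ι] {k : ℝ → ℝ → ℝ} {e f : ι → ℝ → ℝ}
    (hf : ∀ a, PerSmooth (f a)) (hk : ∀ x s, k x s = ∑ a, e a x * f a s) {u : X → ℝ}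
    (hu : Integrable u m) :
    ℓ.op k u =ᵐ[m] fun p => ∑ a, e a (ℓ.co p) * ℓ.avg (fun q => f a (ℓ.co q) * u q) p := by
  filter_upwards [ae_integrable_line (ℓ := ℓ) hu] with p hp
  have hi : ∀ a, Integrable (fun s => f a s * u (ℓ.up p s)) ℓ.lam := fun a => by
    obtain ⟨B, hB⟩ := (hf a).bdd
    exact hp.bdd_mul (c := B) (hf a).continuous.aestronglyMeasurable (Eventually.of_forall hB)
  simp only [Line.op, hk, Finset.sum_mul, mul_assoc]
  rw [integral_finsetSum _ fun a _ => (hi a).const_mul _]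
  simp only [integral_const_mul, Line.meanKer, ℓ.co_up, hL, one_div, inv_one, one_mul]

/-- Smooth periodic functions of the horizontal variables. -/
def SmoothH (β : (Fin 3 → ℝ) → ℝ) : Prop :=
  SmoothS β ∧ ∀ x s, β (Function.update x 2 s) = β x

lemma SmoothH.sd_two {β : (Fin 3 → ℝ) → ℝ} (hβ : SmoothH β) (x : Fin 3 → ℝ) : sd 2 β x = 0 := by
  rw [← pd_snd hβ.1 2 (0, x)]
  have h1 := pd_eq_deriv ((hβ.1.smoothPer.1).differentiable (by simp)) 2 (0, x) (x 2)
  simp only [Function.update_eq_self, hβ.2] at h1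
  exact h1.unique (hasDerivAt_const _ _)

lemma SmoothH.vertical {β : (Fin 3 → ℝ) → ℝ} (hβ : SmoothH β) :
    W T h ⊤ 2 (fun p => β p.2) fun _ => 0 :=
  W.of_const_line le_top hβ.1.memLp fun _ _ => hβ.2 _ _

lemma smoothH_mul {e f : ℝ → ℝ} (he : PerSmooth e) (hf : PerSmooth f) :
    SmoothH fun x => e (x (hor 0)) * f (x (hor 1)) := by
  refine ⟨⟨(he.1.comp (contDiff_apply ℝ ℝ _)).mul (hf.1.comp (contDiff_apply ℝ ℝ _)),
    fun j x => ?_⟩, fun x s => ?_⟩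
  · fin_cases j
    · simp [hor, he.2]
    · simp [hor, hf.2]
  · simp [hor_ne]

lemma SmoothH.const_mul {β : (Fin 3 → ℝ) → ℝ} (hβ : SmoothH β) (c : ℝ) :
    SmoothH fun x => c * β x :=
  ⟨⟨contDiff_const.mul hβ.1.1, fun j x => by simp only [hβ.1.2 j x]⟩, fun x s => by
    simp only [hβ.2]⟩

lemma avg_vertical (j : Fin 2) {F : Pt → ℝ} (hF : IsWeakDeriv T h 2 F fun _ => 0) :
    IsWeakDeriv T h 2 ((qLine T h (hor j)).avg F) fun _ => 0 := by
  have i1 := Line.integrable_op (ℓ := qLine T h (hor j)) (ker_avg (qLine T h (hor j))) hF.1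
  have H : W T h 1 2 F fun _ => 0 :=
    ⟨memLp_one_iff_integrable.2 hF.1, memLp_one_iff_integrable.2 hF.2.1, hF⟩
  have e : (qLine T h (hor j)).op (Line.meanKer (qLine T h (hor j)).L) (fun _ => 0) = fun _ => 0 := by
    ext p; simp [Line.op]
  have := H.op (ℓ' := qLine T h (hor j)) (indep_qLine (hor_ne j).symm) (ker_avg (qLine T h (hor j))) le_rfl
    (memLp_one_iff_integrable.2 i1) (by rw [e]; exact memLp_const 0)
  rw [e] at this
  exact this.weak

lemma avg_avg_eq_sl {F : Pt → ℝ} (hF : IsWeakDeriv T h 2 F fun _ => 0) :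
    (qLine T h (hor 0)).avg ((qLine T h (hor 1)).avg F) =ᵐ[mQ T h] fun p => 1 / h * sl h F p.1 :=
  (eq_avg_of_vertical (avg_vertical 0 (avg_vertical 1 hF))).trans (avg_avg_avg hF.1)

/-- Smoothing a function of the horizontal variables produces finite sums of products of
functions of time and smooth functions of space. -/
lemma hsmo_eq_sum (T h : ℝ) [Fact (0 < T)] [Fact (0 < h)] (n : ℕ) :
    ∃ (ι : Type) (_ : Fintype ι) (a k : ι → (Fin 3 → ℝ) → ℝ),
      (∀ i, SmoothH (a i)) ∧ (∀ i, SmoothH (k i)) ∧ ∀ f, IsWeakDeriv T h 2 f (fun _ => 0) →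
        hsmo T h n f =ᵐ[mQ T h] fun p => ∑ i, sl h (fun q => f q * k i q.2) p.1 * a i p.2 := by
  obtain ⟨ι, _, e, f, he, hf, hek⟩ := separable_cosKer n
  refine ⟨ι × ι, inferInstance, fun i x => e i.1 (x (hor 0)) * e i.2 (x (hor 1)),
    fun i x => 1 / h * (f i.1 (x (hor 0)) * f i.2 (x (hor 1))), fun i => smoothH_mul (he _) (he _),
    fun i => (smoothH_mul (hf _) (hf _)).const_mul _, fun u hu => ?_⟩
  have mulf : ∀ {v : Pt → ℝ} (a : ι) (j : Fin 2), IsWeakDeriv T h 2 v (fun _ => 0) →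
      IsWeakDeriv T h 2 (fun q => f a (q.2 (hor j)) * v q) fun _ => 0 := by
    intro v a j hv
    have hH : SmoothH fun x => f a (x (hor j)) := by
      have h0 := smoothH_mul (hf a) (PerSmooth.const 1)
      have h1 := smoothH_mul (PerSmooth.const 1) (hf a)
      simp only [mul_one, one_mul] at h0 h1
      fin_cases j
      exacts [h0, h1]
    have H : W T h 1 2 v fun _ => 0 :=
      ⟨memLp_one_iff_integrable.2 hv.1, memLp_one_iff_integrable.2 hv.2.1, hv⟩
    have := (hH.vertical (T := T) (h := h)).mul (r := 1) le_rfl H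
    simpa using this.weak
  have h1 := Line.op_separable (qLine_hor_L (T := T) (h := h) 1) hf hek hu.1
  have v1 : ∀ b, IsWeakDeriv T h 2 ((qLine T h (hor 1)).avg fun q => f b (q.2 (hor 1)) * u q)
      fun _ => 0 := fun b => avg_vertical 1 (mulf b 1 hu)
  have hi1 : Integrable ((qLine T h (hor 1)).smo n u) (mQ T h) :=
    Line.integrable_op (ker_cosKer n) hu.1
  have h2 := Line.op_separable (qLine_hor_L (T := T) (h := h) 0) hf hek hi1
  have h3 : ∀ a, (qLine T h (hor 0)).avg (fun q => f a (q.2 (hor 0)) *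
      (qLine T h (hor 1)).smo n u q) =ᵐ[mQ T h] fun p => ∑ b, e b (p.2 (hor 1)) *
      sl h (fun q => u q * (1 / h * (f a (q.2 (hor 0)) * f b (q.2 (hor 1))))) p.1 := by
    intro a
    have c1 : (fun q : Pt => f a (q.2 (hor 0)) * (qLine T h (hor 1)).smo n u q) =ᵐ[mQ T h]
        fun q => ∑ b, e b (q.2 (hor 1)) * (qLine T h (hor 1)).avg
          (fun q => f a (q.2 (hor 0)) * (f b (q.2 (hor 1)) * u q)) q := by
      filter_upwards [h1] with q hq
      have hq' : (qLine T h (hor 1)).smo n u q = _ := hq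
      rw [hq', Finset.mul_sum]
      refine Finset.sum_congr rfl fun b _ => ?_
      simp only [qLine_co, Line.op, qLine_up]
      rw [mul_left_comm, ← integral_const_mul]
      congr 1
      refine integral_congr_ae (Eventually.of_forall fun s => ?_)
      have : hor 0 ≠ hor 1 := by decide
      simp only [Function.update_of_ne this]
      ring
    refine (Line.op_congr c1).trans ?_
    have vi : ∀ b, IsWeakDeriv T h 2 (fun q : Pt => f a (q.2 (hor 0)) * (f b (q.2 (hor 1)) * u q))
      fun _ => 0 := fun b => mulf a 0 (mulf b 1 hu)
    have li : ∀ b, Integrable ((qLine T h (hor 1)).avg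
        (fun q => f a (q.2 (hor 0)) * (f b (q.2 (hor 1)) * u q))) (mQ T h) := fun b =>
      Line.integrable_op (ker_avg (qLine T h (hor 1))) (vi b).1
    have hav : ∀ b, (qLine T h (hor 0)).avg ((qLine T h (hor 1)).avg
        fun q => f a (q.2 (hor 0)) * (f b (q.2 (hor 1)) * u q)) =ᵐ[mQ T h] fun p => 1 / h *
        sl h (fun q => f a (q.2 (hor 0)) * (f b (q.2 (hor 1)) * u q)) p.1 := fun b =>
      avg_avg_eq_sl (vi b)
    have hlin : ∀ b, ∀ᵐ p ∂(mQ T h), Integrable (fun s => (qLine T h (hor 1)).avg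
        (fun q => f a (q.2 (hor 0)) * (f b (q.2 (hor 1)) * u q)) ((qLine T h (hor 0)).up p s))
        (qLine T h (hor 0)).lam := fun b => Line.ae_integrable_line (li b)
    filter_upwards [ae_all_iff.2 hav, ae_all_iff.2 hlin] with p hp hpi
    simp only [Line.op, Line.meanKer] at hp ⊢
    have e2 : ∀ (_ : ι) (s : ℝ), ((qLine T h (hor 0)).up p s).2 (hor 1) = p.2 (hor 1) := fun b s => by
      have : hor 1 ≠ hor 0 := by decide
      simp [Function.update_of_ne this]
    simp only [Finset.mul_sum]
    rw [integral_finsetSum]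
    · refine Finset.sum_congr rfl fun b _ => ?_
      simp only [e2 b]
      have e3 : sl h (fun q => u q * (1 / h * (f a (q.2 (hor 0)) * f b (q.2 (hor 1))))) p.1 =
          1 / h * sl h (fun q => f a (q.2 (hor 0)) * (f b (q.2 (hor 1)) * u q)) p.1 := by
        simp only [sl]
        rw [← integral_const_mul]
        refine integral_congr_ae (Eventually.of_forall fun x => ?_)
        simp only; ring
      rw [e3, ← hp b, ← integral_const_mul]
      refine integral_congr_ae (Eventually.of_forall fun s => ?_)
      simp only; ring
    · intro b _
      simp only [e2 b]
      exact ((hpi b).const_mul _).const_mul _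
  filter_upwards [h2, ae_all_iff.2 h3] with p hp h3p
  have hp' : hsmo T h n u p = _ := hp
  rw [hp', Fintype.sum_prod_type]
  refine Finset.sum_congr rfl fun a _ => ?_
  simp only [qLine_co, h3p a, Finset.mul_sum]
  refine Finset.sum_congr rfl fun b _ => ?_
  ring

end

lemma LineAC.limit {L : ℝ} (hL : 0 < L) {a α : ℕ → ℝ → ℝ} {c e : ℕ → ℝ} {a' α' : ℝ → ℝ} {c' : ℝ}
    (H : ∀ n, LineAC L (a n) (α n) (c n) (e n)) (ha : ∀ n, IntegrableOn (a n) (Ioo 0 L))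
    (ha' : IntegrableOn a' (Ioo 0 L)) (hα' : IntegrableOn α' (Ioo 0 L))
    (h1 : Tendsto (fun n => ∫ s in Ioo 0 L, |a n s - a' s|) atTop (𝓝 0))
    (h2 : Tendsto (fun n => ∫ s in Ioo 0 L, |α n s - α' s|) atTop (𝓝 0))
    (h3 : Tendsto c atTop (𝓝 c')) : ∃ e', LineAC L a' α' c' e' := by
  refine ⟨_, hα', ?_, rfl⟩
  have hP : LineAC L (fun s => c' + ∫ τ in (0:ℝ)..s, α' τ) α' c' (c' + ∫ τ in (0:ℝ)..L, α' τ) :=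
    ⟨hα', Eventually.of_forall fun _ => rfl, rfl⟩
  have hPi : IntegrableOn (fun s => c' + ∫ τ in (0:ℝ)..s, α' τ) (Ioo 0 L) :=
    ((hP.rep hL).1.continuousOn.mono (by rw [uIcc_of_le hL.le])).integrableOn_Icc.mono_set
      Ioo_subset_Icc_self
  set P : ℝ → ℝ := fun s => c' + ∫ τ in (0:ℝ)..s, α' τ
  have hd : IntegrableOn (fun s => |a' s - P s|) (Ioo 0 L) := (ha'.sub hPi).abs
  have bound : ∀ n, ∫ s in Ioo 0 L, |a' s - P s| ≤ (∫ s in Ioo 0 L, |a n s - a' s|) +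
      L * (|c n - c'| + ∫ s in Ioo 0 L, |α n s - α' s|) := fun n => by
    have hc : ∫ _s in Ioo 0 L, (|c n - c'| + ∫ s in Ioo 0 L, |α n s - α' s|) =
        L * (|c n - c'| + ∫ s in Ioo 0 L, |α n s - α' s|) := by
      simp [hL.le]
    have hi : IntegrableOn (fun s => |a n s - a' s|) (Ioo 0 L) := ((ha n).sub ha').abs
    rw [← hc, ← integral_add hi (integrable_const _)]
    refine integral_mono_ae hd (hi.add (integrable_const _)) ?_
    filter_upwards [(H n).2.1, ae_restrict_mem measurableSet_Ioo] with s hs hsm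
    have hii : ∀ {f : ℝ → ℝ}, IntegrableOn f (Ioo 0 L) → IntervalIntegrable f volume 0 s := fun hf =>
      intervalIntegrable_of_Ioo hsm.1 (hf.mono_set (Ioo_subset_Ioo le_rfl hsm.2.le))
    have hint : |∫ τ in (0:ℝ)..s, (α n τ - α' τ)| ≤ ∫ τ in Ioo 0 L, |α n τ - α' τ| := by
      rw [intervalIntegral.integral_of_le hsm.1.le, integral_Ioc_eq_integral_Ioo]
      refine (abs_integral_le_integral_abs).trans ?_
      exact setIntegral_mono_set ((H n).1.sub hα').abs (Eventually.of_forall fun _ => abs_nonneg _)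
        (Ioo_subset_Ioo le_rfl hsm.2.le).eventuallyLE
    rw [intervalIntegral.integral_sub (hii (H n).1) (hii hα')] at hint
    have e : a' s - P s = -(a n s - a' s) + ((c n - c') +
        ((∫ τ in (0:ℝ)..s, α n τ) - ∫ τ in (0:ℝ)..s, α' τ)) := by
      simp only [P]; rw [hs]; ring
    rw [e]
    refine (abs_add_le _ _).trans ?_
    rw [abs_neg]
    have := abs_add_le (c n - c') ((∫ τ in (0:ℝ)..s, α n τ) - ∫ τ in (0:ℝ)..s, α' τ)
    change _ ≤ |a n s - a' s| + (|c n - c'| + ∫ s in Ioo 0 L, |α n s - α' s|)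
    linarith
  have hlim : Tendsto (fun n => (∫ s in Ioo 0 L, |a n s - a' s|) +
      L * (|c n - c'| + ∫ s in Ioo 0 L, |α n s - α' s|)) atTop (𝓝 0) := by
    have h4 : Tendsto (fun n => |c n - c'|) atTop (𝓝 0) := by
      have := (h3.sub_const c').abs
      simpa using this
    simpa using h1.add ((h4.add h2).const_mul L)
  have h0 : ∫ s in Ioo 0 L, |a' s - P s| = 0 :=
    le_antisymm (ge_of_tendsto' hlim bound) (integral_nonneg fun _ => abs_nonneg _)
  have h5 := (integral_eq_zero_iff_of_nonneg (fun _ => abs_nonneg _) hd).1 h0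
  filter_upwards [h5] with s hs
  have : a' s - P s = 0 := by simpa using hs
  exact sub_eq_zero.1 this

lemma LineAC.const_mul {L : ℝ} (hL : 0 < L) {a α : ℝ → ℝ} {c e : ℝ} (k : ℝ) (H : LineAC L a α c e) :
    LineAC L (fun s => k * a s) (fun s => k * α s) (k * c) (k * e) := by
  simpa using (LineAC.const L k).mul hL H

lemma LineAC.sum {ι : Type} (s : Finset ι) {L : ℝ} (hL : 0 < L) {a α : ι → ℝ → ℝ} {c : ι → ℝ}
    (H : ∀ i ∈ s, ∃ e, LineAC L (a i) (α i) (c i) e) :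
    ∃ e, LineAC L (fun t => ∑ i ∈ s, a i t) (fun t => ∑ i ∈ s, α i t) (∑ i ∈ s, c i) e := by
  classical
  induction s using Finset.induction_on with
  | empty => exact ⟨0, by simpa using LineAC.const L 0⟩
  | insert i s hi ih =>
    obtain ⟨e, he⟩ := H i (Finset.mem_insert_self _ _)
    obtain ⟨e', he'⟩ := ih fun j hj => H j (Finset.mem_insert_of_mem hj)
    simp only [Finset.sum_insert hi]
    exact ⟨e + e', he.add hL he'⟩

variable {T h : ℝ} [hT : Fact (0 < T)] [hh : Fact (0 < h)]

/-! ### Convergence in `L¹` -/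

structure ConvL1 (T h : ℝ) (F : ℕ → Pt → ℝ) (f : Pt → ℝ) : Prop where
  seq : ∀ n, Integrable (F n) (mQ T h)
  lim : Integrable f (mQ T h)
  tend : Tendsto (fun n => ∫ p, |F n p - f p| ∂(mQ T h)) atTop (𝓝 0)

namespace ConvL1
variable {F G : ℕ → Pt → ℝ} {f g : Pt → ℝ} {b : ℕ}

lemma of_eLpNorm (hF : ∀ n, MemLp (F n) 1 (mQ T h)) (hf : MemLp f 1 (mQ T h))
    (ht : Tendsto (fun n => eLpNorm (fun p => F n p - f p) 1 (mQ T h)) atTop (𝓝 0)) :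
    ConvL1 T h F f := by
  refine ⟨fun n => memLp_one_iff_integrable.1 (hF n), memLp_one_iff_integrable.1 hf, ?_⟩
  have h1 := (ENNReal.tendsto_toReal ENNReal.zero_ne_top).comp ht
  refine h1.congr fun n => ?_
  have hi : Integrable (fun p => F n p - f p) (mQ T h) :=
    (memLp_one_iff_integrable.1 (hF n)).sub (memLp_one_iff_integrable.1 hf)
  simp only [Function.comp_apply, eLpNorm_one_eq_lintegral_enorm]
  exact (integral_norm_eq_lintegral_enorm hi.1).symm

lemma add (H : ConvL1 T h F f) (H' : ConvL1 T h G g) :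
    ConvL1 T h (fun n p => F n p + G n p) fun p => f p + g p := by
  refine ⟨fun n => (H.seq n).add (H'.seq n), H.lim.add H'.lim, ?_⟩
  have h3 := H.tend.add H'.tend
  rw [add_zero] at h3
  refine squeeze_zero (fun n => integral_nonneg fun _ => abs_nonneg _) (fun n => ?_) h3
  have i1 := ((H.seq n).sub H.lim).abs
  have i2 := ((H'.seq n).sub H'.lim).abs
  have i3 : Integrable (fun p => |F n p + G n p - (f p + g p)|) (mQ T h) :=
    (((H.seq n).add (H'.seq n)).sub (H.lim.add H'.lim)).abs
  refine (integral_mono i3 (i1.add i2) fun p => ?_).trans_eq (integral_add i1 i2)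
  simp only [Pi.add_apply, Pi.sub_apply]
  rw [show F n p + G n p - (f p + g p) = F n p - f p + (G n p - g p) by ring]
  exact abs_add_le _ _

lemma neg (H : ConvL1 T h F f) : ConvL1 T h (fun n p => -F n p) fun p => -f p := by
  refine ⟨fun n => (H.seq n).neg, H.lim.neg, H.tend.congr fun n => ?_⟩
  congr 1; ext p
  rw [← abs_neg]; congr 1; ring

lemma mul_L2 {u : Pt → ℝ} (hu : MemLp u 2 (mQ T h)) (H : ConvL2 T h b F f) :
    ConvL1 T h (fun n p => u p * F n p) fun p => u p * f p := by
  refine of_eLpNorm (fun n => (H.seq n).mul' hu) (H.lim.mul' hu) ?_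
  have h1 := ENNReal.Tendsto.const_mul H.tend (Or.inr hu.2.ne)
  rw [mul_zero] at h1
  refine tendsto_of_tendsto_of_tendsto_of_le_of_le tendsto_const_nhds h1 (fun _ => zero_le)
    fun n => ?_
  have h2 := eLpNorm_smul_le_mul_eLpNorm (p := 2) (q := 2) (r := 1) ((H.seq n).1.sub H.lim.1) hu.1
  have e : (fun p => u p * F n p - u p * f p) = u • (F n - f) := by
    ext p; simp [mul_sub]
  simp only [e]
  exact h2

lemma mul_bdd {u : Pt → ℝ} (hu : Integrable u (mQ T h)) (H : ConvL2 T h b F f) (hb : 1 ≤ b) :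
    ConvL1 T h (fun n p => u p * F n p) fun p => u p * f p := by
  obtain ⟨B, h1, h2⟩ := H.bdd hb
  have mem : ∀ {v : Pt → ℝ}, MemLp v 2 (mQ T h) → (∀ᵐ x ∂(mQ T h), |v x| ≤ B) →
      MemLp (fun p => u p * v p) 1 (mQ T h) := fun hv hB =>
    memLp_one_iff_integrable.2 (hu.mul_of_top_left (memLp_top_of_bound hv.1 B hB))
  refine of_eLpNorm (fun n => mem (H.seq n) (h1 n)) (mem H.lim h2) ?_
  have h3 := tendsto_eLpNorm_mul_zero (q := 1) (by norm_num) (by norm_num)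
    (H := fun n x => F n x - f x) (memLp_one_iff_integrable.2 hu)
    (fun n => (H.seq n).1.sub H.lim.1) H.tend (B := B + B) fun n => by
      filter_upwards [h1 n, h2] with x h1 h2
      exact (abs_sub _ _).trans (add_le_add h1 h2)
  refine h3.congr fun n => ?_
  congr 1; ext p; ring

lemma slice (H : ConvL1 T h F f) :
    Tendsto (fun n => ∫ t, |sl h (F n) t - sl h f t| ∂(mT T)) atTop (𝓝 0) := by
  refine squeeze_zero (fun n => integral_nonneg fun _ => abs_nonneg _) (fun n => ?_) H.tend
  have hi : Integrable (fun p => |F n p - f p|) (mQ T h) := ((H.seq n).sub H.lim).abs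
  rw [← integral_sl hi]
  refine integral_mono_ae ((integrable_sl (H.seq n)).sub (integrable_sl H.lim)).abs (integrable_sl hi) ?_
  filter_upwards [integrable_slice (H.seq n), integrable_slice H.lim] with t h1 h2
  simp only [sl]
  rw [← integral_sub h1 h2]
  exact abs_integral_le_integral_abs

lemma integral (H : ConvL1 T h F f) :
    Tendsto (fun n => ∫ p, F n p ∂(mQ T h)) atTop (𝓝 (∫ p, f p ∂(mQ T h))) := by
  refine tendsto_iff_norm_sub_tendsto_zero.2 (squeeze_zero (fun _ => norm_nonneg _) (fun n => ?_) H.tend)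
  rw [← integral_sub (H.seq n) H.lim]
  exact norm_integral_le_integral_norm _

end ConvL1

/-! ### Linear differential operators commuting with functions of time -/

structure TLin (T h : ℝ) [Fact (0 < T)] [Fact (0 < h)] (k : ℕ) (D : (Pt → ℝ) → Pt → ℝ) : Prop where
  sob : ∀ {m f}, Sob T h 0 (m + k) f → Sob T h 0 m (D f)
  congr : ∀ {f g}, f =ᵐ[mQ T h] g → D f =ᵐ[mQ T h] D g
  add : ∀ {f g}, Sob T h 0 k f → Sob T h 0 k g → D (fun p => f p + g p) =ᵐ[mQ T h] fun p => D f p + D g p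
  time : ∀ {θ : ℝ → ℝ} {f}, MemLp (fun p : Pt => θ p.1) ⊤ (mQ T h) → Sob T h 0 k f →
    D (fun p => θ p.1 * f p) =ᵐ[mQ T h] fun p => θ p.1 * D f p

lemma Sob.time_mul {θ : ℝ → ℝ} (hθ : MemLp (fun p : Pt => θ p.1) ⊤ (mQ T h)) :
    ∀ {m : ℕ} {f : Pt → ℝ}, Sob T h 0 m f → Sob T h 0 m fun p => θ p.1 * f p := by
  have base : ∀ {f : Pt → ℝ}, MemLp f 2 (mQ T h) →
      ConvL2 T h 0 (fun _ p => θ p.1 * f p) fun p => θ p.1 * f p := fun hf =>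
    Sob.of_memLp (hf.mul' hθ) fun hb => absurd hb (by norm_num)
  intro m
  induction m with
  | zero => intro f H; exact base H.memLp
  | succ m ih =>
    intro f H
    have hW : ∀ i, W T h 2 (hor i) (fun p => θ p.1 * f p) (fun p => θ p.1 * wd T h (hor i) f p) :=
      fun i => by simpa using (W.of_const_line le_top hθ fun _ _ => rfl).mul (r := 2) (by norm_num) (H.hasDeriv i)
    exact Conv.of_deriv (base H.memLp) (fun i _ => (hW i).weak) (fun i => (hW i).weak)
      fun i => ih (H.deriv i)

namespace TLin
variable {k l : ℕ} {D E : (Pt → ℝ) → Pt → ℝ}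

lemma wd (i : Fin 2) : TLin T h 1 (wd T h (hor i)) where
  sob H := H.deriv i
  congr h := wd_congr h
  add H H' := ((Sob.hasDeriv H i).add (by norm_num) (Sob.hasDeriv H' i)).wd_eq
  time hθ H := by
    have := (W.of_const_line (T := T) (h := h) (i := hor i) le_top hθ fun _ _ => rfl).mul (r := 2)
      (by norm_num) (Sob.hasDeriv H i)
    simpa using this.wd_eq

lemma comp (hD : TLin T h k D) (hE : TLin T h l E) : TLin T h (k + l) (fun f => D (E f)) where
  sob {m f} H := hD.sob (hE.sob (by rwa [add_assoc]))
  congr h := hD.congr (hE.congr h)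
  add H H' := (hD.congr (hE.add (H.mono le_rfl (by omega)) (H'.mono le_rfl (by omega)))).trans
    (hD.add (hE.sob H) (hE.sob H'))
  time hθ H := (hD.congr (hE.time hθ (H.mono le_rfl (by omega)))).trans (hD.time hθ (hE.sob H))

lemma sum_op (hD : TLin T h k D) (hE : TLin T h k E) : TLin T h k (fun f p => D f p + E f p) where
  sob H := (hD.sob H).add (hE.sob H)
  congr h := by
    filter_upwards [hD.congr h, hE.congr h] with p h1 h2
    rw [h1, h2]
  add H H' := by
    filter_upwards [hD.add H H', hE.add H H'] with p h1 h2
    rw [h1, h2]; ring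
  time hθ H := by
    filter_upwards [hD.time hθ H, hE.time hθ H] with p h1 h2
    rw [h1, h2]; ring

lemma lapH : TLin T h 2 (lapH (CPE.wd T h)) := by
  have := ((wd (T := T) (h := h) 0).comp (wd 0)).sum_op ((wd (T := T) (h := h) 1).comp (wd 1))
  have e : CPE.lapH (CPE.wd T h) = fun f p => CPE.wd T h (hor 0) (CPE.wd T h (hor 0) f) p +
      CPE.wd T h (hor 1) (CPE.wd T h (hor 1) f) p := by
    ext f p; simp [CPE.lapH]
  rw [e]; exact this

lemma sob_sum {ι : Type} (s : Finset ι) {θ : ι → ℝ → ℝ} {f : ι → Pt → ℝ} {m : ℕ}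
    (hθ : ∀ a, MemLp (fun p : Pt => θ a p.1) ⊤ (mQ T h)) (hf : ∀ a, Sob T h 0 m (f a)) :
    Sob T h 0 m fun p => ∑ a ∈ s, θ a p.1 * f a p := by
  classical
  induction s using Finset.induction_on with
  | empty =>
    simp only [Finset.sum_empty]
    have hz : ∀ m, Sob T h 0 m fun _ => (0:ℝ) := fun m => by
      induction m with
      | zero => exact Sob.of_memLp (memLp_const 0) fun hb => absurd hb (by norm_num)
      | succ m ih =>
        exact Conv.of_deriv (Sob.of_memLp (memLp_const 0) fun hb => absurd hb (by norm_num))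
          (fun i _ => (W.const 0 one_le_two).weak) (fun i => (W.const 0 one_le_two).weak) fun _ => ih
    exact hz m
  | insert a s ha ih =>
    simp only [Finset.sum_insert ha]
    exact ((hf a).time_mul (hθ a)).add ih

lemma sum (hD : TLin T h k D) {ι : Type} (s : Finset ι) {θ : ι → ℝ → ℝ} {f : ι → Pt → ℝ}
    (hθ : ∀ a, MemLp (fun p : Pt => θ a p.1) ⊤ (mQ T h)) (hf : ∀ a, Sob T h 0 k (f a)) :
    D (fun p => ∑ a ∈ s, θ a p.1 * f a p) =ᵐ[mQ T h] fun p => ∑ a ∈ s, θ a p.1 * D (f a) p := by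
  classical
  induction s using Finset.induction_on with
  | empty =>
    have h0 := hD.time (θ := fun _ => 0) (memLp_const 0)
      (sob_sum (ι := ι) ∅ (m := k) hθ hf)
    simpa using h0
  | insert a s ha ih =>
    simp only [Finset.sum_insert ha]
    filter_upwards [hD.add ((hf a).time_mul (hθ a)) (sob_sum s hθ hf), hD.time (hθ a) (hf a), ih]
      with p h1 h2 h3
    rw [h1, h2, h3]

end TLin

lemma Conv.lapH {b m : ℕ} {F : ℕ → Pt → ℝ} {f : Pt → ℝ} (H : Conv T h b (m + 2) F f) :
    Conv T h (b - 2) m (fun n => CPE.lapH (wd T h) (F n)) (CPE.lapH (wd T h) f) := by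
  have := ((H.2 0).2.2.2 0).2.2.add ((H.2 1).2.2.2 1).2.2
  refine (this.congr (fun n => Eventually.of_forall fun p => ?_)
    (Eventually.of_forall fun p => ?_)).mono_left (by omega) <;> simp [CPE.lapH]

/-! ### Smooth functions of the horizontal variables -/

lemma SmoothS.sd {β : (Fin 3 → ℝ) → ℝ} (hβ : SmoothS β) (i : Fin 3) : SmoothS (sd i β) := by
  have h1 := hβ.smoothPer.pd i
  have e : (fun x => pd i (fun p : Pt => β p.2) (0, x)) = CPE.sd i β := by
    ext x; exact pd_snd hβ i _
  rw [← e]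
  exact ⟨h1.1.comp (contDiff_const.prodMk contDiff_id), fun j x => h1.2 0 j x⟩

lemma bdd_of_memLp_top {f : Pt → ℝ} (hf : MemLp f ⊤ (mQ T h)) : ∃ B, ∀ᵐ p ∂(mQ T h), |f p| ≤ B := by
  refine ⟨(eLpNormEssSup f (mQ T h)).toReal, ?_⟩
  have h2 : eLpNormEssSup f (mQ T h) ≠ ⊤ := by
    rw [← eLpNorm_exponent_top]; exact hf.2.ne
  filter_upwards [ae_le_eLpNormEssSup (f := f) (μ := mQ T h)] with p hp
  have := ENNReal.toReal_mono h2 hp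
  simpa using this

lemma SmoothS.wd_eq {β : (Fin 3 → ℝ) → ℝ} (hβ : SmoothS β) (i : Fin 3) :
    wd T h i (fun p => β p.2) =ᵐ[mQ T h] fun p => CPE.sd i β p.2 := by
  have h1 := (W.of_smooth (T := T) (h := h) (i := i) (p := ⊤) hβ.smoothPer).wd_eq
  filter_upwards [h1] with p hp
  rw [hp, pd_snd hβ]

lemma SmoothS.hasDeriv {β : (Fin 3 → ℝ) → ℝ} (hβ : SmoothS β) (i : Fin 3) :
    W T h ⊤ i (fun p => β p.2) fun p => CPE.sd i β p.2 := by
  have h1 := W.of_smooth (T := T) (h := h) (i := i) (p := ⊤) hβ.smoothPer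
  exact h1.congr (ae_eq_refl _) (Eventually.of_forall fun p => (pd_snd hβ i p).symm)

lemma SmoothS.sob : ∀ {m b : ℕ} {β : (Fin 3 → ℝ) → ℝ}, SmoothS β → Sob T h b m fun p => β p.2 := by
  have base : ∀ {b : ℕ} {β : (Fin 3 → ℝ) → ℝ}, SmoothS β →
      ConvL2 T h b (fun _ (p : Pt) => β p.2) fun p => β p.2 := fun hβ => by
    have h1 := hβ.memLp (T := T) (h := h)
    exact Sob.of_memLp (h1.mono_exponent le_top) fun _ => bdd_of_memLp_top h1
  intro m
  induction m with
  | zero => intro b β hβ; exact base hβ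
  | succ m ih =>
    intro b β hβ
    exact Conv.of_deriv (base hβ) (fun i _ => (hβ.hasDeriv (hor i)).weak)
      (fun i => (hβ.hasDeriv (hor i)).weak) fun i => ih (hβ.sd (hor i))

lemma sl_sub {f g : Pt → ℝ} (hf : Integrable f (mQ T h)) (hg : Integrable g (mQ T h)) :
    ∀ᵐ t ∂(mT T), sl h (fun p => f p - g p) t = sl h f t - sl h g t := by
  filter_upwards [integrable_slice hf, integrable_slice hg] with t h2 h3
  exact integral_sub h2 h3

lemma sl_sum_time {ι : Type} [Fintype ι] {θ : ι → ℝ → ℝ} {f : ι → Pt → ℝ}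
    (hf : ∀ i, Integrable (f i) (mQ T h)) :
    ∀ᵐ t ∂(mT T), sl h (fun p => ∑ i, θ i p.1 * f i p) t = ∑ i, θ i t * sl h (f i) t := by
  filter_upwards [ae_all_iff.2 fun i => integrable_slice (hf i)] with t ht
  simp only [sl]
  rw [integral_finsetSum _ fun i _ => (ht i).const_mul _]
  simp only [integral_const_mul]

lemma sl_memLp_top {f : Pt → ℝ} (hf : MemLp f ⊤ (mQ T h)) :
    MemLp (fun p : Pt => sl h f p.1) ⊤ (mQ T h) := by
  have hi : Integrable f (mQ T h) := hf.integrable le_top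
  obtain ⟨B, hB⟩ := bdd_of_memLp_top hf
  have hm : AEStronglyMeasurable (fun p : Pt => sl h f p.1) (mQ T h) := by
    rw [mQ_eq]; exact (integrable_sl hi).1.comp_fst
  have hb : ∀ᵐ t ∂(mT T), ‖sl h f t‖ ≤ h * B := by
    filter_upwards [ae_slice hB] with t ht
    have := norm_integral_le_of_norm_le_const (μ := mO h) (f := fun x => f (t, x)) ht
    rw [mO_real] at this
    rw [mul_comm]; exact this
  exact memLp_top_of_bound hm (h * B) (ae_of_time hb)

/-! ### Extension of the momentum equation to nonsmooth test functions -/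

section Momentum

/-- The terms of the momentum equation (component `i`) that do not contain time derivatives. -/
def momRest (T h : ℝ) (i : Fin 2) (A L Z ξ : Pt → ℝ) (B : Fin 2 → Pt → ℝ) (φ : Pt → ℝ) : Pt → ℝ :=
  fun p => A p * φ p + (B 0 p * wd T h (hor 0) φ p + B 1 p * wd T h (hor 1) φ p) +
    L p * lapH (wd T h) φ p +
    Z p * lapH (wd T h) (lapH (wd T h) (wd T h (hor i) fun q => ξ q * φ q)) p

/-- Integrability of the coefficients of the momentum equation. -/
structure MomCoeff (T h : ℝ) [Fact (0 < T)] [Fact (0 < h)] (A L Z ξ : Pt → ℝ) (B : Fin 2 → Pt → ℝ) :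
    Prop where
  hA : Integrable A (mQ T h)
  hB : ∀ j, Integrable (B j) (mQ T h)
  hL : MemLp L 2 (mQ T h)
  hZ : MemLp Z 2 (mQ T h)
  hξ : Sob T h 4 6 ξ

variable {i : Fin 2} {A L Z ξ : Pt → ℝ} {B : Fin 2 → Pt → ℝ}

lemma MomCoeff.conv (H : MomCoeff T h A L Z ξ B) {F : ℕ → Pt → ℝ} {f : Pt → ℝ}
    (hF : Conv T h 3 5 F f) :
    ConvL1 T h (fun n => momRest T h i A L Z ξ B (F n)) (momRest T h i A L Z ξ B f) := by
  have hξ : Conv T h 4 5 (fun _ => ξ) ξ := H.hξ.mono le_rfl (by norm_num)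
  have c1 := (Conv.mul hξ hF (by norm_num)).mono_left (b' := 3) (by norm_num)
  have c2 := (((c1.2 i).2.2).lapH (m := 2)).lapH (m := 0)
  have d : ∀ j : Fin 2, ConvL2 T h 2 (fun n => wd T h (hor j) (F n)) (wd T h (hor j) f) := fun j =>
    (hF.2 j).2.2.base
  exact (((ConvL1.mul_bdd H.hA hF.base (by norm_num)).add
    ((ConvL1.mul_bdd (H.hB 0) (d 0) (by norm_num)).add (ConvL1.mul_bdd (H.hB 1) (d 1) (by norm_num)))).add
    (ConvL1.mul_L2 H.hL (hF.lapH (m := 3)).base)).add (ConvL1.mul_L2 H.hZ c2)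

lemma MomCoeff.congr {f g : Pt → ℝ} (hfg : f =ᵐ[mQ T h] g) :
    momRest T h i A L Z ξ B f =ᵐ[mQ T h] momRest T h i A L Z ξ B g := by
  have hm : (fun q => ξ q * f q) =ᵐ[mQ T h] fun q => ξ q * g q := by
    filter_upwards [hfg] with p hp; rw [hp]
  filter_upwards [hfg, wd_congr (i := hor 0) hfg, wd_congr (i := hor 1) hfg, lapH_congr hfg,
    lapH_congr (lapH_congr (wd_congr (i := hor i) hm))] with p h1 h2 h3 h4 h5
  simp only [momRest, h1, h2, h3, h4, h5]

lemma MomCoeff.sum (H : MomCoeff T h A L Z ξ B) {ι : Type} [Fintype ι] {θ : ι → ℝ → ℝ}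
    {f : ι → Pt → ℝ} (hθ : ∀ a, MemLp (fun p : Pt => θ a p.1) ⊤ (mQ T h))
    (hf : ∀ a, Sob T h 3 5 (f a)) :
    momRest T h i A L Z ξ B (fun p => ∑ a, θ a p.1 * f a p) =ᵐ[mQ T h]
      fun p => ∑ a, θ a p.1 * momRest T h i A L Z ξ B (f a) p := by
  have t5 := (TLin.lapH (T := T) (h := h)).comp ((TLin.lapH (T := T) (h := h)).comp (TLin.wd i))
  have hξf : ∀ a, Sob T h 0 5 fun q => ξ q * f a q := fun a =>
    ((H.hξ.mono le_rfl (by norm_num)).mul (hf a) (by norm_num)).mono (by norm_num) le_rfl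
  have hd : ∀ j, _ := fun j => (TLin.wd (T := T) (h := h) j).sum Finset.univ hθ
    fun a => (hf a).mono (by norm_num) (by norm_num)
  have e : (fun q => ξ q * ∑ a, θ a q.1 * f a q) = fun q => ∑ a, θ a q.1 * (ξ q * f a q) := by
    ext q; rw [Finset.mul_sum]; exact Finset.sum_congr rfl fun a _ => by ring
  filter_upwards [hd 0, hd 1, TLin.lapH.sum Finset.univ hθ
    fun a => (hf a).mono (by norm_num) (by norm_num), t5.sum Finset.univ hθ hξf] with p h1 h2 h3 h4
  simp only [momRest, e]
  rw [h1, h2, h3, h4]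
  simp only [Finset.mul_sum, ← Finset.sum_add_distrib]
  exact Finset.sum_congr rfl fun a _ => by ring

theorem MomCoeff.extend (H : MomCoeff T h A L Z ξ B) {m : Pt → ℝ} (hm : MemLp m 2 (mQ T h))
    {c₀ : (Fin 3 → ℝ) → ℝ} (hc₀ : MemLp c₀ 2 (mO h))
    (hw : ∀ a, SmoothH a → ∃ e, LineAC T (sl h fun p => m p * a p.2)
      (sl h fun p => -momRest T h i A L Z ξ B (fun q => a q.2) p) (∫ x, c₀ x * a x ∂(mO h)) e)
    {φ φt : Pt → ℝ} {φ₀ : (Fin 3 → ℝ) → ℝ} (hφ : Sob T h 3 5 φ)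
    (hz : IsWeakDeriv T h 2 φ fun _ => 0) (hzt : IsWeakDeriv T h 2 φt fun _ => 0)
    (ht : MemLp φt 2 (mQ T h)) (h0 : SmoothH φ₀) (hTD : TD T h φ φt φ₀) :
    ∃ e, LineAC T (sl h fun p => m p * φ p)
      (sl h fun p => m p * φt p + -momRest T h i A L Z ξ B φ p) (∫ x, c₀ x * φ₀ x ∂(mO h)) e := by
  have hpos := hT.out
  have cφ : Conv T h 3 5 (fun n => hsmo T h n φ) φ := hφ.conv_hsmo
  have ct : ConvL2 T h 0 (fun n => hsmo T h n φt) φt :=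
    (Sob.conv_hsmo (m := 0) (b := 0) (Sob.of_memLp ht fun hb => absurd hb (by norm_num)))
  have c0 : ConvL2 T h 0 (fun n => hsmo T h n fun p => φ₀ p.2) fun p => φ₀ p.2 :=
    Sob.conv_hsmo (m := 0) (b := 0) h0.1.sob
  have hc2 : MemLp (fun p : Pt => c₀ p.2) 2 (mQ T h) := by
    rw [mQ_eq]; exact hc₀.comp_snd _
  have k1 := ConvL1.mul_L2 hm cφ.base
  have k2 := ConvL1.mul_L2 hm ct
  have k3 := H.conv (i := i) cφ
  have k4 := ConvL1.mul_L2 hc2 c0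
  have const : ∀ c : ℝ, ∫ _t, c ∂(mT T) = T * c := fun c => by simp [hpos.le]
  refine LineAC.limit hpos (a := fun n => sl h fun p => m p * hsmo T h n φ p)
    (α := fun n => sl h fun p => m p * hsmo T h n φt p +
      -momRest T h i A L Z ξ B (hsmo T h n φ) p)
    (c := fun n => 1 / T * ∫ p, c₀ p.2 * hsmo T h n (fun p => φ₀ p.2) p ∂(mQ T h))
    (e := fun n => 1 / T * (∫ p, c₀ p.2 * hsmo T h n (fun p => φ₀ p.2) p ∂(mQ T h)) +
      ∫ τ in (0:ℝ)..T, sl h (fun p => m p * hsmo T h n φt p +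
      -momRest T h i A L Z ξ B (hsmo T h n φ) p) τ)
    (fun n => ?_) (fun n => integrable_sl (k1.seq n)) (integrable_sl k1.lim)
    (integrable_sl (k2.add k3.neg).lim) k1.slice (k2.add k3.neg).slice ?_
  · obtain ⟨ι, _, a, k, ha, hk, hs⟩ := hsmo_eq_sum T h n
    have hprod : ∀ j, ∃ e, LineAC T
        (fun t => sl h (fun p => φ p * k j p.2) t * sl h (fun p => m p * a j p.2) t)
        (fun t => sl h (fun p => φt p * k j p.2) t * sl h (fun p => m p * a j p.2) t +
          sl h (fun p => φ p * k j p.2) t *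
          sl h (fun p => -momRest T h i A L Z ξ B (fun q => a j q.2) p) t)
        ((∫ x, φ₀ x * k j x ∂(mO h)) * ∫ x, c₀ x * a j x ∂(mO h)) e := fun j => by
      obtain ⟨e, he⟩ := (hTD.mul_space (hk j).1).slice
      obtain ⟨e', he'⟩ := hw (a j) (ha j)
      exact ⟨_, he.mul hpos he'⟩
    obtain ⟨e, he⟩ := LineAC.sum Finset.univ hpos fun j _ => hprod j
    have ima : ∀ j, Integrable (fun p => m p * a j p.2) (mQ T h) := fun j =>
      (hm.integrable one_le_two).mul_of_top_left (ha j).1.memLp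
    have ira : ∀ j, Integrable (momRest T h i A L Z ξ B fun q => a j q.2) (mQ T h) := fun j =>
      (H.conv (i := i) (F := fun _ => fun q => a j q.2) (ha j).1.sob).lim
    have hθ : ∀ j, MemLp (fun p : Pt => sl h (fun q => φ q * k j q.2) p.1) ⊤ (mQ T h) := fun j =>
      sl_memLp_top ((hk j).1.memLp.mul' (hφ.memLp_top (by norm_num)))
    have s1 : sl h (fun p => m p * hsmo T h n φ p) =ᵐ[mT T]
        fun t => ∑ j, sl h (fun p => φ p * k j p.2) t * sl h (fun p => m p * a j p.2) t := by
      refine (sl_congr ?_).trans (sl_sum_time ima)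
      filter_upwards [hs φ hz] with p hp
      rw [hp, Finset.mul_sum]
      exact Finset.sum_congr rfl fun j _ => by ring
    have s2 : sl h (fun p => m p * hsmo T h n φt p) =ᵐ[mT T]
        fun t => ∑ j, sl h (fun p => φt p * k j p.2) t * sl h (fun p => m p * a j p.2) t := by
      refine (sl_congr ?_).trans (sl_sum_time ima)
      filter_upwards [hs φt hzt] with p hp
      rw [hp, Finset.mul_sum]
      exact Finset.sum_congr rfl fun j _ => by ring
    have s3 : sl h (fun p => -momRest T h i A L Z ξ B (hsmo T h n φ) p) =ᵐ[mT T]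
        fun t => ∑ j, sl h (fun p => φ p * k j p.2) t *
          sl h (fun p => -momRest T h i A L Z ξ B (fun q => a j q.2) p) t := by
      refine (sl_congr ?_).trans (sl_sum_time fun j => (ira j).neg)
      filter_upwards [MomCoeff.congr (i := i) (A := A) (L := L) (Z := Z) (ξ := ξ) (B := B) (hs φ hz),
        H.sum (i := i) hθ fun j => (ha j).1.sob] with p h1 h2
      rw [h1, h2, ← Finset.sum_neg_distrib]
      exact Finset.sum_congr rfl fun j _ => by ring
    have e0 : 1 / T * ∫ p, c₀ p.2 * hsmo T h n (fun p => φ₀ p.2) p ∂(mQ T h) =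
        ∑ j, (∫ x, φ₀ x * k j x ∂(mO h)) * ∫ x, c₀ x * a j x ∂(mO h) := by
      have ica : ∀ j, Integrable (fun p : Pt => c₀ p.2 * a j p.2) (mQ T h) := fun j =>
        (hc2.integrable one_le_two).mul_of_top_left (ha j).1.memLp
      rw [← integral_sl (k4.seq n)]
      have : sl h (fun p => c₀ p.2 * hsmo T h n (fun p => φ₀ p.2) p) =ᵐ[mT T] fun _ =>
          ∑ j, (∫ x, φ₀ x * k j x ∂(mO h)) * ∫ x, c₀ x * a j x ∂(mO h) := by
        refine (sl_congr ?_).trans (sl_sum_time (θ := fun j _ => ∫ x, φ₀ x * k j x ∂(mO h)) ica)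
        filter_upwards [hs _ (h0.vertical (T := T) (h := h)).weak] with p hp
        rw [hp, Finset.mul_sum]
        refine Finset.sum_congr rfl fun j _ => ?_
        simp only [sl]; ring
      rw [integral_congr_ae this, const]
      field_simp
    have key : LineAC T (sl h fun p => m p * hsmo T h n φ p) (sl h fun p => m p * hsmo T h n φt p +
        -momRest T h i A L Z ξ B (hsmo T h n φ) p)
        (1 / T * ∫ p, c₀ p.2 * hsmo T h n (fun p => φ₀ p.2) p ∂(mQ T h)) e := by
      rw [e0]
      refine he.congr s1 ?_ hpos
      filter_upwards [sl_add (k2.seq n) (k3.seq n).neg, s2, s3] with t h1 h2 h3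
      refine h1.trans ?_
      rw [Finset.sum_add_distrib, ← h2, ← h3]
      rfl
    exact ⟨key.1, key.2.1, rfl⟩
  · have := k4.integral.const_mul (1 / T)
    have e : 1 / T * ∫ p, c₀ p.2 * φ₀ p.2 ∂(mQ T h) = ∫ x, c₀ x * φ₀ x ∂(mO h) := by
      rw [← integral_sl k4.lim]
      simp only [sl]
      rw [const]
      field_simp
    rwa [e] at this

end Momentum

variable {T h : ℝ} [hT : Fact (0 < T)] [hh : Fact (0 < h)]

/-- Functions whose integrals over almost all time slices vanish. -/
structure Null (T h : ℝ) (f : Pt → ℝ) : Prop where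
  int : Integrable f (mQ T h)
  zero : ∀ᵐ t ∂(mT T), sl h f t = 0

namespace Null
variable {f g : Pt → ℝ}

lemma congr (H : Null T h f) (hfg : f =ᵐ[mQ T h] g) : Null T h g :=
  ⟨H.int.congr hfg, by filter_upwards [H.zero, sl_congr hfg] with t h1 h2; rw [← h2, h1]⟩

lemma of_W {j : Fin 2} (H : W T h 1 (hor j) f g) : Null T h g := ⟨H.right.integrable le_rfl, H.sl_zero⟩

lemma add (H : Null T h f) (H' : Null T h g) : Null T h fun p => f p + g p :=
  ⟨H.int.add H'.int, by
    filter_upwards [H.zero, H'.zero, sl_add H.int H'.int] with t h1 h2 h3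
    rw [h3, h1, h2, add_zero]⟩

lemma const_mul (c : ℝ) (H : Null T h f) : Null T h fun p => c * f p :=
  ⟨H.int.const_mul c, by
    filter_upwards [H.zero] with t h1
    have : sl h (fun p => c * f p) t = c * sl h f t := integral_const_mul _ _
    rw [this, h1, mul_zero]⟩

end Null

/-- Multiplication by functions of time and the horizontal variables commutes with vertical means. -/
lemma avg_mul_of_vertical {F f : Pt → ℝ} (hz : IsWeakDeriv T h 2 F fun _ => 0) :
    (qLine T h 2).avg (fun p => F p * f p) =ᵐ[mQ T h] fun p => F p * (qLine T h 2).avg f p := by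
  have h1 := eq_avg_of_vertical hz
  have h2 : (fun p => F p * f p) =ᵐ[mQ T h] fun p => (qLine T h 2).avg F p * f p := by
    filter_upwards [h1] with p hp; rw [hp]
  filter_upwards [h1, Line.op_congr (ℓ := qLine T h 2) (k := Line.meanKer (qLine T h 2).L) h2]
    with p hp hq
  refine Eq.trans hq ?_
  rw [hp]
  simp only [Line.op, qLine_up, Function.update_idem, Line.meanKer]
  rw [← integral_const_mul]
  refine integral_congr_ae (Eventually.of_forall fun s => ?_)
  simp only; ring

lemma prim_mul_of_vertical {F f : Pt → ℝ} (hz : IsWeakDeriv T h 2 F fun _ => 0) :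
    (qLine T h 2).op Line.primKer (fun p => F p * f p) =ᵐ[mQ T h]
      fun p => F p * (qLine T h 2).op Line.primKer f p := by
  have h1 := eq_avg_of_vertical hz
  have h2 : (fun p => F p * f p) =ᵐ[mQ T h] fun p => (qLine T h 2).avg F p * f p := by
    filter_upwards [h1] with p hp; rw [hp]
  filter_upwards [h1, Line.op_congr (ℓ := qLine T h 2) (k := Line.primKer) h2] with p hp hq
  rw [hq, hp]
  simp only [Line.op, qLine_up, Function.update_idem, Line.meanKer]
  rw [← integral_const_mul]
  refine integral_congr_ae (Eventually.of_forall fun s => ?_)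
  simp only; ring

lemma Null.mean {F f : Pt → ℝ} (hz : IsWeakDeriv T h 2 F fun _ => 0) (hF : MemLp F 2 (mQ T h))
    (hf : MemLp f 2 (mQ T h)) (ha : MemLp ((qLine T h 2).avg f) 2 (mQ T h)) :
    Null T h fun p => F p * ((qLine T h 2).avg f p - f p) := by
  have i1 : Integrable (fun p => F p * f p) (mQ T h) := hF.integrable_mul hf
  have i2 : Integrable (fun p => F p * (qLine T h 2).avg f p) (mQ T h) := hF.integrable_mul ha
  have e : (fun p => F p * ((qLine T h 2).avg f p - f p)) =
      fun p => F p * (qLine T h 2).avg f p - F p * f p := by ext p; ring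
  rw [e]
  refine ⟨i2.sub i1, ?_⟩
  filter_upwards [sl_sub i2 i1, sl_avg 2 i1, sl_congr (avg_mul_of_vertical (f := f) hz)] with t h1 h2 h3
  rw [h1, ← h3]
  exact sub_eq_zero.2 h2

lemma memLp_avg (i : Fin 3) {f : Pt → ℝ} (hf : MemLp f 2 (mQ T h)) :
    MemLp ((qLine T h i).avg f) 2 (mQ T h) := by
  have i1 := Line.integrable_op (ℓ := qLine T h i) (ker_avg (qLine T h i)) (hf.integrable one_le_two)
  have i2 := Line.integrable_op (ℓ := qLine T h i) (ker_avg (qLine T h i)) hf.integrable_sq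
  refine (memLp_two_iff_integrable_sq i1.1).2 (i2.mono' (i1.1.pow 2) ?_)
  filter_upwards [Line.avg_sq_le i hf] with p hp
  rw [Real.norm_eq_abs, abs_of_nonneg (sq_nonneg _)]
  exact hp

lemma vertical_avg {f : Pt → ℝ} (hf : Integrable f (mQ T h)) :
    IsWeakDeriv T h 2 ((qLine T h 2).avg f) fun _ => 0 := by
  have i1 := Line.integrable_op (ℓ := qLine T h 2) (ker_avg (qLine T h 2)) hf
  refine (W.of_const_line le_rfl (memLp_one_iff_integrable.2 i1) fun p s => ?_).weak
  simp [Line.op, Line.meanKer]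

lemma W.avg {j : Fin 2} {f g : Pt → ℝ} (H : W T h 2 (hor j) f g) :
    W T h 2 (hor j) ((qLine T h 2).avg f) ((qLine T h 2).avg g) :=
  H.op (indep_qLine (hor_ne j)) (Line.ker_mean _) one_le_two (memLp_avg 2 H.left) (memLp_avg 2 H.right)

/-! ### Flux identities -/

/-- A density, its logarithmic derivatives up to third order, and a velocity with its derivatives
up to second order. -/
structure Fields (T h : ℝ) [Fact (0 < T)] [Fact (0 < h)] where
  ξ : Pt → ℝ
  e : Pt → ℝ
  q : Fin 2 → Pt → ℝ
  H : Fin 2 → Fin 2 → Pt → ℝ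
  J : Fin 2 → Fin 2 → Fin 2 → Pt → ℝ
  u : Fin 2 → Pt → ℝ
  U : Fin 2 → Fin 2 → Pt → ℝ
  V : Fin 2 → Fin 2 → Fin 2 → Pt → ℝ
  hξ : ∀ j, W T h ⊤ (hor j) ξ fun p => ξ p * q j p
  he : ∀ j, W T h ⊤ (hor j) e fun p => -10 * (e p * q j p)
  hq : ∀ i j, W T h ⊤ (hor i) (q j) (H i j)
  hH : ∀ k i j, W T h ⊤ (hor k) (H i j) (J k i j)
  hu : ∀ i j, W T h 2 (hor j) (u i) (U i j)
  hU : ∀ i j k, W T h 2 (hor k) (U i j) (V i j k)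
  symH : H 1 0 =ᵐ[mQ T h] H 0 1
  symJ : ∀ k i j, J k i j =ᵐ[mQ T h] J i k j
  symV : ∀ i, V i 1 0 =ᵐ[mQ T h] V i 0 1
  zξ : IsWeakDeriv T h 2 ξ fun _ => 0
  zq : ∀ j, IsWeakDeriv T h 2 (q j) fun _ => 0
  zH : ∀ i j, IsWeakDeriv T h 2 (H i j) fun _ => 0

namespace Fields
variable (F : Fields T h)

/-- `|∇ψ|²` -/
def nq : Pt → ℝ := fun p => F.q 0 p ^ 2 + F.q 1 p ^ 2

/-- `Δψ` -/
def tr : Pt → ℝ := fun p => F.H 0 0 p + F.H 1 1 p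

/-- `u · ∇ψ` -/
def uq : Pt → ℝ := fun p => F.u 0 p * F.q 0 p + F.u 1 p * F.q 1 p

/-- `div u + u · ∇ψ` -/
def c : Pt → ℝ := fun p => F.U 0 0 p + F.U 1 1 p + F.uq p

/-- The vertical mean of `div u + u · ∇ψ`. -/
def cb : Pt → ℝ := (qLine T h 2).avg F.c

/-- `∂ₜ ψ` -/
def g (ε : ℝ) : Pt → ℝ := fun p => ε * (F.nq p + F.tr p) - F.cb p

/-- The derivatives of `div u + u · ∇ψ`. -/
def dc (k : Fin 2) : Pt → ℝ := fun p => F.V 0 0 k p + F.V 1 1 k p +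
  ((F.U 0 k p * F.q 0 p + F.u 0 p * F.H k 0 p) + (F.U 1 k p * F.q 1 p + F.u 1 p * F.H k 1 p))

/-- The derivatives of `∂ₜ ψ`. -/
def dg (ε : ℝ) (k : Fin 2) : Pt → ℝ := fun p =>
  ε * (2 * (F.q 0 p * F.H k 0 p + F.q 1 p * F.H k 1 p) + (F.J k 0 0 p + F.J k 1 1 p)) -
    (qLine T h 2).avg (F.dc k) p

lemma w_nq (k : Fin 2) : W T h ⊤ (hor k) F.nq
    fun p => 2 * (F.q 0 p * F.H k 0 p + F.q 1 p * F.H k 1 p) := by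
  have := (((F.hq k 0).mul (r := ⊤) le_top (F.hq k 0)).add le_top
    ((F.hq k 1).mul (r := ⊤) le_top (F.hq k 1)))
  refine this.congr (Eventually.of_forall fun p => ?_) (Eventually.of_forall fun p => ?_)
  · simp only [nq]; ring
  · simp only; ring

lemma w_tr (k : Fin 2) : W T h ⊤ (hor k) F.tr fun p => F.J k 0 0 p + F.J k 1 1 p :=
  (F.hH k 0 0).add le_top (F.hH k 1 1)

lemma w_uq (k : Fin 2) : W T h 2 (hor k) F.uq fun p =>
    (F.U 0 k p * F.q 0 p + F.u 0 p * F.H k 0 p) + (F.U 1 k p * F.q 1 p + F.u 1 p * F.H k 1 p) :=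
  ((F.hu 0 k).mul (r := 2) one_le_two (F.hq k 0)).add one_le_two
    ((F.hu 1 k).mul (r := 2) one_le_two (F.hq k 1))

lemma w_c (k : Fin 2) : W T h 2 (hor k) F.c (F.dc k) :=
  ((F.hU 0 0 k).add one_le_two (F.hU 1 1 k)).add one_le_two (F.w_uq k)

lemma w_cb (k : Fin 2) : W T h 2 (hor k) F.cb ((qLine T h 2).avg (F.dc k)) := (F.w_c k).avg

lemma w_g (ε : ℝ) (k : Fin 2) : W T h 2 (hor k) (F.g ε) (F.dg ε k) :=
  ((((F.w_nq k).add le_top (F.w_tr k)).const_mul le_top ε).mono le_top).sub one_le_two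
    (F.w_cb k)

lemma w_ξu (i j : Fin 2) : W T h 2 (hor j) (fun p => F.ξ p * F.u i p) fun p =>
    F.ξ p * F.q j p * F.u i p + F.ξ p * F.U i j p :=
  (F.hξ j).mul (r := 2) one_le_two (F.hu i j)

lemma w_ξq (i j : Fin 2) : W T h ⊤ (hor j) (fun p => F.ξ p * F.q i p) fun p =>
    F.ξ p * F.q j p * F.q i p + F.ξ p * F.H j i p :=
  (F.hξ j).mul (r := ⊤) le_top (F.hq j i)

lemma c_memLp : MemLp F.c 2 (mQ T h) := (F.w_c 0).left

lemma cb_memLp : MemLp F.cb 2 (mQ T h) := (F.w_cb 0).left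

lemma null_convection (ε : ℝ) : Null T h fun p =>
    F.ξ p * (F.u 0 p * F.dg ε 0 p + F.u 1 p * F.dg ε 1 p) + F.ξ p * F.c p * F.g ε p := by
  refine ((Null.of_W ((F.w_ξu 0 0).mul (r := 1) le_rfl (F.w_g ε 0))).add
    (Null.of_W ((F.w_ξu 1 1).mul (r := 1) le_rfl (F.w_g ε 1)))).congr (Eventually.of_forall fun p => ?_)
  simp only [c, uq]; ring

lemma null_stress : Null T h fun p => F.ξ p * (F.c p ^ 2 +
    (F.u 0 p * F.u 0 p * F.H 0 0 p + F.u 0 p * F.u 1 p * F.H 0 1 p +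
      (F.u 1 p * F.u 0 p * F.H 1 0 p + F.u 1 p * F.u 1 p * F.H 1 1 p)) -
    (F.U 0 0 p ^ 2 + 2 * (F.U 0 1 p * F.U 1 0 p) + F.U 1 1 p ^ 2)) := by
  have f1 : ∀ i, W T h 1 (hor i) (fun p => F.ξ p * F.u i p * F.uq p) _ := fun i =>
    (F.w_ξu i i).mul (r := 1) le_rfl (F.w_uq i)
  have f2 : ∀ i j, W T h 1 (hor j) (fun p => F.ξ p * F.u i p * F.U j i p) _ := fun i j =>
    (F.w_ξu i j).mul (r := 1) le_rfl (F.hU j i j)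
  have f3 : ∀ i, W T h 1 (hor i) (fun p => F.ξ p * F.u i p * (F.U 0 0 p + F.U 1 1 p)) _ := fun i =>
    (F.w_ξu i i).mul (r := 1) le_rfl ((F.hU 0 0 i).add one_le_two (F.hU 1 1 i))
  have n := (((Null.of_W (f1 0)).add (Null.of_W (f1 1))).add
    (((Null.of_W (f2 0 0)).add (Null.of_W (f2 0 1))).add
      ((Null.of_W (f2 1 0)).add (Null.of_W (f2 1 1))) |>.const_mul (-1))).add
    ((Null.of_W (f3 0)).add (Null.of_W (f3 1)))
  refine n.congr ?_
  filter_upwards [F.symH, F.symV 0, F.symV 1] with p h1 h2 h3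
  simp only [c, uq, h1, h2, h3]
  ring

lemma null_drift : Null T h fun p => F.ξ p * (F.c p * (1 / 2 * F.nq p + F.tr p) -
    (F.U 0 0 p * F.H 0 0 p + F.U 0 1 p * F.H 0 1 p + (F.U 1 0 p * F.H 1 0 p + F.U 1 1 p * F.H 1 1 p))) := by
  have f1 : ∀ i, W T h 2 (hor i) (fun p => F.ξ p * F.u i p * F.nq p) _ := fun i =>
    (F.w_ξu i i).mul (r := 2) one_le_two (F.w_nq i)
  have f2 : ∀ i, W T h 2 (hor i) (fun p => F.ξ p * F.u i p * F.tr p) _ := fun i =>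
    (F.w_ξu i i).mul (r := 2) one_le_two (F.w_tr i)
  have f3 : ∀ i j, W T h 2 (hor j) (fun p => F.ξ p * F.u i p * F.H i j p) _ := fun i j =>
    (F.w_ξu i j).mul (r := 2) one_le_two (F.hH j i j)
  have o : ∀ {j : Fin 2} {f g : Pt → ℝ}, W T h 2 (hor j) f g → Null T h g := fun w =>
    Null.of_W (w.mono one_le_two)
  have n := ((((o (f1 0)).add (o (f1 1))).const_mul (1 / 2)).add ((o (f2 0)).add (o (f2 1)))).add
    ((((o (f3 0 0)).add (o (f3 0 1))).add ((o (f3 1 0)).add (o (f3 1 1)))).const_mul (-1))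
  refine n.congr ?_
  filter_upwards [F.symH, F.symJ 1 0 1, F.symJ 0 1 0] with p h1 h2 h3
  simp only [c, uq, nq, tr, h1, h2, h3]
  ring

lemma null_evolution (ε : ℝ) : Null T h fun p => F.ξ p * (F.nq p + F.tr p) * F.g ε p +
    F.ξ p * (F.q 0 p * F.dg ε 0 p + F.q 1 p * F.dg ε 1 p) := by
  have f : ∀ i, W T h 2 (hor i) (fun p => F.ξ p * F.q i p * F.g ε p) _ := fun i =>
    (F.w_ξq i i).mul (r := 2) one_le_two (F.w_g ε i)
  refine ((Null.of_W ((f 0).mono one_le_two)).add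
    (Null.of_W ((f 1).mono one_le_two))).congr (Eventually.of_forall fun p => ?_)
  simp only [nq, tr]; ring

lemma null_pressure : Null T h fun p => F.ξ p * (F.nq p + F.tr p) := by
  refine ((Null.of_W ((F.w_ξq 0 0).mono le_top)).add
    (Null.of_W ((F.w_ξq 1 1).mono le_top))).congr (Eventually.of_forall fun p => ?_)
  simp only [nq, tr]; ring

lemma null_cold : Null T h fun p => F.e p * (F.tr p - 10 * F.nq p) := by
  have f : ∀ i, W T h ⊤ (hor i) (fun p => F.e p * F.q i p) _ := fun i =>
    (F.he i).mul (r := ⊤) le_top (F.hq i i)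
  refine ((Null.of_W ((f 0).mono le_top)).add
    (Null.of_W ((f 1).mono le_top))).congr (Eventually.of_forall fun p => ?_)
  simp only [nq, tr]; ring

lemma null_capillarity : Null T h fun p => F.ξ p * (1 / 2 * F.tr p + 1 / 4 * F.nq p) *
    (F.nq p + F.tr p) - 1 / 2 * (F.ξ p *
    (F.H 0 0 p ^ 2 + F.H 0 1 p ^ 2 + (F.H 1 0 p ^ 2 + F.H 1 1 p ^ 2))) := by
  have f1 : ∀ i, W T h ⊤ (hor i) (fun p => F.ξ p * F.q i p * F.tr p) _ := fun i =>
    (F.w_ξq i i).mul (r := ⊤) le_top (F.w_tr i)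
  have f2 : ∀ i j, W T h ⊤ (hor j) (fun p => F.ξ p * F.q i p * F.H i j p) _ := fun i j =>
    (F.w_ξq i j).mul (r := ⊤) le_top (F.hH j i j)
  have f3 : ∀ i, W T h ⊤ (hor i) (fun p => F.ξ p * F.q i p * F.nq p) _ := fun i =>
    (F.w_ξq i i).mul (r := ⊤) le_top (F.w_nq i)
  have o : ∀ {j : Fin 2} {f g : Pt → ℝ}, W T h ⊤ (hor j) f g → Null T h g := fun w =>
    Null.of_W (w.mono le_top)
  have n := ((((o (f1 0)).add (o (f1 1))).const_mul (1 / 2)).add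
    (((o (f3 0)).add (o (f3 1))).const_mul (1 / 4))).add
    ((((o (f2 0 0)).add (o (f2 0 1))).add ((o (f2 1 0)).add (o (f2 1 1)))).const_mul (-1 / 2))
  refine n.congr ?_
  filter_upwards [F.symH, F.symJ 1 0 1, F.symJ 0 1 0] with p h1 h2 h3
  simp only [nq, tr, h1, h2, h3]
  ring

lemma null_tr : Null T h F.tr :=
  (Null.of_W ((F.hq 0 0).mono le_top)).add (Null.of_W ((F.hq 1 1).mono le_top))

lemma null_div : Null T h fun p => F.U 0 0 p + F.U 1 1 p :=
  (Null.of_W ((F.hu 0 0).mono one_le_two)).add (Null.of_W ((F.hu 1 1).mono one_le_two))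

lemma null_mean {f : Pt → ℝ} (hf : MemLp f 2 (mQ T h)) (hz : IsWeakDeriv T h 2 f fun _ => 0) :
    Null T h fun p => f p * (F.cb p - F.c p) := Null.mean hz hf F.c_memLp F.cb_memLp

/-- The regularized length of the velocity. -/
def ρ (a : ℝ) : Pt → ℝ := fun p => Real.sqrt (F.u 0 p ^ 2 + F.u 1 p ^ 2 + a ^ 2)

lemma w_ρ {a : ℝ} (ha : 0 < a) (j : Fin 2) : W T h 2 (hor j) (F.ρ a)
    fun p => (F.u 0 p * F.U 0 j p + F.u 1 p * F.U 1 j p) / F.ρ a p := by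
  have w := ((F.hu 0 j).mul (r := 1) le_rfl (F.hu 0 j)).add le_rfl
    ((F.hu 1 j).mul (r := 1) le_rfl (F.hu 1 j))
  have hpos : ∀ y : ℝ, 0 ≤ y → 0 < Real.sqrt (y + a ^ 2) := fun y hy => Real.sqrt_pos.2 (by positivity)
  have hac := w.ac.comp (K := Ici 0) isClosed_Ici (F := fun y => Real.sqrt (y + a ^ 2))
    (F' := fun y => 1 / (2 * Real.sqrt (y + a ^ 2))) (fun y hy => ?_) ?_ ?_
  · have hρ : F.ρ a = fun p => Real.sqrt (F.u 0 p * F.u 0 p + F.u 1 p * F.u 1 p + a ^ 2) := by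
      ext p; simp only [ρ, pow_two]
    have hac' : (qLine T h (hor j)).AC (F.ρ a)
        fun p => (F.u 0 p * F.U 0 j p + F.u 1 p * F.U 1 j p) / F.ρ a p := by
      refine hac.congr (Eventually.of_forall fun p => by rw [hρ]) (Eventually.of_forall fun p => ?_)
      have h0 := hpos (F.u 0 p * F.u 0 p + F.u 1 p * F.u 1 p)
        (add_nonneg (mul_self_nonneg _) (mul_self_nonneg _))
      rw [hρ]
      field_simp
      ring
    have m0 := (F.hu 0 j).left
    have m1 := (F.hu 1 j).left
    have hm : AEStronglyMeasurable (F.ρ a) (mQ T h) := by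
      rw [hρ]
      exact Real.continuous_sqrt.comp_aestronglyMeasurable
        (((m0.1.mul m0.1).add (m1.1.mul m1.1)).add aestronglyMeasurable_const)
    have hle : ∀ p, |F.u 0 p| ≤ F.ρ a p ∧ |F.u 1 p| ≤ F.ρ a p := fun p => by
      constructor <;> refine Real.abs_le_sqrt ?_ <;> nlinarith [sq_nonneg (F.u 0 p), sq_nonneg (F.u 1 p), sq_nonneg a]
    have hρpos : ∀ p, 0 < F.ρ a p := fun p => Real.sqrt_pos.2 (by positivity)
    refine W.of_ac one_le_two ?_ ?_ hac'
    · refine MemLp.mono' ((m0.abs.add m1.abs).add (memLp_const a)) hm (Eventually.of_forall fun p => ?_)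
      rw [Real.norm_eq_abs, abs_of_pos (hρpos p)]
      refine Real.sqrt_le_iff.2 ⟨by simp only [Pi.add_apply, Pi.abs_apply]; positivity, ?_⟩
      simp only [Pi.add_apply, Pi.abs_apply]
      nlinarith [abs_nonneg (F.u 0 p), abs_nonneg (F.u 1 p), sq_abs (F.u 0 p), sq_abs (F.u 1 p),
        mul_nonneg (abs_nonneg (F.u 0 p)) (abs_nonneg (F.u 1 p)),
        mul_nonneg (abs_nonneg (F.u 0 p)) ha.le, mul_nonneg (abs_nonneg (F.u 1 p)) ha.le]
    · have r0 := (F.hu 0 j).right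
      have r1 := (F.hu 1 j).right
      refine MemLp.mono' (r0.abs.add r1.abs)
        (((m0.1.mul r0.1).add (m1.1.mul r1.1)).aemeasurable.div hm.aemeasurable).aestronglyMeasurable
        (Eventually.of_forall fun p => ?_)
      rw [Real.norm_eq_abs, abs_div, abs_of_pos (hρpos p), div_le_iff₀ (hρpos p)]
      refine (abs_add_le _ _).trans ?_
      rw [abs_mul, abs_mul]
      simp only [Pi.add_apply, Pi.abs_apply]
      nlinarith [mul_le_mul_of_nonneg_right (hle p).1 (abs_nonneg (F.U 0 j p)),
        mul_le_mul_of_nonneg_right (hle p).2 (abs_nonneg (F.U 1 j p))]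
  · have h1 : HasDerivAt (fun y : ℝ => y + a ^ 2) 1 y := (hasDerivAt_id y).add_const _
    exact h1.sqrt (Real.sqrt_pos.1 (hpos y hy)).ne'
  · exact ContinuousOn.div continuousOn_const (by fun_prop) fun y hy => by
      have := hpos y hy
      positivity
  · exact Eventually.of_forall fun p => by
      exact add_nonneg (mul_self_nonneg (F.u 0 p)) (mul_self_nonneg (F.u 1 p))

/-- `div (ρ u)` -/
def dρ (a : ℝ) : Pt → ℝ := fun p => F.ρ a p * (F.U 0 0 p + F.U 1 1 p) +
  (F.u 0 p * (F.u 0 p * F.U 0 0 p + F.u 1 p * F.U 1 0 p) +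
    F.u 1 p * (F.u 0 p * F.U 0 1 p + F.u 1 p * F.U 1 1 p)) / F.ρ a p

lemma null_damping {a : ℝ} (ha : 0 < a) : Null T h fun p =>
    F.ξ p * F.ρ a p * F.uq p + F.ξ p * F.dρ a p := by
  refine ((Null.of_W ((F.w_ξu 0 0).mul (r := 1) le_rfl (F.w_ρ ha 0))).add
    (Null.of_W ((F.w_ξu 1 1).mul (r := 1) le_rfl (F.w_ρ ha 1)))).congr (Eventually.of_forall fun p => ?_)
  simp only [dρ, uq]
  ring

end Fields

instance (P : Fixed) : Fact (0 < P.T) := ⟨P.T_pos⟩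
instance (P : Fixed) : Fact (0 < P.h) := ⟨P.h_pos⟩

section
variable {T h : ℝ} [hT : Fact (0 < T)] [hh : Fact (0 < h)]

lemma SmoothS.memLp_mO {β : (Fin 3 → ℝ) → ℝ} (hβ : SmoothS β) : MemLp β ⊤ (mO h) := by
  have : Fact ((0:ℝ) < 1) := ⟨one_pos⟩
  obtain ⟨B, hB⟩ := bdd_of_memLp_top (hβ.memLp (T := 1) (h := h))
  have hne : NeZero (mT 1) := ⟨by rw [Ne, Measure.restrict_eq_zero, Real.volume_Ioo]; simp⟩
  obtain ⟨t, ht⟩ := (ae_slice hB).exists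
  exact memLp_top_of_bound hβ.1.continuous.aestronglyMeasurable B ht

/-- An evolution equation in weak form, tested by functions of time. -/
lemma lineAC_of_form {m N : Pt → ℝ} {c : ℝ} (hm : Integrable m (mQ T h)) (hN : Integrable N (mQ T h))
    (hw : ∀ α, Bump T α → ∫ p, (α p.1 * m p + tailInt T α p.1 * N p) ∂(mQ T h) =
      tailInt T α 0 * c) : ∃ e, LineAC T (sl h m) (sl h fun p => -N p) c e := by
  refine lineAC_of_weak_time (integrable_sl hm) (integrable_sl hN.neg) fun α hα => ?_
  obtain ⟨B, hB⟩ := hα.bound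
  have i1 : Integrable (fun p : Pt => α p.1 * m p) (mQ T h) := hm.bdd_mul (c := B)
    (hα.continuous.comp continuous_fst).aestronglyMeasurable (Eventually.of_forall fun p => hB _)
  have hc := (contDiff_tailInt (T := T) hα.1).1.continuous
  have i2 : ∀ {N : Pt → ℝ}, Integrable N (mQ T h) →
      Integrable (fun p : Pt => tailInt T α p.1 * N p) (mQ T h) := fun hN =>
    hN.mul_of_top_right (memLp_top_of_continuous (hc.comp continuous_fst))
  have h1 := hw α hα
  have e1 : (fun t => α t * sl h m t) = sl h fun p => α p.1 * m p := by
    ext t; exact (sl_time_mul _ _ _).symm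
  have e2 : (fun t => tailInt T α t * sl h (fun p => -N p) t) =
      sl h fun p => tailInt T α p.1 * -N p := by
    ext t; exact (sl_time_mul _ _ _).symm
  rw [integral_add i1 (i2 hN)] at h1
  rw [e1, e2, integral_sl i1, integral_sl (i2 (N := fun p => -N p) hN.neg)]
  simp only [mul_neg, integral_neg]
  linarith

lemma ubar_eq (u : Pt → Fin 2 → ℝ) (p : Pt) (i : Fin 2) :
    ubar h u p i = (qLine T h 2).avg (fun q => u q i) p := by
  have hpos := hh.out
  simp only [ubar, Line.op, Line.meanKer, qLine_up, integral_const_mul, qLine_L, side, if_true]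
  rw [intervalIntegral.integral_of_le hpos.le, integral_Ioc_eq_integral_Ioo]
  simp only [Line.lam, qLine_L, side, if_true]

lemma utilde_eq (u : Pt → Fin 2 → ℝ) (i : Fin 2) : (fun p => utilde u p i) =ᵐ[mQ T h]
    (qLine T h 2).op Line.primKer (fun q => u q i) := by
  filter_upwards [ae_mem_interior (T := T) (h := h)] with p hp
  have h2 := Ioo_subset_Icc_self (hp.2 2)
  simp only [side, if_true] at h2
  have := Line.prim_integral (α := fun s => u (p.1, Function.update p.2 2 s) i) h2
  simp only [utilde, Line.op, qLine_up, qLine_co]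
  rw [← this]
  simp only [Line.lam, qLine_L, side, if_true]

end

/-- The hypotheses of the Bresch-Desjardins estimate. -/
structure Sol (P : Fixed) (R : Reg) (ξ₀ : (Fin 3 → ℝ) → ℝ) (u₀ : (Fin 3 → ℝ) → Fin 2 → ℝ)
    (ξ : Pt → ℝ) (u : Pt → Fin 2 → ℝ) : Prop where
  data : IsInitialData P ξ₀ u₀
  sol : IsWeakSolution P R ξ₀ u₀ ξ u
  low : ∃ c > 0, ∀ᵐ p ∂(volume.restrict (Q P.T P.h)), c ≤ ξ p
  inf : LinfH P.T P.h 5 ξ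
  two : L2H P.T P.h 6 ξ

/-- `ln ξ` -/
abbrev lnf {α : Type} (ξ : α → ℝ) : α → ℝ := fun p => Real.log (ξ p)

namespace IsInitialData
variable {P : Fixed} {ξ₀ : (Fin 3 → ℝ) → ℝ} {u₀ : (Fin 3 → ℝ) → Fin 2 → ℝ}

lemma smooth (D : IsInitialData P ξ₀ u₀) : SmoothH ξ₀ :=
  ⟨⟨D.density_smooth, D.density_periodic⟩, fun x s => D.density_vertical _ _ (by simp) (by simp)⟩

lemma pos (D : IsInitialData P ξ₀ u₀) (x : Fin 3 → ℝ) : 0 < ξ₀ x := by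
  obtain ⟨ς, hς, h1⟩ := D.density_pos
  exact hς.trans_le (h1 x)

lemma smooth_comp (D : IsInitialData P ξ₀ u₀) {F : ℝ → ℝ} (hF : ContDiffOn ℝ ∞ F (Ioi 0)) :
    SmoothH fun x => F (ξ₀ x) := by
  refine ⟨⟨hF.comp_contDiff D.density_smooth D.pos, fun j x => ?_⟩, fun x s => ?_⟩
  · simp only [D.density_periodic j x]
  · simp only [D.smooth.2 x s]

end IsInitialData

namespace Sol
variable {P : Fixed} {R : Reg} {ξ₀ : (Fin 3 → ℝ) → ℝ} {u₀ : (Fin 3 → ℝ) → Fin 2 → ℝ}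
  {ξ : Pt → ℝ} {u : Pt → Fin 2 → ℝ}

lemma zξ (S : Sol P R ξ₀ u₀ ξ u) : IsWeakDeriv P.T P.h 2 ξ fun _ => 0 := by
  refine (W.of_const_line (T := P.T) (h := P.h) one_le_two S.two.1 fun p s => ?_).weak
  exact S.sol.density_vertical p.1 _ _ (by simp) (by simp)

lemma sob (S : Sol P R ξ₀ u₀ ξ u) : Sob P.T P.h 4 6 ξ :=
  sob_of_spaces S.two (fun _ => S.inf) (by norm_num) S.zξ

lemma range (S : Sol P R ξ₀ u₀ ξ u) : ∃ c B, 0 < c ∧ ∀ᵐ p ∂(mQ P.T P.h), ξ p ∈ Icc c B := by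
  obtain ⟨c, hc, h1⟩ := S.low
  obtain ⟨B, h2⟩ := S.sob.bdd (by norm_num)
  refine ⟨c, B, hc, ?_⟩
  filter_upwards [h1, h2] with p h1 h2
  exact ⟨h1, (le_abs_self _).trans h2⟩

lemma pos (S : Sol P R ξ₀ u₀ ξ u) : ∀ᵐ p ∂(mQ P.T P.h), 0 < ξ p := by
  obtain ⟨c, B, hc, h1⟩ := S.range
  filter_upwards [h1] with p hp using hc.trans_le hp.1

lemma comp (S : Sol P R ξ₀ u₀ ξ u) {F : ℝ → ℝ} (hF : ContDiffOn ℝ ∞ F (Ioi 0)) :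
    Sob P.T P.h 4 6 fun p => F (ξ p) := by
  obtain ⟨c, B, hc, h1⟩ := S.range
  exact Sob.comp hc h1 S.sob (by norm_num) (by norm_num) hF

lemma comp_deriv (S : Sol P R ξ₀ u₀ ξ u) {F F' : ℝ → ℝ} (hF : ∀ x > 0, HasDerivAt F (F' x) x)
    (hF' : ContinuousOn F' (Ioi 0)) (i : Fin 3) {g : Pt → ℝ} {p : ENNReal} (hp : 1 ≤ p)
    (hg : W P.T P.h p i ξ g) :
    W P.T P.h p i (fun p => F (ξ p)) fun p => F' (ξ p) * g p := by
  obtain ⟨c, B, hc, h1⟩ := S.range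
  exact hg.comp hp (fun x hx => hF x (hc.trans_le hx.1))
    (hF'.mono fun x hx => hc.trans_le hx.1) h1

lemma comp_vertical (S : Sol P R ξ₀ u₀ ξ u) {F F' : ℝ → ℝ} (hF : ∀ x > 0, HasDerivAt F (F' x) x)
    (hF' : ContinuousOn F' (Ioi 0)) : IsWeakDeriv P.T P.h 2 (fun p => F (ξ p)) fun _ => 0 := by
  have h0 : W P.T P.h 2 2 ξ fun _ => 0 := ⟨S.two.1, memLp_const 0, S.zξ⟩
  simpa using (S.comp_deriv hF hF' 2 one_le_two h0).weak

lemma contDiffOn_log : ContDiffOn ℝ ∞ Real.log (Ioi 0) :=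
  Real.contDiffOn_log.mono fun _ hx => (ne_of_gt hx)

lemma contDiffOn_zpow (n : ℤ) : ContDiffOn ℝ ∞ (fun x : ℝ => x ^ n) (Ioi 0) := fun x hx => by
  have hx' : x ≠ 0 := ne_of_gt hx
  cases n with
  | ofNat n => simpa using (contDiff_id.pow n).contDiffAt.contDiffWithinAt
  | negSucc n =>
    simp only [zpow_negSucc]
    exact ((contDiff_id.pow (n + 1)).contDiffAt.inv (pow_ne_zero _ hx')).contDiffWithinAt

lemma contDiffOn_sqrt : ContDiffOn ℝ ∞ Real.sqrt (Ioi 0) := fun _ hx =>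
  (Real.contDiffAt_sqrt (ne_of_gt hx)).contDiffWithinAt

lemma sob_log (S : Sol P R ξ₀ u₀ ξ u) : Sob P.T P.h 4 6 (lnf ξ) := S.comp contDiffOn_log

/-- The derivatives of `ξ` in terms of those of `ln ξ`. -/
lemma wξ (S : Sol P R ξ₀ u₀ ξ u) (j : Fin 2) :
    W P.T P.h ⊤ (hor j) ξ fun p => ξ p * wd P.T P.h (hor j) (lnf ξ) p := by
  have h1 := S.sob.hasDeriv_top j
  have h2 := (S.comp_deriv (fun x hx => Real.hasDerivAt_log (ne_of_gt hx))
    (continuousOn_inv₀.mono fun _ hx => ne_of_gt hx) (hor j) le_top h1).wd_eq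
  refine h1.congr (ae_eq_refl _) ?_
  filter_upwards [h2, S.pos] with p h2 h3
  rw [h2]
  field_simp

lemma wd_ξ (S : Sol P R ξ₀ u₀ ξ u) (j : Fin 2) :
    wd P.T P.h (hor j) ξ =ᵐ[mQ P.T P.h] fun p => ξ p * wd P.T P.h (hor j) (lnf ξ) p := (S.wξ j).wd_eq

lemma comp_top (S : Sol P R ξ₀ u₀ ξ u) {F F' : ℝ → ℝ} (hF : ∀ x > 0, HasDerivAt F (F' x) x)
    (hF' : ContinuousOn F' (Ioi 0)) (j : Fin 2) :
    W P.T P.h ⊤ (hor j) (fun p => F (ξ p))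
      fun p => F' (ξ p) * (ξ p * wd P.T P.h (hor j) (lnf ξ) p) :=
  S.comp_deriv hF hF' _ le_top (S.wξ j)

lemma w_zpow (S : Sol P R ξ₀ u₀ ξ u) (n : ℤ) (j : Fin 2) :
    W P.T P.h ⊤ (hor j) (fun p => ξ p ^ n)
      fun p => n * (ξ p ^ n * wd P.T P.h (hor j) (lnf ξ) p) := by
  have h1 := S.comp_top (F := fun x => x ^ n) (F' := fun x => n * x ^ (n - 1))
    (fun x hx => hasDerivAt_zpow n x (Or.inl (ne_of_gt hx)))
    (continuousOn_const.mul (contDiffOn_zpow (n - 1)).continuousOn) j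
  refine h1.congr (ae_eq_refl _) ?_
  filter_upwards [S.pos] with p hp
  rw [zpow_sub_one₀ hp.ne']
  field_simp

lemma vel (S : Sol P R ξ₀ u₀ ξ u) (i : Fin 2) (k : Fin 3) :
    W P.T P.h 2 k (fun p => u p i) (wd P.T P.h k fun p => u p i) :=
  ⟨(S.sol.velocity_L2H2 i).1, ((S.sol.velocity_L2H2 i).2 k).2.1,
    isWeakDeriv_wd ((S.sol.velocity_L2H2 i).2 k).1⟩

lemma vel2 (S : Sol P R ξ₀ u₀ ξ u) (i : Fin 2) (k l : Fin 3) :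
    W P.T P.h 2 k (wd P.T P.h l fun p => u p i) (wd P.T P.h k (wd P.T P.h l fun p => u p i)) :=
  ⟨((S.sol.velocity_L2H2 i).2 l).2.1, (((S.sol.velocity_L2H2 i).2 l).2.2 k).2,
    isWeakDeriv_wd (((S.sol.velocity_L2H2 i).2 l).2.2 k).1⟩

lemma z_log (S : Sol P R ξ₀ u₀ ξ u) : IsWeakDeriv P.T P.h 2 (lnf ξ) fun _ => 0 :=
  S.comp_vertical (fun _ hx => Real.hasDerivAt_log (ne_of_gt hx))
    (continuousOn_inv₀.mono fun _ hx => ne_of_gt hx)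

/-- The fields associated with a solution. -/
def fields (S : Sol P R ξ₀ u₀ ξ u) : Fields P.T P.h where
  ξ := ξ
  e := fun p => ξ p ^ (-10 : ℤ)
  q := fun j => wd P.T P.h (hor j) (lnf ξ)
  H := fun i j => wd P.T P.h (hor i) (wd P.T P.h (hor j) (lnf ξ))
  J := fun k i j => wd P.T P.h (hor k) (wd P.T P.h (hor i) (wd P.T P.h (hor j) (lnf ξ)))
  u := fun i p => u p i
  U := fun i j => wd P.T P.h (hor j) fun p => u p i
  V := fun i j k => wd P.T P.h (hor k) (wd P.T P.h (hor j) fun p => u p i)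
  hξ := S.wξ
  he := fun j => by
    refine (S.w_zpow (-10) j).congr (ae_eq_refl _) (Eventually.of_forall fun p => ?_)
    norm_num
  hq := fun i j => (S.sob_log.deriv j).hasDeriv_top (b := 1) i
  hH := fun k i j => ((S.sob_log.deriv j).deriv i).hasDeriv_top (b := 0) k
  hu := fun i j => S.vel i (hor j)
  hU := fun i j k => S.vel2 i (hor k) (hor j)
  symH := S.sob_log.wd_comm (m := 4) 1 0
  symJ := fun k i j => (S.sob_log.deriv j).wd_comm (m := 3) k i
  symV := fun i => wd_comm ⟨_, (S.vel i (hor 0)).weak⟩ ⟨_, (S.vel i (hor 1)).weak⟩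
    ⟨_, (S.vel2 i (hor 1) (hor 0)).weak⟩
  zξ := S.zξ
  zq := fun j => (S.sob_log.hasDeriv j).weak.vertical_zero S.z_log
  zH := fun i j => ((S.sob_log.deriv j).hasDeriv i).weak.vertical_zero
    ((S.sob_log.hasDeriv j).weak.vertical_zero S.z_log)

end Sol

section
variable {T h : ℝ} [hT : Fact (0 < T)] [hh : Fact (0 < h)]

lemma Fields.cb_eq (F : Fields T h) : F.cb =ᵐ[mQ T h] fun p =>
    (qLine T h 2).avg (F.U 0 0) p + (qLine T h 2).avg (F.U 1 1) p +
      (F.q 0 p * (qLine T h 2).avg (F.u 0) p + F.q 1 p * (qLine T h 2).avg (F.u 1) p) := by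
  have i0 := (F.hu 0 0).right.integrable one_le_two
  have i1 := (F.hu 1 1).right.integrable one_le_two
  have iq : ∀ j, Integrable (fun p => F.q j p * F.u j p) (mQ T h) := fun j =>
    ((F.hu j j).left.mul' (r := 2) (F.hq j j).left).integrable one_le_two
  have e : F.c = fun p => (F.U 0 0 p + F.U 1 1 p) + (F.q 0 p * F.u 0 p + F.q 1 p * F.u 1 p) := by
    ext p; simp only [Fields.c, Fields.uq]; ring
  filter_upwards [Line.avg_add (ℓ := qLine T h 2) (i0.add i1) ((iq 0).add (iq 1)),
    Line.avg_add (ℓ := qLine T h 2) i0 i1, Line.avg_add (ℓ := qLine T h 2) (iq 0) (iq 1),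
    avg_mul_of_vertical (f := F.u 0) (F.zq 0), avg_mul_of_vertical (f := F.u 1) (F.zq 1)]
    with p h1 h2 h3 h4 h5
  rw [Fields.cb, e]
  refine h1.trans ?_
  refine congrArg₂ (· + ·) h2 (h3.trans ?_)
  rw [h4, h5]

end

namespace Sol
variable {P : Fixed} {R : Reg} {ξ₀ : (Fin 3 → ℝ) → ℝ} {u₀ : (Fin 3 → ℝ) → Fin 2 → ℝ}
  {ξ : Pt → ℝ} {u : Pt → Fin 2 → ℝ}

lemma smooth_init (S : Sol P R ξ₀ u₀ ξ u) : SmoothH ξ₀ := S.data.smooth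

lemma smooth_log (S : Sol P R ξ₀ u₀ ξ u) : SmoothH (lnf ξ₀) :=
  S.data.smooth_comp contDiffOn_log

/-- The evolution of the density. -/
lemma td_ξ (S : Sol P R ξ₀ u₀ ξ u) : TD P.T P.h ξ (fun p => ξ p * S.fields.g R.ε p) ξ₀ := by
  set F := S.fields with hF
  have hg := (F.w_g R.ε 0).left
  have i0 : Integrable ξ₀ (mO P.h) := S.smooth_init.1.memLp_mO.integrable le_top
  refine TD.of_slices (S.two.1.integrable one_le_two)
    ((hg.mul' (r := 2) (F.hξ 0).left).integrable one_le_two) i0 fun β hβ => ?_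
  have wb : ∀ j : Fin 2, W P.T P.h ⊤ (hor j) (fun p => β p.2) fun p => sd (hor j) β p.2 := fun j =>
    hβ.hasDeriv _
  set ub : Fin 2 → Pt → ℝ := fun j => (qLine P.T P.h 2).avg (F.u j) with hub
  have wub : ∀ j, W P.T P.h 2 (hor j) (ub j) ((qLine P.T P.h 2).avg (F.U j j)) := fun j =>
    (F.hu j j).avg
  set N : Pt → ℝ := fun p => -(ξ p * ub 0 p * sd (hor 0) β p.2 + ξ p * ub 1 p * sd (hor 1) β p.2) +
    R.ε * (ξ p * F.q 0 p * sd (hor 0) β p.2 + ξ p * F.q 1 p * sd (hor 1) β p.2) with hN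
  have n1 : ∀ j, W P.T P.h 2 (hor j) (fun p => ξ p * ub j p * β p.2) _ := fun j =>
    (((F.hξ j).mul (r := 2) one_le_two (wub j)).mul (r := 2) one_le_two (wb j))
  have n2 : ∀ j, W P.T P.h ⊤ (hor j) (fun p => ξ p * F.q j p * β p.2) _ := fun j =>
    ((F.w_ξq j j).mul (r := ⊤) le_top (wb j))
  have null : Null P.T P.h fun p => -N p - ξ p * F.g R.ε p * β p.2 := by
    have o : ∀ {j : Fin 2} {p} {f g : Pt → ℝ}, 1 ≤ p → W P.T P.h p (hor j) f g → Null P.T P.h g :=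
      fun hp w => Null.of_W (w.mono hp)
    refine (((o one_le_two (n1 0)).add (o one_le_two (n1 1))).add
      (((o le_top (n2 0)).add (o le_top (n2 1))).const_mul (-R.ε))).congr ?_
    filter_upwards [F.cb_eq] with p hp
    simp only [Fields.g, hp, hN, Fields.nq, Fields.tr]
    change ((ξ p * F.q 0 p * ub 0 p + ξ p * (qLine P.T P.h 2).avg (F.U 0 0) p) * β p.2 + _ +
      ((ξ p * F.q 1 p * ub 1 p + ξ p * (qLine P.T P.h 2).avg (F.U 1 1) p) * β p.2 + _)) + -R.ε *
      ((ξ p * F.q 0 p * F.q 0 p + ξ p * F.H 0 0 p) * β p.2 + _ +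
      ((ξ p * F.q 1 p * F.q 1 p + ξ p * F.H 1 1 p) * β p.2 + _)) = _
    ring
  have iN : Integrable N (mQ P.T P.h) := by
    have a : ∀ j, Integrable (fun p => ξ p * ub j p * sd (hor j) β p.2) (mQ P.T P.h) := fun j =>
      ((((wub j).left.mul' (r := 2) (F.hξ 0).left)).integrable one_le_two).mul_of_top_left (wb j).right
    have b : ∀ j, Integrable (fun p => ξ p * F.q j p * sd (hor j) β p.2) (mQ P.T P.h) := fun j =>
      ((((F.hq 0 j).left.mul' (r := ⊤) (F.hξ 0).left)).integrable le_top).mul_of_top_left (wb j).right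
    exact (((a 0).add (a 1)).neg).add (((b 0).add (b 1)).const_mul _)
  have iβ : Integrable (fun p => ξ p * β p.2) (mQ P.T P.h) :=
    (S.two.1.integrable one_le_two).mul_of_top_left hβ.memLp
  have iξg : Integrable (fun p => ξ p * F.g R.ε p * β p.2) (mQ P.T P.h) :=
    ((hg.mul' (r := 2) (F.hξ 0).left).integrable one_le_two).mul_of_top_left hβ.memLp
  have key := lineAC_of_form (T := P.T) (h := P.h) (c := ∫ x, ξ₀ x * β x ∂(mO P.h)) iβ iN fun α hα => ?_
  · obtain ⟨e, he⟩ := key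
    refine ⟨e, he.congr (Eventually.of_forall fun _ => rfl) ?_ P.T_pos⟩
    filter_upwards [null.zero, sl_sub iN.neg iξg] with t h1 h2
    have : sl P.h (fun p => -N p - ξ p * F.g R.ε p * β p.2) t = _ := h2
    rw [h1] at this
    change _ = sl P.h (-N) t
    linarith
  · have h1 := S.sol.mass _ (testInitial_time_mul hα hβ)
    obtain ⟨hc, hd⟩ := contDiff_tailInt (T := P.T) hα.1
    have e1 : ∫ x in Om P.h, ξ₀ x * (tailInt P.T α 0 * β x) =
        tailInt P.T α 0 * ∫ x, ξ₀ x * β x ∂(mO P.h) := by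
      rw [← integral_const_mul]
      exact integral_congr_ae (Eventually.of_forall fun x => by simp only; ring)
    refine Eq.trans ?_ (h1.trans e1)
    refine integral_congr_ae ?_
    filter_upwards [S.wd_ξ 0, S.wd_ξ 1] with p h1 h2
    simp only [massForm, td_time_mul hc hd hβ, pd_time_mul hc hβ, Fin.sum_univ_two, h1, h2,
      ubar_eq (T := P.T), hN]
    change _ = -(ξ p * (-α p.1 * β p.2)) - (ξ p * ub 0 p * _ + ξ p * ub 1 p * _) + R.ε *
      (ξ p * F.q 0 p * _ + ξ p * F.q 1 p * _)
    ring

lemma td_log (S : Sol P R ξ₀ u₀ ξ u) : TD P.T P.h (lnf ξ) (S.fields.g R.ε) (lnf ξ₀) := by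
  obtain ⟨c, B, hc, h1⟩ := S.range
  have i0 : Integrable (lnf ξ₀) (mO P.h) := S.smooth_log.1.memLp_mO.integrable le_top
  have h2 := S.td_ξ.comp (F := Real.log) (F' := fun x => x⁻¹)
    (fun x hx => Real.hasDerivAt_log (hc.trans_le hx.1).ne')
    (continuousOn_inv₀.mono fun x hx => (hc.trans_le hx.1).ne') h1 i0
  refine h2.congr (ae_eq_refl _) ?_ (ae_eq_refl _)
  filter_upwards [S.pos] with p hp
  field_simp

lemma td_q (S : Sol P R ξ₀ u₀ ξ u) (k : Fin 2) :
    TD P.T P.h (S.fields.q k) (S.fields.dg R.ε k) (sd (hor k) (lnf ξ₀)) :=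
  S.td_log.wd S.smooth_log.1 (S.sob_log.hasDeriv k).weak (S.fields.w_g R.ε k).weak

end Sol

section
variable {T h : ℝ} [hT : Fact (0 < T)] [hh : Fact (0 < h)]

lemma SmoothH.sd {β : (Fin 3 → ℝ) → ℝ} (hβ : SmoothH β) (j : Fin 2) : SmoothH (sd (hor j) β) := by
  refine ⟨hβ.1.sd _, fun x s => ?_⟩
  have e : (fun y => β (y + (Function.update x 2 s - x))) = β := by
    ext y
    have : y + (Function.update x 2 s - x) = Function.update y 2 (y 2 + (s - x 2)) := by
      ext i
      by_cases hi : i = 2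
      · subst hi; simp
      · simp [hi]
    rw [this, hβ.2]
  have h1 := fderiv_comp_add_right (𝕜 := ℝ) (f := β) (x := x) (Function.update x 2 s - x)
  rw [e] at h1
  simp only [CPE.sd]
  rw [h1]
  congr 2; abel

lemma lap_pd_time_mul {χ : ℝ → ℝ} {a : (Fin 3 → ℝ) → ℝ} (hχ : ContDiff ℝ ∞ χ) (ha : SmoothH a)
    (p : Pt) : lap pd (fun q => χ q.1 * a q.2) p = χ p.1 * lapH sd a p.2 := by
  have e : ∀ i, pd i (fun q : Pt => χ q.1 * a q.2) = fun q => χ q.1 * sd i a q.2 := fun i => by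
    ext q; exact pd_time_mul hχ ha.1 i q
  have e2 : sd 2 a = fun _ => 0 := by ext x; exact ha.sd_two x
  have e3 : pd 2 (fun q : Pt => χ q.1 * sd 2 a q.2) p = 0 := by
    simp only [e2, mul_zero, pd]
    simp
  simp only [lap, lapH, Fin.sum_univ_three, Fin.sum_univ_two, e, e3, add_zero]
  have h0 := pd_time_mul hχ (ha.1.sd (hor 0)) (hor 0) p
  have h1 := pd_time_mul hχ (ha.1.sd (hor 1)) (hor 1) p
  simp only [hor, Fin.castSucc_zero, Fin.castSucc_one] at h0 h1 ⊢
  rw [h0, h1]; ring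

lemma SmoothS.lapH_eq {β : (Fin 3 → ℝ) → ℝ} (hβ : SmoothS β) :
    lapH (wd T h) (fun p => β p.2) =ᵐ[mQ T h] fun p => lapH CPE.sd β p.2 := by
  filter_upwards [(wd_congr (i := hor 0) (hβ.wd_eq (T := T) (h := h) (hor 0))).trans
    ((hβ.sd _).wd_eq (hor 0)), (wd_congr (i := hor 1) (hβ.wd_eq (T := T) (h := h) (hor 1))).trans
    ((hβ.sd _).wd_eq (hor 1))] with p h0 h1
  simp only [lapH, Fin.sum_univ_two, h0, h1]

end

namespace Sol
variable {P : Fixed} {R : Reg} {ξ₀ : (Fin 3 → ℝ) → ℝ} {u₀ : (Fin 3 → ℝ) → Fin 2 → ℝ}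
  {ξ : Pt → ℝ} {u : Pt → Fin 2 → ℝ}

/-- `√ξ` -/
abbrev sq' (ξ : Pt → ℝ) : Pt → ℝ := fun q => Real.sqrt (ξ q)

/-- The lower order terms of the momentum equation. -/
def coA (P : Fixed) (R : Reg) (ξ : Pt → ℝ) (u : Pt → Fin 2 → ℝ) (i : Fin 2) : Pt → ℝ := fun p =>
  R.r₀ * u p i + P.r * (ξ p * (len (u p) * u p i)) +
    R.ε * (wd P.T P.h (hor 0) ξ p * wd P.T P.h (hor 0) (fun q => u q i) p +
      wd P.T P.h (hor 1) ξ p * wd P.T P.h (hor 1) (fun q => u q i) p) +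
    2 * R.κ * (lapH (wd P.T P.h) (sq' ξ) p * wd P.T P.h (hor i) (sq' ξ) p)

/-- The isotropic part of the stress. -/
def coS (P : Fixed) (R : Reg) (ξ : Pt → ℝ) : Pt → ℝ := fun p =>
  -ξ p + R.η * ξ p ^ (-10 : ℤ) + R.κ * (lapH (wd P.T P.h) (sq' ξ) p * sq' ξ p)

/-- The stress. -/
def coB (P : Fixed) (R : Reg) (ξ : Pt → ℝ) (u : Pt → Fin 2 → ℝ) (i j : Fin 2) : Pt → ℝ := fun p =>
  -(ξ p * (u p i * u p j)) + 2 * P.ν₁ * (ξ p * symGrad (wd P.T P.h) u i j p) +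
    (if i = j then 1 else 0) * coS P R ξ p

def coL (P : Fixed) (R : Reg) (u : Pt → Fin 2 → ℝ) (i : Fin 2) : Pt → ℝ := fun p =>
  R.μ * lap (wd P.T P.h) (fun q => u q i) p

def coZ (P : Fixed) (R : Reg) (ξ : Pt → ℝ) : Pt → ℝ := fun p =>
  R.δ * lapH (wd P.T P.h) (lapH (wd P.T P.h) (lapH (wd P.T P.h) ξ)) p

/-- The terms of component `i` of the momentum equation without time derivatives. -/
abbrev rest (P : Fixed) (R : Reg) (ξ : Pt → ℝ) (u : Pt → Fin 2 → ℝ) (i : Fin 2) :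
    (Pt → ℝ) → Pt → ℝ :=
  momRest P.T P.h i (coA P R ξ u i) (coL P R u i) (coZ P R ξ) ξ (coB P R ξ u i)

lemma len_le (v : Fin 2 → ℝ) : len v ≤ |v 0| + |v 1| := by
  refine Real.sqrt_le_iff.2 ⟨by positivity, ?_⟩
  simp only [CPE.sq, Fin.sum_univ_two]
  nlinarith [sq_abs (v 0), sq_abs (v 1), mul_nonneg (abs_nonneg (v 0)) (abs_nonneg (v 1))]

lemma memLp_len (S : Sol P R ξ₀ u₀ ξ u) : MemLp (fun p => len (u p)) 2 (mQ P.T P.h) := by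
  have m0 := (S.vel 0 0).left
  have m1 := (S.vel 1 0).left
  refine (m0.abs.add m1.abs).mono' ?_ (Eventually.of_forall fun p => ?_)
  · have e : (fun p => len (u p)) = fun p => Real.sqrt (u p 0 * u p 0 + u p 1 * u p 1) := by
      ext p; simp only [len, CPE.sq, Fin.sum_univ_two, pow_two]
    rw [e]
    exact Real.continuous_sqrt.comp_aestronglyMeasurable ((m0.1.mul m0.1).add (m1.1.mul m1.1))
  · exact (abs_of_nonneg (Real.sqrt_nonneg _)).trans_le (len_le _)

lemma memLp_symGrad (S : Sol P R ξ₀ u₀ ξ u) (i j : Fin 2) :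
    MemLp (symGrad (wd P.T P.h) u i j) 2 (mQ P.T P.h) := by
  have := ((S.vel j (hor i)).right.add (S.vel i (hor j)).right).const_mul (1 / 2)
  refine (memLp_congr_ae (Eventually.of_forall fun p => ?_)).1 this
  simp only [symGrad, Pi.add_apply]; ring

lemma memLp_lap (S : Sol P R ξ₀ u₀ ξ u) (i : Fin 2) :
    MemLp (lap (wd P.T P.h) fun q => u q i) 2 (mQ P.T P.h) := by
  have e : (lap (wd P.T P.h) fun q => u q i) = fun p =>
      wd P.T P.h 0 (wd P.T P.h 0 fun q => u q i) p + wd P.T P.h 1 (wd P.T P.h 1 fun q => u q i) p +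
      wd P.T P.h 2 (wd P.T P.h 2 fun q => u q i) p := by
    ext p; simp only [lap, Fin.sum_univ_three]
  rw [e]
  exact ((S.vel2 i 0 0).right.add (S.vel2 i 1 1).right).add (S.vel2 i 2 2).right

lemma sob_sqrt (S : Sol P R ξ₀ u₀ ξ u) : Sob P.T P.h 4 6 (sq' ξ) := S.comp contDiffOn_sqrt

lemma coeff (S : Sol P R ξ₀ u₀ ξ u) (i : Fin 2) :
    MomCoeff P.T P.h (coA P R ξ u i) (coL P R u i) (coZ P R ξ) ξ (coB P R ξ u i) := by
  have hξ := S.sob.memLp_top (by norm_num)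
  have hu := fun j : Fin 2 => (S.vel j 0).left
  have hs := S.sob_sqrt
  have hls : MemLp (lapH (wd P.T P.h) (sq' ξ)) ⊤ (mQ P.T P.h) := hs.lapH.memLp_top (by norm_num)
  have hds : ∀ j, MemLp (wd P.T P.h (hor j) (sq' ξ)) ⊤ (mQ P.T P.h) := fun j =>
    (hs.deriv j).memLp_top (by norm_num)
  have hdξ : ∀ j, MemLp (wd P.T P.h (hor j) ξ) ⊤ (mQ P.T P.h) := fun j =>
    (S.sob.deriv j).memLp_top (by norm_num)
  have i1 : Integrable (fun p => len (u p) * u p i) (mQ P.T P.h) := S.memLp_len.integrable_mul (hu i)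
  have i2 : ∀ j, Integrable (fun p => wd P.T P.h (hor j) ξ p * wd P.T P.h (hor j) (fun q => u q i) p)
      (mQ P.T P.h) := fun j =>
    ((S.vel i (hor j)).right.integrable one_le_two).mul_of_top_right (hdξ j)
  have i3 : Integrable (fun p => lapH (wd P.T P.h) (sq' ξ) p * wd P.T P.h (hor i) (sq' ξ) p)
      (mQ P.T P.h) := ((hds i).mul' (r := ⊤) hls).integrable le_top
  have hS : Integrable (coS P R ξ) (mQ P.T P.h) := by
    have h1 : MemLp (fun p => ξ p ^ (-10 : ℤ)) ⊤ (mQ P.T P.h) :=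
      (S.comp (contDiffOn_zpow (-10))).memLp_top (by norm_num)
    exact ((hξ.integrable le_top).neg.add ((h1.integrable le_top).const_mul _)).add
      ((((hs.memLp_top (by norm_num)).mul' (r := ⊤) hls).integrable le_top).const_mul _)
  refine ⟨?_, fun j => ?_, (S.memLp_lap i).const_mul _, ?_, S.sob⟩
  · exact (((((hu i).integrable one_le_two).const_mul _).add
      ((i1.mul_of_top_right hξ).const_mul _)).add (((i2 0).add (i2 1)).const_mul _)).add
      (i3.const_mul _)
  · have j1 : Integrable (fun p => u p i * u p j) (mQ P.T P.h) := (hu i).integrable_mul (hu j)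
    exact ((j1.mul_of_top_right hξ).neg.add
      ((((S.memLp_symGrad i j).integrable one_le_two).mul_of_top_right hξ).const_mul _)).add
      (hS.const_mul _)
  · exact S.sob.lapH.lapH.lapH.memLp.const_mul _

lemma momentumForm_eq (S : Sol P R ξ₀ u₀ ξ u) {α : ℝ → ℝ} (hα : Bump P.T α)
    {a : Fin 2 → (Fin 3 → ℝ) → ℝ} (ha : ∀ i, SmoothH (a i)) :
    momentumForm P R ξ u (fun p i => tailInt P.T α p.1 * a i p.2) =ᵐ[mQ P.T P.h] fun p =>
      (α p.1 * (ξ p * u p 0 * a 0 p.2) + tailInt P.T α p.1 * rest P R ξ u 0 (fun q => a 0 q.2) p) +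
      (α p.1 * (ξ p * u p 1 * a 1 p.2) + tailInt P.T α p.1 * rest P R ξ u 1 (fun q => a 1 q.2) p) := by
  obtain ⟨hc, hd⟩ := contDiff_tailInt (T := P.T) hα.1
  have hχ : MemLp (fun p : Pt => tailInt P.T α p.1) ⊤ (mQ P.T P.h) :=
    memLp_top_of_continuous (hc.continuous.comp continuous_fst)
  have t4 := (TLin.lapH (T := P.T) (h := P.h)).comp TLin.lapH
  have hξa : ∀ i, Sob P.T P.h 0 5 fun q => ξ q * a i q.2 := fun i =>
    ((S.sob.mono le_rfl (by norm_num)).mul ((ha i).1.sob (b := 4)) (by norm_num)).mono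
      (by norm_num) le_rfl
  have hdiv : (divH (wd P.T P.h) fun q j => ξ q * (tailInt P.T α q.1 * a j q.2)) =ᵐ[mQ P.T P.h]
      fun p => tailInt P.T α p.1 * (wd P.T P.h (hor 0) (fun q => ξ q * a 0 q.2) p +
        wd P.T P.h (hor 1) (fun q => ξ q * a 1 q.2) p) := by
    have e : ∀ j, (fun q : Pt => ξ q * (tailInt P.T α q.1 * a j q.2)) =
        fun q => tailInt P.T α q.1 * (ξ q * a j q.2) := fun j => by ext q; ring
    filter_upwards [(TLin.wd (T := P.T) (h := P.h) 0).time hχ ((hξa 0).mono le_rfl (by norm_num)),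
      (TLin.wd (T := P.T) (h := P.h) 1).time hχ ((hξa 1).mono le_rfl (by norm_num))] with p h0 h1
    simp only [divH, Fin.sum_univ_two, e, h0, h1]
    ring
  have hδ : lapH (wd P.T P.h) (lapH (wd P.T P.h) (divH (wd P.T P.h)
      fun q j => ξ q * (tailInt P.T α q.1 * a j q.2))) =ᵐ[mQ P.T P.h] fun p => tailInt P.T α p.1 *
      (lapH (wd P.T P.h) (lapH (wd P.T P.h) (wd P.T P.h (hor 0) fun q => ξ q * a 0 q.2)) p +
      lapH (wd P.T P.h) (lapH (wd P.T P.h) (wd P.T P.h (hor 1) fun q => ξ q * a 1 q.2)) p) := by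
    have s0 := (hξa 0).deriv 0
    have s1 := (hξa 1).deriv 1
    refine (t4.congr hdiv).trans ((t4.time hχ (s0.add s1)).trans ?_)
    filter_upwards [t4.add s0 s1] with p hp
    rw [hp]
  filter_upwards [hδ, (ha 0).1.wd_eq (T := P.T) (h := P.h) (hor 0),
    (ha 0).1.wd_eq (T := P.T) (h := P.h) (hor 1), (ha 1).1.wd_eq (T := P.T) (h := P.h) (hor 0),
    (ha 1).1.wd_eq (T := P.T) (h := P.h) (hor 1), (ha 0).1.lapH_eq (T := P.T) (h := P.h),
    (ha 1).1.lapH_eq (T := P.T) (h := P.h)] with p h1 h2 h3 h4 h5 h6 h7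
  have z : ∀ i, pd 2 (fun q : Pt => tailInt P.T α q.1 * a i q.2) p = 0 := fun i => by
    rw [pd_time_mul hc (ha i).1, (ha i).sd_two, mul_zero]
  have d1 := fun j => pd_time_mul hc (ha 0).1 j p
  have d2 := fun j => pd_time_mul hc (ha 1).1 j p
  have e1 := td_time_mul hc hd (ha 0).1 p
  have e2 := td_time_mul hc hd (ha 1).1 p
  have l1 := lap_pd_time_mul hc (ha 0) p
  have l2 := lap_pd_time_mul hc (ha 1) p
  simp only [momentumForm, momRest, coA, coB, coL, coZ, coS, Fin.sum_univ_two, h1, h2, h3, h4, h5, h6,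
    h7, z, divH, d1, d2, e1, e2, l1, l2, if_true, one_mul]
  simp only [Fin.zero_eq_one_iff, Fin.one_eq_zero_iff, OfNat.ofNat_ne_one, if_false, zero_mul, add_zero]
  ring

lemma rest_zero (S : Sol P R ξ₀ u₀ ξ u) (i : Fin 2) :
    rest P R ξ u i (fun _ => 0) =ᵐ[mQ P.T P.h] fun _ => 0 := by
  have := (S.coeff i).sum (i := i) (ι := Fin 0) (θ := fun _ _ => 0) (f := fun _ _ => 0)
    (fun _ => memLp_const 0) (fun a => a.elim0)
  simpa using this

lemma memLp_init (S : Sol P R ξ₀ u₀ ξ u) (i : Fin 2) : MemLp (fun x => ξ₀ x * u₀ x i) 2 (mO P.h) :=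
  (S.data.velocity_memLp i).mul' S.smooth_init.1.memLp_mO

lemma momentum_smooth (S : Sol P R ξ₀ u₀ ξ u) (i : Fin 2) {a : (Fin 3 → ℝ) → ℝ} (ha : SmoothH a) :
    ∃ e, LineAC P.T (sl P.h fun p => ξ p * u p i * a p.2)
      (sl P.h fun p => -rest P R ξ u i (fun q => a q.2) p) (∫ x, ξ₀ x * u₀ x i * a x ∂(mO P.h)) e := by
  have hm : MemLp (fun p => ξ p * u p i) 2 (mQ P.T P.h) :=
    (S.vel i 0).left.mul' (S.sob.memLp_top (by norm_num))
  refine lineAC_of_form ((hm.integrable one_le_two).mul_of_top_left ha.1.memLp)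
    ((S.coeff i).conv (i := i) (F := fun _ => fun q => a q.2) ha.1.sob).lim fun α hα => ?_
  set b : Fin 2 → (Fin 3 → ℝ) → ℝ := fun k => if k = i then a else fun _ => 0 with hb
  have h0 : SmoothH fun _ => (0:ℝ) := ⟨⟨contDiff_const, fun _ _ => rfl⟩, fun _ _ => rfl⟩
  have hbs : ∀ k, SmoothH (b k) := fun k => by
    simp only [hb]; split_ifs
    exacts [ha, h0]
  obtain ⟨hc, hd⟩ := contDiff_tailInt (T := P.T) hα.1
  have h1 := S.sol.momentum (fun p k => tailInt P.T α p.1 * b k p.2)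
    (fun k => testInitial_time_mul hα (hbs k).1) fun k p _ => by
      rw [pd_time_mul hc (hbs k).1, (hbs k).sd_two, mul_zero]
  have e1 : ∫ x in Om P.h, ∑ k : Fin 2, ξ₀ x * u₀ x k * (tailInt P.T α 0 * b k x) =
      tailInt P.T α 0 * ∫ x, ξ₀ x * u₀ x i * a x ∂(mO P.h) := by
    rw [← integral_const_mul]
    refine integral_congr_ae (Eventually.of_forall fun x => ?_)
    simp only [Fin.sum_univ_two, hb]
    fin_cases i <;> simp <;> ring
  refine Eq.trans ?_ (h1.trans e1)
  refine integral_congr_ae ?_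
  filter_upwards [S.momentumForm_eq hα hbs, S.rest_zero 0, S.rest_zero 1] with p h2 h3 h4
  rw [h2]
  simp only [hb]
  fin_cases i
  · simp [h4]
  · simp [h3]

/-- The momentum equation tested by the gradient of `ln ξ`. -/
lemma momentum_log (S : Sol P R ξ₀ u₀ ξ u) (k : Fin 2) :
    ∃ e, LineAC P.T (sl P.h fun p => ξ p * u p k * S.fields.q k p)
      (sl P.h fun p => ξ p * u p k * S.fields.dg R.ε k p + -rest P R ξ u k (S.fields.q k) p)
      (∫ x, ξ₀ x * u₀ x k * sd (hor k) (lnf ξ₀) x ∂(mO P.h)) e := by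
  have hm : MemLp (fun p => ξ p * u p k) 2 (mQ P.T P.h) :=
    (S.vel k 0).left.mul' (S.sob.memLp_top (by norm_num))
  have zg : IsWeakDeriv P.T P.h 2 (S.fields.g R.ε) fun _ => 0 := by
    have w0 : ∀ {f : Pt → ℝ}, IsWeakDeriv P.T P.h 2 f (fun _ => 0) → W P.T P.h 1 2 f fun _ => 0 :=
      fun hf => ⟨memLp_one_iff_integrable.2 hf.1, memLp_const 0, hf⟩
    have wq : ∀ j, W P.T P.h ⊤ 2 (S.fields.q j) fun _ => 0 := fun j =>
      ⟨(S.fields.hq 0 j).left, memLp_const 0, S.fields.zq j⟩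
    have wn : W P.T P.h 1 2 S.fields.nq fun _ => 0 := by
      have := ((((wq 0).mul (r := ⊤) le_top (wq 0)).add le_top
        ((wq 1).mul (r := ⊤) le_top (wq 1))).mono (q := 1) le_top)
      refine this.congr (Eventually.of_forall fun p => ?_) (Eventually.of_forall fun p => ?_)
      · simp only [Fields.nq]; ring
      · simp
    have wt := (w0 (S.fields.zH 0 0)).add le_rfl (w0 (S.fields.zH 1 1))
    have wc := w0 (vertical_avg (S.fields.c_memLp.integrable one_le_two))
    have w := ((((wn.add le_rfl wt).const_mul le_rfl R.ε).sub le_rfl wc)).weak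
    simp only [mul_zero, add_zero, sub_zero] at w
    exact w
  refine (S.coeff k).extend (i := k) hm (S.memLp_init k) (fun a ha => S.momentum_smooth k ha)
    ((S.sob_log.deriv k)) (S.fields.zq k) ?_ (S.fields.w_g R.ε k).right (S.smooth_log.sd k) (S.td_q k)
  exact (S.fields.w_g R.ε k).weak.vertical_zero zg

end Sol

section
variable {T h : ℝ} [hT : Fact (0 < T)] [hh : Fact (0 < h)]

lemma integral_Q_eq_sl {t : ℝ} (ht : t ∈ Icc 0 T) {g : Pt → ℝ} (hg : Integrable g (mQ T h)) :
    ∫ p in Q t h, g p = ∫ τ in (0:ℝ)..t, sl h g τ := by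
  have hi : Integrable (fun p : Pt => (Iio t).indicator (fun _ => (1:ℝ)) p.1 * g p) (mQ T h) := by
    refine hg.bdd_mul (c := 1) ((indicator_bdd t).1.comp measurable_fst).aestronglyMeasurable
      (Eventually.of_forall fun p => ?_)
    by_cases hp : p.1 < t <;> simp [indicator, hp]
  rw [integral_Q_eq ht.2, ← integral_sl hi, intervalIntegral.integral_of_le ht.1,
    integral_Ioc_eq_integral_Ioo]
  have e : sl h (fun p : Pt => (Iio t).indicator (fun _ => (1:ℝ)) p.1 * g p) =
      (Iio t).indicator (sl h g) := by
    ext s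
    rw [sl_time_mul]
    by_cases hs : s < t <;> simp [indicator, hs]
  rw [e, integral_indicator measurableSet_Iio, Measure.restrict_restrict measurableSet_Iio]
  congr 2
  ext s
  simp only [mem_inter_iff, mem_Iio, mem_Ioo]
  constructor
  · rintro ⟨a, b, c⟩; exact ⟨b, a⟩
  · rintro ⟨a, b⟩; exact ⟨b, a, b.trans_le ht.2⟩

/-- The integral of `f` over the time slices evolves by the integral of `g`, from the value `c`. -/
structure Ev (T h : ℝ) (f g : Pt → ℝ) (c : ℝ) : Prop where
  left : Integrable f (mQ T h)
  right : Integrable g (mQ T h)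
  line : ∃ e, LineAC T (sl h f) (sl h g) c e

namespace Ev
variable {f g f' g' : Pt → ℝ} {c c' : ℝ}

lemma add (H : Ev T h f g c) (H' : Ev T h f' g' c') :
    Ev T h (fun p => f p + f' p) (fun p => g p + g' p) (c + c') := by
  obtain ⟨e, he⟩ := H.line
  obtain ⟨e', he'⟩ := H'.line
  exact ⟨H.left.add H'.left, H.right.add H'.right, e + e',
    (he.add hT.out he').congr (sl_add H.left H'.left) (sl_add H.right H'.right) hT.out⟩

lemma const_mul (a : ℝ) (H : Ev T h f g c) :
    Ev T h (fun p => a * f p) (fun p => a * g p) (a * c) := by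
  obtain ⟨e, he⟩ := H.line
  refine ⟨H.left.const_mul a, H.right.const_mul a, a * e, (he.const_mul hT.out a).congr ?_ ?_ hT.out⟩ <;>
    exact Eventually.of_forall fun t => integral_const_mul _ _

lemma congr_right (H : Ev T h f g c) (N : Null T h fun p => g p - g' p) : Ev T h f g' c := by
  have hi : Integrable g' (mQ T h) := (H.right.sub N.int).congr
    (Eventually.of_forall fun p => by simp only [Pi.sub_apply]; ring)
  obtain ⟨e, he⟩ := H.line
  refine ⟨H.left, hi, e, he.congr (ae_eq_refl _) ?_ hT.out⟩
  filter_upwards [N.zero, sl_sub H.right hi] with t h1 h2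
  have : sl h (fun p => g p - g' p) t = _ := h2
  rw [h1] at this
  linarith

lemma integral (H : Ev T h f g c) : ∀ᵐ t ∂(mT T), sl h f t = c + ∫ p in Q t h, g p := by
  obtain ⟨e, he⟩ := H.line
  filter_upwards [he.2.1, ae_restrict_mem measurableSet_Ioo] with t h1 h2
  rw [h1, integral_Q_eq_sl (Ioo_subset_Icc_self h2) H.right]

end Ev

lemma TD.ev {f g : Pt → ℝ} {f₀ : (Fin 3 → ℝ) → ℝ} (H : TD T h f g f₀) :
    Ev T h f g (∫ x, f₀ x ∂(mO h)) := ⟨H.left, H.right, H.slice⟩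

end

namespace Sol
variable {P : Fixed} {R : Reg} {ξ₀ : (Fin 3 → ℝ) → ℝ} {u₀ : (Fin 3 → ℝ) → Fin 2 → ℝ}
  {ξ : Pt → ℝ} {u : Pt → Fin 2 → ℝ}

lemma wd_sqrt (S : Sol P R ξ₀ u₀ ξ u) (j : Fin 2) : W P.T P.h ⊤ (hor j) (sq' ξ)
    fun p => 1 / 2 * (sq' ξ p * S.fields.q j p) := by
  have h1 := S.comp_top (F := Real.sqrt) (F' := fun x => 1 / (2 * Real.sqrt x))
    (fun x hx => Real.hasDerivAt_sqrt (ne_of_gt hx))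
    (ContinuousOn.div continuousOn_const (by fun_prop) fun x hx => by
      have : 0 < Real.sqrt x := Real.sqrt_pos.2 hx
      positivity) j
  refine h1.congr (ae_eq_refl _) ?_
  filter_upwards [S.pos] with p hp
  have h2 : 0 < Real.sqrt (ξ p) := Real.sqrt_pos.2 hp
  have h3 := Real.mul_self_sqrt hp.le
  simp only [sq']
  change _ = 1 / (2 * Real.sqrt (ξ p)) * (ξ p * S.fields.q j p)
  nth_rewrite 3 [← h3]
  field_simp

lemma lapH_sqrt (S : Sol P R ξ₀ u₀ ξ u) : lapH (wd P.T P.h) (sq' ξ) =ᵐ[mQ P.T P.h]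
    fun p => sq' ξ p * (1 / 2 * S.fields.tr p + 1 / 4 * S.fields.nq p) := by
  have h1 : ∀ j : Fin 2, wd P.T P.h (hor j) (wd P.T P.h (hor j) (sq' ξ)) =ᵐ[mQ P.T P.h] fun p =>
      1 / 2 * (1 / 2 * (sq' ξ p * S.fields.q j p) * S.fields.q j p + sq' ξ p * S.fields.H j j p) :=
    fun j => (wd_congr (S.wd_sqrt j).wd_eq).trans
      (((S.wd_sqrt j).mul (r := ⊤) le_top (S.fields.hq j j)).const_mul le_top (1 / 2)).wd_eq
  filter_upwards [h1 0, h1 1] with p h1 h2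
  simp only [lapH, Fin.sum_univ_two, h1, h2, Fields.tr, Fields.nq]
  ring

/-- `Δ³ ξ` -/
abbrev L3 (P : Fixed) (ξ : Pt → ℝ) : Pt → ℝ := lapH (wd P.T P.h) (lapH (wd P.T P.h) (lapH (wd P.T P.h) ξ))

lemma lapH_flux (S : Sol P R ξ₀ u₀ ξ u) : (fun p =>
    lapH (wd P.T P.h) (lapH (wd P.T P.h) (wd P.T P.h (hor 0) fun q => ξ q * S.fields.q 0 q)) p +
    lapH (wd P.T P.h) (lapH (wd P.T P.h) (wd P.T P.h (hor 1) fun q => ξ q * S.fields.q 1 q)) p)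
      =ᵐ[mQ P.T P.h] L3 P ξ := by
  have t4 := (TLin.lapH (T := P.T) (h := P.h)).comp TLin.lapH
  have e : ∀ j, wd P.T P.h (hor j) (fun q => ξ q * S.fields.q j q) =ᵐ[mQ P.T P.h]
      wd P.T P.h (hor j) (wd P.T P.h (hor j) ξ) := fun j => wd_congr (S.wd_ξ j).symm
  have s : ∀ j, Sob P.T P.h 0 4 (wd P.T P.h (hor j) (wd P.T P.h (hor j) ξ)) := fun j =>
    ((S.sob.deriv j).deriv j).mono (by norm_num) le_rfl
  have el : lapH (wd P.T P.h) ξ = fun p => wd P.T P.h (hor 0) (wd P.T P.h (hor 0) ξ) p +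
      wd P.T P.h (hor 1) (wd P.T P.h (hor 1) ξ) p := by
    ext p; simp only [lapH, Fin.sum_univ_two]
  filter_upwards [t4.congr (e 0), t4.congr (e 1), t4.add (s 0) (s 1)] with p h0 h1 h2
  rw [h0, h1, L3, el, h2]

/-- The terms of the momentum equation tested by the gradient of `ln ξ`. -/
def restSum (S : Sol P R ξ₀ u₀ ξ u) : Pt → ℝ := fun p =>
  R.r₀ * S.fields.uq p + P.r * (ξ p * (len (u p) * S.fields.uq p)) +
  R.ε * (ξ p * (S.fields.q 0 p * S.fields.q 0 p * S.fields.U 0 0 p +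
    S.fields.q 0 p * S.fields.q 1 p * (S.fields.U 0 1 p + S.fields.U 1 0 p) +
    S.fields.q 1 p * S.fields.q 1 p * S.fields.U 1 1 p)) -
  ξ p * (u p 0 * u p 0 * S.fields.H 0 0 p + u p 0 * u p 1 * S.fields.H 0 1 p +
    (u p 1 * u p 0 * S.fields.H 1 0 p + u p 1 * u p 1 * S.fields.H 1 1 p)) +
  2 * P.ν₁ * (ξ p * (S.fields.U 0 0 p * S.fields.H 0 0 p + S.fields.U 0 1 p * S.fields.H 0 1 p +
    (S.fields.U 1 0 p * S.fields.H 1 0 p + S.fields.U 1 1 p * S.fields.H 1 1 p))) -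
  ξ p * S.fields.tr p + R.η * (ξ p ^ (-10 : ℤ) * S.fields.tr p) +
  R.κ * (ξ p * (1 / 2 * S.fields.tr p + 1 / 4 * S.fields.nq p) * (S.fields.nq p + S.fields.tr p)) +
  R.μ * (lap (wd P.T P.h) (fun q => u q 0) p * lapH (wd P.T P.h) (S.fields.q 0) p +
    lap (wd P.T P.h) (fun q => u q 1) p * lapH (wd P.T P.h) (S.fields.q 1) p) +
  R.δ * L3 P ξ p ^ 2

lemma rest_sum (S : Sol P R ξ₀ u₀ ξ u) : (fun p => rest P R ξ u 0 (S.fields.q 0) p +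
    rest P R ξ u 1 (S.fields.q 1) p) =ᵐ[mQ P.T P.h] S.restSum := by
  filter_upwards [S.lapH_flux, S.lapH_sqrt, (S.wd_sqrt 0).wd_eq, (S.wd_sqrt 1).wd_eq, S.wd_ξ 0, S.wd_ξ 1,
    S.pos, S.fields.symH] with p h1 h2 h3 h4 h5 h6 h7 h8
  have hs := Real.mul_self_sqrt h7.le
  set s := Real.sqrt (ξ p) with hsd
  have e1 : sq' ξ p = s := rfl
  have hH : ∀ i j, wd P.T P.h (hor i) (S.fields.q j) p = S.fields.H i j p := fun _ _ => rfl
  have hq : ∀ j, wd P.T P.h (hor j) (lnf ξ) p = S.fields.q j p := fun _ => rfl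
  have hU : ∀ i j : Fin 2, wd P.T P.h (hor j) (fun q => u q i) p = S.fields.U i j p := fun _ _ => rfl
  simp only [rest, momRest, coA, coB, coL, coZ, coS, symGrad, h2, h3, h4, h5, h6, e1, hH, hq, hU,
    if_true, one_mul, Fin.zero_eq_one_iff, Fin.one_eq_zero_iff, OfNat.ofNat_ne_one, if_false, zero_mul,
    add_zero, restSum, Fields.uq]
  change _ = R.r₀ * (u p 0 * _ + u p 1 * _) + P.r * (ξ p * (len (u p) * (u p 0 * _ + u p 1 * _))) +
    _ - _ + _ - _ + _ + _ + _ + _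
  generalize ξ p ^ (-10 : ℤ) = e
  rw [h8, ← hs, Fields.nq, Fields.tr]
  linear_combination R.δ * L3 P ξ p * h1

/-- The Bresch-Desjardins density without the kinetic energy. -/
def cross (S : Sol P R ξ₀ u₀ ξ u) : Pt → ℝ := fun p =>
  2 * P.ν₁ * (ξ p * u p 0 * S.fields.q 0 p + ξ p * u p 1 * S.fields.q 1 p) +
    2 * P.ν₁ ^ 2 * (ξ p * S.fields.nq p) + -2 * P.ν₁ * R.r₀ * lnf ξ p

/-- The initial value of the Bresch-Desjardins functional without the kinetic energy. -/
def crossInit (P : Fixed) (R : Reg) (ξ₀ : (Fin 3 → ℝ) → ℝ) (u₀ : (Fin 3 → ℝ) → Fin 2 → ℝ) : ℝ :=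
  2 * P.ν₁ * ((∫ x, ξ₀ x * u₀ x 0 * sd (hor 0) (lnf ξ₀) x ∂(mO P.h)) +
      ∫ x, ξ₀ x * u₀ x 1 * sd (hor 1) (lnf ξ₀) x ∂(mO P.h)) +
    2 * P.ν₁ ^ 2 * (∫ x, ξ₀ x * (sd (hor 0) (lnf ξ₀) x * sd (hor 0) (lnf ξ₀) x +
      sd (hor 1) (lnf ξ₀) x * sd (hor 1) (lnf ξ₀) x) ∂(mO P.h)) +
    -2 * P.ν₁ * R.r₀ * ∫ x, lnf ξ₀ x ∂(mO P.h)

/-- The part of the dissipation that is not contained in the energy inequality. -/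
def diss (S : Sol P R ξ₀ u₀ ξ u) : Pt → ℝ := fun p =>
  2 * P.ν₁ * (ξ p * (S.fields.c p - S.fields.cb p) ^ 2) +
    P.ν₁ * (ξ p * (S.fields.U 0 1 p - S.fields.U 1 0 p) ^ 2) +
    2 * P.ν₁ * (ξ p * S.fields.nq p) + 20 * P.ν₁ * R.η * (ξ p ^ (-10 : ℤ) * S.fields.nq p) +
    P.ν₁ * R.κ * (ξ p * (S.fields.H 0 0 p ^ 2 + S.fields.H 0 1 p ^ 2 +
      (S.fields.H 1 0 p ^ 2 + S.fields.H 1 1 p ^ 2))) +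
    2 * P.ν₁ * R.δ * L3 P ξ p ^ 2 + 2 * P.ν₁ * R.r₀ * R.ε * S.fields.nq p

/-- `|Dₓ(u)|²` -/
def strain (S : Sol P R ξ₀ u₀ ξ u) : Pt → ℝ := fun p =>
  S.fields.U 0 0 p ^ 2 + 1 / 2 * (S.fields.U 0 1 p + S.fields.U 1 0 p) ^ 2 + S.fields.U 1 1 p ^ 2

/-- The terms that are small with the regularization parameters. -/
def err (S : Sol P R ξ₀ u₀ ξ u) : Pt → ℝ := fun p =>
  -2 * P.ν₁ * R.ε * (ξ p * (S.fields.nq p + S.fields.tr p) * S.fields.c p) -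
  2 * P.ν₁ * R.ε * (ξ p * (S.fields.q 0 p * S.fields.q 0 p * S.fields.U 0 0 p +
    S.fields.q 0 p * S.fields.q 1 p * (S.fields.U 0 1 p + S.fields.U 1 0 p) +
    S.fields.q 1 p * S.fields.q 1 p * S.fields.U 1 1 p)) -
  4 * P.ν₁ ^ 2 * R.ε * (ξ p * (S.fields.nq p + S.fields.tr p) *
    (1 / 2 * S.fields.nq p + S.fields.tr p)) -
  2 * P.ν₁ * R.μ * (lap (wd P.T P.h) (fun q => u q 0) p * lapH (wd P.T P.h) (S.fields.q 0) p +
    lap (wd P.T P.h) (fun q => u q 1) p * lapH (wd P.T P.h) (S.fields.q 1) p) -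
  2 * P.ν₁ * P.r * (ξ p * (len (u p) - S.fields.ρ R.ε p) * S.fields.uq p - ξ p * S.fields.dρ R.ε p)

lemma cross_ev (S : Sol P R ξ₀ u₀ ξ u) : Ev P.T P.h S.cross (fun p =>
    2 * P.ν₁ * ((ξ p * u p 0 * S.fields.dg R.ε 0 p + -rest P R ξ u 0 (S.fields.q 0) p) +
      (ξ p * u p 1 * S.fields.dg R.ε 1 p + -rest P R ξ u 1 (S.fields.q 1) p)) +
    2 * P.ν₁ ^ 2 * (ξ p * S.fields.g R.ε p * S.fields.nq p +
      ξ p * (2 * (S.fields.q 0 p * S.fields.dg R.ε 0 p + S.fields.q 1 p * S.fields.dg R.ε 1 p))) +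
    -2 * P.ν₁ * R.r₀ * S.fields.g R.ε p) (crossInit P R ξ₀ u₀) := by
  have hξ := S.sob.memLp_top (by norm_num)
  have hq : ∀ k, MemLp (S.fields.q k) ⊤ (mQ P.T P.h) := fun k => (S.fields.hq 0 k).left
  have hdg : ∀ k, MemLp (S.fields.dg R.ε k) 2 (mQ P.T P.h) := fun k => (S.fields.w_g R.ε k).right
  have hg : MemLp (S.fields.g R.ε) 2 (mQ P.T P.h) := (S.fields.w_g R.ε 0).left
  have hξu : ∀ k, MemLp (fun p => ξ p * u p k) 2 (mQ P.T P.h) := fun k => (S.vel k 0).left.mul' hξ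
  have m : ∀ k, Ev P.T P.h (fun p => ξ p * u p k * S.fields.q k p)
      (fun p => ξ p * u p k * S.fields.dg R.ε k p + -rest P R ξ u k (S.fields.q k) p)
      (∫ x, ξ₀ x * u₀ x k * sd (hor k) (lnf ξ₀) x ∂(mO P.h)) := fun k =>
    ⟨((hξu k).integrable one_le_two).mul_of_top_left (hq k),
      ((hξu k).integrable_mul (hdg k)).add ((S.coeff k).conv (i := k) (F := fun _ => S.fields.q k)
        (S.sob_log.deriv k)).lim.neg, S.momentum_log k⟩
  have hq0 : ∀ k, MemLp (sd (hor k) (lnf ξ₀)) ⊤ (mO P.h) := fun k => (S.smooth_log.1.sd _).memLp_mO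
  have tq : ∀ k, TD P.T P.h (fun p => S.fields.q k p * S.fields.q k p) _ _ := fun k =>
    (S.td_q k).mul (S.td_q k) (((hq k).mul' (r := ⊤) (hq k)).integrable le_top)
      ((((hdg k).integrable one_le_two).mul_of_top_left (hq k)).add
        (((hdg k).integrable one_le_two).mul_of_top_right (hq k)))
      (((hq0 k).mul' (r := ⊤) (hq0 k)).integrable le_top)
  have hnq : MemLp (fun p => S.fields.q 0 p * S.fields.q 0 p + S.fields.q 1 p * S.fields.q 1 p) ⊤
      (mQ P.T P.h) := ((hq 0).mul' (r := ⊤) (hq 0)).add ((hq 1).mul' (r := ⊤) (hq 1))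
  have tn := S.td_ξ.mul ((tq 0).add (tq 1)) ((hnq.mul' (r := ⊤) hξ).integrable le_top)
    (((((hg.integrable one_le_two).mul_of_top_right hξ)).mul_of_top_left hnq).add
      (((tq 0).add (tq 1)).right.mul_of_top_right hξ))
    (((((hq0 0).mul' (r := ⊤) (hq0 0)).add ((hq0 1).mul' (r := ⊤) (hq0 1))).mul' (r := ⊤)
      S.smooth_init.1.memLp_mO).integrable le_top)
  have key := ((((m 0).add (m 1)).const_mul (2 * P.ν₁)).add (tn.ev.const_mul (2 * P.ν₁ ^ 2))).add
    (S.td_log.ev.const_mul (-2 * P.ν₁ * R.r₀))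
  refine cast (congrArg₂ (fun a b => Ev P.T P.h a b _) ?_ ?_) key
  · ext p; simp only [cross, Fields.nq]; ring
  · ext p; simp only [Fields.nq]; ring

/-- The evolution of the Bresch-Desjardins functional without the kinetic energy. -/
lemma cross_balance (S : Sol P R ξ₀ u₀ ξ u) : Ev P.T P.h S.cross
    (fun p => 2 * P.ν₁ * (ξ p * S.strain p) - S.diss p + S.err p) (crossInit P R ξ₀ u₀) := by
  set F := S.fields with hF
  refine S.cross_ev.congr_right ?_
  have hξ := S.sob.memLp_top (b := 4) (by norm_num)
  have mtr := (F.w_tr 0).left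
  have mnq := (F.w_nq 0).left
  have zn : IsWeakDeriv P.T P.h 2 (fun p => F.ξ p * (1 / 2 * F.nq p + F.tr p)) fun _ => 0 := by
    have wξ : W P.T P.h ⊤ 2 F.ξ fun _ => 0 := ⟨hξ, memLp_const 0, F.zξ⟩
    have wq : ∀ j, W P.T P.h ⊤ 2 (F.q j) fun _ => 0 := fun j => ⟨(F.hq 0 j).left, memLp_const 0, F.zq j⟩
    have wH : ∀ i j, W P.T P.h ⊤ 2 (F.H i j) fun _ => 0 := fun i j =>
      ⟨(F.hH 0 i j).left, memLp_const 0, F.zH i j⟩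
    have := wξ.mul (r := ⊤) le_top (((((wq 0).mul (r := ⊤) le_top (wq 0)).add le_top
      ((wq 1).mul (r := ⊤) le_top (wq 1))).const_mul le_top (1 / 2)).add le_top
      ((wH 0 0).add le_top (wH 1 1)))
    refine (this.congr (Eventually.of_forall fun p => ?_) (Eventually.of_forall fun p => ?_)).weak
    · simp only [Fields.nq, Fields.tr]; ring
    · simp
  have hcb : MemLp (fun p => F.ξ p * F.cb p) 2 (mQ P.T P.h) := F.cb_memLp.mul' hξ
  have zcb : IsWeakDeriv P.T P.h 2 (fun p => F.ξ p * F.cb p) fun _ => 0 := by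
    have wξ : W P.T P.h ⊤ 2 F.ξ fun _ => 0 := ⟨hξ, memLp_const 0, F.zξ⟩
    have wc : W P.T P.h 2 2 F.cb fun _ => 0 :=
      ⟨F.cb_memLp, memLp_const 0, vertical_avg (F.c_memLp.integrable one_le_two)⟩
    simpa using (wξ.mul (r := 2) one_le_two wc).weak
  have mn : MemLp (fun p => F.ξ p * (1 / 2 * F.nq p + F.tr p)) 2 (mQ P.T P.h) :=
    MemLp.mono_exponent (((mnq.const_mul (1 / 2)).add mtr).mul' (r := ⊤) hξ) le_top
  have z1 : IsWeakDeriv P.T P.h 2 (fun _ => (1:ℝ)) fun _ => 0 := (W.const 1 le_top).weak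
  have n1 := (F.null_convection R.ε).const_mul (2 * P.ν₁)
  have n2 := F.null_stress.const_mul (2 * P.ν₁)
  have n3 := F.null_drift.const_mul (4 * P.ν₁ ^ 2)
  have n4 := (F.null_evolution R.ε).const_mul (4 * P.ν₁ ^ 2)
  have n5 := F.null_pressure.const_mul (2 * P.ν₁)
  have n6 := F.null_cold.const_mul (-2 * P.ν₁ * R.η)
  have n7 := F.null_capillarity.const_mul (-2 * P.ν₁ * R.κ)
  have n8 := F.null_tr.const_mul (-2 * P.ν₁ * R.r₀ * R.ε)
  have n9 := F.null_div.const_mul (2 * P.ν₁ * R.r₀)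
  have n10 := (F.null_mean hcb zcb).const_mul (2 * P.ν₁)
  have n11 := (F.null_mean mn zn).const_mul (4 * P.ν₁ ^ 2)
  have n12 := (F.null_mean (memLp_const 1) z1).const_mul (2 * P.ν₁ * R.r₀)
  have n13 := (F.null_damping R.ε_pos).const_mul (-2 * P.ν₁ * P.r)
  refine (((((((((((((n1.add n2).add n3).add n4).add n5).add n6).add n7).add n8).add n9).add n10).add
    n11).add n12).add n13)).congr ?_
  filter_upwards [S.rest_sum, F.symH] with p h1 h2
  have e1 : F.ξ p = ξ p := rfl
  have e2 : F.e p = ξ p ^ (-10 : ℤ) := rfl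
  have e3 : ∀ i, F.u i p = u p i := fun _ => rfl
  simp only [restSum, ← hF] at h1
  simp only [diss, err, strain, ← hF, e1, e2, e3, Fields.uq, Fields.c, Fields.g, h2] at h1 ⊢
  generalize ξ p ^ (-10 : ℤ) = e at *
  linear_combination (2 * P.ν₁) * h1

end Sol

lemma Line.op_add {X : Type} [MeasurableSpace X] {m : Measure X} {ℓ : Line m} [IsFiniteMeasure m]
    {k : ℝ → ℝ → ℝ} {f g : X → ℝ} (hk : Ker k) (hf : Integrable f m) (hg : Integrable g m) :
    ℓ.op k (fun p => f p + g p) =ᵐ[m] fun p => ℓ.op k f p + ℓ.op k g p := by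
  filter_upwards [ae_integrable_ker (ℓ := ℓ) hk hf, ae_integrable_ker (ℓ := ℓ) hk hg] with p h1 h2
  simp only [op, mul_add]
  exact integral_add (h1 _) (h2 _)

section
variable {T h : ℝ} [hT : Fact (0 < T)] [hh : Fact (0 < h)]

/-- The vertical primitive. -/
abbrev prim (T h : ℝ) [Fact (0 < T)] [Fact (0 < h)] : (Pt → ℝ) → Pt → ℝ := (qLine T h 2).op Line.primKer

lemma W.prim {f : Pt → ℝ} (hf : Integrable f (mQ T h)) : W T h 1 2 (prim T h f) f := by
  refine W.of_ac le_rfl (memLp_one_iff_integrable.2 (Line.integrable_op Line.ker_prim hf))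
    (memLp_one_iff_integrable.2 hf) ?_
  filter_upwards [Line.ae_integrable_line (ℓ := qLine T h 2) hf] with p hp
  refine ⟨0, _, fun hi => absurd rfl hi, hp, ?_, rfl⟩
  filter_upwards [ae_restrict_mem measurableSet_Ioo] with s hs
  rw [CPE.prim, Line.op_up, Line.prim_integral (α := fun τ => f ((qLine T h 2).up p τ))
    (Ioo_subset_Icc_self hs), zero_add]

lemma Fields.prim_c (F : Fields T h) : prim T h F.c =ᵐ[mQ T h] fun p =>
    prim T h (F.U 0 0) p + prim T h (F.U 1 1) p +
      (F.q 0 p * prim T h (F.u 0) p + F.q 1 p * prim T h (F.u 1) p) := by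
  have i0 := (F.hu 0 0).right.integrable one_le_two
  have i1 := (F.hu 1 1).right.integrable one_le_two
  have iq : ∀ j, Integrable (fun p => F.q j p * F.u j p) (mQ T h) := fun j =>
    ((F.hu j j).left.mul' (r := 2) (F.hq j j).left).integrable one_le_two
  have e : F.c = fun p => (F.U 0 0 p + F.U 1 1 p) + (F.q 0 p * F.u 0 p + F.q 1 p * F.u 1 p) := by
    ext p; simp only [Fields.c, Fields.uq]; ring
  have k := Line.ker_prim
  filter_upwards [Line.op_add (ℓ := qLine T h 2) k (i0.add i1) ((iq 0).add (iq 1)),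
    Line.op_add (ℓ := qLine T h 2) k i0 i1, Line.op_add (ℓ := qLine T h 2) k (iq 0) (iq 1),
    prim_mul_of_vertical (f := F.u 0) (F.zq 0), prim_mul_of_vertical (f := F.u 1) (F.zq 1)]
    with p h1 h2 h3 h4 h5
  rw [e]
  refine h1.trans ?_
  refine congrArg₂ (· + ·) h2 (h3.trans ?_)
  rw [h4, h5]

lemma Fields.w_ξ_op (F : Fields T h) {k : ℝ → ℝ → ℝ} (hk : Line.Ker k) (j : Fin 2) :
    W T h 1 (hor j) (fun p => F.ξ p * (qLine T h 2).op k (F.u j) p) fun p =>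
      F.ξ p * F.q j p * (qLine T h 2).op k (F.u j) p + F.ξ p * (qLine T h 2).op k (F.U j j) p :=
  (F.hξ j).mul (r := 1) le_rfl (((F.hu j j).mono one_le_two).op (indep_qLine (hor_ne j)) hk le_rfl
    (memLp_one_iff_integrable.2 (Line.integrable_op hk ((F.hu j j).left.integrable one_le_two)))
    (memLp_one_iff_integrable.2 (Line.integrable_op hk ((F.hu j j).right.integrable one_le_two))))

lemma W.height : W T h ⊤ 2 (fun p : Pt => p.2 2) fun _ => 1 := by
  have hs : SmoothPer fun p : Pt => p.2 2 := by
    refine ⟨(contDiff_apply ℝ ℝ 2).comp contDiff_snd, fun t j x => ?_⟩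
    simp [Pi.single_eq_of_ne' (hor_ne j)]
  refine (W.of_smooth hs).congr (ae_eq_refl _) (Eventually.of_forall fun p => ?_)
  have : HasFDerivAt (fun p : Pt => p.2 2) ((ContinuousLinearMap.proj (R := ℝ) (φ := fun _ : Fin 3 => ℝ) 2).comp
      (ContinuousLinearMap.snd ℝ ℝ (Fin 3 → ℝ))) p :=
    ((ContinuousLinearMap.proj (R := ℝ) (φ := fun _ : Fin 3 => ℝ) 2).comp
      (ContinuousLinearMap.snd ℝ ℝ (Fin 3 → ℝ))).hasFDerivAt
  simp [pd, this.fderiv]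

end

namespace Sol
variable {P : Fixed} {R : Reg} {ξ₀ : (Fin 3 → ℝ) → ℝ} {u₀ : (Fin 3 → ℝ) → Fin 2 → ℝ}
  {ξ : Pt → ℝ} {u : Pt → Fin 2 → ℝ}

lemma vert_eq (S : Sol P R ξ₀ u₀ ξ u) : vert P.T P.h ξ u =ᵐ[mQ P.T P.h]
    fun p => -prim P.T P.h S.fields.c p + p.2 2 * S.fields.cb p := by
  have h1 : ∀ j, wd P.T P.h (hor j) (fun q => ξ q * utilde u q j) =ᵐ[mQ P.T P.h] _ := fun j =>
    (wd_congr (by filter_upwards [utilde_eq (T := P.T) (h := P.h) u j] with p hp; rw [hp]; rfl)).trans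
      (S.fields.w_ξ_op Line.ker_prim j).wd_eq
  have h2 : ∀ j, wd P.T P.h (hor j) (fun q => ξ q * ubar P.h u q j) =ᵐ[mQ P.T P.h] _ := fun j =>
    (wd_congr (Eventually.of_forall fun p => by
      rw [ubar_eq (T := P.T)]; rfl)).trans (S.fields.w_ξ_op (ker_avg (qLine P.T P.h 2)) j).wd_eq
  filter_upwards [h1 0, h1 1, h2 0, h2 1, S.fields.prim_c, S.fields.cb_eq, S.pos]
    with p a b c d e f hp
  simp only [vert, divH, Fin.sum_univ_two, a, b, c, d]
  rw [e, f]
  change -(ξ p * _ * _ + ξ p * _ + (ξ p * _ * _ + ξ p * _)) / ξ p + p.2 2 * ((ξ p * _ * _ + ξ p * _ +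
    (ξ p * _ * _ + ξ p * _)) / ξ p) = _
  field_simp
  ring

/-- The vertical derivative of the vertical velocity. -/
lemma wd_vert (S : Sol P R ξ₀ u₀ ξ u) : wd P.T P.h 2 (vert P.T P.h ξ u) =ᵐ[mQ P.T P.h]
    fun p => -S.fields.c p + S.fields.cb p := by
  have wc : W P.T P.h 1 2 S.fields.cb fun _ => 0 :=
    ⟨S.fields.cb_memLp.mono_exponent one_le_two, memLp_const 0,
      vertical_avg (S.fields.c_memLp.integrable one_le_two)⟩
  have w := ((W.prim (S.fields.c_memLp.integrable one_le_two)).neg le_rfl).add le_rfl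
    (W.height.mul (r := 1) le_rfl wc)
  refine ((wd_congr S.vert_eq).trans w.wd_eq).trans (Eventually.of_forall fun p => ?_)
  simp

end Sol

namespace Line
variable {X : Type} [MeasurableSpace X] {m : Measure X} {ℓ : Line m} [IsFiniteMeasure m] {f g F : X → ℝ}

lemma avg_nonneg (hg : ∀ p, 0 ≤ g p) (p : X) : 0 ≤ ℓ.avg g p := by
  have := ℓ.L_pos
  exact integral_nonneg fun s => mul_nonneg (by simp only [meanKer]; positivity) (hg _)

/-- In products with functions that are constant along the lines, a function may be replaced by
its mean. -/
lemma integrable_mul_of_avg (hF : AEStronglyMeasurable F m) (hc : ∀ p s, F (ℓ.up p s) = F p)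
    (hg : Integrable g m) (hg0 : ∀ p, 0 ≤ g p) (hi : Integrable (fun p => F p * ℓ.avg g p) m) :
    Integrable (fun p => F p * g p) m := by
  have hL := ℓ.L_pos
  refine ⟨hF.mul hg.1, ?_⟩
  have h1 := lintegral_prod_line (ℓ := ℓ) (F := fun p => ‖F p * g p‖ₑ) (hF.mul hg.1).enorm
  have h2 : ∫⁻ p, ∫⁻ s, ‖F (ℓ.up p s) * g (ℓ.up p s)‖ₑ ∂ℓ.lam ∂m =
      ∫⁻ p, ENNReal.ofReal ℓ.L * ‖F p * ℓ.avg g p‖ₑ ∂m := by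
    refine lintegral_congr_ae ?_
    filter_upwards [ae_integrable_line (ℓ := ℓ) hg] with p hp
    simp only [hc, enorm_mul]
    rw [lintegral_const_mul'' _ hp.1.enorm, mul_left_comm]
    congr 1
    have e : ℓ.avg g p = 1 / ℓ.L * ∫ s, g (ℓ.up p s) ∂ℓ.lam := by
      simp only [avg, op, meanKer, integral_const_mul]
    rw [Real.enorm_of_nonneg (avg_nonneg hg0 p), ← ENNReal.ofReal_mul hL.le, e, ← mul_assoc,
      mul_one_div_cancel hL.ne', one_mul, ofReal_integral_eq_lintegral_ofReal hp
        (Eventually.of_forall fun s => hg0 _)]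
    exact lintegral_congr fun s => Real.enorm_of_nonneg (hg0 _)
  rw [h2, lintegral_const_mul' _ _ ENNReal.ofReal_ne_top] at h1
  have h3 : ENNReal.ofReal ℓ.L ≠ 0 := by simpa using hL
  have h4 := (ENNReal.mul_right_inj h3 ENNReal.ofReal_ne_top).1 h1
  rw [HasFiniteIntegral, ← h4]
  exact hi.2

end Line

section
variable {T h : ℝ} [hT : Fact (0 < T)] [hh : Fact (0 < h)]

lemma MemLp.of_time {s : ℝ → ℝ} (hs : Integrable s (mT T)) (h0 : ∀ t, 0 ≤ s t) :
    MemLp (fun p : Pt => Real.sqrt (1 + s p.1)) 2 (mQ T h) := by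
  have h1 : Integrable (fun p : Pt => 1 + s p.1) (mQ T h) := by
    rw [mQ_eq]; exact (integrable_const _).add (hs.comp_fst _)
  refine (memLp_two_iff_integrable_sq (Real.continuous_sqrt.comp_aestronglyMeasurable h1.1)).2
    (h1.congr (Eventually.of_forall fun p => ?_))
  exact (Real.sq_sqrt (add_nonneg one_pos.le (h0 _))).symm

/-- Functions that are bounded in `L²` at almost all times and have square integrable second
horizontal and first vertical derivatives are integrable to the power three. -/
theorem integrable_cube {f f₀ f₁ f₀₁ f₂ : Pt → ℝ} (H0 : W T h 2 (hor 0) f f₀)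
    (H1 : W T h 2 (hor 1) f f₁) (H01 : W T h 2 (hor 1) f₀ f₀₁) (H2 : W T h 2 2 f f₂) {B : ℝ}
    (hB : ∀ᵐ t ∂(mT T), sl h (fun p => f p ^ 2) t ≤ B) :
    Integrable (fun p => |f p| ^ 3) (mQ T h) := by
  have hpos := hh.out
  set k : Pt → ℝ := fun q => |f q| + |f₀ q| + (|f₁ q| + |f₀₁ q|) with hk
  have mk : MemLp k 2 (mQ T h) := (H0.left.abs.add H0.right.abs).add (H1.right.abs.add H01.right.abs)
  set N := (qLine T h 0).avg ((qLine T h 1).avg k) with hN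
  have mN : MemLp N 2 (mQ T h) := memLp_avg 0 (memLp_avg 1 mk)
  have c0 : ∀ p s, N ((qLine T h 0).up p s) = N p := fun p s => by
    rw [hN, Line.avg, Line.op_up]; rfl
  have c1 : ∀ p s, N ((qLine T h 1).up p s) = N p := fun p s => by
    simp only [hN, Line.op, Line.meanKer, qLine_up]
    refine integral_congr_ae (Eventually.of_forall fun s' => ?_)
    simp only
    congr 1
    refine integral_congr_ae (Eventually.of_forall fun s'' => ?_)
    simp only
    rw [Function.update_comm (by decide : (1 : Fin 3) ≠ 0), Function.update_idem]
  have le : ∀ᵐ p ∂(mQ T h), |f p| ≤ N p := ae_abs_le_avg_avg (H0.mono one_le_two)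
    (H1.mono one_le_two) (H01.mono one_le_two)
  set g : Pt → ℝ := fun p => f p * f p with hg
  set g₂ : Pt → ℝ := fun p => f₂ p * f p + f p * f₂ p with hg₂
  have wg : W T h 1 2 g g₂ := H2.mul (r := 1) le_rfl H2
  have ig := wg.left.integrable le_rfl
  have ig₂ := wg.right.integrable le_rfl
  have g0 : ∀ p, 0 ≤ g p := fun p => mul_self_nonneg _
  have ia : ∀ (i : Fin 3) {v : Pt → ℝ}, Integrable v (mQ T h) →
      Integrable ((qLine T h i).avg v) (mQ T h) := fun i v hv =>
    Line.integrable_op (ker_avg (qLine T h i)) hv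
  set m := (qLine T h 0).avg ((qLine T h 1).avg g) with hm
  set m₂ := (qLine T h 0).avg ((qLine T h 1).avg g₂) with hm₂
  have wm : W T h 1 2 m m₂ := by
    have w1 := wg.op (indep_qLine (by decide : (2 : Fin 3) ≠ 1)) (ker_avg (qLine T h 1)) le_rfl
      (memLp_one_iff_integrable.2 (ia 1 ig)) (memLp_one_iff_integrable.2 (ia 1 ig₂))
    exact w1.op (indep_qLine (by decide : (2 : Fin 3) ≠ 0)) (ker_avg (qLine T h 0)) le_rfl
      (memLp_one_iff_integrable.2 (ia 0 (ia 1 ig))) (memLp_one_iff_integrable.2 (ia 0 (ia 1 ig₂)))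
  set w : Pt → ℝ := fun p => g p + h * |g₂ p| with hw
  have iw : Integrable w (mQ T h) := ig.add (ig₂.abs.const_mul h)
  have le2 : ∀ᵐ p ∂(mQ T h), |m p| + h * |m₂ p| ≤ (qLine T h 0).avg ((qLine T h 1).avg w) p := by
    have ih := ig₂.abs.const_mul h
    have a1 := Line.avg_add (ℓ := qLine T h 1) ig ih
    have a2 := Line.avg_add (ℓ := qLine T h 0) (ia 1 ig) (ia 1 ih)
    have a3 := Line.avg_mono (ℓ := qLine T h 0) (ia 1 ig₂).abs (ia 1 ig₂.abs)
      (Eventually.of_forall fun p => Line.abs_avg_le p)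
    have cm : ∀ (i : Fin 3) (v : Pt → ℝ), (qLine T h i).avg (fun q => h * v q) =
        fun p => h * (qLine T h i).avg v p := fun i v => by
      ext p
      simp only [Line.op, ← integral_const_mul]
      exact integral_congr_ae (Eventually.of_forall fun s => by simp only; ring)
    filter_upwards [Line.op_congr (ℓ := qLine T h 0) (k := Line.meanKer (qLine T h 0).L) a1, a2, a3]
      with p b1 b2 b3
    have e0 : |m p| = m p := abs_of_nonneg (Line.avg_nonneg (fun q => Line.avg_nonneg g0 q) p)
    have b1' : (qLine T h 0).avg ((qLine T h 1).avg w) p = _ := b1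
    have b2' : _ = (qLine T h 0).avg ((qLine T h 1).avg g) p +
      (qLine T h 0).avg ((qLine T h 1).avg fun q => h * |g₂ q|) p := b2
    rw [b1']
    refine le_of_le_of_eq ?_ b2'.symm
    rw [cm, cm, e0]
    have b4 : |m₂ p| ≤ (qLine T h 0).avg ((qLine T h 1).avg fun q => |g₂ q|) p :=
      (Line.abs_avg_le p).trans b3
    exact add_le_add le_rfl (mul_le_mul_of_nonneg_left b4 hpos.le)
  have le3 : ∀ᵐ p ∂(mQ T h), |m p| ≤ 1 / h * sl h w p.1 := by
    have a1 := wm.ac.abs_le (wm.left.integrable le_rfl) (wm.right.integrable le_rfl)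
    have e : (qLine T h 2).L = h := by simp [side]
    rw [e] at a1
    have a2 := Line.avg_mono (ℓ := qLine T h 2) ((wm.left.integrable le_rfl).abs.add
      ((wm.right.integrable le_rfl).abs.const_mul h)) (ia 0 (ia 1 iw)) le2
    filter_upwards [a1, a2, avg_avg_avg iw] with p b1 b2 b3
    exact b1.trans (b2.trans_eq b3)
  set s : ℝ → ℝ := sl h fun p => f₂ p ^ 2 with hs
  have s0 : ∀ t, 0 ≤ s t := fun t => integral_nonneg fun x => sq_nonneg _
  have le4 : ∀ᵐ t ∂(mT T), sl h w t ≤ (|B| + h * (|B| + 1)) * Real.sqrt (1 + s t) := by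
    filter_upwards [hB, integrable_slice ig, integrable_slice ig₂, integrable_slice H2.left.integrable_sq,
      integrable_slice H2.right.integrable_sq] with t hb i1 i2 i3 i4
    set l := Real.sqrt (1 + s t) with hl
    have l1 : 1 ≤ l := Real.one_le_sqrt.2 (by linarith [s0 t])
    have lsq : l ^ 2 = 1 + s t := Real.sq_sqrt (by linarith [s0 t])
    have lp : 0 < l := by linarith
    have j1 : ∫ x, (g (t, x) + h * |g₂ (t, x)|) ∂(mO h) ≤
        ∫ x, (f (t, x) ^ 2 + h * (l * f (t, x) ^ 2 + 1 / l * f₂ (t, x) ^ 2)) ∂(mO h) := by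
      refine integral_mono (i1.add (i2.abs.const_mul h))
        (i3.add (((i3.const_mul l).add (i4.const_mul (1 / l))).const_mul h)) fun x => ?_
      simp only [hg, hg₂]
      have : |f₂ (t, x) * f (t, x) + f (t, x) * f₂ (t, x)| ≤
          l * f (t, x) ^ 2 + 1 / l * f₂ (t, x) ^ 2 := by
        have e : l * f (t, x) ^ 2 + 1 / l * f₂ (t, x) ^ 2 =
            1 / l * ((l * f (t, x)) ^ 2 + f₂ (t, x) ^ 2) := by field_simp
        have e2 : |f₂ (t, x) * f (t, x) + f (t, x) * f₂ (t, x)| =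
            1 / l * |2 * (l * f (t, x)) * f₂ (t, x)| := by
          rw [show f₂ (t, x) * f (t, x) + f (t, x) * f₂ (t, x) =
            1 / l * (2 * (l * f (t, x)) * f₂ (t, x)) by field_simp; ring, abs_mul,
            abs_of_pos (by positivity : 0 < 1 / l)]
        rw [e, e2]
        gcongr
        rw [abs_le]
        constructor <;> nlinarith [sq_nonneg (l * f (t, x) + f₂ (t, x)), sq_nonneg (l * f (t, x) - f₂ (t, x))]
      nlinarith [mul_le_mul_of_nonneg_left this hpos.le]
    have j2 : ∫ x, (f (t, x) ^ 2 + h * (l * f (t, x) ^ 2 + 1 / l * f₂ (t, x) ^ 2)) ∂(mO h) =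
        sl h (fun p => f p ^ 2) t + h * (l * sl h (fun p => f p ^ 2) t + 1 / l * s t) := by
      have i5 : Integrable (fun x => l * f (t, x) ^ 2 + 1 / l * f₂ (t, x) ^ 2) (mO h) :=
        (i3.const_mul l).add (i4.const_mul (1 / l))
      rw [integral_add i3 (i5.const_mul h), integral_const_mul,
        integral_add (i3.const_mul l) (i4.const_mul (1 / l)), integral_const_mul, integral_const_mul]
      rfl
    refine (j1.trans_eq j2).trans ?_
    have b1 : sl h (fun p => f p ^ 2) t ≤ |B| := hb.trans (le_abs_self _)
    have b2 : 1 / l * s t ≤ l := by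
      rw [one_div, inv_mul_le_iff₀ lp]; nlinarith
    have b3 := abs_nonneg B
    have b4 : l * sl h (fun p => f p ^ 2) t ≤ l * |B| := by gcongr
    have b5 : |B| ≤ |B| * l := le_mul_of_one_le_right b3 l1
    have b6 : h * (l * sl h (fun p => f p ^ 2) t + 1 / l * s t) ≤ h * (l * |B| + l) := by gcongr
    nlinarith
  have iN : Integrable (fun p => N p * m p) (mQ T h) := by
    have ml := MemLp.of_time (h := h) (integrable_sl H2.right.integrable_sq) s0
    have i0 : Integrable (fun p => |N p| * Real.sqrt (1 + s p.1)) (mQ T h) := mN.abs.integrable_mul ml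
    refine (i0.const_mul (1 / h * (|B| + h * (|B| + 1)))).mono' (mN.1.mul wm.left.1) ?_
    filter_upwards [le3, ae_of_time (h := h) le4] with p a b
    rw [norm_mul, Real.norm_eq_abs, Real.norm_eq_abs]
    have : |m p| ≤ 1 / h * ((|B| + h * (|B| + 1)) * Real.sqrt (1 + s p.1)) :=
      a.trans (mul_le_mul_of_nonneg_left b (by positivity))
    nlinarith [mul_le_mul_of_nonneg_left this (abs_nonneg (N p))]
  have i1 := Line.integrable_mul_of_avg (ℓ := qLine T h 0) mN.1 c0 (ia 1 ig)
    (fun p => Line.avg_nonneg g0 p) iN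
  have i2 := Line.integrable_mul_of_avg (ℓ := qLine T h 1) mN.1 c1 ig g0 i1
  refine i2.mono' (H0.left.1.norm.pow 3) ?_
  filter_upwards [le] with p hp
  rw [Real.norm_eq_abs, abs_of_nonneg (by positivity)]
  calc |f p| ^ 3 = |f p| * (f p * f p) := by rw [← abs_mul_abs_self]; ring
    _ ≤ N p * (f p * f p) := mul_le_mul_of_nonneg_right hp (mul_self_nonneg _)

end

namespace Sol
variable {P : Fixed} {R : Reg} {ξ₀ : (Fin 3 → ℝ) → ℝ} {u₀ : (Fin 3 → ℝ) → Fin 2 → ℝ}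
  {ξ : Pt → ℝ} {u : Pt → Fin 2 → ℝ}

/-- `|∇ₓ² ln ξ|²` -/
def hess (S : Sol P R ξ₀ u₀ ξ u) : Pt → ℝ := fun p => S.fields.H 0 0 p ^ 2 + S.fields.H 0 1 p ^ 2 +
  (S.fields.H 1 0 p ^ 2 + S.fields.H 1 1 p ^ 2)

/-- `|∂_z u|²` -/
def shear (P : Fixed) (u : Pt → Fin 2 → ℝ) : Pt → ℝ := fun p =>
  wd P.T P.h 2 (fun q => u q 0) p ^ 2 + wd P.T P.h 2 (fun q => u q 1) p ^ 2

/-- `|Δu|²` -/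
def lapSq (P : Fixed) (u : Pt → Fin 2 → ℝ) : Pt → ℝ := fun p =>
  lap (wd P.T P.h) (fun q => u q 0) p ^ 2 + lap (wd P.T P.h) (fun q => u q 1) p ^ 2

lemma gradSq_sqrt (S : Sol P R ξ₀ u₀ ξ u) : gradSq (wd P.T P.h) (sq' ξ) =ᵐ[mQ P.T P.h]
    fun p => 1 / 4 * (ξ p * S.fields.nq p) := by
  filter_upwards [(S.wd_sqrt 0).wd_eq, (S.wd_sqrt 1).wd_eq, S.pos] with p h0 h1 hp
  simp only [gradSq, Fin.sum_univ_two, h0, h1, sq', mul_pow, Real.sq_sqrt hp.le, Fields.nq]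
  ring

lemma gradSq_zpow (S : Sol P R ξ₀ u₀ ξ u) : gradSq (wd P.T P.h) (fun q => ξ q ^ (-5 : ℤ))
    =ᵐ[mQ P.T P.h] fun p => 25 * (ξ p ^ (-10 : ℤ) * S.fields.nq p) := by
  filter_upwards [(S.w_zpow (-5) 0).wd_eq, (S.w_zpow (-5) 1).wd_eq, S.pos] with p h0 h1 hp
  have e : ξ p ^ (-10 : ℤ) = (ξ p ^ (-5 : ℤ)) ^ 2 := by
    rw [← zpow_natCast, ← zpow_mul]; norm_num
  simp only [gradSq, Fin.sum_univ_two, h0, h1, e, Fields.nq]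
  push_cast
  change (-5 * (_ * S.fields.q 0 p)) ^ 2 + (-5 * (_ * S.fields.q 1 p)) ^ 2 = _
  ring

lemma energyDissipation_eq (S : Sol P R ξ₀ u₀ ξ u) : energyDissipation P R ξ u =ᵐ[mQ P.T P.h]
    fun p => R.ε * (ξ p * S.fields.nq p) + R.r₀ * CPE.sq (u p) + P.r * (ξ p * len (u p) ^ 3) +
      2 * P.ν₁ * (ξ p * S.strain p) + P.ν₂ * (ξ p * shear P u p) + R.μ * lapSq P u p +
      10 * R.η * R.ε * (ξ p ^ (-10 : ℤ) * S.fields.nq p) + R.κ * R.ε / 2 * (ξ p * S.hess p) +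
      R.δ * R.ε * L3 P ξ p ^ 2 := by
  filter_upwards [S.gradSq_sqrt, S.gradSq_zpow] with p h0 h1
  simp only [energyDissipation]
  rw [h1]
  have h0' : gradSq (wd P.T P.h) (fun q => Real.sqrt (ξ q)) p = _ := h0
  rw [h0']
  simp only [Fin.sum_univ_two, symGrad, hessSq, strain, shear, lapSq, hess]
  change _ + P.r * ξ p * len (u p) ^ 3 + 2 * P.ν₁ * ξ p * (((S.fields.U 0 0 p + S.fields.U 0 0 p) / 2) ^ 2 +
    ((S.fields.U 1 0 p + S.fields.U 0 1 p) / 2) ^ 2 + (((S.fields.U 0 1 p + S.fields.U 1 0 p) / 2) ^ 2 +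
    ((S.fields.U 1 1 p + S.fields.U 1 1 p) / 2) ^ 2)) + _ + _ + _ + R.κ * R.ε / 2 * ξ p *
    (S.fields.H 0 0 p ^ 2 + S.fields.H 0 1 p ^ 2 + (S.fields.H 1 0 p ^ 2 + S.fields.H 1 1 p ^ 2)) + _ = _
  ring

lemma bdDissipation_eq (S : Sol P R ξ₀ u₀ ξ u) : bdDissipation P R ξ u =ᵐ[mQ P.T P.h]
    fun p => 2 * P.ν₁ * (ξ p * (S.fields.c p - S.fields.cb p) ^ 2) + 2 * P.ν₁ * (ξ p * S.fields.nq p) +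
      P.r * (ξ p * len (u p) ^ 3) + P.ν₂ * (ξ p * shear P u p) +
      40 * P.ν₁ * R.η * (ξ p ^ (-10 : ℤ) * S.fields.nq p) + R.μ * lapSq P u p +
      P.ν₁ * R.κ * (ξ p * S.hess p) + R.r₀ * CPE.sq (u p) + 2 * P.ν₁ * R.δ * L3 P ξ p ^ 2 +
      P.ν₁ * (ξ p * (S.fields.U 0 1 p - S.fields.U 1 0 p) ^ 2) + P.ν₁ * R.r₀ * R.ε * S.fields.nq p := by
  filter_upwards [S.gradSq_sqrt, S.gradSq_zpow, S.wd_vert, S.wd_ξ 0, S.wd_ξ 1, S.pos]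
    with p h0 h1 h2 h3 h4 hp
  have h5 : gradSq (wd P.T P.h) ξ p / ξ p ^ 2 = S.fields.nq p := by
    simp only [gradSq, Fin.sum_univ_two, h3, h4]
    change ((ξ p * S.fields.q 0 p) ^ 2 + (ξ p * S.fields.q 1 p) ^ 2) / _ = _
    rw [Fields.nq]
    field_simp
  simp only [bdDissipation]
  rw [h1, h2, h5]
  have h0' : gradSq (wd P.T P.h) (fun q => Real.sqrt (ξ q)) p = _ := h0
  rw [h0']
  simp only [Fin.sum_univ_two, skewGrad, hessSq, shear, lapSq, hess]
  change _ + P.r * ξ p * len (u p) ^ 3 + _ + _ + _ + R.κ * P.ν₁ * ξ p *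
    (S.fields.H 0 0 p ^ 2 + S.fields.H 0 1 p ^ 2 + (S.fields.H 1 0 p ^ 2 + S.fields.H 1 1 p ^ 2)) + _ + _ +
    2 * P.ν₁ * ξ p * (((S.fields.U 0 0 p - S.fields.U 0 0 p) / 2) ^ 2 +
    ((S.fields.U 1 0 p - S.fields.U 0 1 p) / 2) ^ 2 + (((S.fields.U 0 1 p - S.fields.U 1 0 p) / 2) ^ 2 +
    ((S.fields.U 1 1 p - S.fields.U 1 1 p) / 2) ^ 2)) + _ = _
  ring

lemma bdDensity_eq (S : Sol P R ξ₀ u₀ ξ u) (p : Pt) : bdDensity (wd P.T P.h) P R ξ u p =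
    1 / 2 * (ξ p * CPE.sq (u p)) + S.cross p := by
  simp only [bdDensity, CPE.sq, Fin.sum_univ_two, cross, lnf]
  change 1 / 2 * ξ p * ((u p 0 + 2 * P.ν₁ * S.fields.q 0 p) ^ 2 +
    (u p 1 + 2 * P.ν₁ * S.fields.q 1 p) ^ 2) - _ = _
  rw [Fields.nq]
  ring

/-! ### Integrability -/

section Integrability

lemma int_mul (S : Sol P R ξ₀ u₀ ξ u) {f : Pt → ℝ} (hf : Integrable f (mQ P.T P.h)) :
    Integrable (fun p => ξ p * f p) (mQ P.T P.h) :=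
  hf.mul_of_top_right (S.sob.memLp_top (by norm_num))

lemma int_zpow (S : Sol P R ξ₀ u₀ ξ u) {f : Pt → ℝ} (hf : Integrable f (mQ P.T P.h)) :
    Integrable (fun p => ξ p ^ (-10 : ℤ) * f p) (mQ P.T P.h) :=
  hf.mul_of_top_right ((S.comp (contDiffOn_zpow (-10))).memLp_top (by norm_num))

lemma int_sq (S : Sol P R ξ₀ u₀ ξ u) : Integrable (fun p => CPE.sq (u p)) (mQ P.T P.h) := by
  simp only [CPE.sq, Fin.sum_univ_two]
  exact (S.vel 0 0).left.integrable_sq.add (S.vel 1 0).left.integrable_sq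

lemma int_nq (S : Sol P R ξ₀ u₀ ξ u) : Integrable S.fields.nq (mQ P.T P.h) :=
  (S.fields.w_nq 0).left.integrable le_top

lemma int_hess (S : Sol P R ξ₀ u₀ ξ u) : Integrable S.hess (mQ P.T P.h) := by
  have h : ∀ i j, MemLp (S.fields.H i j) 2 (mQ P.T P.h) := fun i j =>
    (S.fields.hH 0 i j).left.mono_exponent le_top
  exact ((h 0 0).integrable_sq.add (h 0 1).integrable_sq).add
    ((h 1 0).integrable_sq.add (h 1 1).integrable_sq)

lemma memLp_U (S : Sol P R ξ₀ u₀ ξ u) (i j : Fin 2) : MemLp (S.fields.U i j) 2 (mQ P.T P.h) :=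
  (S.fields.hu i j).right

lemma int_strain (S : Sol P R ξ₀ u₀ ξ u) : Integrable S.strain (mQ P.T P.h) :=
  ((S.memLp_U 0 0).integrable_sq.add
    (((S.memLp_U 0 1).add (S.memLp_U 1 0)).integrable_sq.const_mul (1 / 2))).add
    (S.memLp_U 1 1).integrable_sq

lemma int_shear (S : Sol P R ξ₀ u₀ ξ u) : Integrable (shear P u) (mQ P.T P.h) :=
  (S.vel 0 2).right.integrable_sq.add (S.vel 1 2).right.integrable_sq

lemma int_lapSq (S : Sol P R ξ₀ u₀ ξ u) : Integrable (lapSq P u) (mQ P.T P.h) :=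
  (S.memLp_lap 0).integrable_sq.add (S.memLp_lap 1).integrable_sq

lemma int_L3 (S : Sol P R ξ₀ u₀ ξ u) : Integrable (fun p => L3 P ξ p ^ 2) (mQ P.T P.h) :=
  S.sob.lapH.lapH.lapH.memLp.integrable_sq

lemma int_cube (S : Sol P R ξ₀ u₀ ξ u) : Integrable (fun p => len (u p) ^ 3) (mQ P.T P.h) := by
  obtain ⟨c, hc, hlow⟩ := S.low
  have hs : MemLp (sq' ξ) ⊤ (mQ P.T P.h) := S.sob_sqrt.memLp_top (by norm_num)
  have key : ∀ i, Integrable (fun p => |u p i| ^ 3) (mQ P.T P.h) := fun i => by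
    have hm : MemLp (fun p => Real.sqrt (ξ p) * u p i) 2 (mQ P.T P.h) := (S.vel i 0).left.mul' hs
    obtain ⟨B, hB⟩ := (S.sol.velocity_LinfL2 i).slice hm
    refine integrable_cube (S.vel i (hor 0)) (S.vel i (hor 1)) (S.vel2 i (hor 1) (hor 0)) (S.vel i 2)
      (B := 1 / c * B) ?_
    have h1 : ∀ᵐ p ∂(mQ P.T P.h), u p i ^ 2 ≤ 1 / c * (Real.sqrt (ξ p) * u p i) ^ 2 := by
      filter_upwards [hlow] with p hp
      rw [mul_pow, Real.sq_sqrt (hc.le.trans hp), one_div, inv_mul_eq_div, le_div_iff₀ hc]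
      nlinarith [sq_nonneg (u p i)]
    filter_upwards [hB, sl_mono (S.vel i 0).left.integrable_sq (hm.integrable_sq.const_mul (1 / c)) h1]
      with t h2 h3
    refine h3.trans ?_
    have : sl P.h (fun p => 1 / c * (Real.sqrt (ξ p) * u p i) ^ 2) t = 1 / c * _ := integral_const_mul _ _
    rw [this]
    exact mul_le_mul_of_nonneg_left h2 (by positivity)
  refine ((((key 0).add (key 1)).const_mul 4)).mono' (S.memLp_len.1.pow 3) (Eventually.of_forall fun p => ?_)
  have h0 : 0 ≤ len (u p) := Real.sqrt_nonneg _
  rw [Real.norm_eq_abs, abs_of_nonneg (pow_nonneg h0 3)]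
  refine (pow_le_pow_left₀ h0 (len_le _) 3).trans ?_
  simp only [Pi.add_apply]
  nlinarith [abs_nonneg (u p 0), abs_nonneg (u p 1), mul_nonneg (add_nonneg (abs_nonneg (u p 0))
    (abs_nonneg (u p 1))) (sq_nonneg (|u p 0| - |u p 1|))]

lemma int_energyDissipation (S : Sol P R ξ₀ u₀ ξ u) :
    Integrable (energyDissipation P R ξ u) (mQ P.T P.h) :=
  (((((((((S.int_mul S.int_nq).const_mul _).add (S.int_sq.const_mul _)).add
    ((S.int_mul S.int_cube).const_mul _)).add ((S.int_mul S.int_strain).const_mul _)).add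
    ((S.int_mul S.int_shear).const_mul _)).add (S.int_lapSq.const_mul _)).add
    ((S.int_zpow S.int_nq).const_mul _)).add ((S.int_mul S.int_hess).const_mul _)).add
    (S.int_L3.const_mul _) |>.congr S.energyDissipation_eq.symm

lemma int_osc (S : Sol P R ξ₀ u₀ ξ u) :
    Integrable (fun p => (S.fields.c p - S.fields.cb p) ^ 2) (mQ P.T P.h) :=
  (S.fields.c_memLp.sub S.fields.cb_memLp).integrable_sq

lemma int_vorticity (S : Sol P R ξ₀ u₀ ξ u) :
    Integrable (fun p => (S.fields.U 0 1 p - S.fields.U 1 0 p) ^ 2) (mQ P.T P.h) :=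
  ((S.memLp_U 0 1).sub (S.memLp_U 1 0)).integrable_sq

lemma int_bdDissipation (S : Sol P R ξ₀ u₀ ξ u) : Integrable (bdDissipation P R ξ u) (mQ P.T P.h) :=
  (((((((((((S.int_mul S.int_osc).const_mul _).add ((S.int_mul S.int_nq).const_mul _)).add
    ((S.int_mul S.int_cube).const_mul _)).add ((S.int_mul S.int_shear).const_mul _)).add
    ((S.int_zpow S.int_nq).const_mul _)).add (S.int_lapSq.const_mul _)).add
    ((S.int_mul S.int_hess).const_mul _)).add (S.int_sq.const_mul _)).add (S.int_L3.const_mul _)).add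
    ((S.int_mul S.int_vorticity).const_mul _)).add (S.int_nq.const_mul _)
    |>.congr S.bdDissipation_eq.symm

lemma int_diss (S : Sol P R ξ₀ u₀ ξ u) : Integrable S.diss (mQ P.T P.h) :=
  (((((((S.int_mul S.int_osc).const_mul _).add ((S.int_mul S.int_vorticity).const_mul _)).add
    ((S.int_mul S.int_nq).const_mul _)).add ((S.int_zpow S.int_nq).const_mul _)).add
    ((S.int_mul S.int_hess).const_mul _)).add (S.int_L3.const_mul _)).add (S.int_nq.const_mul _)

lemma int_err (S : Sol P R ξ₀ u₀ ξ u) : Integrable S.err (mQ P.T P.h) :=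
  ((S.cross_balance.right.add S.int_diss).sub ((S.int_mul S.int_strain).const_mul (2 * P.ν₁))).congr
    (Eventually.of_forall fun p => by simp only [Pi.add_apply, Pi.sub_apply]; ring)

end Integrability

lemma bdDissipation_le (S : Sol P R ξ₀ u₀ ξ u) : ∀ᵐ p ∂(mQ P.T P.h),
    bdDissipation P R ξ u p ≤ 2 * S.diss p + energyDissipation P R ξ u p := by
  filter_upwards [S.bdDissipation_eq, S.energyDissipation_eq, S.pos] with p h1 h2 hp
  rw [h1, h2, diss]
  have := P.ν₁_pos; have := R.ε_pos; have := R.η_pos; have := R.κ_pos; have := R.δ_pos; have := R.r₀_pos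
  have n1 : 0 ≤ S.fields.nq p := add_nonneg (sq_nonneg _) (sq_nonneg _)
  have n2 : 0 ≤ S.hess p := by unfold hess; positivity
  have n3 : 0 ≤ S.strain p := by unfold strain; positivity
  have n4 : 0 ≤ ξ p ^ (-10 : ℤ) := by positivity
  have a1 : 0 ≤ P.ν₁ * (ξ p * (S.fields.c p - S.fields.cb p) ^ 2) := by positivity
  have a2 : 0 ≤ P.ν₁ * (ξ p * (S.fields.U 0 1 p - S.fields.U 1 0 p) ^ 2) := by positivity
  have a3 : 0 ≤ P.ν₁ * (ξ p * S.fields.nq p) := by positivity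
  have a4 : 0 ≤ P.ν₁ * R.κ * (ξ p * S.hess p) := by positivity
  have a5 : 0 ≤ P.ν₁ * R.δ * L3 P ξ p ^ 2 := by positivity
  have a6 : 0 ≤ P.ν₁ * R.r₀ * R.ε * S.fields.nq p := by positivity
  have a7 : 0 ≤ R.ε * (ξ p * S.fields.nq p) := by positivity
  have a8 : 0 ≤ R.κ * R.ε / 2 * (ξ p * S.hess p) := by positivity
  have a9 : 0 ≤ R.η * R.ε * (ξ p ^ (-10 : ℤ) * S.fields.nq p) := by positivity
  have a10 : 0 ≤ R.δ * R.ε * L3 P ξ p ^ 2 := by positivity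
  have a11 : 0 ≤ P.ν₁ * (ξ p * S.strain p) := by positivity
  rw [hess] at a4 a8 ⊢
  linarith

end Sol

section
variable {T h : ℝ} [hT : Fact (0 < T)] [hh : Fact (0 < h)]

lemma Q_subset {t : ℝ} (ht : t ≤ T) : Q t h ⊆ Q T h := fun _ hp => ⟨⟨hp.1.1, hp.1.2.trans_le ht⟩, hp.2⟩

lemma ae_Q {t : ℝ} (ht : t ≤ T) {p : Pt → Prop} (hp : ∀ᵐ x ∂(mQ T h), p x) :
    ∀ᵐ x ∂(volume.restrict (Q t h)), p x :=
  ae_restrict_of_ae_restrict_of_subset (Q_subset ht) hp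

lemma integrable_Q {t : ℝ} (ht : t ≤ T) {f : Pt → ℝ} (hf : Integrable f (mQ T h)) :
    IntegrableOn f (Q t h) := IntegrableOn.mono_set hf (Q_subset ht)

lemma integral_Q_mono {t : ℝ} (ht : t ≤ T) {f g : Pt → ℝ} (hf : Integrable f (mQ T h))
    (hg : Integrable g (mQ T h)) (hfg : ∀ᵐ p ∂(mQ T h), f p ≤ g p) :
    ∫ p in Q t h, f p ≤ ∫ p in Q t h, g p :=
  integral_mono_ae (integrable_Q ht hf) (integrable_Q ht hg) (ae_Q ht hfg)

lemma integral_Q_le_of_sl {t : ℝ} (ht : t ∈ Icc 0 T) {f : Pt → ℝ} (hf : Integrable f (mQ T h)) {B : ℝ}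
    (hB0 : 0 ≤ B) (hB : ∀ᵐ t ∂(mT T), sl h f t ≤ B) : ∫ p in Q t h, f p ≤ T * B := by
  rw [integral_Q_eq_sl ht hf, intervalIntegral.integral_of_le ht.1, integral_Ioc_eq_integral_Ioo]
  have hs : IntegrableOn (sl h f) (Ioo 0 t) :=
    IntegrableOn.mono_set (integrable_sl hf) (Ioo_subset_Ioo_right ht.2)
  refine (integral_mono_ae hs (integrable_const B)
    (ae_restrict_of_ae_restrict_of_subset (Ioo_subset_Ioo_right ht.2) hB)).trans ?_
  simp only [integral_const, smul_eq_mul, Measure.real, Measure.restrict_apply MeasurableSet.univ,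
    univ_inter, Real.volume_Ioo, sub_zero, ENNReal.toReal_ofReal ht.1]
  exact mul_le_mul_of_nonneg_right ht.2 hB0

lemma SmoothS.add {f g : (Fin 3 → ℝ) → ℝ} (hf : SmoothS f) (hg : SmoothS g) :
    SmoothS fun x => f x + g x :=
  ⟨hf.1.add hg.1, fun j x => by simp only [hf.2 j x, hg.2 j x]⟩

lemma SmoothS.lapH {f : (Fin 3 → ℝ) → ℝ} (hf : SmoothS f) : SmoothS (lapH CPE.sd f) := by
  have : CPE.lapH CPE.sd f = fun x => CPE.sd (hor 0) (CPE.sd (hor 0) f) x +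
      CPE.sd (hor 1) (CPE.sd (hor 1) f) x := by
    ext x; simp only [CPE.lapH, Fin.sum_univ_two]
  rw [this]
  exact ((hf.sd _).sd _).add ((hf.sd _).sd _)

lemma SmoothS.integrable_gradSq {f : (Fin 3 → ℝ) → ℝ} (hf : SmoothS f) :
    Integrable (gradSq CPE.sd f) (mO h) := by
  have h1 : ∀ j : Fin 2, MemLp (CPE.sd (hor j) f) 2 (mO h) := fun j =>
    (hf.sd _).memLp_mO.mono_exponent le_top
  refine ((h1 0).integrable_sq.add (h1 1).integrable_sq).congr (Eventually.of_forall fun x => ?_)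
  simp only [gradSq, Fin.sum_univ_two, Pi.add_apply]

end

lemma gradSq_nonneg {α : Type} (d : Fin 3 → (α → ℝ) → α → ℝ) (f : α → ℝ) (p : α) : 0 ≤ gradSq d f p :=
  Finset.sum_nonneg fun _ _ => sq_nonneg _

lemma sq_nonneg' (v : Fin 2 → ℝ) : 0 ≤ sq v := Finset.sum_nonneg fun _ _ => sq_nonneg _

lemma entropy_nonneg {x : ℝ} (hx : 0 < x) : 0 ≤ x * Real.log x - x + 1 := by
  have h1 := mul_le_mul_of_nonneg_left (Real.one_sub_inv_le_log_of_pos hx) hx.le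
  rw [mul_sub, mul_inv_cancel₀ hx.ne'] at h1
  linarith

lemma le_entropy {x : ℝ} (hx : 0 < x) : x ≤ x * Real.log x - x + 1 + 2 := by
  have he := Real.exp_one_lt_three
  have h0 := Real.exp_pos 1
  have h1 := mul_le_mul_of_nonneg_left (Real.one_sub_inv_le_log_of_pos (div_pos hx h0)) hx.le
  rw [Real.log_div hx.ne' h0.ne', Real.log_exp, inv_div, mul_sub, mul_div_cancel₀ _ hx.ne'] at h1
  linarith

/-- The initial energy is bounded in terms of the data. -/
lemma IsInitialData.energy_le {P : Fixed} {ξ₀ : (Fin 3 → ℝ) → ℝ} {u₀ : (Fin 3 → ℝ) → Fin 2 → ℝ}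
    (D : IsInitialData P ξ₀ u₀) (M : ℝ) : ∃ E, ∀ R : Reg, R.δ ≤ M → R.η ≤ M → R.κ ≤ M →
      0 ≤ initialEnergy P R ξ₀ u₀ ∧ initialEnergy P R ξ₀ u₀ ≤ E := by
  have iu : Integrable (fun x => sq (u₀ x)) (mO P.h) := by
    simp only [sq, Fin.sum_univ_two]
    exact (D.velocity_memLp 0).integrable_sq.add (D.velocity_memLp 1).integrable_sq
  have m0 : MemLp ξ₀ ⊤ (mO P.h) := D.smooth.1.memLp_mO
  have i1 : Integrable (fun x => 1 / 2 * (ξ₀ x * sq (u₀ x))) (mO P.h) :=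
    (iu.mul_of_top_right m0).const_mul _
  have i2 : Integrable (fun x => ξ₀ x * Real.log (ξ₀ x) - ξ₀ x + 1) (mO P.h) :=
    ((((D.smooth_comp Sol.contDiffOn_log).1.memLp_mO.mul' (r := ⊤) m0).integrable le_top).sub
      (m0.integrable le_top)).add (integrable_const _)
  have i3 : Integrable (fun x => ξ₀ x ^ (-10 : ℤ)) (mO P.h) :=
    (D.smooth_comp (Sol.contDiffOn_zpow (-10))).1.memLp_mO.integrable le_top
  have i4 : Integrable (gradSq CPE.sd fun x => Real.sqrt (ξ₀ x)) (mO P.h) :=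
    (D.smooth_comp Sol.contDiffOn_sqrt).1.integrable_gradSq
  have i5 : Integrable (gradSq CPE.sd (lapH CPE.sd (lapH CPE.sd ξ₀))) (mO P.h) :=
    D.smooth.1.lapH.lapH.integrable_gradSq
  have key : ∀ a b c : ℝ, Integrable (fun x => 1 / 2 * (ξ₀ x * sq (u₀ x)) +
      (ξ₀ x * Real.log (ξ₀ x) - ξ₀ x + 1) + a * ξ₀ x ^ (-10 : ℤ) +
      b * gradSq CPE.sd (fun x => Real.sqrt (ξ₀ x)) x +
      c * gradSq CPE.sd (lapH CPE.sd (lapH CPE.sd ξ₀)) x) (mO P.h) := fun a b c =>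
    (((i1.add i2).add (i3.const_mul a)).add (i4.const_mul b)).add (i5.const_mul c)
  refine ⟨_, fun R h1 h2 h3 => ⟨integral_nonneg fun x => ?_,
    integral_mono ((key (1 / 11 * R.η) R.κ (R.δ / 2)).congr (Eventually.of_forall fun x => ?_))
      (key (1 / 11 * M) M (M / 2)) fun x => ?_⟩⟩
  · have a1 := D.pos x
    have a2 := sq_nonneg' (u₀ x)
    have a3 := entropy_nonneg a1
    have a4 := gradSq_nonneg CPE.sd (fun q => Real.sqrt (ξ₀ q)) x
    have a5 := gradSq_nonneg CPE.sd (lapH CPE.sd (lapH CPE.sd ξ₀)) x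
    have := R.η_pos; have := R.κ_pos; have := R.δ_pos
    simp only [energyDensity, Pi.zero_apply]
    positivity
  · simp only [energyDensity]; ring
  · have a1 := D.pos x
    have a4 := gradSq_nonneg CPE.sd (fun q => Real.sqrt (ξ₀ q)) x
    have a5 := gradSq_nonneg CPE.sd (lapH CPE.sd (lapH CPE.sd ξ₀)) x
    have a6 : 0 < ξ₀ x ^ (-10 : ℤ) := by positivity
    have b1 := mul_le_mul_of_nonneg_right h2 a6.le
    have b2 := mul_le_mul_of_nonneg_right h3 a4
    have b3 := mul_le_mul_of_nonneg_right h1 a5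
    simp only [energyDensity]
    linarith

/-- The initial values of the Bresch-Desjardins functionals are bounded in terms of the data. -/
lemma IsInitialData.bd_le {P : Fixed} {ξ₀ : (Fin 3 → ℝ) → ℝ} {u₀ : (Fin 3 → ℝ) → Fin 2 → ℝ}
    (D : IsInitialData P ξ₀ u₀) (M : ℝ) : ∃ X, ∀ R : Reg, R.r₀ ≤ M →
      Sol.crossInit P R ξ₀ u₀ ≤ X ∧ -X ≤ ∫ x in Om P.h, bdDensity CPE.sd P R ξ₀ u₀ x := by
  have hl := D.smooth_comp Sol.contDiffOn_log
  have il : Integrable (fun x => Real.log (ξ₀ x)) (mO P.h) := hl.1.memLp_mO.integrable le_top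
  set L := ∫ x, Real.log (ξ₀ x) ∂(mO P.h) with hL
  set a := 2 * P.ν₁ * ((∫ x, ξ₀ x * u₀ x 0 * CPE.sd (hor 0) (lnf ξ₀) x ∂(mO P.h)) +
      ∫ x, ξ₀ x * u₀ x 1 * CPE.sd (hor 1) (lnf ξ₀) x ∂(mO P.h)) +
    2 * P.ν₁ ^ 2 * (∫ x, ξ₀ x * (CPE.sd (hor 0) (lnf ξ₀) x * CPE.sd (hor 0) (lnf ξ₀) x +
      CPE.sd (hor 1) (lnf ξ₀) x * CPE.sd (hor 1) (lnf ξ₀) x) ∂(mO P.h)) with ha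
  have hν := P.ν₁_pos
  refine ⟨|a| + 2 * P.ν₁ * (M * |L|), fun R hR => ?_⟩
  have h1 : |R.r₀ * L| ≤ M * |L| := by
    rw [abs_mul, abs_of_pos R.r₀_pos]
    exact mul_le_mul_of_nonneg_right hR (abs_nonneg _)
  have h2 := mul_le_mul_of_nonneg_left (abs_le.1 h1).1 hν.le
  have h3 := mul_le_mul_of_nonneg_left (abs_le.1 h1).2 hν.le
  constructor
  · have : Sol.crossInit P R ξ₀ u₀ = a + -2 * P.ν₁ * R.r₀ * L := rfl
    rw [this]
    linarith [le_abs_self a]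
  · have m : ∀ i, MemLp (fun x => u₀ x i + 2 * P.ν₁ * CPE.sd (hor i) (lnf ξ₀) x) 2 (mO P.h) := fun i =>
      (D.velocity_memLp i).add (((hl.1.sd _).memLp_mO.mono_exponent le_top).const_mul _)
    have i1 : Integrable (fun x => 1 / 2 * (ξ₀ x * ((u₀ x 0 + 2 * P.ν₁ * CPE.sd (hor 0) (lnf ξ₀) x) ^ 2 +
        (u₀ x 1 + 2 * P.ν₁ * CPE.sd (hor 1) (lnf ξ₀) x) ^ 2))) (mO P.h) :=
      (((m 0).integrable_sq.add (m 1).integrable_sq).mul_of_top_right D.smooth.1.memLp_mO).const_mul _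
    have e : (fun x => bdDensity CPE.sd P R ξ₀ u₀ x) = fun x =>
        1 / 2 * (ξ₀ x * ((u₀ x 0 + 2 * P.ν₁ * CPE.sd (hor 0) (lnf ξ₀) x) ^ 2 +
        (u₀ x 1 + 2 * P.ν₁ * CPE.sd (hor 1) (lnf ξ₀) x) ^ 2)) - 2 * P.ν₁ * R.r₀ * Real.log (ξ₀ x) := by
      ext x; simp only [bdDensity, sq, Fin.sum_univ_two]; ring
    rw [e, integral_sub i1 (il.const_mul _), integral_const_mul (2 * P.ν₁ * R.r₀)]
    have h4 : 0 ≤ ∫ x in Om P.h, 1 / 2 * (ξ₀ x * ((u₀ x 0 + 2 * P.ν₁ * CPE.sd (hor 0) (lnf ξ₀) x) ^ 2 +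
        (u₀ x 1 + 2 * P.ν₁ * CPE.sd (hor 1) (lnf ξ₀) x) ^ 2)) := integral_nonneg fun x => by
      have := D.pos x
      simp only [Pi.zero_apply]
      positivity
    change -_ ≤ _ - 2 * P.ν₁ * R.r₀ * L
    linarith [abs_nonneg a]

namespace Sol
variable {P : Fixed} {R : Reg} {ξ₀ : (Fin 3 → ℝ) → ℝ} {u₀ : (Fin 3 → ℝ) → Fin 2 → ℝ}
  {ξ : Pt → ℝ} {u : Pt → Fin 2 → ℝ}

lemma int_energyDensity (S : Sol P R ξ₀ u₀ ξ u) :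
    Integrable (energyDensity (wd P.T P.h) R ξ u) (mQ P.T P.h) := by
  have m0 := S.sob.memLp_top (b := 4) (by norm_num)
  have i1 := (S.int_mul S.int_sq).const_mul (1 / 2)
  have i2 : Integrable (fun x => ξ x * Real.log (ξ x) - ξ x + 1) (mQ P.T P.h) :=
    ((((S.sob_log.memLp_top (by norm_num)).mul' (r := ⊤) m0).integrable le_top).sub
      (m0.integrable le_top)).add (integrable_const _)
  have i3 : Integrable (fun x => ξ x ^ (-10 : ℤ)) (mQ P.T P.h) :=
    ((S.comp (contDiffOn_zpow (-10))).memLp_top (by norm_num)).integrable le_top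
  have i4 : Integrable (gradSq (wd P.T P.h) (sq' ξ)) (mQ P.T P.h) :=
    ((S.int_mul S.int_nq).const_mul _).congr S.gradSq_sqrt.symm
  have i5 : Integrable (gradSq (wd P.T P.h) (lapH (wd P.T P.h) (lapH (wd P.T P.h) ξ))) (mQ P.T P.h) := by
    have m := fun j : Fin 2 => (S.sob.lapH.lapH.deriv j).memLp
    refine ((m 0).integrable_sq.add (m 1).integrable_sq).congr (Eventually.of_forall fun p => ?_)
    simp only [gradSq, Fin.sum_univ_two, Pi.add_apply]
  refine ((((i1.add i2).add (i3.const_mul (1 / 11 * R.η))).add (i4.const_mul R.κ)).add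
    (i5.const_mul (R.δ / 2))).congr (Eventually.of_forall fun p => ?_)
  simp only [energyDensity, Pi.add_apply]
  ring

lemma energyDensity_ge (S : Sol P R ξ₀ u₀ ξ u) : ∀ᵐ p ∂(mQ P.T P.h),
    0 ≤ energyDensity (wd P.T P.h) R ξ u p ∧
    1 / 2 * (ξ p * CPE.sq (u p)) ≤ energyDensity (wd P.T P.h) R ξ u p ∧
    ξ p ≤ energyDensity (wd P.T P.h) R ξ u p + 2 ∧
    R.η / 11 * ξ p ^ (-10 : ℤ) ≤ energyDensity (wd P.T P.h) R ξ u p ∧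
    ∀ i : Fin 2, R.δ / 2 * wd P.T P.h (hor i) (lapH (wd P.T P.h) (lapH (wd P.T P.h) ξ)) p ^ 2 ≤
      energyDensity (wd P.T P.h) R ξ u p := by
  filter_upwards [S.pos] with p hp
  have := R.η_pos; have := R.κ_pos; have hδ := R.δ_pos
  have a1 : 0 ≤ 1 / 2 * ξ p * CPE.sq (u p) := mul_nonneg (by positivity) (sq_nonneg' _)
  have a2 := entropy_nonneg hp
  have a3 : 0 ≤ 1 / 11 * R.η * ξ p ^ (-10 : ℤ) := by positivity
  have a4 : 0 ≤ R.κ * gradSq (wd P.T P.h) (fun q => Real.sqrt (ξ q)) p :=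
    mul_nonneg (by positivity) (gradSq_nonneg _ _ _)
  set v := lapH (wd P.T P.h) (lapH (wd P.T P.h) ξ)
  have a5 : 0 ≤ R.δ / 2 * gradSq (wd P.T P.h) v p := mul_nonneg (by positivity) (gradSq_nonneg _ _ _)
  have a6 : ∀ i : Fin 2, R.δ / 2 * wd P.T P.h (hor i) v p ^ 2 ≤ R.δ / 2 * gradSq (wd P.T P.h) v p := fun i =>
    mul_le_mul_of_nonneg_left (Finset.single_le_sum (f := fun j : Fin 2 => wd P.T P.h (hor j) v p ^ 2)
      (fun j _ => sq_nonneg _) (Finset.mem_univ i)) (by positivity)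
  have a7 := le_entropy hp
  unfold energyDensity
  refine ⟨by linarith, by linarith, by linarith, by linarith, fun i => ?_⟩
  have := a6 i
  linarith

lemma energyDissipation_ge (S : Sol P R ξ₀ u₀ ξ u) : ∀ᵐ p ∂(mQ P.T P.h),
    0 ≤ energyDissipation P R ξ u p ∧ 2 * P.ν₁ * (ξ p * S.strain p) ≤ energyDissipation P R ξ u p ∧
    R.μ * lapSq P u p ≤ energyDissipation P R ξ u p := by
  filter_upwards [S.energyDissipation_eq, S.pos] with p h1 hp
  rw [h1]
  have := P.ν₁_pos; have := P.ν₂_pos; have := P.r_pos; have := R.ε_pos; have := R.η_pos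
  have := R.κ_pos; have := R.δ_pos; have := R.r₀_pos; have := R.μ_pos
  have n1 : 0 ≤ S.fields.nq p := add_nonneg (sq_nonneg _) (sq_nonneg _)
  have n2 : 0 ≤ S.hess p := by unfold hess; positivity
  have n3 : 0 ≤ S.strain p := by unfold strain; positivity
  have n4 := sq_nonneg' (u p)
  have n5 : 0 ≤ len (u p) := Real.sqrt_nonneg _
  have n6 : 0 ≤ shear P u p := by unfold shear; positivity
  have n7 : 0 ≤ lapSq P u p := by unfold lapSq; positivity
  have b1 : 0 ≤ R.ε * (ξ p * S.fields.nq p) := by positivity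
  have b2 : 0 ≤ R.r₀ * CPE.sq (u p) := by positivity
  have b3 : 0 ≤ P.r * (ξ p * len (u p) ^ 3) := by positivity
  have b4 : 0 ≤ 2 * P.ν₁ * (ξ p * S.strain p) := by positivity
  have b5 : 0 ≤ P.ν₂ * (ξ p * shear P u p) := by positivity
  have b6 : 0 ≤ R.μ * lapSq P u p := by positivity
  have b7 : 0 ≤ 10 * R.η * R.ε * (ξ p ^ (-10 : ℤ) * S.fields.nq p) := by positivity
  have b8 : 0 ≤ R.κ * R.ε / 2 * (ξ p * S.hess p) := by positivity
  have b9 : 0 ≤ R.δ * R.ε * L3 P ξ p ^ 2 := by positivity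
  exact ⟨by linarith, by linarith, by linarith⟩

/-- Bounds in `L^∞(0, T; L¹)` from the energy inequality. -/
lemma energy_slice (S : Sol P R ξ₀ u₀ ξ u) {f : Pt → ℝ} (hf : Integrable f (mQ P.T P.h))
    (hle : ∀ᵐ p ∂(mQ P.T P.h), f p ≤ energyDensity (wd P.T P.h) R ξ u p) :
    ∀ᵐ t ∂(mT P.T), sl P.h f t ≤ initialEnergy P R ξ₀ u₀ := by
  filter_upwards [S.sol.energy, sl_mono hf S.int_energyDensity hle, ae_restrict_mem measurableSet_Ioo]
    with t h1 h2 h3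
  have h4 : 0 ≤ ∫ p in Q t P.h, energyDissipation P R ξ u p :=
    integral_nonneg_of_ae (ae_Q h3.2.le (S.energyDissipation_ge.mono fun p hp => hp.1))
  change sl P.h _ t + _ ≤ _ at h1
  linarith

/-- Bounds in `L¹` from the energy inequality. -/
lemma energy_time (S : Sol P R ξ₀ u₀ ξ u) {f : Pt → ℝ} (hf : Integrable f (mQ P.T P.h))
    (hle : ∀ᵐ p ∂(mQ P.T P.h), f p ≤ energyDissipation P R ξ u p) :
    ∀ᵐ t ∂(mT P.T), ∫ p in Q t P.h, f p ≤ initialEnergy P R ξ₀ u₀ := by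
  filter_upwards [S.sol.energy, ae_slice (S.energyDensity_ge.mono fun p hp => hp.1),
    ae_restrict_mem measurableSet_Ioo] with t h1 h2 h3
  have h4 : 0 ≤ sl P.h (energyDensity (wd P.T P.h) R ξ u) t := integral_nonneg_of_ae h2
  have h5 := integral_Q_mono h3.2.le hf S.int_energyDissipation hle
  change sl P.h _ t + _ ≤ _ at h1
  linarith

end Sol

/-- A bound for the derivatives of the density up to order three. -/
def derivBound (h E δ : ℝ) : ℝ := 4 * (h + (E + h + 2 * E / δ)) / h

/-- A bound for the inverse of the density. -/
def invBound (h E δ η : ℝ) : ℝ :=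
  1 / h * ((1 + 3 * derivBound h E δ + 2 * derivBound h E δ ^ 2) * (h + 11 * E / η))

/-- A bound for the derivatives of the logarithm of the density up to order three. -/
def logBound (h E δ η : ℝ) : ℝ :=
  1 + 8 * (1 + |derivBound h E δ * invBound h E δ η|) ^ 3

lemma pow_le_one_add {y : ℝ} (hy : 0 ≤ y) {k : ℕ} (hk : k ≤ 10) : y ^ k ≤ 1 + y ^ 10 := by
  rcases le_total y 1 with h | h
  · linarith [pow_le_one₀ hy h (n := k), pow_nonneg hy 10]
  · linarith [pow_le_pow_right₀ h hk]

namespace Sol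
variable {P : Fixed} {R : Reg} {ξ₀ : (Fin 3 → ℝ) → ℝ} {u₀ : (Fin 3 → ℝ) → Fin 2 → ℝ}
  {ξ : Pt → ℝ} {u : Pt → Fin 2 → ℝ} {E : ℝ}

lemma sl_density_le (S : Sol P R ξ₀ u₀ ξ u) (hE : initialEnergy P R ξ₀ u₀ ≤ E) :
    ∀ᵐ t ∂(mT P.T), sl P.h ξ t ≤ E + 2 * P.h := by
  have hi := S.two.1.integrable one_le_two
  have h2 : Integrable (fun _ : Pt => (2:ℝ)) (mQ P.T P.h) := integrable_const _
  filter_upwards [S.energy_slice (f := fun p => ξ p - 2) (hi.sub h2) (S.energyDensity_ge.mono fun p hp => by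
    linarith [hp.2.2.1]), sl_sub hi h2] with t h3 h4
  have h5 : sl P.h (fun _ => (2:ℝ)) t = 2 * P.h := by
    simp only [sl, integral_const, mO_real, smul_eq_mul]; ring
  have h4' : sl P.h (fun p => ξ p - 2) t = _ := h4
  rw [h4', h5] at h3
  linarith

lemma wds_le (S : Sol P R ξ₀ u₀ ξ u) (h0 : 0 ≤ E) (hE : initialEnergy P R ξ₀ u₀ ≤ E)
    {l : List (Fin 2)} (hl : l.length ≤ 3) :
    ∀ᵐ p ∂(mQ P.T P.h), |wds P.T P.h l ξ p| ≤ derivBound P.h E R.δ := by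
  have hδ := R.δ_pos
  have hh := P.h_pos
  have hq : 0 ≤ 2 * E / R.δ := by positivity
  refine wds_bound (S.sob.mono (by norm_num) le_rfl) S.zξ ?_ (fun i => ?_) hl
  · filter_upwards [S.sl_density_le hE, sl_congr (h := P.h) (f := fun p => |ξ p|) (g := ξ)
      (S.pos.mono fun p hp => abs_of_pos hp)] with t h1 h2
    rw [h2]
    linarith
  · have m := (S.sob.lapH.lapH.deriv i).memLp.integrable_sq
    filter_upwards [S.energy_slice (m.const_mul (R.δ / 2))
      (S.energyDensity_ge.mono fun p hp => hp.2.2.2.2 i)] with t h1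
    have h2 : sl P.h (fun p => R.δ / 2 *
      wd P.T P.h (hor i) (lapH (wd P.T P.h) (lapH (wd P.T P.h) ξ)) p ^ 2) t = R.δ / 2 *
      sl P.h (fun p => wd P.T P.h (hor i) (lapH (wd P.T P.h) (lapH (wd P.T P.h) ξ)) p ^ 2) t :=
      integral_const_mul _ _
    rw [h2] at h1
    have h3 : sl P.h (fun p => wd P.T P.h (hor i) (lapH (wd P.T P.h) (lapH (wd P.T P.h) ξ)) p ^ 2) t ≤
        2 * E / R.δ := by
      rw [le_div_iff₀ hδ]
      linarith
    linarith

/-- The first derivatives of the density and of its logarithm. -/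
lemma log_deriv_le (S : Sol P R ξ₀ u₀ ξ u) (h0 : 0 ≤ E) (hE : initialEnergy P R ξ₀ u₀ ≤ E) :
    ∀ᵐ p ∂(mQ P.T P.h), 0 ≤ derivBound P.h E R.δ ∧
      (∀ j, |S.fields.q j p| ≤ derivBound P.h E R.δ * (ξ p)⁻¹) ∧
      (∀ i j, |S.fields.H i j p| ≤ derivBound P.h E R.δ * (ξ p)⁻¹ +
        (derivBound P.h E R.δ * (ξ p)⁻¹) ^ 2) ∧
      ∀ k i, |S.fields.J k k i p| ≤ derivBound P.h E R.δ * (ξ p)⁻¹ +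
        3 * (derivBound P.h E R.δ * (ξ p)⁻¹) ^ 2 + 4 * (derivBound P.h E R.δ * (ξ p)⁻¹) ^ 3 := by
  set F := S.fields
  have e1 : ∀ j, wds P.T P.h [j] ξ =ᵐ[mQ P.T P.h] fun p => ξ p * F.q j p := S.wd_ξ
  have e2 : ∀ j i, wds P.T P.h [j, i] ξ =ᵐ[mQ P.T P.h] _ := fun j i =>
    (wd_congr (e1 i)).trans (F.w_ξq i j).wd_eq
  have e3 : ∀ k j i, wds P.T P.h [k, j, i] ξ =ᵐ[mQ P.T P.h] _ := fun k j i =>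
    (wd_congr (e2 j i)).trans (((F.w_ξq j k).mul (r := ⊤) le_top (F.hq k i)).add le_top
      ((F.hξ k).mul (r := ⊤) le_top (F.hH k j i))).wd_eq
  have b0 := S.wds_le h0 hE (l := []) (by simp)
  have b1 : ∀ᵐ p ∂(mQ P.T P.h), ∀ j, |wds P.T P.h [j] ξ p| ≤ derivBound P.h E R.δ :=
    ae_all_iff.2 fun j => S.wds_le h0 hE (by simp)
  have b2 : ∀ᵐ p ∂(mQ P.T P.h), ∀ j i, |wds P.T P.h [j, i] ξ p| ≤ derivBound P.h E R.δ :=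
    ae_all_iff.2 fun j => ae_all_iff.2 fun i => S.wds_le h0 hE (by simp)
  have b3 : ∀ᵐ p ∂(mQ P.T P.h), ∀ k i, |wds P.T P.h [k, k, i] ξ p| ≤ derivBound P.h E R.δ :=
    ae_all_iff.2 fun j => ae_all_iff.2 fun i => S.wds_le h0 hE (by simp)
  filter_upwards [b0, b1, b2, b3, ae_all_iff.2 e1, ae_all_iff.2 fun j => ae_all_iff.2 (e2 j),
    ae_all_iff.2 fun k => ae_all_iff.2 fun i => e3 k k i, S.pos] with p b0 b1 b2 b3 e1 e2 e3 hp
  have hB := (abs_nonneg _).trans b0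
  set B := derivBound P.h E R.δ
  have hy : 0 < (ξ p)⁻¹ := inv_pos.2 hp
  have div : ∀ {a : ℝ}, |ξ p * a| ≤ B → |a| ≤ B * (ξ p)⁻¹ := fun {a} h => by
    rw [abs_mul, abs_of_pos hp] at h
    rw [← div_eq_mul_inv, le_div_iff₀ hp, mul_comm]
    exact h
  have q1 : ∀ j, |F.q j p| ≤ B * (ξ p)⁻¹ := fun j => div (by rw [← e1]; exact b1 j)
  set a := B * (ξ p)⁻¹ with ha
  have a0 : 0 ≤ a := mul_nonneg hB hy.le
  have q2 : ∀ i j, |F.q i p * F.q j p| ≤ a ^ 2 := fun i j => by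
    rw [abs_mul, pow_two]; exact mul_le_mul (q1 i) (q1 j) (abs_nonneg _) a0
  have H1 : ∀ j i, |F.H j i p| ≤ a + a ^ 2 := fun j i => by
    have h1 : |F.q j p * F.q i p + F.H j i p| ≤ a := div (by
      have := b2 j i
      rw [e2] at this
      refine le_of_eq_of_le ?_ this
      congr 1
      change _ = ξ p * _ * _ + ξ p * _
      ring)
    have h2 := abs_sub (F.q j p * F.q i p + F.H j i p) (F.q j p * F.q i p)
    rw [add_sub_cancel_left] at h2
    linarith [q2 j i]
  have qH : ∀ i j k, |F.q i p * F.H j k p| ≤ a ^ 2 + a ^ 3 := fun i j k => by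
    rw [abs_mul]
    refine (mul_le_mul (q1 i) (H1 j k) (abs_nonneg _) a0).trans_eq ?_
    ring
  refine ⟨hB, q1, H1, fun k i => ?_⟩
  have h1 : |F.q k p * F.q k p * F.q i p + 2 * (F.q k p * F.H k i p) + F.q i p * F.H k k p +
      F.J k k i p| ≤ a := div (by
    have := b3 k i
    rw [e3] at this
    refine le_of_eq_of_le ?_ this
    congr 1
    change _ = (ξ p * F.q k p * F.q k p + ξ p * F.H k k p) * F.q i p + (ξ p * F.q k p) * F.H k i p +
      ((ξ p * F.q k p) * F.H k i p + ξ p * F.J k k i p)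
    ring)
  have h2 : |F.q k p * F.q k p * F.q i p| ≤ a ^ 3 := by
    rw [abs_mul]
    refine (mul_le_mul (q2 k k) (q1 i) (abs_nonneg _) (by positivity)).trans_eq ?_
    ring
  have h3 := abs_le.1 (qH k k i)
  have h4 := abs_le.1 (qH i k k)
  have h5 := abs_le.1 h1
  have h6 := abs_le.1 h2
  rw [abs_le]
  constructor <;> linarith [h3.1, h3.2, h4.1, h4.2, h5.1, h5.2, h6.1, h6.2]

lemma inv_le (S : Sol P R ξ₀ u₀ ξ u) (h0 : 0 ≤ E) (hE : initialEnergy P R ξ₀ u₀ ≤ E) :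
    ∀ᵐ p ∂(mQ P.T P.h), (ξ p)⁻¹ ≤ invBound P.h E R.δ R.η := by
  set F := S.fields
  set B := derivBound P.h E R.δ with hB
  have hη := R.η_pos
  have hh := P.h_pos
  have w0 : ∀ j, W P.T P.h ⊤ (hor j) (fun p => (ξ p)⁻¹) fun p => -((ξ p)⁻¹ * F.q j p) := fun j => by
    refine (S.w_zpow (-1) j).congr (Eventually.of_forall fun p => ?_) (Eventually.of_forall fun p => ?_)
    · simp
    · simp only [zpow_neg_one, Int.cast_neg, Int.cast_one, neg_mul, one_mul]; rfl
  have w1 : W P.T P.h ⊤ (hor 1) (fun p => -((ξ p)⁻¹ * F.q 0 p)) fun p =>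
      -(-((ξ p)⁻¹ * F.q 1 p) * F.q 0 p + (ξ p)⁻¹ * F.H 1 0 p) :=
    ((w0 1).mul (r := ⊤) le_top (F.hq 1 0)).neg le_top
  have hz : IsWeakDeriv P.T P.h 2 (fun p => (ξ p)⁻¹) fun _ => 0 :=
    S.comp_vertical (F := fun x => x⁻¹) (F' := fun x => -(x ^ 2)⁻¹)
      (fun x hx => hasDerivAt_inv (ne_of_gt hx))
      (ContinuousOn.neg (ContinuousOn.inv₀ (by fun_prop) fun x hx => pow_ne_zero _ (ne_of_gt hx)))
  have key := ae_abs_le_sl hz ((w0 0).mono le_top) ((w0 1).mono le_top)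
    (w1.mono le_top)
  have i10 : Integrable (fun p => ξ p ^ (-10 : ℤ)) (mQ P.T P.h) :=
    ((S.comp (contDiffOn_zpow (-10))).memLp_top (by norm_num)).integrable le_top
  have ig : Integrable (fun p => |(ξ p)⁻¹| + |-((ξ p)⁻¹ * F.q 0 p)| + (|-((ξ p)⁻¹ * F.q 1 p)| +
      |-(-((ξ p)⁻¹ * F.q 1 p) * F.q 0 p + (ξ p)⁻¹ * F.H 1 0 p)|)) (mQ P.T P.h) :=
    (((w0 0).left.integrable le_top).abs.add ((w0 0).right.integrable le_top).abs).add
      (((w0 1).right.integrable le_top).abs.add (w1.right.integrable le_top).abs)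
  have i1 : Integrable (fun p => 1 + ξ p ^ (-10 : ℤ)) (mQ P.T P.h) := (integrable_const 1).add i10
  have hle := sl_mono ig (i1.const_mul (1 + 3 * B + 2 * B ^ 2)) (by
    filter_upwards [S.log_deriv_le h0 hE, S.pos] with p ⟨hB0, b1, b2, _⟩ hp
    have hy : 0 < (ξ p)⁻¹ := inv_pos.2 hp
    have e10 : ξ p ^ (-10 : ℤ) = (ξ p)⁻¹ ^ 10 := by
      rw [inv_pow, zpow_neg]; norm_cast
    rw [e10]
    set y := (ξ p)⁻¹
    have c1 := b1 0
    have c2 := b1 1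
    have c3 := b2 1 0
    have d1 : |-(y * F.q 0 p)| ≤ B * y ^ 2 := by
      rw [abs_neg, abs_mul, abs_of_pos hy]
      calc _ ≤ y * (B * y) := by gcongr
        _ = _ := by ring
    have d2 : |-(y * F.q 1 p)| ≤ B * y ^ 2 := by
      rw [abs_neg, abs_mul, abs_of_pos hy]
      calc _ ≤ y * (B * y) := by gcongr
        _ = _ := by ring
    have d3 : |-(-(y * F.q 1 p) * F.q 0 p + y * F.H 1 0 p)| ≤ B * y ^ 2 + 2 * B ^ 2 * y ^ 3 := by
      rw [abs_neg]
      refine (abs_add_le _ _).trans ?_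
      rw [abs_mul, abs_mul y, abs_of_pos hy]
      calc _ ≤ (B * y ^ 2) * (B * y) + y * (B * y + (B * y) ^ 2) := by gcongr
        _ = _ := by ring
    rw [abs_of_pos hy]
    have p1 := pow_le_one_add hy.le (k := 1) (by norm_num)
    have p2 := mul_le_mul_of_nonneg_left (pow_le_one_add hy.le (k := 2) (by norm_num)) hB0
    have p3 := mul_le_mul_of_nonneg_left (pow_le_one_add hy.le (k := 3) (by norm_num)) (sq_nonneg B)
    rw [pow_one] at p1
    change B * y ^ 2 ≤ B * _ at p2
    nlinarith)
  have hsl : ∀ᵐ t ∂(mT P.T), sl P.h (fun p => ξ p ^ (-10 : ℤ)) t ≤ 11 * E / R.η := by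
    filter_upwards [S.energy_slice (i10.const_mul (R.η / 11))
      (S.energyDensity_ge.mono fun p hp => hp.2.2.2.1)] with t h1
    have h2 : sl P.h (fun p => R.η / 11 * ξ p ^ (-10 : ℤ)) t = R.η / 11 *
      sl P.h (fun p => ξ p ^ (-10 : ℤ)) t := integral_const_mul _ _
    rw [h2] at h1
    rw [le_div_iff₀ hη]
    linarith
  have hsl2 : ∀ᵐ t ∂(mT P.T), sl P.h (fun p => (1 + 3 * B + 2 * B ^ 2) * (1 + ξ p ^ (-10 : ℤ))) t =
      (1 + 3 * B + 2 * B ^ 2) * (P.h + sl P.h (fun p => ξ p ^ (-10 : ℤ)) t) := by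
    filter_upwards [integrable_slice i10] with t ht
    simp only [sl]
    rw [integral_const_mul, integral_add (integrable_const 1) ht]
    rw [integral_const, mO_real, smul_eq_mul, mul_one]
  filter_upwards [key, ae_of_time (h := P.h) hle, ae_of_time (h := P.h) hsl, ae_of_time (h := P.h) hsl2,
    S.log_deriv_le h0 hE] with p h1 h2 h3 h4 h5
  have hB0 : 0 ≤ B := h5.1
  refine (le_abs_self _).trans (h1.trans ?_)
  rw [invBound, ← hB]
  refine mul_le_mul_of_nonneg_left (h2.trans (h4.le.trans ?_)) (by positivity)
  exact mul_le_mul_of_nonneg_left (by linarith) (by positivity)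

/-- The derivatives of the logarithm of the density are bounded in terms of the energy. -/
lemma log_bound (S : Sol P R ξ₀ u₀ ξ u) (h0 : 0 ≤ E) (hE : initialEnergy P R ξ₀ u₀ ≤ E) :
    ∀ᵐ p ∂(mQ P.T P.h), (∀ j, |S.fields.q j p| ≤ logBound P.h E R.δ R.η) ∧
      (∀ i j, |S.fields.H i j p| ≤ logBound P.h E R.δ R.η) ∧
      ∀ i, |lapH (wd P.T P.h) (S.fields.q i) p| ≤ 2 * logBound P.h E R.δ R.η := by
  filter_upwards [S.log_deriv_le h0 hE, S.inv_le h0 hE, S.pos] with p ⟨hB, b1, b2, b3⟩ h2 hp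
  have hy : 0 < (ξ p)⁻¹ := inv_pos.2 hp
  set B := derivBound P.h E R.δ with hBd
  set a := B * (ξ p)⁻¹
  set x := |B * invBound P.h E R.δ R.η| with hx
  have ha : 0 ≤ a := mul_nonneg hB hy.le
  have hax : a ≤ x := (mul_le_mul_of_nonneg_left h2 hB).trans (le_abs_self _)
  have hx0 : 0 ≤ x := abs_nonneg _
  have e : logBound P.h E R.δ R.η = 1 + 8 * (1 + x) ^ 3 := rfl
  have a2 : a ^ 2 ≤ x ^ 2 := pow_le_pow_left₀ ha hax 2
  have a3 : a ^ 3 ≤ x ^ 3 := pow_le_pow_left₀ ha hax 3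
  have x2 := pow_nonneg hx0 2
  have x3 := pow_nonneg hx0 3
  have ex : (1 + x) ^ 3 = 1 + 3 * x + 3 * x ^ 2 + x ^ 3 := by ring
  have hJ : ∀ k i, |S.fields.J k k i p| ≤ 1 + 8 * (1 + x) ^ 3 := fun k i => by linarith [b3 k i]
  rw [e]
  refine ⟨fun j => by linarith [b1 j], fun i j => by linarith [b2 i j], fun i => ?_⟩
  simp only [lapH, Fin.sum_univ_two]
  refine (abs_add_le _ _).trans ?_
  linarith [hJ 0 i, hJ 1 i, show |wd P.T P.h (hor 0) (wd P.T P.h (hor 0) (S.fields.q i)) p| =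
    |S.fields.J 0 0 i p| from rfl, show |wd P.T P.h (hor 1) (wd P.T P.h (hor 1) (S.fields.q i)) p| =
    |S.fields.J 1 1 i p| from rfl]

end Sol

/-- The coefficient of `ε` in the bound for the error terms, for first and second derivatives of the
logarithm of the density bounded by `k`. -/
def errCoeff (ν r k : ℝ) : ℝ :=
  2 * ν * ((2 * k ^ 2 + 2 * k) * (3 + k)) + 2 * ν * (3 * k ^ 2) +
    4 * ν ^ 2 * ((2 * k ^ 2 + 2 * k) * (k ^ 2 + 2 * k)) + 2 * ν * r * (k + 6)

lemma errCoeff_nonneg {ν r k : ℝ} (hν : 0 < ν) (hr : 0 < r) (hk : 0 ≤ k) : 0 ≤ errCoeff ν r k := by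
  unfold errCoeff; positivity

lemma abs_trace_le {a b d : ℝ} :
    (|a| + |d| + |b|) ^ 2 ≤ 6 * (a ^ 2 + 1 / 2 * b ^ 2 + d ^ 2) := by
  nlinarith [sq_nonneg (|a| - |d|), sq_nonneg (|a| - |b|), sq_nonneg (|b| - |d|), sq_abs a, sq_abs b,
    sq_abs d, sq_nonneg a, sq_nonneg d]

lemma mul_abs_le_sqrt {μ a b k : ℝ} (hμ : 0 < μ) (hb : |b| ≤ 2 * k) :
    μ * |a * b| ≤ Real.sqrt μ * (1 / 2 * (μ * a ^ 2 + 4 * k ^ 2)) := by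
  have h0 := Real.sqrt_nonneg μ
  have h1 := Real.sq_sqrt hμ.le
  have h2 : b ^ 2 ≤ 4 * k ^ 2 := by
    rw [← sq_abs b]; nlinarith [abs_nonneg b]
  set m := Real.sqrt μ
  rw [← h1, abs_mul]
  have h3 : m * |a| * |b| ≤ 1 / 2 * (m ^ 2 * a ^ 2 + 4 * k ^ 2) := by
    nlinarith [sq_nonneg (m * |a| - |b|), sq_abs a, sq_abs b]
  nlinarith [mul_le_mul_of_nonneg_left h3 h0]

lemma viscous_le {μ ν a₀ b₀ a₁ b₁ k : ℝ} (hμ : 0 < μ) (hν : 0 ≤ ν) (h₀ : |b₀| ≤ 2 * k)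
    (h₁ : |b₁| ≤ 2 * k) : -(2 * ν * μ * (a₀ * b₀ + a₁ * b₁)) ≤
      Real.sqrt μ * (ν * (μ * (a₀ ^ 2 + a₁ ^ 2) + 8 * k ^ 2)) := by
  have w : ∀ {a b : ℝ}, |b| ≤ 2 * k →
      -(μ * (a * b)) ≤ Real.sqrt μ * (1 / 2 * (μ * a ^ 2 + 4 * k ^ 2)) := fun {a b} h => by
    refine le_trans ?_ (mul_abs_le_sqrt hμ h)
    rw [← mul_neg]
    exact mul_le_mul_of_nonneg_left (neg_le_abs _) hμ.le
  have := mul_le_mul_of_nonneg_left (add_le_add (w (a := a₀) h₀) (w (a := a₁) h₁))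
    (by positivity : 0 ≤ 2 * ν)
  linarith

lemma abs_sqrt_sub_le {x ε : ℝ} (hx : 0 ≤ x) (hε : 0 ≤ ε) :
    |Real.sqrt x - Real.sqrt (x + ε ^ 2)| ≤ ε ∧ Real.sqrt (x + ε ^ 2) ≤ Real.sqrt x + ε := by
  have h1 : Real.sqrt x ≤ Real.sqrt (x + ε ^ 2) := Real.sqrt_le_sqrt (by nlinarith [sq_nonneg ε])
  have h2 : Real.sqrt (x + ε ^ 2) ≤ Real.sqrt x + ε := by
    refine Real.sqrt_le_iff.2 ⟨by positivity, ?_⟩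
    nlinarith [Real.sq_sqrt hx, mul_nonneg (Real.sqrt_nonneg x) hε]
  exact ⟨abs_le.2 ⟨by linarith, by linarith⟩, h2⟩

lemma abs_quadratic_le {x y a b d : ℝ} :
    |x * x * a + x * y * b + y * y * d| ≤ (x ^ 2 + y ^ 2) * (|a| + |d| + |b|) := by
  have h1 : |x * y| ≤ x ^ 2 + y ^ 2 := by
    rw [abs_mul]; nlinarith [sq_nonneg (|x| - |y|), sq_abs x, sq_abs y, sq_nonneg x, sq_nonneg y]
  have h2 : |x * x| ≤ x ^ 2 + y ^ 2 := by rw [abs_mul_self]; nlinarith [sq_nonneg y]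
  have h3 : |y * y| ≤ x ^ 2 + y ^ 2 := by rw [abs_mul_self]; nlinarith [sq_nonneg x]
  refine (abs_add_three _ _ _).trans ?_
  rw [abs_mul, abs_mul (x * y), abs_mul (y * y)]
  have := mul_le_mul_of_nonneg_right h1 (abs_nonneg b)
  have := mul_le_mul_of_nonneg_right h2 (abs_nonneg a)
  have := mul_le_mul_of_nonneg_right h3 (abs_nonneg d)
  linarith

namespace Sol
variable {P : Fixed} {R : Reg} {ξ₀ : (Fin 3 → ℝ) → ℝ} {u₀ : (Fin 3 → ℝ) → Fin 2 → ℝ}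
  {ξ : Pt → ℝ} {u : Pt → Fin 2 → ℝ} {E : ℝ}

lemma abs_dρ_le (S : Sol P R ξ₀ u₀ ξ u) (p : Pt) : |S.fields.dρ R.ε p| ≤
    CPE.sq (u p) + 6 * S.strain p + 2 * R.ε * (1 + 3 * S.strain p) := by
  set A := |S.fields.U 0 0 p| + |S.fields.U 1 1 p| + |S.fields.U 0 1 p + S.fields.U 1 0 p| with hA
  have hε := R.ε_pos
  have hs0 := sq_nonneg' (u p)
  have esq : CPE.sq (u p) = u p 0 ^ 2 + u p 1 ^ 2 := by simp only [CPE.sq, Fin.sum_univ_two]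
  have hA0 : 0 ≤ A := by positivity
  have hA2 : A ^ 2 ≤ 6 * S.strain p := abs_trace_le
  have eρ : S.fields.ρ R.ε p = Real.sqrt (CPE.sq (u p) + R.ε ^ 2) := by rw [esq]; rfl
  have hρ : 0 < S.fields.ρ R.ε p := by rw [eρ]; positivity
  have hρ2 : S.fields.ρ R.ε p ^ 2 = CPE.sq (u p) + R.ε ^ 2 := by
    rw [eρ]; exact Real.sq_sqrt (by positivity)
  have hρl : S.fields.ρ R.ε p ≤ len (u p) + R.ε := by
    rw [eρ]; exact (abs_sqrt_sub_le hs0 hε.le).2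
  have hl2 : len (u p) ^ 2 = CPE.sq (u p) := Real.sq_sqrt hs0
  have h1 : |S.fields.dρ R.ε p| ≤ 2 * (S.fields.ρ R.ε p * A) := by
    have e : S.fields.dρ R.ε p = S.fields.ρ R.ε p * (S.fields.U 0 0 p + S.fields.U 1 1 p) +
      (u p 0 * u p 0 * S.fields.U 0 0 p + u p 0 * u p 1 * (S.fields.U 0 1 p + S.fields.U 1 0 p) +
        u p 1 * u p 1 * S.fields.U 1 1 p) / S.fields.ρ R.ε p := by
      have e3 : ∀ i, S.fields.u i p = u p i := fun _ => rfl
      simp only [Fields.dρ, e3]; ring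
    rw [e]
    have q1 : |S.fields.U 0 0 p + S.fields.U 1 1 p| ≤ A :=
      (abs_add_le _ _).trans (by rw [hA]; linarith [abs_nonneg (S.fields.U 0 1 p + S.fields.U 1 0 p)])
    have q2 : |(u p 0 * u p 0 * S.fields.U 0 0 p + u p 0 * u p 1 * (S.fields.U 0 1 p + S.fields.U 1 0 p) +
        u p 1 * u p 1 * S.fields.U 1 1 p) / S.fields.ρ R.ε p| ≤ S.fields.ρ R.ε p * A := by
      rw [abs_div, abs_of_pos hρ, div_le_iff₀ hρ]
      refine abs_quadratic_le.trans ?_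
      rw [← esq]
      nlinarith [mul_nonneg (sq_nonneg R.ε) hA0]
    refine (abs_add_le _ _).trans ?_
    rw [abs_mul, abs_of_pos hρ]
    nlinarith [mul_le_mul_of_nonneg_left q1 hρ.le]
  have h2 : len (u p) * A ≤ 1 / 2 * CPE.sq (u p) + 3 * S.strain p := by
    nlinarith [sq_nonneg (len (u p) - A)]
  have h3 : A ≤ 1 + 3 * S.strain p := by nlinarith [sq_nonneg (A - 1)]
  have h4 := mul_le_mul_of_nonneg_right hρl hA0
  nlinarith [mul_le_mul_of_nonneg_left h3 hε.le]

lemma err_le (S : Sol P R ξ₀ u₀ ξ u) {k : ℝ} (hk : 1 ≤ k) {p : Pt} (hp : 0 < ξ p)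
    (hq : ∀ j, |S.fields.q j p| ≤ k) (hH : ∀ i j, |S.fields.H i j p| ≤ k)
    (hL : ∀ i, |lapH (wd P.T P.h) (S.fields.q i) p| ≤ 2 * k) :
    S.err p ≤ 12 * P.ν₁ * P.r * (ξ p * CPE.sq (u p) + ξ p * S.strain p) +
      R.ε * errCoeff P.ν₁ P.r k * (ξ p + (ξ p * CPE.sq (u p) + ξ p * S.strain p)) +
      Real.sqrt R.μ * (P.ν₁ * (R.μ * lapSq P u p + 8 * k ^ 2)) := by
  have hε := R.ε_pos
  have hν := P.ν₁_pos
  have hr := P.r_pos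
  have hk0 : 0 ≤ k := zero_le_one.trans hk
  have hs0 := sq_nonneg' (u p)
  set s := S.strain p with hs
  set l := CPE.sq (u p) with hl
  have esq : l = u p 0 ^ 2 + u p 1 ^ 2 := by simp only [hl, CPE.sq, Fin.sum_univ_two]
  set A := |S.fields.U 0 0 p| + |S.fields.U 1 1 p| + |S.fields.U 0 1 p + S.fields.U 1 0 p| with hA
  have hA0 : 0 ≤ A := by positivity
  have hA2 : A ^ 2 ≤ 6 * s := abs_trace_le
  have hs0' : 0 ≤ s := by nlinarith [sq_nonneg A]
  have hA1 : A ≤ 1 + 3 * s := by nlinarith [sq_nonneg (A - 1)]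
  have q2 : ∀ j, S.fields.q j p ^ 2 ≤ k ^ 2 := fun j => by
    rw [← sq_abs]; exact pow_le_pow_left₀ (abs_nonneg _) (hq j) 2
  have hnq : |S.fields.nq p| ≤ 2 * k ^ 2 := by
    rw [Fields.nq, abs_of_nonneg (by positivity)]; linarith [q2 0, q2 1]
  have htr : |S.fields.tr p| ≤ 2 * k := (abs_add_le _ _).trans (by linarith [hH 0 0, hH 1 1])
  have hnt : |S.fields.nq p + S.fields.tr p| ≤ 2 * k ^ 2 + 2 * k := (abs_add_le _ _).trans (by linarith)
  have hnt' : |1 / 2 * S.fields.nq p + S.fields.tr p| ≤ k ^ 2 + 2 * k := (abs_add_le _ _).trans (by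
    rw [abs_mul, abs_of_pos (by norm_num : (0:ℝ) < 1 / 2)]; linarith)
  have hu : ∀ i, |u p i| ≤ 1 / 2 * (1 + u p i ^ 2) := fun i => by
    nlinarith [sq_nonneg (|u p i| - 1), sq_abs (u p i)]
  have huq : |S.fields.uq p| ≤ k * (1 + l) := by
    refine (abs_add_le _ _).trans ?_
    rw [abs_mul, abs_mul]
    have e3 : ∀ i, S.fields.u i p = u p i := fun _ => rfl
    simp only [e3]
    have a0 := mul_le_mul (hu 0) (hq 0) (abs_nonneg _) (by positivity)
    have a1 := mul_le_mul (hu 1) (hq 1) (abs_nonneg _) (by positivity)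
    rw [esq]
    nlinarith [mul_nonneg hk0 (sq_nonneg (u p 0)), mul_nonneg hk0 (sq_nonneg (u p 1))]
  have hc : |S.fields.c p| ≤ (1 + 3 * s) + k * (1 + l) := by
    refine (abs_add_le _ _).trans (add_le_add ((abs_add_le _ _).trans ?_) huq)
    linarith [abs_nonneg (S.fields.U 0 1 p + S.fields.U 1 0 p)]
  have hc' : |S.fields.c p| ≤ (3 + k) * (1 + l + s) := by
    refine hc.trans ?_
    nlinarith [mul_nonneg hk0 hs0']
  have t1 : |(S.fields.nq p + S.fields.tr p) * S.fields.c p| ≤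
      (2 * k ^ 2 + 2 * k) * (3 + k) * (1 + l + s) := by
    rw [abs_mul, mul_assoc]; gcongr
  have t2 : |S.fields.q 0 p * S.fields.q 0 p * S.fields.U 0 0 p +
      S.fields.q 0 p * S.fields.q 1 p * (S.fields.U 0 1 p + S.fields.U 1 0 p) +
      S.fields.q 1 p * S.fields.q 1 p * S.fields.U 1 1 p| ≤ 3 * k ^ 2 * (1 + l + s) := by
    have hq' : ∀ i j, |S.fields.q i p * S.fields.q j p| ≤ k ^ 2 := fun i j => by
      rw [abs_mul, pow_two]; exact mul_le_mul (hq i) (hq j) (abs_nonneg _) hk0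
    refine (abs_add_three _ _ _).trans ?_
    rw [abs_mul, abs_mul (_ * _) (_ + _), abs_mul (S.fields.q 1 p * S.fields.q 1 p)]
    have b0 := mul_le_mul_of_nonneg_right (hq' 0 0) (abs_nonneg (S.fields.U 0 0 p))
    have b1 := mul_le_mul_of_nonneg_right (hq' 0 1) (abs_nonneg (S.fields.U 0 1 p + S.fields.U 1 0 p))
    have b2 := mul_le_mul_of_nonneg_right (hq' 1 1) (abs_nonneg (S.fields.U 1 1 p))
    have b3 : k ^ 2 * A ≤ k ^ 2 * (3 * (1 + l + s)) := by gcongr; linarith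
    rw [hA] at b3
    linarith
  have t3 : |(S.fields.nq p + S.fields.tr p) * (1 / 2 * S.fields.nq p + S.fields.tr p)| ≤
      (2 * k ^ 2 + 2 * k) * (k ^ 2 + 2 * k) * (1 + l + s) := by
    rw [abs_mul]
    calc _ ≤ (2 * k ^ 2 + 2 * k) * (k ^ 2 + 2 * k) := by gcongr
      _ ≤ _ := le_mul_of_one_le_right (by positivity) (by linarith)
  have eρ : S.fields.ρ R.ε p = Real.sqrt (l + R.ε ^ 2) := by rw [esq]; rfl
  have t5 : |(len (u p) - S.fields.ρ R.ε p) * S.fields.uq p| ≤ R.ε * (k * (1 + l)) := by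
    rw [abs_mul, eρ]
    exact mul_le_mul (abs_sqrt_sub_le hs0 hε.le).1 huq (abs_nonneg _) hε.le
  have t6 := S.abs_dρ_le p
  rw [← hl, ← hs] at t6
  have v4 : -(2 * P.ν₁ * R.μ * (lap (wd P.T P.h) (fun q => u q 0) p * lapH (wd P.T P.h) (S.fields.q 0) p +
      lap (wd P.T P.h) (fun q => u q 1) p * lapH (wd P.T P.h) (S.fields.q 1) p)) ≤
      Real.sqrt R.μ * (P.ν₁ * (R.μ * lapSq P u p + 8 * k ^ 2)) := by
    rw [lapSq]; exact viscous_le R.μ_pos hν.le (hL 0) (hL 1)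
  have hpε : 0 ≤ R.ε * ξ p := by positivity
  have v1 := mul_le_mul_of_nonneg_left ((neg_le_abs _).trans t1)
    (by positivity : 0 ≤ 2 * P.ν₁ * (R.ε * ξ p))
  have v2 := mul_le_mul_of_nonneg_left ((neg_le_abs _).trans t2)
    (by positivity : 0 ≤ 2 * P.ν₁ * (R.ε * ξ p))
  have v3 := mul_le_mul_of_nonneg_left ((neg_le_abs _).trans t3)
    (by positivity : 0 ≤ 4 * P.ν₁ ^ 2 * (R.ε * ξ p))
  have v5 := mul_le_mul_of_nonneg_left ((neg_le_abs _).trans t5)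
    (by positivity : 0 ≤ 2 * P.ν₁ * P.r * ξ p)
  have v6 := mul_le_mul_of_nonneg_left ((le_abs_self _).trans t6)
    (by positivity : 0 ≤ 2 * P.ν₁ * P.r * ξ p)
  have v7 : 2 * P.ν₁ * P.r * ξ p * (R.ε * (k * (1 + l)) + (l + 6 * s + 2 * R.ε * (1 + 3 * s))) ≤
      12 * P.ν₁ * P.r * (ξ p * l + ξ p * s) +
        2 * P.ν₁ * P.r * (k + 6) * (R.ε * ξ p * (1 + l + s)) := by
    have y1 : l + 6 * s ≤ 6 * (l + s) := by linarith only [hs0]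
    have y2 : k * (1 + l) + 2 * (1 + 3 * s) ≤ (k + 6) * (1 + l + s) := by
      linarith only [mul_nonneg hk0 hs0', hs0, hs0']
    have z1 := mul_le_mul_of_nonneg_left y1 (by positivity : 0 ≤ 2 * P.ν₁ * P.r * ξ p)
    have z2 := mul_le_mul_of_nonneg_left y2 (by positivity : 0 ≤ 2 * P.ν₁ * P.r * (R.ε * ξ p))
    linarith only [z1, z2]
  rw [err, errCoeff]
  linarith only [v1, v2, v3, v4, v5, v6, v7]

lemma integral_err_le (S : Sol P R ξ₀ u₀ ξ u) (h0 : 0 ≤ E) (hE : initialEnergy P R ξ₀ u₀ ≤ E) {k : ℝ}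
    (hk : k = logBound P.h E R.δ R.η) : ∀ᵐ t ∂(mT P.T), ∫ p in Q t P.h, S.err p ≤
      12 * P.ν₁ * P.r * (P.T * (2 * E) + E / (2 * P.ν₁)) +
      R.ε * errCoeff P.ν₁ P.r k * (P.T * (E + 2 * P.h) + (P.T * (2 * E) + E / (2 * P.ν₁))) +
      Real.sqrt R.μ * (P.ν₁ * (E + P.T * (8 * k ^ 2 * P.h))) := by
  have hν := P.ν₁_pos
  have hh := P.h_pos
  have hr := P.r_pos
  have hε := R.ε_pos
  have hk1 : 1 ≤ k := by rw [hk, logBound]; exact le_add_of_nonneg_right (by positivity)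
  have iξ := S.two.1.integrable one_le_two
  have i1 := S.int_mul S.int_sq
  have i2 := S.int_mul S.int_strain
  have i3 := S.int_lapSq.const_mul R.μ
  have i4 : Integrable (fun _ : Pt => 8 * k ^ 2) (mQ P.T P.h) := integrable_const _
  have hsq : ∀ᵐ t ∂(mT P.T), sl P.h (fun p => ξ p * CPE.sq (u p)) t ≤ 2 * E := by
    filter_upwards [S.energy_slice (i1.const_mul (1 / 2)) (S.energyDensity_ge.mono fun p hp => hp.2.1)]
      with t h1
    have h2 : sl P.h (fun p => 1 / 2 * (ξ p * CPE.sq (u p))) t = 1 / 2 *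
      sl P.h (fun p => ξ p * CPE.sq (u p)) t := integral_const_mul _ _
    rw [h2] at h1
    linarith
  have hc : ∀ᵐ t ∂(mT P.T), sl P.h (fun _ => 8 * k ^ 2) t ≤ 8 * k ^ 2 * P.h :=
    Eventually.of_forall fun t => by
      simp only [sl, integral_const, mO_real, smul_eq_mul]; exact (mul_comm _ _).le
  have key := S.log_bound h0 hE
  rw [← hk] at key
  filter_upwards [S.energy_time (i2.const_mul (2 * P.ν₁)) (S.energyDissipation_ge.mono fun p hp => hp.2.1),
    S.energy_time i3 (S.energyDissipation_ge.mono fun p hp => hp.2.2), ae_restrict_mem measurableSet_Ioo]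
    with t h1 h2 ht
  have ht' : t ∈ Icc 0 P.T := ⟨ht.1.le, ht.2.le⟩
  have a1 := integral_Q_le_of_sl ht' i1 (by positivity) hsq
  have a2 := integral_Q_le_of_sl ht' iξ (by positivity) (S.sl_density_le hE)
  have a3 := integral_Q_le_of_sl ht' i4 (by positivity) hc
  have a4 : ∫ p in Q t P.h, ξ p * S.strain p ≤ E / (2 * P.ν₁) := by
    rw [integral_const_mul] at h1
    rw [le_div_iff₀ (by positivity)]
    linarith
  have hm := integral_Q_mono ht'.2 S.int_err
    ((((i1.add i2).const_mul (12 * P.ν₁ * P.r)).add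
      ((iξ.add (i1.add i2)).const_mul (R.ε * errCoeff P.ν₁ P.r k))).add
      (((i3.add i4).const_mul P.ν₁).const_mul (Real.sqrt R.μ)))
    (by filter_upwards [key, S.pos] with p h3 h4 using S.err_le hk1 h4 h3.1 h3.2.1 h3.2.2)
  refine hm.trans ?_
  have j1 := integrable_Q ht'.2 i1
  have j2 := integrable_Q ht'.2 i2
  have j3 := integrable_Q ht'.2 i3
  have j4 := integrable_Q ht'.2 i4
  have jξ := integrable_Q ht'.2 iξ
  have e : ∫ p in Q t P.h, (12 * P.ν₁ * P.r * (ξ p * CPE.sq (u p) + ξ p * S.strain p) +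
      R.ε * errCoeff P.ν₁ P.r k * (ξ p + (ξ p * CPE.sq (u p) + ξ p * S.strain p)) +
      Real.sqrt R.μ * (P.ν₁ * (R.μ * lapSq P u p + 8 * k ^ 2))) =
      12 * P.ν₁ * P.r * ((∫ p in Q t P.h, ξ p * CPE.sq (u p)) + ∫ p in Q t P.h, ξ p * S.strain p) +
      R.ε * errCoeff P.ν₁ P.r k * ((∫ p in Q t P.h, ξ p) +
        ((∫ p in Q t P.h, ξ p * CPE.sq (u p)) + ∫ p in Q t P.h, ξ p * S.strain p)) +
      Real.sqrt R.μ * (P.ν₁ * ((∫ p in Q t P.h, R.μ * lapSq P u p) + ∫ p in Q t P.h, 8 * k ^ 2)) := by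
    have j5 : IntegrableOn (fun p => ξ p * CPE.sq (u p) + ξ p * S.strain p) (Q t P.h) := j1.add j2
    have j6 : IntegrableOn (fun p => ξ p + (ξ p * CPE.sq (u p) + ξ p * S.strain p)) (Q t P.h) := jξ.add j5
    have j7 : IntegrableOn (fun p => R.μ * lapSq P u p + 8 * k ^ 2) (Q t P.h) := j3.add j4
    have j8 : IntegrableOn (fun p => 12 * P.ν₁ * P.r * (ξ p * CPE.sq (u p) + ξ p * S.strain p) +
      R.ε * errCoeff P.ν₁ P.r k * (ξ p + (ξ p * CPE.sq (u p) + ξ p * S.strain p))) (Q t P.h) :=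
      (j5.const_mul _).add (j6.const_mul _)
    rw [integral_add j8 ((j7.const_mul _).const_mul _), integral_add (j5.const_mul _) (j6.const_mul _),
      integral_const_mul, integral_const_mul, integral_const_mul, integral_const_mul, integral_add jξ j5,
      integral_add j1 j2, integral_add j3 j4]
  refine e.le.trans ?_
  have he := errCoeff_nonneg hν hr (zero_le_one.trans hk1)
  gcongr
  exact h2.trans hE

lemma neg_cross_le (S : Sol P R ξ₀ u₀ ξ u) : ∀ᵐ p ∂(mQ P.T P.h),
    -S.cross p ≤ 1 / 2 * (ξ p * CPE.sq (u p)) + 2 * P.ν₁ * R.r₀ * ξ p := by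
  filter_upwards [S.pos] with p hp
  have h1 := S.bdDensity_eq p
  have h2 : 0 ≤ 1 / 2 * ξ p * CPE.sq (fun i => u p i + 2 * P.ν₁ *
      wd P.T P.h (hor i) (fun q => Real.log (ξ q)) p) := mul_nonneg (by positivity) (sq_nonneg' _)
  have h3 := mul_le_mul_of_nonneg_left (Real.log_le_sub_one_of_pos hp)
    (mul_nonneg (mul_nonneg two_pos.le P.ν₁_pos.le) R.r₀_pos.le)
  have h4 := mul_nonneg (mul_nonneg two_pos.le P.ν₁_pos.le) R.r₀_pos.le
  rw [bdDensity] at h1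
  linarith

/-- The Bresch-Desjardins entropy estimate with the error terms in integral form. -/
lemma entropy_le (S : Sol P R ξ₀ u₀ ξ u) (hE : initialEnergy P R ξ₀ u₀ ≤ E) :
    ∀ᵐ t ∂(mT P.T), IntegrableOn (fun x => bdDensity (wd P.T P.h) P R ξ u (t, x)) (Om P.h) ∧
      (∫ x in Om P.h, bdDensity (wd P.T P.h) P R ξ u (t, x)) + ∫ p in Q t P.h, bdDissipation P R ξ u p ≤
        5 * E + 2 * P.ν₁ * R.r₀ * (E + 2 * P.h) + 2 * crossInit P R ξ₀ u₀ +
          2 * ∫ p in Q t P.h, S.err p := by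
  have hν := P.ν₁_pos
  have hr₀ := R.r₀_pos
  have iξ := S.two.1.integrable one_le_two
  have i1 := (S.int_mul S.int_sq).const_mul (1 / 2)
  have i2 := (S.int_mul S.int_strain).const_mul (2 * P.ν₁)
  have ic := S.cross_balance.left
  have ib : Integrable (bdDensity (wd P.T P.h) P R ξ u) (mQ P.T P.h) :=
    (i1.add ic).congr (Eventually.of_forall fun p => (S.bdDensity_eq p).symm)
  filter_upwards [S.energy_slice i1 (S.energyDensity_ge.mono fun p hp => hp.2.1),
    S.energy_time i2 (S.energyDissipation_ge.mono fun p hp => hp.2.1),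
    S.energy_time S.int_energyDissipation (Eventually.of_forall fun _ => le_rfl),
    S.cross_balance.integral, integrable_slice ib, sl_add i1 ic, S.sl_density_le hE,
    sl_mono ic.neg (i1.add (iξ.const_mul (2 * P.ν₁ * R.r₀))) S.neg_cross_le,
    sl_add i1 (iξ.const_mul (2 * P.ν₁ * R.r₀)), ae_restrict_mem measurableSet_Ioo]
    with t h1 h2 h3 h4 h5 h6 h7 h8 h9 ht
  refine ⟨h5, ?_⟩
  have j2 := integrable_Q ht.2.le i2
  have jd := integrable_Q ht.2.le S.int_diss
  have je := integrable_Q ht.2.le S.int_err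
  have jE := integrable_Q ht.2.le S.int_energyDissipation
  have j3 : IntegrableOn (fun p => 2 * P.ν₁ * (ξ p * S.strain p) - S.diss p) (Q t P.h) := j2.sub jd
  rw [integral_add j3 je, integral_sub j2 jd] at h4
  have hb : ∫ x in Om P.h, bdDensity (wd P.T P.h) P R ξ u (t, x) =
      sl P.h (fun p => 1 / 2 * (ξ p * CPE.sq (u p))) t + sl P.h S.cross t :=
    (integral_congr_ae (Eventually.of_forall fun x => S.bdDensity_eq (t, x))).trans h6
  have hd := integral_Q_mono ht.2.le S.int_bdDissipation
    ((S.int_diss.const_mul 2).add S.int_energyDissipation) S.bdDissipation_le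
  have hd' : ∫ p in Q t P.h, (2 * S.diss p + energyDissipation P R ξ u p) =
      2 * (∫ p in Q t P.h, S.diss p) + ∫ p in Q t P.h, energyDissipation P R ξ u p := by
    rw [integral_add (jd.const_mul 2) jE, integral_const_mul]
  have hn : sl P.h (fun p => -S.cross p) t = -sl P.h S.cross t := integral_neg _
  have hξ : sl P.h (fun p => 2 * P.ν₁ * R.r₀ * ξ p) t = 2 * P.ν₁ * R.r₀ * sl P.h ξ t :=
    integral_const_mul _ _
  have h8' : sl P.h (fun p => -S.cross p) t ≤
    sl P.h (fun p => 1 / 2 * (ξ p * CPE.sq (u p)) + 2 * P.ν₁ * R.r₀ * ξ p) t := h8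
  have hd2 : ∫ p in Q t P.h, bdDissipation P R ξ u p ≤
    ∫ p in Q t P.h, (2 * S.diss p + energyDissipation P R ξ u p) := hd
  rw [h9, hn, hξ] at h8'
  rw [hd'] at hd2
  have h7' := mul_le_mul_of_nonneg_left h7 (by positivity : 0 ≤ 2 * P.ν₁ * R.r₀)
  rw [hb]
  linarith only [h1, h2, h3, h4, h8', hd2, h7', hE]

end Sol
end CPE

end

theorem lemma4p1 (P : CPE.Fixed)
    (ξ₀ : (Fin 3 → ℝ) → ℝ) (u₀ : (Fin 3 → ℝ) → Fin 2 → ℝ)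
    (hdata : CPE.IsInitialData P ξ₀ u₀) (M : ℝ) :
    ∃ C > 0, ∃ K : ℝ → ℝ → ℝ, (∀ δ η, 0 < K δ η) ∧
      ∀ R : CPE.Reg, R.δ ≤ M → R.η ≤ M → R.κ ≤ M → R.r₀ ≤ M →
      ∀ (ξ : CPE.Pt → ℝ) (u : CPE.Pt → Fin 2 → ℝ),
        CPE.IsWeakSolution P R ξ₀ u₀ ξ u →
        (∃ c > 0, ∀ᵐ p ∂(volume.restrict (CPE.Q P.T P.h)), c ≤ ξ p) →
        CPE.LinfH P.T P.h 5 ξ → CPE.L2H P.T P.h 6 ξ →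
        IntegrableOn (CPE.bdDissipation P R ξ u) (CPE.Q P.T P.h) ∧
        ∀ᵐ t ∂(volume.restrict (Ioo (0 : ℝ) P.T)),
          IntegrableOn (fun x => CPE.bdDensity (CPE.wd P.T P.h) P R ξ u (t, x)) (CPE.Om P.h) ∧
          (∫ x in CPE.Om P.h, CPE.bdDensity (CPE.wd P.T P.h) P R ξ u (t, x))
            + ∫ p in CPE.Q t P.h, CPE.bdDissipation P R ξ u p
          ≤ (∫ x in CPE.Om P.h, CPE.bdDensity CPE.sd P R ξ₀ u₀ x)
            + CPE.initialEnergy P R ξ₀ u₀ + C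
            + R.ε * K R.δ R.η + Real.sqrt R.μ * K R.δ R.η := by
  obtain ⟨E', hE'⟩ := hdata.energy_le M
  obtain ⟨X, hX⟩ := hdata.bd_le M
  set E := |E'| with hEabs
  have hE0 : 0 ≤ E := abs_nonneg _
  have hν := P.ν₁_pos
  have hh := P.h_pos
  have hT := P.T_pos
  have hr := P.r_pos
  set B := P.T * (2 * E) + E / (2 * P.ν₁) with hB
  have hB0 : 0 ≤ B := by positivity
  set k : ℝ → ℝ → ℝ := fun δ η => CPE.logBound P.h E δ η with hk
  set K : ℝ → ℝ → ℝ := fun δ η => 1 + |2 * (CPE.errCoeff P.ν₁ P.r (k δ η) *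
    (P.T * (E + 2 * P.h) + B))| + |2 * (P.ν₁ * (E + P.T * (8 * k δ η ^ 2 * P.h)))| with hK
  refine ⟨1 + (5 * E + 2 * P.ν₁ * |M| * (E + 2 * P.h) + 3 * |X| + 24 * P.ν₁ * P.r * B), by positivity, K,
    fun δ η => by simp only [hK]; positivity, ?_⟩
  intro R hδ hη hκ hr₀ ξ u hsol hlow hinf htwo
  have S : CPE.Sol P R ξ₀ u₀ ξ u := ⟨hdata, hsol, hlow, hinf, htwo⟩
  obtain ⟨e0, e1⟩ := hE' R hδ hη hκ
  obtain ⟨x0, x1⟩ := hX R hr₀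
  have hE : CPE.initialEnergy P R ξ₀ u₀ ≤ E := e1.trans (le_abs_self _)
  refine ⟨S.int_bdDissipation, ?_⟩
  filter_upwards [S.entropy_le hE, S.integral_err_le hE0 hE rfl] with t h1 h2
  refine ⟨h1.1, h1.2.trans ?_⟩
  have a1 : R.ε * (2 * (CPE.errCoeff P.ν₁ P.r (k R.δ R.η) * (P.T * (E + 2 * P.h) + B))) ≤
      R.ε * K R.δ R.η := by
    refine mul_le_mul_of_nonneg_left ((le_abs_self _).trans ?_) R.ε_pos.le
    simp only [hK]
    linarith only [abs_nonneg (2 * (P.ν₁ * (E + P.T * (8 * k R.δ R.η ^ 2 * P.h))))]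
  have a2 : Real.sqrt R.μ * (2 * (P.ν₁ * (E + P.T * (8 * k R.δ R.η ^ 2 * P.h)))) ≤
      Real.sqrt R.μ * K R.δ R.η := by
    refine mul_le_mul_of_nonneg_left ((le_abs_self _).trans ?_) (Real.sqrt_nonneg _)
    simp only [hK]
    linarith only [abs_nonneg (2 * (CPE.errCoeff P.ν₁ P.r (k R.δ R.η) * (P.T * (E + 2 * P.h) + B)))]
  have a3 : 2 * P.ν₁ * R.r₀ * (E + 2 * P.h) ≤ 2 * P.ν₁ * |M| * (E + 2 * P.h) := by
    gcongr
    exact hr₀.trans (le_abs_self _)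
  linarith only [a1, a2, a3, h2, e0, x0, x1, le_abs_self X]
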